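/- **Setting.** Fix $\mathtt g,H_0>0$ and a positively oriented Jordan curve $\Gamma\subset\mathbb R^2$ of class $C^\infty$ and length $L$, parametrized by arc length $s$. Let $\mathcal I$ be its bounded interior, $\mathcal E$ its exterior, $N$ the unit normal on $\Gamma$ pointing into $\mathcal E$, and ${\mathfrak d}_{\rm tan}=\partial_s$ on $\Gamma$. The spaces $H^\sigma(\Gamma)$ are defined through Fourier series in $s\in\mathbb R/L\mathbb Z$. All constants below may depend on $\mathtt g$, $H_0$ and $\Gamma$. Let $h_{\rm i}\in C^\infty(\overline{\mathcal I})$ with $h_{\rm i}\ge c_0>0$. The Dirichlet-to-Neumann map $\Lambda:H^{1/2}(\Gamma)\to H^{-1/2}(\Gamma)$ is $\Lambda\psi=(N\cdot(h_{\rm i}\nabla\psi^{\mathfrak h}))_{|\Gamma}$, where $\psi^{\mathfrak h}\in H^1(\mathcal I)$ solves $\nabla\cdot(h_{\rm i}\nabla\psi^{\mathfrak h})=0$ in $\mathcal I$, $\psi^{\mathfrak h}=\psi$ on $\Gamma$. For $u=(\zeta,v)\in\mathbb R\times\mathbb R^2$ put $h=H_0+\zeta$, $$\Sigma(u)=\begin{pmatrix}\mathtt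 g&v^{\rm T}\\ v&h\,\mathrm{Id}\end{pmatrix},\qquad G_j=\begin{pmatrix}0&\mathbf e_j^{\rm T}\\ \mathbf e_j&0\end{pmatrix},\qquad S(u)=\Sigma(u)^{-1}.$$ Let $u,\partial_tu\in L^\infty((0,T)\times\mathcal E)$ with $\mathtt g h-|v|^2\ge c_0$ on $(0,T)\times\mathcal E$. For $U=(U_1,U_2,U_3)$ write $U^{\rm I}=U_1$, $U^{\rm II}=(U_2,U_3)$. Consider $$\partial_t\check u+\Sigma(u)G_j\partial_j\check u=\Sigma(u)\dot f\ \text{ in }(0,T)\times\mathcal E,\qquad N\cdot\check u^{\rm II}-\Lambda\check\psi_{\rm i}=g_1,\quad \partial_t\check\psi_{\rm i}+\check u^{\rm I}=g_2\ \text{ on }(0,T)\times\Gamma.$$ A regular solution is a pair with $\check u\in \mathbb W^1_T=C([0,T];H^1(\mathcal E))\cap C^1([0,T];L^2(\mathcal E))$ and $\check\psi_{\rm i}\in C^1([0,T];H^{1/2}(\Gamma))$. Let $\tilde g_1\in\mathbb W^1_T$ have trace $g_1$ on $(0,T)\times\Gamma$, and write $|||\tilde g_1(t)|||_1=\|\tilde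 g_1(t)\|_{H^1(\mathcal E)}+\|\partial_t\tilde g_1(t)\|_{L^2(\mathcal E)}$. For $\lambda>0$ put $|f|_{L^2_{\lambda,t}}=(\int_0^te^{-2\lambda t'}|f(t')|^2dt')^{1/2}$, $I_{\lambda,t}(f)=\sup_{t'\in[0,t]}e^{-\lambda t'}|f(t')|+\sqrt\lambda\,|f|_{L^2_{\lambda,t}}$ and $S^*_{\lambda,t}(f)=\sup\{|\int_0^te^{-2\lambda t'}f\varphi\,dt'|:I_{\lambda,t}(\varphi)\le1\}$. **Statement.** (a) There are constants $0<\underline{\mathfrak c}<\overline{\mathfrak C}$, depending only on $\Gamma$, $c_0$ and (an upper bound of) $\|h_{\rm i}\|_{L^\infty(\mathcal I)}$, with $$\underline{\mathfrak c}\,|{\mathfrak d}_{\rm tan}\psi|^2_{H^{-1/2}(\Gamma)}\le\langle\Lambda\psi,\psi\rangle_{H^{-1/2}\times H^{1/2}}\le\overline{\mathfrak C}\,|{\mathfrak d}_{\rm tan}\psi|^2_{H^{-1/2}(\Gamma)}\qquad(\psi\in H^{1/2}(\Gamma)).$$ (b) $S(u)$ is symmetric, the matrices $S(u)\Sigma(u)G_j$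 are symmetric, and $\alpha_0|w|^2\le w\cdot S(u)w\le\beta_0|w|^2$ for $w\in\mathbb R^3$, with $\alpha_0,\beta_0>0$ depending only on $c_0$ and $\|u\|_{L^\infty}$. With this $\alpha_0$, there are $\lambda_0>0$ depending only on $c_0$ and $\|(u,\partial_tu)\|_{L^\infty}$ and, for any $0<\underline{\mathfrak c}<\overline{\mathfrak C}$, a constant $C_0>0$ depending only on $c_0,\underline{\mathfrak c},\overline{\mathfrak C},\|u\|_{L^\infty}$, such that whenever $\underline{\mathfrak c},\overline{\mathfrak C}$ satisfy the inequalities in (a) for $h_{\rm i}$, every regular solution as above satisfies, for all $\lambda\ge\lambda_0$ and $t\in[0,T]$, $$2\int_0^te^{-2\lambda t'}\Bigl(\int_\Gamma\check u^{\rm I}(N\cdot\check u^{\rm II})\Bigr)dt'\le-E_{\rm bdry}(t)+S_{\rm data}(t)+\frac{\alpha_0}8I_{\lambda,t}(\|\check u(\cdot)\|_{L^2(\mathcal E)})^2,$$ where $$E_{\rm bdry}(t)=\underline{\mathfrak c}\bigl(e^{-2\lambda t}|{\mathfrak d}_{\rm tan}\check\psi_{\rm i}(t)|^2_{H^{-1/2}(\Gamma)}+\lambda|{\mathfrak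 d}_{\rm tan}\check\psi_{\rm i}|^2_{L^2_{\lambda,t}H^{-1/2}(\Gamma)}\bigr),$$ $$S_{\rm data}(t)=C_0\bigl(|{\mathfrak d}_{\rm tan}\check\psi_{\rm i}(0)|^2_{H^{-1/2}(\Gamma)}+\|\tilde g_1(0)\|^2_{L^2(\mathcal E)}+S^*_{\lambda,t}(\|\dot f(\cdot)\|_{L^2(\mathcal E)})^2+S^*_{\lambda,t}(|||\tilde g_1(\cdot)|||_1)^2+\lambda^{-1}|{\mathfrak d}_{\rm tan}g_2|^2_{L^2_{\lambda,t}H^{-1/2}(\Gamma)}\bigr).$$ All these quantities are finite and non-negative (the left-hand side is a finite integral), and $S_{\rm data}$ is non-decreasing in $t$; that is, the boundary term $2\check u^{\rm I}(N\cdot\check u^{\rm II})$ is weakly dissipative. -/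

import Mathlib

open MeasureTheory Set Filter Topology
open scoped ContDiff ENNReal Matrix

noncomputable section

namespace WaveStructure

/-- The horizontal plane. -/
abbrev Plane : Type := EuclideanSpace ℝ (Fin 2)

/-- The state space `ℝ³`; `U 0` is `U^I` and `(U 1, U 2)` is `U^II`. -/
abbrev State : Type := EuclideanSpace ℝ (Fin 3)

/-! ### The curve, the interior and the exterior region -/

/-- The vector `-(γ'(s))^⊥ = (γ₂'(s), -γ₁'(s))`. -/
def curveNormal (γ : ℝ → Plane) (s : ℝ) : Plane :=
  !₂[deriv γ s 1, -(deriv γ s 0)]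

/-- The points enclosed by a closed curve: the bounded components of its complement. -/
def curveInterior (γ : ℝ → Plane) : Set Plane :=
  {x | x ∉ range γ ∧ Bornology.IsBounded (connectedComponentIn (range γ)ᶜ x)}

/-- The outer region of a closed curve: the unbounded component of its complement. -/
def curveExterior (γ : ℝ → Plane) : Set Plane :=
  {x | x ∉ range γ ∧ ¬ Bornology.IsBounded (connectedComponentIn (range γ)ᶜ x)}

/-- A positively oriented Jordan curve of class `C^∞`, parametrized by arc length. Positive
orientation: the exterior lies on the side of `n = -(γ')^⊥` (the right-hand side), and the interior
on the opposite side. -/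
structure JordanCurve where
  /-- the length -/
  L : ℝ
  L_pos : 0 < L
  /-- the arc length parametrization -/
  γ : ℝ → Plane
  smooth : ContDiff ℝ ∞ γ
  periodic : Function.Periodic γ L
  injOn : InjOn γ (Ico 0 L)
  unit_speed : ∀ s, ‖deriv γ s‖ = 1
  oriented : ∀ s, ∃ ε > 0, ∀ r ∈ Ioo (0 : ℝ) ε,
    γ s + r • curveNormal γ s ∈ curveExterior γ ∧ γ s - r • curveNormal γ s ∈ curveInterior γ

namespace JordanCurve

/-- The unit normal on the curve pointing towards the exterior. -/
def normal (Γ : JordanCurve) (s : ℝ) : Plane := curveNormal Γ.γ s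

/-- The interior region `𝓘`. -/
def int (Γ : JordanCurve) : Set Plane := curveInterior Γ.γ

/-- The exterior region `𝓔`. -/
def ext (Γ : JordanCurve) : Set Plane := curveExterior Γ.γ

end JordanCurve

/-! ### Lebesgue and Sobolev spaces -/

/-- `L²(Ω; F)`. -/
abbrev L2 (Ω : Set Plane) (F : Type) [NormedAddCommGroup F] : Type :=
  Lp F 2 (volume.restrict Ω)

/-- `L²(Γ; F)`; a function on the curve is written as a function of the arc length
`s ∈ (0, L]`. -/
abbrev L2Γ (Γ : JordanCurve) (F : Type) [NormedAddCommGroup F] : Type :=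
  Lp F 2 ((volume : Measure ℝ).restrict (Ioc 0 Γ.L))

/-- The partial derivative `∂_j φ` of a smooth function. -/
def pderiv {F : Type} [NormedAddCommGroup F] [NormedSpace ℝ F] (j : Fin 2) (φ : Plane → F)
    (x : Plane) : F :=
  fderiv ℝ φ x (EuclideanSpace.single j 1)

/-- `g = ∂_j f` in the sense of distributions in `Ω`. -/
def IsWeakPartial {F : Type} [NormedAddCommGroup F] [NormedSpace ℝ F] (Ω : Set Plane) (j : Fin 2)
    (f g : L2 Ω F) : Prop :=
  ∀ φ : Plane → ℝ, ContDiff ℝ ∞ φ → HasCompactSupport φ → tsupport φ ⊆ Ω →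
    ∫ x in Ω, pderiv j φ x • f x = -∫ x in Ω, φ x • g x

/-- `f ∈ H¹(Ω)`, whose weak derivatives are `df 0` and `df 1`, has the trace `g ∈ L²(Γ)` on the
boundary curve: the trace operator is the continuous extension of the restriction
`φ ↦ φ|_Γ` from smooth compactly supported functions. -/
def HasTrace {F : Type} [NormedAddCommGroup F] [NormedSpace ℝ F] (Γ : JordanCurve) (Ω : Set Plane)
    (f : L2 Ω F) (df : Fin 2 → L2 Ω F) (g : L2Γ Γ F) : Prop :=
  ∃ φ : ℕ → Plane → F, (∀ n, ContDiff ℝ ∞ (φ n) ∧ HasCompactSupport (φ n)) ∧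
    Tendsto (fun n => eLpNorm (fun x => φ n x - f x) 2 (volume.restrict Ω)) atTop (𝓝 0) ∧
    (∀ j, Tendsto (fun n => eLpNorm (fun x => pderiv j (φ n) x - df j x) 2 (volume.restrict Ω))
      atTop (𝓝 0)) ∧
    Tendsto (fun n => eLpNorm (fun s => φ n (Γ.γ s) - g s) 2 (volume.restrict (Ioc 0 Γ.L)))
      atTop (𝓝 0)

/-- The space `𝕎¹_T = C([0,T]; H¹(Ω)) ∩ C¹([0,T]; L²(Ω))`. -/
structure W1 (Ω : Set Plane) (F : Type) [NormedAddCommGroup F] [NormedSpace ℝ F] (T : ℝ) where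
  /-- the function -/
  val : ℝ → L2 Ω F
  /-- its time derivative -/
  dt : ℝ → L2 Ω F
  /-- its space derivatives -/
  dx : Fin 2 → ℝ → L2 Ω F
  isWeakPartial : ∀ j, ∀ t ∈ Icc 0 T, IsWeakPartial Ω j (val t) (dx j t)
  hasDeriv : ∀ t ∈ Icc 0 T, HasDerivWithinAt val (dt t) (Icc 0 T) t
  continuousOn_dx : ∀ j, ContinuousOn (dx j) (Icc 0 T)
  continuousOn_dt : ContinuousOn dt (Icc 0 T)

/-- `|||f(t)|||_1 = ‖f(t)‖_{H¹(Ω)} + ‖∂_t f(t)‖_{L²(Ω)}`. -/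
def W1.norm1 {Ω : Set Plane} {F : Type} [NormedAddCommGroup F] [NormedSpace ℝ F] {T : ℝ}
    (f : W1 Ω F T) (t : ℝ) : ℝ :=
  Real.sqrt (‖f.val t‖ ^ 2 + ∑ j, ‖f.dx j t‖ ^ 2) + ‖f.dt t‖

/-! ### Sobolev norms on the curve -/

/-- The `k`-th frequency on the circle of length `L`. -/
def freq (Γ : JordanCurve) (k : ℤ) : ℝ := 2 * Real.pi * k / Γ.L

/-- The Fourier coefficients `(1/L) ∫₀ᴸ g(s) e^{-2πiks/L} ds`. -/
def fourierCoef (Γ : JordanCurve) (g : L2Γ Γ ℝ) (k : ℤ) : ℂ :=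
  (1 / (Γ.L : ℂ)) * ∫ s in Ioc 0 Γ.L, (g s : ℂ) * Complex.exp (-(Complex.I * (freq Γ k : ℂ) * (s : ℂ)))

/-- The `H^σ(Γ)` norm of the distribution with Fourier coefficients `c`. -/
def hNormCoef (Γ : JordanCurve) (σ : ℝ) (c : ℤ → ℂ) : ℝ≥0∞ :=
  (∑' k : ℤ, ENNReal.ofReal (Γ.L * (1 + freq Γ k ^ 2) ^ σ * ‖c k‖ ^ 2)) ^ (1 / 2 : ℝ)

/-- `|g|_{H^σ(Γ)}`. -/
def hNorm (Γ : JordanCurve) (σ : ℝ) (g : L2Γ Γ ℝ) : ℝ≥0∞ :=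
  hNormCoef Γ σ (fourierCoef Γ g)

/-- `|𝔡_tan g|_{H^σ(Γ)}`; the tangential derivative is the arc length derivative. -/
def hNormTan (Γ : JordanCurve) (σ : ℝ) (g : L2Γ Γ ℝ) : ℝ≥0∞ :=
  hNormCoef Γ σ (fun k => Complex.I * (freq Γ k : ℂ) * fourierCoef Γ g k)

/-- `ψ ∈ C¹([0,T]; H^σ(Γ))` with time derivative `ψt`. -/
structure IsC1H (Γ : JordanCurve) (σ T : ℝ) (ψ ψt : ℝ → L2Γ Γ ℝ) : Prop where
  mem : ∀ t ∈ Icc 0 T, hNorm Γ σ (ψ t) < ⊤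
  mem_dt : ∀ t ∈ Icc 0 T, hNorm Γ σ (ψt t) < ⊤
  hasDeriv : ∀ t ∈ Icc 0 T,
    Tendsto (fun τ => hNorm Γ σ (ψ τ - ψ t - (τ - t) • ψt t) / ENNReal.ofReal |τ - t|)
      (𝓝[Icc 0 T \ {t}] t) (𝓝 0)
  continuous_dt : ∀ t ∈ Icc 0 T,
    Tendsto (fun τ => hNorm Γ σ (ψt τ - ψt t)) (𝓝[Icc 0 T] t) (𝓝 0)

/-! ### The Dirichlet-to-Neumann map -/

/-- The assumption on `h_i`: smooth on the closed interior region and bounded below by `c₀`. -/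
structure DepthAssumption (Γ : JordanCurve) (c₀ : ℝ) (hi : Plane → ℝ) : Prop where
  smooth : ContDiffOn ℝ ∞ hi (closure Γ.int)
  lower : ∀ x ∈ Γ.int, c₀ ≤ hi x

/-- `p ∈ H¹(𝓘)`, with gradient `dp`, has trace `ψ` on `Γ`. -/
def IsExtension (Γ : JordanCurve) (ψ : L2Γ Γ ℝ) (p : L2 Γ.int ℝ) (dp : Fin 2 → L2 Γ.int ℝ) :
    Prop :=
  (∀ j, IsWeakPartial Γ.int j p (dp j)) ∧ HasTrace Γ Γ.int p dp ψ

/-- `p`, with gradient `dp`, is the weak solution in `H¹(𝓘)` of `∇·(h_i ∇p) = 0` in `𝓘`,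
`p = ψ` on `Γ`; the test functions run through `H¹₀(𝓘)`. -/
def IsHarmonicExtension (Γ : JordanCurve) (hi : Plane → ℝ) (ψ : L2Γ Γ ℝ) (p : L2 Γ.int ℝ)
    (dp : Fin 2 → L2 Γ.int ℝ) : Prop :=
  IsExtension Γ ψ p dp ∧
    ∀ (q : L2 Γ.int ℝ) (dq : Fin 2 → L2 Γ.int ℝ), IsExtension Γ 0 q dq →
      ∫ x in Γ.int, hi x * ∑ j, dp j x * dq j x = 0

open Classical in
/-- The gradient of the harmonic extension `ψ^𝔥` of `ψ ∈ H^{1/2}(Γ)`. -/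
def harmonicGrad (Γ : JordanCurve) (hi : Plane → ℝ) (ψ : L2Γ Γ ℝ) : Fin 2 → L2 Γ.int ℝ :=
  if h : ∃ dp : Fin 2 → L2 Γ.int ℝ, ∃ p, IsHarmonicExtension Γ hi ψ p dp then h.choose else 0

open Classical in
/-- The gradient of some extension of `η ∈ H^{1/2}(Γ)` to a function in `H¹(𝓘)`. -/
def extensionGrad (Γ : JordanCurve) (η : L2Γ Γ ℝ) : Fin 2 → L2 Γ.int ℝ :=
  if h : ∃ dq : Fin 2 → L2 Γ.int ℝ, ∃ q, IsExtension Γ η q dq then h.choose else 0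

/-- The Dirichlet-to-Neumann map: `dirichletToNeumann Γ hi ψ η` is the duality bracket
`⟨Λψ, η⟩` between `H^{-1/2}(Γ)` and `H^{1/2}(Γ)`, where `Λψ = N·(h_i ∇ψ^𝔥)|_Γ` is the weak conormal
derivative `η ↦ ∫_𝓘 h_i ∇ψ^𝔥 · ∇η̃`, with `η̃` an extension of `η` (the value does not depend on
the extension, because `∇·(h_i ∇ψ^𝔥) = 0`). -/
def dirichletToNeumann (Γ : JordanCurve) (hi : Plane → ℝ) (ψ η : L2Γ Γ ℝ) : ℝ :=
  ∫ x in Γ.int, hi x * ∑ j, harmonicGrad Γ hi ψ j x * extensionGrad Γ η j x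

/-- `cl` and `cu` are lower and upper constants in the equivalence of `⟨Λψ, ψ⟩` and
`|𝔡_tan ψ|²_{H^{-1/2}}`. -/
def IsDNConstants (Γ : JordanCurve) (hi : Plane → ℝ) (cl cu : ℝ) : Prop :=
  ∀ ψ : L2Γ Γ ℝ, hNorm Γ (1 / 2) ψ < ⊤ →
    cl * (hNormTan Γ (-1 / 2) ψ).toReal ^ 2 ≤ dirichletToNeumann Γ hi ψ ψ ∧
    dirichletToNeumann Γ hi ψ ψ ≤ cu * (hNormTan Γ (-1 / 2) ψ).toReal ^ 2

/-! ### Weighted norms in time -/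

/-- `|f|_{L²_{λ,t}}`, for a function `f` with values in `[0,∞]` (the norm in space). -/
def l2Norm (lam t : ℝ) (f : ℝ → ℝ≥0∞) : ℝ≥0∞ :=
  (∫⁻ τ in Icc 0 t, ENNReal.ofReal (Real.exp (-2 * lam * τ)) * f τ ^ 2) ^ (1 / 2 : ℝ)

/-- `I_{λ,t}(f)`, the supremum over `[0,t]` of `e^{-λτ}|f(τ)|` plus `√λ |f|_{L²_{λ,t}}`. -/
def iNorm (lam t : ℝ) (f : ℝ → ℝ) : ℝ≥0∞ :=
  (⨆ τ ∈ Icc 0 t, ENNReal.ofReal (Real.exp (-lam * τ) * |f τ|)) +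
    ENNReal.ofReal (Real.sqrt lam) * l2Norm lam t (fun τ => ENNReal.ofReal |f τ|)

/-- The dual norm `S*_{λ,t}(f)` of `I_{λ,t}` for the scalar product of `L²_λ(0,t)`. Since the sign
of `φ` is free, the absolute value may be taken inside the integral. -/
def sStar (lam t : ℝ) (f : ℝ → ℝ) : ℝ≥0∞ :=
  ⨆ (φ : ℝ → ℝ) (_ : Measurable φ) (_ : iNorm lam t φ ≤ 1),
    ∫⁻ τ in Icc 0 t, ENNReal.ofReal (Real.exp (-2 * lam * τ) * |f τ * φ τ|)

/-! ### The linearized wave-structure system -/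

/-- The matrix `Σ(u)` at `u = (ζ, v)`, with `h = H₀ + ζ`. -/
def sigmaMat (gr H₀ : ℝ) (U : State) : Matrix (Fin 3) (Fin 3) ℝ :=
  !![gr, U 1, U 2; U 1, H₀ + U 0, 0; U 2, 0, H₀ + U 0]

/-- The symmetrizer `S(u) = Σ(u)⁻¹`. -/
def symMat (gr H₀ : ℝ) (U : State) : Matrix (Fin 3) (Fin 3) ℝ := (sigmaMat gr H₀ U)⁻¹

/-- The constant matrices `G₁`, `G₂`. -/
def gMat (j : Fin 2) : Matrix (Fin 3) (Fin 3) ℝ :=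
  if j = 0 then !![0, 1, 0; 1, 0, 0; 0, 0, 0] else !![0, 0, 1; 0, 0, 0; 1, 0, 0]

/-- Subcriticality `g h - |v|² ≥ c₀` at the state `u = (ζ, v)`. -/
def IsSubcritical (gr H₀ c₀ : ℝ) (U : State) : Prop :=
  c₀ ≤ gr * (H₀ + U 0) - (U 1 ^ 2 + U 2 ^ 2)

/-- `S` symmetrizes the matrices `A 0`, `A 1`, with coercivity constant `α₀` and upper
bound `β₀`. -/
structure IsSymmetrizer (S : Matrix (Fin 3) (Fin 3) ℝ) (A : Fin 2 → Matrix (Fin 3) (Fin 3) ℝ)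
    (α₀ β₀ : ℝ) : Prop where
  symm : S.IsSymm
  symm_mul : ∀ j, (S * A j).IsSymm
  lower : ∀ w : State, α₀ * ‖w‖ ^ 2 ≤ w.ofLp ⬝ᵥ S *ᵥ w.ofLp
  upper : ∀ w : State, w.ofLp ⬝ᵥ S *ᵥ w.ofLp ≤ β₀ * ‖w‖ ^ 2

/-- Lebesgue measure on `(0,T) × Ω`. -/
def cylMeasure (Ω : Set Plane) (T : ℝ) : Measure (ℝ × Plane) :=
  (volume.restrict (Ioo 0 T)).prod (volume.restrict Ω)

/-- The assumptions on the state `u` around which one linearizes: `u` and `∂_t u = ut` are in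
`L^∞((0,T) × 𝓔)`, with norms `‖u‖ ≤ M₀` and `‖(u, ∂_t u)‖ ≤ M₁`, and `u` is subcritical.
A bounded function with bounded weak time derivative is identified with its representative that is
absolutely continuous in time. -/
structure BackgroundState (Γ : JordanCurve) (gr H₀ c₀ M₀ M₁ T : ℝ) (u ut : ℝ → Plane → State) :
    Prop where
  meas : AEStronglyMeasurable (Function.uncurry u) (cylMeasure Γ.ext T)
  meas_dt : AEStronglyMeasurable (Function.uncurry ut) (cylMeasure Γ.ext T)
  bound : ∀ᵐ z ∂(cylMeasure Γ.ext T), ‖u z.1 z.2‖ ≤ M₀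
  bound_dt : ∀ᵐ z ∂(cylMeasure Γ.ext T), ‖ut z.1 z.2‖ ≤ M₁
  bound_le : M₀ ≤ M₁
  hasDeriv : ∀ᵐ x ∂(volume.restrict Γ.ext), ∀ t ∈ Icc 0 T, u t x = u 0 x + ∫ τ in (0 : ℝ)..t, ut τ x
  subcritical : ∀ᵐ z ∂(cylMeasure Γ.ext T), IsSubcritical gr H₀ c₀ (u z.1 z.2)

/-- `N · U^II` at the point of arc length `s` of the curve. -/
def normalPart (Γ : JordanCurve) (s : ℝ) (U : State) : ℝ :=
  Γ.normal s 0 * U 1 + Γ.normal s 1 * U 2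

/-- `(w, ψ)`, with `w ∈ 𝕎¹_T` and `ψ ∈ C¹([0,T]; H^{1/2}(Γ))`, is a regular solution of the
transformed linearized system
`∂_t w + Σ(u) G_j ∂_j w = Σ(u) f` in `(0,T) × 𝓔`,
`N·w^II - Λψ = g₁` and `∂_t ψ + w^I = g₂` on `(0,T) × Γ`.
Here `wΓ` is the trace of `w` and `ψt = ∂_t ψ`; the first boundary condition is an identity
in `H^{-1/2}(Γ)`. -/
structure IsRegularSolution (Γ : JordanCurve) (gr H₀ T : ℝ) (hi : Plane → ℝ)
    (u : ℝ → Plane → State) (f : ℝ → L2 Γ.ext State) (g₁ g₂ : ℝ → L2Γ Γ ℝ)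
    (w : W1 Γ.ext State T) (wΓ : ℝ → L2Γ Γ State) (ψ ψt : ℝ → L2Γ Γ ℝ) : Prop where
  trace : ∀ t ∈ Icc 0 T, HasTrace Γ Γ.ext (w.val t) (fun j => w.dx j t) (wΓ t)
  regular : IsC1H Γ (1 / 2) T ψ ψt
  equation : ∀ᵐ t ∂(volume.restrict (Ioo 0 T)), ∀ᵐ x ∂(volume.restrict Γ.ext),
    (w.dt t x).ofLp + ∑ j, (sigmaMat gr H₀ (u t x) * gMat j) *ᵥ (w.dx j t x).ofLp =
      sigmaMat gr H₀ (u t x) *ᵥ (f t x).ofLp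
  boundary₁ : ∀ t ∈ Ioo 0 T, ∀ η : L2Γ Γ ℝ, hNorm Γ (1 / 2) η < ⊤ →
    (∫ s in Ioc 0 Γ.L, normalPart Γ s (wΓ t s) * η s) - dirichletToNeumann Γ hi (ψ t) η =
      ∫ s in Ioc 0 Γ.L, g₁ t s * η s
  boundary₂ : ∀ t ∈ Ioo 0 T, ∀ᵐ s ∂(volume.restrict (Ioc 0 Γ.L)),
    ψt t s + wΓ t s 0 = g₂ t s

/-- The integral over `Γ` of the boundary term `𝔅[w] = 2 w^I (N·w^II)`, at one time. -/
def boundaryTerm (Γ : JordanCurve) (wΓ : L2Γ Γ State) : ℝ :=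
  2 * ∫ s in Ioc 0 Γ.L, wΓ s 0 * normalPart Γ s (wΓ s)

/-- The boundary energy
`c (e^{-2λt} |𝔡_tan ψ(t)|²_{H^{-1/2}} + λ |𝔡_tan ψ|²_{L²_{λ,t} H^{-1/2}})`. -/
def boundaryEnergy (Γ : JordanCurve) (cl : ℝ) (ψ : ℝ → L2Γ Γ ℝ) (lam t : ℝ) : ℝ≥0∞ :=
  ENNReal.ofReal cl *
    (ENNReal.ofReal (Real.exp (-2 * lam * t)) * hNormTan Γ (-1 / 2) (ψ t) ^ 2 +
      ENNReal.ofReal lam * l2Norm lam t (fun τ => hNormTan Γ (-1 / 2) (ψ τ)) ^ 2)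

/-- The data term
`C₀ (|𝔡_tan ψ(0)|²_{H^{-1/2}} + ‖g̃₁(0)‖² + S*(‖f‖)² + S*(|||g̃₁|||₁)²
  + λ⁻¹ |𝔡_tan g₂|²_{L²_{λ,t} H^{-1/2}})`. -/
def dataTerm (Γ : JordanCurve) (C₀ : ℝ) {T : ℝ} (ψ : ℝ → L2Γ Γ ℝ) (f : ℝ → L2 Γ.ext State)
    (g₁ext : W1 Γ.ext ℝ T) (g₂ : ℝ → L2Γ Γ ℝ) (lam t : ℝ) : ℝ≥0∞ :=
  ENNReal.ofReal C₀ *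
    (hNormTan Γ (-1 / 2) (ψ 0) ^ 2 + ENNReal.ofReal (‖g₁ext.val 0‖ ^ 2) +
      sStar lam t (fun τ => ‖f τ‖) ^ 2 + sStar lam t g₁ext.norm1 ^ 2 +
      ENNReal.ofReal lam⁻¹ * l2Norm lam t (fun τ => hNormTan Γ (-1 / 2) (g₂ τ)) ^ 2)

/-- The boundary term `τ ↦ ∫_Γ 𝔅(τ)` is weakly dissipative, with threshold `lam₀`, boundary energy
`E` and data term `S` (all the quantities involved are finite); `α₀` is the coercivity constant of
the symmetrizer and `w` the solution. -/
structure IsWeaklyDissipative (Γ : JordanCurve) {T : ℝ} (w : W1 Γ.ext State T) (B : ℝ → ℝ)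
    (α₀ lam₀ : ℝ) (E S : ℝ → ℝ → ℝ≥0∞) : Prop where
  integrable : IntegrableOn B (Icc 0 T)
  energy_finite : ∀ lam ≥ lam₀, ∀ t ∈ Icc 0 T, E lam t < ⊤
  data_finite : ∀ lam ≥ lam₀, ∀ t ∈ Icc 0 T, S lam t < ⊤
  iNorm_finite : ∀ lam ≥ lam₀, ∀ t ∈ Icc 0 T, iNorm lam t (fun τ => ‖w.val τ‖) < ⊤
  data_mono : ∀ lam ≥ lam₀, MonotoneOn (S lam) (Icc 0 T)
  estimate : ∀ lam ≥ lam₀, ∀ t ∈ Icc 0 T,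
    ∫ τ in (0 : ℝ)..t, Real.exp (-2 * lam * τ) * B τ ≤
      -(E lam t).toReal + (S lam t).toReal +
        α₀ / 8 * (iNorm lam t (fun τ => ‖w.val τ‖)).toReal ^ 2

end WaveStructure

end

noncomputable section
namespace WaveStructure

/-! ### Traces as the closure of a graph -/

section TraceSpace

variable {F : Type} [NormedAddCommGroup F] [NormedSpace ℝ F]

/-! The Dirichlet-to-Neumann form is a Gram form. Let T = √h_i ∇ act on the H¹(𝓘) functions with
trace, and let K be the image of those with zero trace; K is closed by the Poincaré inequality
(`exists_poincare`). The component Φψ of T(extension of ψ) orthogonal to K depends on ψ only and is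
the weighted gradient of the harmonic extension. Hence ⟨Λψ,η⟩ = ⟨Φψ,Φη⟩, and ‖Φψ‖² is the least
weighted Dirichlet energy of an extension of ψ (`exists_dn_factorization`). Part (a) thus reduces to
two inequalities involving the gradient alone: a homogeneous trace estimate for the lower bound
(`IsSide.exists_trace_hNorm`), and for the upper bound an extension built from Fourier modes that
decay like e^{|k|r} in tubular coordinates (`exists_extension`).

For part (b), the two conditions on Γ turn the boundary term into 2g₁w^I + 2⟨Λψ,w^I⟩ with w^I = g₂ -
∂_tψ. The second summand is 2⟨Φψ,Φg₂⟩ - d/dt ‖Φψ‖². After multiplication by e^{-2λt} an integration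
by parts produces -2λ∫‖Φψ‖², half of which absorbs the cross term with Φg₂ (`boundary_energy_le`).

The first summand is the delicate one, since the trace of w^I is not controlled by the L² norm of w.
The integral of g₁w^I over Γ is rewritten as an integral over 𝓔 by means of a field X supported near
Γ (`IsSide.exists_trace_identity`); the only term with a derivative of w is g̃₁ X_j ∂_j w^I. Now the
last two rows of ∑ G_j ∂_j w are exactly ∇w^I, and the symmetrized equation says ∑ G_j ∂_j w = f -
S(u)∂_t w. The time derivative is then moved onto g̃₁, for which Lipschitz continuity of S(u) in
time is enough (`weighted_pairing_le`). What remains involves only f, g̃₁ with its first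
derivatives, and the L² norm of w, and it is closed by the duality between I and S* and by Young's
inequality (`exists_boundary_source_bound`); I(g̃₁) itself is bounded by g̃₁(0) and S*(∂_t g̃₁)
(`iNorm_sq_le_of_hasDeriv`). The threshold λ₀ only has to dominate the Lipschitz constant of S(u).
-/

lemma pderiv_add {j : Fin 2} {φ ψ : Plane → F} (hφ : ContDiff ℝ ∞ φ) (hψ : ContDiff ℝ ∞ ψ) :
    pderiv j (φ + ψ) = pderiv j φ + pderiv j ψ := by
  funext x
  simp only [pderiv, Pi.add_apply]
  rw [fderiv_add (hφ.differentiable (by simp) x) (hψ.differentiable (by simp) x)]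
  rfl

lemma pderiv_smul {j : Fin 2} {φ : Plane → F} (c : ℝ) (hφ : ContDiff ℝ ∞ φ) :
    pderiv j (c • φ) = c • pderiv j φ := by
  funext x
  simp only [pderiv, Pi.smul_apply]
  rw [fderiv_const_smul (hφ.differentiable (by simp) x)]
  rfl

lemma contDiff_pderiv {j : Fin 2} {φ : Plane → F} (hφ : ContDiff ℝ ∞ φ) :
    ContDiff ℝ ∞ (pderiv j φ) :=
  (hφ.fderiv_right (m := ∞) (by simp)).clm_apply contDiff_const

lemma hasCompactSupport_pderiv {j : Fin 2} {φ : Plane → F} (hφ : HasCompactSupport φ) :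
    HasCompactSupport (pderiv j φ) :=
  hφ.fderiv_apply (𝕜 := ℝ) _

variable (F) in
/-- The space of smooth compactly supported functions on the plane. -/
def testFun : Submodule ℝ (Plane → F) where
  carrier := {φ | ContDiff ℝ ∞ φ ∧ HasCompactSupport φ}
  add_mem' h₁ h₂ := ⟨h₁.1.add h₂.1, h₁.2.add h₂.2⟩
  zero_mem' := ⟨contDiff_const, HasCompactSupport.zero⟩
  smul_mem' c _ h := ⟨h.1.const_smul c, h.2.smul_left (f := fun _ => c)⟩

lemma memLp_of_test {E : Type} [NormedAddCommGroup E] {φ : Plane → E} (hφ : Continuous φ) (hc : HasCompactSupport φ)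
    (Ω : Set Plane) : MemLp φ 2 (volume.restrict Ω) :=
  (hφ.memLp_of_hasCompactSupport (μ := volume) hc).restrict Ω

lemma JordanCurve.continuous_γ (Γ : JordanCurve) : Continuous Γ.γ := Γ.smooth.continuous

lemma memLp_Ioc {E : Type} [NormedAddCommGroup E] {g : ℝ → E} (hg : Continuous g) (a b : ℝ) :
    MemLp g 2 ((volume : Measure ℝ).restrict (Ioc a b)) := by
  obtain ⟨C, hC⟩ := (isCompact_Icc (a := a) (b := b)).exists_bound_of_continuousOn hg.continuousOn
  refine MemLp.of_bound hg.aestronglyMeasurable C ?_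
  filter_upwards [ae_restrict_mem measurableSet_Ioc] with s hs
  exact hC s ⟨hs.1.le, hs.2⟩

/-- The space of triples (function, gradient, boundary values). -/
abbrev Triple (Γ : JordanCurve) (Ω : Set Plane) (F : Type) [NormedAddCommGroup F] : Type :=
  L2 Ω F × (Fin 2 → L2 Ω F) × L2Γ Γ F

/-- The triple `(φ, ∇φ, φ|_Γ)` of a smooth compactly supported function. -/
def testTriple (Γ : JordanCurve) (Ω : Set Plane) : testFun F →ₗ[ℝ] Triple Γ Ω F where
  toFun φ := ((memLp_of_test φ.2.1.continuous φ.2.2 Ω).toLp φ.1,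
    fun j => (memLp_of_test (contDiff_pderiv (j := j) φ.2.1).continuous
      (hasCompactSupport_pderiv φ.2.2) Ω).toLp _,
    (memLp_Ioc (φ.2.1.continuous.comp Γ.continuous_γ) 0 Γ.L).toLp _)
  map_add' φ ψ := by
    refine Prod.ext rfl (Prod.ext ?_ rfl)
    funext j
    simp only [Submodule.coe_add, pderiv_add φ.2.1 ψ.2.1]
    rfl
  map_smul' c φ := by
    refine Prod.ext rfl (Prod.ext ?_ rfl)
    funext j
    simp only [Submodule.coe_smul, pderiv_smul c φ.2.1]
    rfl

/-- The space of triples `(f, ∇f, f|_Γ)` with `f ∈ H¹(Ω)` (in the closure of test functions). -/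
def traceSpace (Γ : JordanCurve) (Ω : Set Plane) (F : Type) [NormedAddCommGroup F]
    [NormedSpace ℝ F] : Submodule ℝ (Triple Γ Ω F) :=
  (LinearMap.range (testTriple (F := F) Γ Ω)).topologicalClosure

lemma testTriple_mem (Γ : JordanCurve) (Ω : Set Plane) (φ : testFun F) :
    testTriple Γ Ω φ ∈ traceSpace Γ Ω F :=
  Submodule.le_topologicalClosure _ ⟨φ, rfl⟩

lemma isClosed_traceSpace (Γ : JordanCurve) (Ω : Set Plane) :
    IsClosed (traceSpace Γ Ω F : Set (Triple Γ Ω F)) :=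
  Submodule.isClosed_topologicalClosure _

/-- Closed properties extend from test functions to the trace space. -/
lemma traceSpace_induction {Γ : JordanCurve} {Ω : Set Plane} {P : Triple Γ Ω F → Prop}
    (hP : IsClosed {x | P x}) (h : ∀ φ, P (testTriple Γ Ω φ)) {x : Triple Γ Ω F}
    (hx : x ∈ traceSpace Γ Ω F) : P x := by
  refine closure_minimal (t := {x | P x}) ?_ hP hx
  rintro _ ⟨φ, rfl⟩
  exact h φ

lemma tendsto_toLp_iff {E : Type} [NormedAddCommGroup E] {α : Type*} [MeasurableSpace α] {μ : Measure α} {φ : ℕ → α → E}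
    (hφ : ∀ n, MemLp (φ n) 2 μ) (f : Lp E 2 μ) :
    Tendsto (fun n => (hφ n).toLp (φ n)) atTop (𝓝 f) ↔
      Tendsto (fun n => eLpNorm (fun x => φ n x - f x) 2 μ) atTop (𝓝 0) := by
  rw [Lp.tendsto_Lp_iff_tendsto_eLpNorm']
  refine iff_of_eq (congrArg (fun g => Tendsto g atTop (𝓝 0)) (funext fun n => ?_))
  refine eLpNorm_congr_ae ?_
  filter_upwards [(hφ n).coeFn_toLp] with x hx
  simp [hx]

/-- The three convergences together are convergence of `testTriple` in a product of normed spaces,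
where closure is sequential. Traces thereby become membership in a closed subspace, and any closed
property of triples need only be checked on test functions. -/
theorem hasTrace_iff {Γ : JordanCurve} {Ω : Set Plane} {f : L2 Ω F} {df : Fin 2 → L2 Ω F}
    {g : L2Γ Γ F} : HasTrace Γ Ω f df g ↔ (f, df, g) ∈ traceSpace Γ Ω F := by
  have key : ∀ φ : ℕ → testFun F, Tendsto (fun n => testTriple Γ Ω (φ n)) atTop (𝓝 (f, df, g)) ↔
      Tendsto (fun n => eLpNorm (fun x => (φ n).1 x - f x) 2 (volume.restrict Ω)) atTop (𝓝 0) ∧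
      (∀ j, Tendsto (fun n => eLpNorm (fun x => pderiv j (φ n).1 x - df j x) 2
        (volume.restrict Ω)) atTop (𝓝 0)) ∧
      Tendsto (fun n => eLpNorm (fun s => (φ n).1 (Γ.γ s) - g s) 2
        (volume.restrict (Ioc 0 Γ.L))) atTop (𝓝 0) := by
    intro φ
    rw [Prod.tendsto_iff, Prod.tendsto_iff, tendsto_pi_nhds]
    refine and_congr (tendsto_toLp_iff (fun n => memLp_of_test (φ n).2.1.continuous (φ n).2.2 Ω) f)
      (and_congr (forall_congr' fun j => ?_) ?_)
    · exact tendsto_toLp_iff (fun n => memLp_of_test (contDiff_pderiv (j := j) (φ n).2.1).continuous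
        (hasCompactSupport_pderiv (φ n).2.2) Ω) (df j)
    · exact tendsto_toLp_iff
        (fun n => memLp_Ioc ((φ n).2.1.continuous.comp Γ.continuous_γ) 0 Γ.L) g
  constructor
  · rintro ⟨φ, hφ, h⟩
    refine mem_closure_of_tendsto ((key fun n => ⟨φ n, hφ n⟩).2 h) ?_
    exact Eventually.of_forall fun n => ⟨⟨φ n, hφ n⟩, rfl⟩
  · intro h
    obtain ⟨x, hx, hlim⟩ := mem_closure_iff_seq_limit.1 h
    choose φ hφ using hx
    refine ⟨fun n => (φ n).1, fun n => (φ n).2, (key φ).1 ?_⟩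
    simpa only [hφ] using hlim

end TraceSpace

/-! ### Multiplication operators on `L²` -/

section L2Ops

variable {α : Type*} [MeasurableSpace α] {μ : Measure α}

lemma L2_norm_sq {F : Type*} [NormedAddCommGroup F] [InnerProductSpace ℝ F] (f : Lp F 2 μ) :
    ‖f‖ ^ 2 = ∫ x, ‖f x‖ ^ 2 ∂μ := by
  rw [← real_inner_self_eq_norm_sq, L2.inner_def]
  simp only [real_inner_self_eq_norm_sq]

lemma L2_norm_sq_toLp {F : Type*} [NormedAddCommGroup F] [InnerProductSpace ℝ F] {f : α → F}
    (hf : MemLp f 2 μ) : ‖hf.toLp f‖ ^ 2 = ∫ x, ‖f x‖ ^ 2 ∂μ := by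
  rw [L2_norm_sq]
  refine integral_congr_ae ?_
  filter_upwards [hf.coeFn_toLp] with x hx
  rw [hx]

variable {F G : Type*} [NormedAddCommGroup F] [NormedSpace ℝ F] [NormedAddCommGroup G]
  [NormedSpace ℝ G]

/-- Pointwise application of a bounded measurable field of operators. -/
theorem exists_mulOp {A : α → F →L[ℝ] G} (hA : AEStronglyMeasurable A μ) {C : ℝ} (hC : 0 ≤ C)
    (hb : ∀ᵐ x ∂μ, ‖A x‖ ≤ C) : ∃ T : Lp F 2 μ →L[ℝ] Lp G 2 μ, ‖T‖ ≤ C ∧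
      ∀ f : Lp F 2 μ, T f =ᵐ[μ] fun x => A x (f x) := by
  have hm : ∀ f : Lp F 2 μ, MemLp (fun x => A x (f x)) 2 μ := by
    intro f
    refine (Lp.memLp f).of_le_mul (c := C)
      (isBoundedBilinearMap_apply.continuous.comp_aestronglyMeasurable
        (hA.prodMk (Lp.aestronglyMeasurable f))) ?_
    filter_upwards [hb] with x hx
    exact ((A x).le_opNorm _).trans (mul_le_mul_of_nonneg_right hx (norm_nonneg _))
  let T₀ : Lp F 2 μ →ₗ[ℝ] Lp G 2 μ :=
    { toFun := fun f => (hm f).toLp _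
      map_add' := by
        intro f g
        rw [← MemLp.toLp_add]
        refine MemLp.toLp_congr _ _ ?_
        filter_upwards [Lp.coeFn_add f g] with x hx
        rw [hx, Pi.add_apply, Pi.add_apply, map_add]
      map_smul' := by
        intro c f
        rw [RingHom.id_apply, ← MemLp.toLp_const_smul]
        refine MemLp.toLp_congr _ _ ?_
        filter_upwards [Lp.coeFn_smul c f] with x hx
        rw [hx, Pi.smul_apply, Pi.smul_apply, map_smul] }
  have hT₀ : ∀ f, ‖T₀ f‖ ≤ C * ‖f‖ := by
    intro f
    refine Lp.norm_le_mul_norm_of_ae_le_mul ?_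
    filter_upwards [(hm f).coeFn_toLp, hb] with x hx hxb
    change ‖((hm f).toLp _) x‖ ≤ _
    rw [hx]
    exact ((A x).le_opNorm _).trans (mul_le_mul_of_nonneg_right hxb (norm_nonneg _))
  exact ⟨T₀.mkContinuous C hT₀, T₀.mkContinuous_norm_le hC hT₀, fun f => (hm f).coeFn_toLp⟩

/-- Multiplication by a bounded measurable function. -/
theorem exists_smulOp {m : α → ℝ} (hm : AEStronglyMeasurable m μ) {C : ℝ} (hC : 0 ≤ C)
    (hb : ∀ᵐ x ∂μ, |m x| ≤ C) : ∃ T : Lp F 2 μ →L[ℝ] Lp F 2 μ, ‖T‖ ≤ C ∧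
      ∀ f : Lp F 2 μ, T f =ᵐ[μ] fun x => m x • f x := by
  obtain ⟨T, hT, h⟩ := exists_mulOp (F := F) (G := F) (A := fun x => m x • ContinuousLinearMap.id ℝ F)
    (hm.smul_const _) hC (hb.mono fun x hx => by
      refine (norm_smul_le (m x) (ContinuousLinearMap.id ℝ F)).trans ?_
      rw [Real.norm_eq_abs]
      exact (mul_le_of_le_one_right (abs_nonneg (m x)) ContinuousLinearMap.norm_id_le).trans hx)
  exact ⟨T, hT, h⟩

lemma integral_mul_mul_eq_inner {m : α → ℝ} {T : Lp ℝ 2 μ →L[ℝ] Lp ℝ 2 μ}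
    (hT : ∀ f : Lp ℝ 2 μ, T f =ᵐ[μ] fun x => m x • f x) (f g : Lp ℝ 2 μ) :
    inner ℝ (T f) g = ∫ x, m x * (f x * g x) ∂μ := by
  rw [L2.inner_def]
  refine integral_congr_ae ?_
  filter_upwards [hT f] with x hx
  rw [hx]
  simp only [smul_eq_mul, RCLike.inner_apply, conj_trivial]
  ring

lemma L2_inner_eq (f g : Lp ℝ 2 μ) : inner ℝ f g = ∫ x, f x * g x ∂μ := by
  rw [L2.inner_def]
  simp only [RCLike.inner_apply, conj_trivial, mul_comm]

end L2Ops

/-! ### Weak derivatives of elements of the trace space -/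

/-- Elements of the trace space have the prescribed weak derivatives. -/
theorem isWeakPartial_of_mem_traceSpace {Γ : JordanCurve} {Ω : Set Plane}
    {x : Triple Γ Ω ℝ} (hx : x ∈ traceSpace Γ Ω ℝ) (j : Fin 2) :
    IsWeakPartial Ω j x.1 (x.2.1 j) := by
  intro θ hθ hθc hθs
  let a : L2 Ω ℝ := (memLp_of_test (contDiff_pderiv (j := j) hθ).continuous
      (hasCompactSupport_pderiv hθc) Ω).toLp _
  let b : L2 Ω ℝ := (memLp_of_test hθ.continuous hθc Ω).toLp _
  have ha : ∀ f : L2 Ω ℝ, ∫ x in Ω, pderiv j θ x • f x = inner ℝ a f := by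
    intro f
    rw [L2_inner_eq]
    refine integral_congr_ae ?_
    filter_upwards [MemLp.coeFn_toLp (memLp_of_test (contDiff_pderiv (j := j) hθ).continuous
      (hasCompactSupport_pderiv hθc) Ω)] with x hx
    rw [hx, smul_eq_mul]
  have hb : ∀ f : L2 Ω ℝ, ∫ x in Ω, θ x • f x = inner ℝ b f := by
    intro f
    rw [L2_inner_eq]
    refine integral_congr_ae ?_
    filter_upwards [MemLp.coeFn_toLp (memLp_of_test hθ.continuous hθc Ω)] with x hx
    rw [hx, smul_eq_mul]
  rw [ha, hb]
  refine traceSpace_induction (P := fun x => inner ℝ a x.1 = -inner ℝ b (x.2.1 j)) ?_ ?_ hx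
  · exact isClosed_eq (by fun_prop) (by fun_prop)
  · intro φ
    rw [← ha, ← hb]
    -- The support of θ lies in Ω, so both integrals extend to the whole plane, where integration by
    -- parts has no boundary term.
    have hz : ∀ x ∉ Ω, x ∉ tsupport θ := fun x hx h => hx (hθs h)
    have e₁ : ∫ x in Ω, pderiv j θ x • (testTriple Γ Ω φ).1 x = ∫ x, pderiv j θ x * φ.1 x := by
      refine Eq.trans (integral_congr_ae ?_)
        (setIntegral_eq_integral_of_forall_compl_eq_zero (s := Ω) fun x hx => ?_)
      · filter_upwards [MemLp.coeFn_toLp (memLp_of_test φ.2.1.continuous φ.2.2 Ω)] with x hx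
        exact congrArg (fun y => pderiv j θ x * y) hx
      · have h0 : fderiv ℝ θ x = 0 := by
          by_contra h
          exact hz x hx (support_fderiv_subset ℝ h)
        simp [pderiv, h0]
    have e₂ : ∫ x in Ω, θ x • (testTriple Γ Ω φ).2.1 j x = ∫ x, θ x * pderiv j φ.1 x := by
      refine Eq.trans (integral_congr_ae ?_)
        (setIntegral_eq_integral_of_forall_compl_eq_zero (s := Ω) fun x hx => ?_)
      · filter_upwards [MemLp.coeFn_toLp (memLp_of_test (contDiff_pderiv (j := j) φ.2.1).continuous
          (hasCompactSupport_pderiv φ.2.2) Ω)] with x hx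
        exact congrArg (fun y => θ x * y) hx
      · simp [image_eq_zero_of_notMem_tsupport (hz x hx)]
    rw [e₁, e₂]
    have := integral_mul_fderiv_eq_neg_fderiv_mul_of_integrable (μ := (volume : Measure Plane))
      (f := θ) (g := φ.1) (v := EuclideanSpace.single j 1) ?_ ?_ ?_
      (fun x _ => hθ.differentiable (by simp) x) (fun x _ => φ.2.1.differentiable (by simp) x)
    · simp only [pderiv]
      linarith
    · exact ((contDiff_pderiv (j := j) hθ).continuous.mul φ.2.1.continuous).integrable_of_hasCompactSupport
        (φ.2.2.mul_left)
    · exact (hθ.continuous.mul (contDiff_pderiv (j := j) φ.2.1).continuous).integrable_of_hasCompactSupport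
        (hθc.mul_right)
    · exact (hθ.continuous.mul φ.2.1.continuous).integrable_of_hasCompactSupport (φ.2.2.mul_left)

/-- The weak derivative clause passes to limits of test functions, so it is automatic once the
triple lies in the closed trace space. -/
lemma isExtension_iff {Γ : JordanCurve} {ψ : L2Γ Γ ℝ} {p : L2 Γ.int ℝ}
    {dp : Fin 2 → L2 Γ.int ℝ} : IsExtension Γ ψ p dp ↔ (p, dp, ψ) ∈ traceSpace Γ Γ.int ℝ := by
  rw [IsExtension, hasTrace_iff]
  exact ⟨fun h => h.2, fun h => ⟨fun j => isWeakPartial_of_mem_traceSpace h j, h⟩⟩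

end WaveStructure
end

noncomputable section
namespace WaveStructure

/-! ### Tubular coordinates -/

namespace JordanCurve

variable (Γ : JordanCurve)

instance : Fact (0 < Γ.L) := ⟨Γ.L_pos⟩

/-- The unit tangent. -/
def tang (s : ℝ) : Plane := deriv Γ.γ s

/-- The curvature. -/
def curv (s : ℝ) : ℝ := deriv Γ.tang s 1 * Γ.tang s 0 - deriv Γ.tang s 0 * Γ.tang s 1

lemma contDiff_tang : ContDiff ℝ ∞ Γ.tang :=
  (contDiff_infty_iff_deriv.1 Γ.smooth).2

lemma contDiff_coord {n : WithTop ℕ∞} {E : Type*} [NormedAddCommGroup E] [NormedSpace ℝ E]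
    {f : E → Plane} (hf : ContDiff ℝ n f) (i : Fin 2) : ContDiff ℝ n (fun x => f x i) :=
  contDiff_euclidean.1 hf i

lemma contDiff_normal : ContDiff ℝ ∞ Γ.normal := by
  refine contDiff_euclidean.2 fun i => ?_
  have h := Γ.contDiff_tang
  fin_cases i
  · exact contDiff_coord h 1
  · exact (contDiff_coord h 0).neg

lemma contDiff_curv : ContDiff ℝ ∞ Γ.curv := by
  have h := Γ.contDiff_tang
  have h' : ContDiff ℝ ∞ (deriv Γ.tang) := (contDiff_infty_iff_deriv.1 h).2
  exact ((contDiff_coord h' 1).mul (contDiff_coord h 0)).sub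
    ((contDiff_coord h' 0).mul (contDiff_coord h 1))

lemma normal_zero (s : ℝ) : Γ.normal s 0 = Γ.tang s 1 := rfl

lemma normal_one (s : ℝ) : Γ.normal s 1 = -Γ.tang s 0 := rfl

lemma periodic_tang : Function.Periodic Γ.tang Γ.L := fun s => by
  unfold tang
  rw [← deriv_comp_add_const, show (fun x => Γ.γ (x + Γ.L)) = Γ.γ from funext Γ.periodic]

lemma periodic_normal : Function.Periodic Γ.normal Γ.L := fun s => by
  ext i
  fin_cases i
  · exact congrArg (fun v : Plane => v 1) (Γ.periodic_tang s)
  · exact congrArg (fun v : Plane => -v 0) (Γ.periodic_tang s)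

lemma periodic_curv : Function.Periodic Γ.curv Γ.L := fun s => by
  have h : deriv Γ.tang (s + Γ.L) = deriv Γ.tang s := by
    rw [← deriv_comp_add_const, show (fun x => Γ.tang (x + Γ.L)) = Γ.tang from
      funext Γ.periodic_tang]
  simp only [curv, h, Γ.periodic_tang s]

lemma tang_sq (s : ℝ) : Γ.tang s 0 ^ 2 + Γ.tang s 1 ^ 2 = 1 := by
  have h := Γ.unit_speed s
  rw [EuclideanSpace.norm_eq, Real.sqrt_eq_one] at h
  simpa [Fin.sum_univ_two, tang] using h

lemma hasDerivAt_coord {f : ℝ → Plane} {f' : Plane} {s : ℝ} (hf : HasDerivAt f f' s) (i : Fin 2) :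
    HasDerivAt (fun s => f s i) (f' i) s :=
  (EuclideanSpace.proj i : Plane →L[ℝ] ℝ).hasFDerivAt.comp_hasDerivAt s hf

lemma hasDerivAt_of_coord {f : ℝ → Plane} {f' : Plane} {s : ℝ}
    (hf : ∀ i, HasDerivAt (fun s => f s i) (f' i) s) : HasDerivAt f f' s :=
  (PiLp.continuousLinearEquiv 2 ℝ (fun _ : Fin 2 => ℝ)).symm.hasFDerivAt.comp_hasDerivAt s
    (hasDerivAt_pi.2 hf)

lemma hasDerivAt_tang (s : ℝ) : HasDerivAt Γ.tang (deriv Γ.tang s) s :=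
  (Γ.contDiff_tang.differentiable (by simp) s).hasDerivAt

/-- Frenet's formula: differentiating |τ|² = 1 gives τ·τ' = 0, and since the normal is the tangent
rotated by a right angle, its derivative is a multiple of τ. -/
lemma hasDerivAt_normal (s : ℝ) : HasDerivAt Γ.normal (Γ.curv s • Γ.tang s) s := by
  have h0 := hasDerivAt_coord (Γ.hasDerivAt_tang s) 0
  have h1 := hasDerivAt_coord (Γ.hasDerivAt_tang s) 1
  have hsq := (h0.pow 2).add (h1.pow 2)
  have hc : HasDerivAt (fun s => Γ.tang s 0 ^ 2 + Γ.tang s 1 ^ 2) 0 s := by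
    simp only [Γ.tang_sq]
    exact hasDerivAt_const s 1
  have e := hsq.unique hc
  have hs := Γ.tang_sq s
  norm_num at e
  refine hasDerivAt_of_coord fun i => ?_
  fin_cases i
  · refine h1.congr_deriv ?_
    simp only [curv, PiLp.smul_apply, smul_eq_mul, Fin.zero_eta]
    linear_combination (-(deriv Γ.tang s 1)) * hs + Γ.tang s 1 / 2 * e
  · refine h0.neg.congr_deriv ?_
    simp only [curv, PiLp.smul_apply, smul_eq_mul, Fin.mk_one]
    linear_combination (deriv Γ.tang s 0) * hs - Γ.tang s 0 / 2 * e

/-- The tubular coordinates `(s, r) ↦ γ(s) + r N(s)`. -/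
def tube (p : ℝ × ℝ) : Plane := Γ.γ p.1 + p.2 • Γ.normal p.1

/-- The signed Jacobian of the tubular coordinates. -/
def jac (p : ℝ × ℝ) : ℝ := 1 + p.2 * Γ.curv p.1

lemma contDiff_tube : ContDiff ℝ ∞ Γ.tube :=
  (Γ.smooth.comp contDiff_fst).add (contDiff_snd.smul (Γ.contDiff_normal.comp contDiff_fst))

lemma contDiff_jac : ContDiff ℝ ∞ Γ.jac :=
  contDiff_const.add (contDiff_snd.mul (Γ.contDiff_curv.comp contDiff_fst))

lemma tube_add_period (s r : ℝ) : Γ.tube (s + Γ.L, r) = Γ.tube (s, r) := by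
  simp only [tube, Γ.periodic s, Γ.periodic_normal s]

lemma jac_add_period (s r : ℝ) : Γ.jac (s + Γ.L, r) = Γ.jac (s, r) := by
  simp only [jac, Γ.periodic_curv s]

/-- The derivative of the tubular coordinates. -/
def tubeDeriv (p : ℝ × ℝ) : ℝ × ℝ →L[ℝ] Plane :=
  (ContinuousLinearMap.fst ℝ ℝ ℝ).smulRight (Γ.jac p • Γ.tang p.1) +
    (ContinuousLinearMap.snd ℝ ℝ ℝ).smulRight (Γ.normal p.1)

lemma hasDerivAt_γ (s : ℝ) : HasDerivAt Γ.γ (Γ.tang s) s :=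
  (Γ.smooth.differentiable (by simp) s).hasDerivAt

lemma hasFDerivAt_tube (p : ℝ × ℝ) : HasFDerivAt Γ.tube (Γ.tubeDeriv p) p := by
  have h1 := (Γ.hasDerivAt_γ p.1).hasFDerivAt.comp p (hasFDerivAt_fst (𝕜 := ℝ) (p := p))
  have h2 := (Γ.hasDerivAt_normal p.1).hasFDerivAt.comp p (hasFDerivAt_fst (𝕜 := ℝ) (p := p))
  have h3 := (hasFDerivAt_snd (𝕜 := ℝ) (p := p)).smul h2
  refine (h1.add h3).congr_fderiv ?_
  ext i <;> (simp [tubeDeriv, jac]; try ring)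

/-- The derivative of the tubular coordinates, as an equivalence. -/
def tubeDerivEquiv (p : ℝ × ℝ) (h : Γ.jac p ≠ 0) : (ℝ × ℝ) ≃L[ℝ] Plane :=
  ContinuousLinearEquiv.equivOfInverse (Γ.tubeDeriv p)
    (((Γ.jac p)⁻¹ • innerSL ℝ (Γ.tang p.1)).prod (innerSL ℝ (Γ.normal p.1)))
    (by
      intro q
      have := Γ.tang_sq p.1
      ext
      · simp [tubeDeriv, Fin.sum_univ_two, PiLp.inner_apply, normal_zero, normal_one]
        field_simp
        linear_combination q.1 * Γ.jac p * this
      · simp [tubeDeriv, Fin.sum_univ_two, PiLp.inner_apply, normal_zero, normal_one]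
        linear_combination q.2 * this)
    (by
      intro v
      have := Γ.tang_sq p.1
      ext i
      fin_cases i
      · simp [tubeDeriv, Fin.sum_univ_two, PiLp.inner_apply, normal_zero, normal_one]
        field_simp
        linear_combination v 0 * this
      · simp [tubeDeriv, Fin.sum_univ_two, PiLp.inner_apply, normal_zero, normal_one]
        field_simp
        linear_combination v 1 * this)

lemma hasFDerivAt_tube_equiv (p : ℝ × ℝ) (h : Γ.jac p ≠ 0) :
    HasFDerivAt Γ.tube (Γ.tubeDerivEquiv p h : ℝ × ℝ →L[ℝ] Plane) p := by
  refine (Γ.hasFDerivAt_tube p).congr_fderiv ?_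
  ext <;> rfl

/-- The derivative of a function along the tubular coordinates. -/
lemma hasDerivAt_comp_tube_left {F : Type*} [NormedAddCommGroup F] [NormedSpace ℝ F]
    {φ : Plane → F} (hφ : Differentiable ℝ φ) (s r : ℝ) :
    HasDerivAt (fun s => φ (Γ.tube (s, r)))
      (Γ.jac (s, r) • fderiv ℝ φ (Γ.tube (s, r)) (Γ.tang s)) s := by
  have h1 : HasDerivAt (fun s : ℝ => (s, r)) (1, 0) s := (hasDerivAt_id s).prodMk (hasDerivAt_const s r)
  have h2 := (hφ (Γ.tube (s, r))).hasFDerivAt.comp_hasDerivAt s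
    ((Γ.hasFDerivAt_tube (s, r)).comp_hasDerivAt s h1)
  refine h2.congr_deriv ?_
  simp [tubeDeriv]

lemma hasDerivAt_comp_tube_right {F : Type*} [NormedAddCommGroup F] [NormedSpace ℝ F]
    {φ : Plane → F} (hφ : Differentiable ℝ φ) (s r : ℝ) :
    HasDerivAt (fun r => φ (Γ.tube (s, r))) (fderiv ℝ φ (Γ.tube (s, r)) (Γ.normal s)) r := by
  have h1 : HasDerivAt (fun r : ℝ => (s, r)) (0, 1) r := (hasDerivAt_const r s).prodMk (hasDerivAt_id r)
  have h2 := (hφ (Γ.tube (s, r))).hasFDerivAt.comp_hasDerivAt r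
    ((Γ.hasFDerivAt_tube (s, r)).comp_hasDerivAt r h1)
  refine h2.congr_deriv ?_
  simp [tubeDeriv]

lemma fderiv_eq_pderiv {F : Type} [NormedAddCommGroup F] [NormedSpace ℝ F] (φ : Plane → F)
    (x v : Plane) : fderiv ℝ φ x v = v 0 • pderiv 0 φ x + v 1 • pderiv 1 φ x := by
  have : v = v 0 • EuclideanSpace.single 0 1 + v 1 • EuclideanSpace.single 1 1 := by
    ext i
    fin_cases i <;> simp
  conv_lhs => rw [this]
  simp [pderiv]

/-- The gradient in the frame of the tubular coordinates. -/
lemma sum_pderiv_sq (φ : Plane → ℝ) (x : Plane) (s : ℝ) :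
    ∑ j, pderiv j φ x ^ 2 = fderiv ℝ φ x (Γ.tang s) ^ 2 + fderiv ℝ φ x (Γ.normal s) ^ 2 := by
  have := Γ.tang_sq s
  simp only [fderiv_eq_pderiv φ x, Fin.sum_univ_two, normal_zero, normal_one, smul_eq_mul]
  linear_combination (-(pderiv 0 φ x ^ 2 + pderiv 1 φ x ^ 2)) * this

/-! ### The tubular neighbourhood -/

/-- `δ` is an admissible radius of the tubular neighbourhood. -/
structure IsTubeRadius (δ : ℝ) : Prop where
  pos : 0 < δ
  inj : ∀ p q : ℝ × ℝ, |p.2| < δ → |q.2| < δ → Γ.tube p = Γ.tube q →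
    (p.1 : AddCircle Γ.L) = q.1 ∧ p.2 = q.2
  jac_lower : ∀ p : ℝ × ℝ, |p.2| < δ → 1 / 2 ≤ Γ.jac p
  jac_upper : ∀ p : ℝ × ℝ, |p.2| < δ → Γ.jac p ≤ 2

lemma exists_curv_bound : ∃ C, 0 < C ∧ ∀ s, |Γ.curv s| ≤ C := by
  obtain ⟨C, hC⟩ := (isCompact_Icc (a := 0) (b := 0 + Γ.L)).exists_bound_of_continuousOn
    Γ.contDiff_curv.continuous.continuousOn
  refine ⟨max C 1, by positivity, fun s => ?_⟩
  obtain ⟨t, ht, he⟩ := Γ.periodic_curv.exists_mem_Ico₀ Γ.L_pos s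
  rw [he]
  exact (hC t ⟨ht.1, by linarith [ht.2]⟩).trans (le_max_left _ _)

lemma lift_eq {X : Type*} {f : ℝ → X} (hf : Function.Periodic f Γ.L) {s t : ℝ}
    (h : (s : AddCircle Γ.L) = t) : f s = f t := by
  have := congrArg hf.lift h
  simpa using this

/-- On the compact zero section (circle) × {0} the tube map is injective, because the curve is
simple, and it is locally injective by the inverse function theorem. A map with these two properties
is injective on a neighbourhood of the compact set, and the tube lemma makes that neighbourhood
uniform in s. -/
theorem exists_tubeRadius : ∃ δ, Γ.IsTubeRadius δ := by
  let g : AddCircle Γ.L × ℝ → Plane := fun x => Γ.periodic.lift x.1 + x.2 • Γ.periodic_normal.lift x.1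
  have hg : ∀ p : ℝ × ℝ, g ((p.1 : AddCircle Γ.L), p.2) = Γ.tube p := fun p => rfl
  have hgc : Continuous g :=
    (((Γ.continuous_γ).quotient_lift _).comp continuous_fst).add
      (continuous_snd.smul ((Γ.contDiff_normal.continuous.quotient_lift _).comp continuous_fst))
  have hinj : InjOn g (univ ×ˢ {0}) := by
    rintro ⟨x, r⟩ ⟨-, hr⟩ ⟨y, r'⟩ ⟨-, hr'⟩ h
    obtain rfl : r = 0 := hr
    obtain rfl : r' = 0 := hr'
    obtain ⟨⟨a, ha⟩, rfl⟩ := (AddCircle.equivIco Γ.L 0).symm.surjective x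
    obtain ⟨⟨b, hb⟩, rfl⟩ := (AddCircle.equivIco Γ.L 0).symm.surjective y
    have h1 : Γ.tube (a, 0) = Γ.tube (b, 0) := h
    simp only [tube, zero_smul, add_zero] at h1
    rw [zero_add] at ha hb
    have := Γ.injOn ha hb h1
    subst this
    rfl
  have hloc : ∀ x ∈ (univ : Set (AddCircle Γ.L)) ×ˢ ({0} : Set ℝ), ∃ u ∈ 𝓝 x, InjOn g u := by
    rintro ⟨x, r⟩ ⟨-, hr⟩
    obtain rfl : r = 0 := hr
    obtain ⟨a, rfl⟩ := QuotientAddGroup.mk_surjective x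
    have hj : Γ.jac (a, 0) ≠ 0 := by simp [jac]
    let e := (Γ.contDiff_tube.contDiffAt (x := (a, (0 : ℝ)))).toOpenPartialHomeomorph Γ.tube
      (Γ.hasFDerivAt_tube_equiv _ hj) (by simp)
    have he : InjOn Γ.tube e.source := e.injOn
    have hmem : (a, (0 : ℝ)) ∈ e.source :=
      ContDiffAt.mem_toOpenPartialHomeomorph_source _ (Γ.hasFDerivAt_tube_equiv _ hj) (by simp)
    -- The inverse function theorem applies to the unrolled coordinates; the open quotient map
    -- transports the neighbourhood to the circle.
    let m : ℝ × ℝ → AddCircle Γ.L × ℝ := Prod.map (fun s => (s : AddCircle Γ.L)) id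
    have hm : IsOpenMap m := QuotientAddGroup.isOpenMap_coe.prodMap IsOpenMap.id
    refine ⟨m '' e.source, hm.image_mem_nhds (e.open_source.mem_nhds hmem), ?_⟩
    rintro _ ⟨p, hp, rfl⟩ _ ⟨q, hq, rfl⟩ h
    exact congrArg m (he hp hq h)
  obtain ⟨t, ht, htinj⟩ := hinj.exists_mem_nhdsSet
    (isCompact_univ.prod isCompact_singleton) (fun x _ => hgc.continuousAt) hloc
  obtain ⟨u, hu, hsu, hut⟩ := mem_nhdsSet_iff_exists.1 ht
  obtain ⟨v, w, hv, hw, hsv, htw, hvw⟩ := generalized_tube_lemma isCompact_univ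
    (isCompact_singleton (x := (0 : ℝ))) hu hsu
  obtain ⟨ε, hε, hεw⟩ := Metric.isOpen_iff.1 hw 0 (htw rfl)
  obtain ⟨C, hC, hCb⟩ := Γ.exists_curv_bound
  -- The second entry of the minimum keeps |r κ| below 1/2, hence the Jacobian between 1/2 and 3/2.
  have hjac : ∀ p : ℝ × ℝ, |p.2| < min ε (1 / (2 * C)) → |p.2 * Γ.curv p.1| ≤ 1 / 2 := by
    intro p hp
    have h1 := hp.trans_le (min_le_right _ _)
    rw [abs_mul]
    calc |p.2| * |Γ.curv p.1| ≤ 1 / (2 * C) * C :=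
          mul_le_mul h1.le (hCb _) (abs_nonneg _) (by positivity)
      _ = 1 / 2 := by field_simp
  refine ⟨min ε (1 / (2 * C)), by positivity, ?_, ?_, ?_⟩
  · intro p q hp hq h
    have hmem : ∀ p : ℝ × ℝ, |p.2| < min ε (1 / (2 * C)) → ((p.1 : AddCircle Γ.L), p.2) ∈ t := by
      intro p hp
      refine hut (hvw ⟨hsv (mem_univ _), hεw ?_⟩)
      simpa using hp.trans_le (min_le_left _ _)
    have := htinj (hmem p hp) (hmem q hq) h
    exact Prod.ext_iff.1 this
  · intro p hp
    have := abs_le.1 (hjac p hp)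
    unfold jac
    linarith
  · intro p hp
    have := abs_le.1 (hjac p hp)
    unfold jac
    linarith

end JordanCurve
end WaveStructure
end

noncomputable section
namespace WaveStructure

/-! ### The two sides of the curve -/

namespace JordanCurve

variable (Γ : JordanCurve)

lemma isCompact_range : IsCompact (range Γ.γ) := by
  have : range Γ.γ = Γ.γ '' Icc 0 Γ.L := by
    refine subset_antisymm ?_ (image_subset_range _ _)
    rintro _ ⟨s, rfl⟩
    obtain ⟨t, ht, he⟩ := Γ.periodic.exists_mem_Ico₀ Γ.L_pos s
    exact ⟨t, ⟨ht.1, ht.2.le⟩, he.symm⟩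
  rw [this]
  exact isCompact_Icc.image Γ.continuous_γ

lemma isOpen_compl_range : IsOpen (range Γ.γ)ᶜ := Γ.isCompact_range.isClosed.isOpen_compl

lemma connectedComponentIn_eq_of_isPreconnected {S : Set Plane} (hS : IsPreconnected S)
    (hSΓ : S ⊆ (range Γ.γ)ᶜ) {x y : Plane} (hx : x ∈ S) (hy : y ∈ S) :
    connectedComponentIn (range Γ.γ)ᶜ x = connectedComponentIn (range Γ.γ)ᶜ y :=
  connectedComponentIn_eq (hS.subset_connectedComponentIn hx hSΓ hy)

lemma isOpen_int : IsOpen Γ.int := by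
  rw [isOpen_iff_mem_nhds]
  rintro x ⟨hx, hb⟩
  filter_upwards [Γ.isOpen_compl_range.connectedComponentIn.mem_nhds
    (mem_connectedComponentIn (F := (range Γ.γ)ᶜ) hx)] with y hy
  exact ⟨connectedComponentIn_subset _ _ hy, by rwa [← connectedComponentIn_eq hy]⟩

lemma isOpen_ext : IsOpen Γ.ext := by
  rw [isOpen_iff_mem_nhds]
  rintro x ⟨hx, hb⟩
  filter_upwards [Γ.isOpen_compl_range.connectedComponentIn.mem_nhds
    (mem_connectedComponentIn (F := (range Γ.γ)ᶜ) hx)] with y hy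
  exact ⟨connectedComponentIn_subset _ _ hy, by rwa [← connectedComponentIn_eq hy]⟩

/-- If x lies outside a ball containing the curve, then the ray {t x : t ≥ 1} avoids the curve and
stays in the component of x, which is therefore unbounded. -/
lemma isBounded_int : Bornology.IsBounded Γ.int := by
  obtain ⟨R, hR⟩ := Γ.isCompact_range.isBounded.subset_closedBall 0
  have hRn : ∀ y ∈ range Γ.γ, ‖y‖ ≤ R := fun y hy => by simpa using hR hy
  refine (Metric.isBounded_closedBall (x := (0 : Plane)) (r := R)).subset fun x hx => ?_
  by_contra hxR
  rw [mem_closedBall_zero_iff, not_le] at hxR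
  have hR0 : 0 ≤ R := (norm_nonneg _).trans (hRn _ (mem_range_self 0))
  have hx0 : 0 < ‖x‖ := hR0.trans_lt hxR
  have hray : (fun t : ℝ => t • x) '' Ici 1 ⊆ connectedComponentIn (range Γ.γ)ᶜ x := by
    refine IsPreconnected.subset_connectedComponentIn
      (isPreconnected_Ici.image _ (by fun_prop)) ⟨1, mem_Ici.2 le_rfl, one_smul _ _⟩ ?_
    rintro _ ⟨t, ht, rfl⟩ hmem
    have := hRn _ hmem
    simp only [norm_smul, Real.norm_eq_abs] at this
    have h1 : (1 : ℝ) ≤ |t| := (mem_Ici.1 ht).trans (le_abs_self t)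
    nlinarith
  obtain ⟨K, hK⟩ := (hx.2.subset hray).exists_norm_le
  have := hK _ ⟨max 1 ((K + 1) / ‖x‖), mem_Ici.2 (le_max_left _ _), rfl⟩
  simp only [norm_smul, Real.norm_eq_abs] at this
  have h2 : (K + 1) / ‖x‖ ≤ |max 1 ((K + 1) / ‖x‖)| := (le_max_right _ _).trans (le_abs_self _)
  have h3 := mul_le_mul_of_nonneg_right h2 hx0.le
  rw [div_mul_cancel₀ _ hx0.ne'] at h3
  linarith

/-- `Ω` is the side of the curve towards which `σ N` points. -/
structure IsSide (δ σ : ℝ) (Ω : Set Plane) : Prop where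
  radius : Γ.IsTubeRadius δ
  sq : σ ^ 2 = 1
  isOpen : IsOpen Ω
  mem_iff : ∀ s r, |r| < δ → (Γ.tube (s, r) ∈ Ω ↔ 0 < σ * r)

variable {Γ}

lemma IsTubeRadius.notMem_range {δ : ℝ} (hδ : Γ.IsTubeRadius δ) {s r : ℝ} (hr : |r| < δ)
    (h0 : r ≠ 0) : Γ.tube (s, r) ∉ range Γ.γ := by
  rintro ⟨t, ht⟩
  refine h0 (hδ.inj (s, r) (t, 0) hr (by simpa using hδ.pos) ?_).2
  rw [← ht]
  simp [tube]

/-- The orientation only decides the side for very small r. For larger r the normal segment over s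
is connected and, by injectivity of the tube, does not meet the curve again, so it remains in one
component of the complement. -/
lemma IsTubeRadius.side {δ : ℝ} (hδ : Γ.IsTubeRadius δ) (s r : ℝ) (hr : |r| < δ) :
    (0 < r → Γ.tube (s, r) ∈ Γ.ext) ∧ (r < 0 → Γ.tube (s, r) ∈ Γ.int) := by
  obtain ⟨ε, hε, h⟩ := Γ.oriented s
  have hδ0 := hδ.pos
  set m := min ε δ / 2
  have hm : 0 < m := by positivity
  have hmε : m < ε := by linarith [min_le_left ε δ, show m = min ε δ / 2 from rfl]
  have hmδ : m < δ := by linarith [min_le_right ε δ, show m = min ε δ / 2 from rfl]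
  have hcont : Continuous fun r => Γ.tube (s, r) := Γ.contDiff_tube.continuous.comp (by fun_prop)
  constructor
  · intro h0
    have hm' : Γ.tube (s, m) ∈ Γ.ext := (h m ⟨hm, hmε⟩).1
    have hS : (fun r => Γ.tube (s, r)) '' Ioo 0 δ ⊆ (range Γ.γ)ᶜ := by
      rintro _ ⟨r, hr, rfl⟩
      exact hδ.notMem_range (abs_lt.2 ⟨by linarith [hr.1], hr.2⟩) hr.1.ne'
    have hr' : Γ.tube (s, r) ∈ (fun r => Γ.tube (s, r)) '' Ioo 0 δ := ⟨r, ⟨h0, (abs_lt.1 hr).2⟩, rfl⟩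
    refine ⟨hS hr', ?_⟩
    rw [Γ.connectedComponentIn_eq_of_isPreconnected (isPreconnected_Ioo.image _ hcont.continuousOn)
      hS hr' (y := Γ.tube (s, m)) ⟨m, ⟨hm, hmδ⟩, rfl⟩]
    exact hm'.2
  · intro h0
    have hm' : Γ.tube (s, -m) ∈ Γ.int := by
      have := (h m ⟨hm, hmε⟩).2
      rw [sub_eq_add_neg, ← neg_smul] at this
      exact this
    have hS : (fun r => Γ.tube (s, r)) '' Ioo (-δ) 0 ⊆ (range Γ.γ)ᶜ := by
      rintro _ ⟨r, hr, rfl⟩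
      exact hδ.notMem_range (abs_lt.2 ⟨hr.1, by linarith [hr.2]⟩) hr.2.ne
    have hr' : Γ.tube (s, r) ∈ (fun r => Γ.tube (s, r)) '' Ioo (-δ) 0 :=
      ⟨r, ⟨(abs_lt.1 hr).1, h0⟩, rfl⟩
    refine ⟨hS hr', ?_⟩
    rw [Γ.connectedComponentIn_eq_of_isPreconnected (isPreconnected_Ioo.image _ hcont.continuousOn)
      hS hr' (y := Γ.tube (s, -m)) ⟨-m, ⟨by linarith, by linarith⟩, rfl⟩]
    exact hm'.2

lemma tube_zero (s : ℝ) : Γ.tube (s, 0) = Γ.γ s := by simp [tube]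

lemma IsTubeRadius.isSide_ext {δ : ℝ} (hδ : Γ.IsTubeRadius δ) : Γ.IsSide δ 1 Γ.ext where
  radius := hδ
  sq := by norm_num
  isOpen := Γ.isOpen_ext
  mem_iff s r hr := by
    rw [one_mul]
    refine ⟨fun h => ?_, (hδ.side s r hr).1⟩
    rcases lt_trichotomy r 0 with h0 | h0 | h0
    · exact absurd ((hδ.side s r hr).2 h0).2 h.2
    · subst h0
      exact absurd ⟨s, (tube_zero s).symm⟩ h.1
    · exact h0

lemma IsTubeRadius.isSide_int {δ : ℝ} (hδ : Γ.IsTubeRadius δ) : Γ.IsSide δ (-1) Γ.int where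
  radius := hδ
  sq := by norm_num
  isOpen := Γ.isOpen_int
  mem_iff s r hr := by
    rw [neg_one_mul, neg_pos]
    refine ⟨fun h => ?_, (hδ.side s r hr).2⟩
    rcases lt_trichotomy r 0 with h0 | h0 | h0
    · exact h0
    · subst h0
      exact absurd ⟨s, (tube_zero s).symm⟩ h.1
    · exact absurd h.2 ((hδ.side s r hr).1 h0).2

/-! ### Functions given in tubular coordinates -/

variable (Γ)

open Classical in
/-- The function on the plane that is given by `G` in the tubular coordinates, extended by `0`. -/
def push (δ : ℝ) (G : ℝ × ℝ → ℝ) (x : Plane) : ℝ :=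
  if h : ∃ p : ℝ × ℝ, |p.2| < δ ∧ Γ.tube p = x then G h.choose else 0

/-- A function of the tubular coordinates that defines a test function on the plane. -/
structure IsTubeFun (δ : ℝ) (G : ℝ × ℝ → ℝ) : Prop where
  periodic : ∀ r, Function.Periodic (fun s => G (s, r)) Γ.L
  smooth : ContDiffOn ℝ ∞ G {p | |p.2| < δ}
  zero : ∀ p : ℝ × ℝ, δ / 2 ≤ |p.2| → G p = 0

variable {Γ}

/-- The choice made in `push` is harmless: within the tube the coordinates are unique up to a period
in s, and G is periodic. -/
lemma IsTubeRadius.push_tube {δ : ℝ} (hδ : Γ.IsTubeRadius δ) {G : ℝ × ℝ → ℝ}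
    (hG : ∀ r, Function.Periodic (fun s => G (s, r)) Γ.L) {p : ℝ × ℝ} (hp : |p.2| < δ) :
    Γ.push δ G (Γ.tube p) = G p := by
  have h : ∃ q : ℝ × ℝ, |q.2| < δ ∧ Γ.tube q = Γ.tube p := ⟨p, hp, rfl⟩
  rw [push, dif_pos h]
  obtain ⟨h1, h2⟩ := hδ.inj _ _ h.choose_spec.1 hp h.choose_spec.2
  have := Γ.lift_eq (hG p.2) h1
  rw [← this]
  exact congrArg G (Prod.ext rfl h2)

lemma push_of_notMem {δ : ℝ} {G : ℝ × ℝ → ℝ} {x : Plane}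
    (hx : ∀ p : ℝ × ℝ, |p.2| < δ → Γ.tube p ≠ x) : Γ.push δ G x = 0 := by
  rw [push, dif_neg]
  rintro ⟨p, hp, h⟩
  exact hx p hp h

lemma isCompact_tube_image (a : ℝ) : IsCompact (Γ.tube '' {p | |p.2| ≤ a}) := by
  have : Γ.tube '' {p | |p.2| ≤ a} = Γ.tube '' (Icc 0 Γ.L ×ˢ Icc (-a) a) := by
    ext x
    constructor
    · rintro ⟨⟨s, r⟩, hp, rfl⟩
      obtain ⟨t, ht, he⟩ := Function.Periodic.exists_mem_Ico₀
        (f := fun s => Γ.tube (s, r)) (fun s => Γ.tube_add_period s r) Γ.L_pos s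
      exact ⟨(t, r), ⟨⟨ht.1, ht.2.le⟩, abs_le.1 hp⟩, he.symm⟩
    · rintro ⟨⟨s, r⟩, hp, rfl⟩
      exact ⟨(s, r), abs_le.2 hp.2, rfl⟩
  rw [this]
  exact (isCompact_Icc.prod isCompact_Icc).image Γ.contDiff_tube.continuous

lemma IsTubeRadius.support_push {δ : ℝ} (hδ : Γ.IsTubeRadius δ) {G : ℝ × ℝ → ℝ}
    (hG : Γ.IsTubeFun δ G) {x : Plane} (hx : x ∉ Γ.tube '' {p | |p.2| ≤ δ / 2}) :
    Γ.push δ G x = 0 := by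
  by_cases h : ∃ p : ℝ × ℝ, |p.2| < δ ∧ Γ.tube p = x
  · obtain ⟨p, hp, rfl⟩ := h
    rw [hδ.push_tube hG.periodic hp]
    refine hG.zero p (le_of_lt ?_)
    by_contra hle
    exact hx ⟨p, not_lt.1 hle, rfl⟩
  · exact push_of_notMem fun p hp he => h ⟨p, hp, he⟩

/-- Two open sets cover the plane: in the tube the function is G composed with a smooth local
inverse of the tube map, and off the compact tube of half the radius it vanishes identically. -/
lemma IsTubeRadius.push_mem {δ : ℝ} (hδ : Γ.IsTubeRadius δ) {G : ℝ × ℝ → ℝ}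
    (hG : Γ.IsTubeFun δ G) : Γ.push δ G ∈ testFun ℝ := by
  constructor
  · rw [contDiff_iff_contDiffAt]
    intro x
    by_cases h : ∃ p : ℝ × ℝ, |p.2| < δ ∧ Γ.tube p = x
    · obtain ⟨p, hp, rfl⟩ := h
      have hj : Γ.jac p ≠ 0 := by linarith [hδ.jac_lower p hp]
      have hopen : IsOpen {p : ℝ × ℝ | |p.2| < δ} := isOpen_lt (by fun_prop) continuous_const
      let hc := Γ.contDiff_tube.contDiffAt (x := p)
      let e := hc.toOpenPartialHomeomorph Γ.tube (Γ.hasFDerivAt_tube_equiv p hj) (by simp)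
      have hinv := hc.to_localInverse (Γ.hasFDerivAt_tube_equiv p hj) (by simp)
      have hinv0 := hc.localInverse_apply_image (Γ.hasFDerivAt_tube_equiv p hj) (by simp)
      have hx : Γ.tube p ∈ e.target :=
        hc.image_mem_toOpenPartialHomeomorph_target (Γ.hasFDerivAt_tube_equiv p hj) (by simp)
      have hGp : ContDiffAt ℝ ∞ G (e.symm (Γ.tube p)) := by
        have : e.symm (Γ.tube p) = p := hinv0
        rw [this]
        exact hG.smooth.contDiffAt (hopen.mem_nhds hp)
      have hcomp : ContDiffAt ℝ ∞ (fun y => G (e.symm y)) (Γ.tube p) :=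
        hGp.comp (Γ.tube p) hinv
      refine hcomp.congr_of_eventuallyEq ?_
      have hcont : Tendsto e.symm (𝓝 (Γ.tube p)) (𝓝 p) := by
        have := e.continuousAt_symm hx
        rwa [ContinuousAt, show e.symm (Γ.tube p) = p from hinv0] at this
      filter_upwards [e.open_target.mem_nhds hx, hcont (hopen.mem_nhds hp)] with y hy hy'
      have he : Γ.tube (e.symm y) = y := e.right_inv hy
      conv_lhs => rw [← he]
      exact hδ.push_tube hG.periodic hy'
    · have hx : x ∉ Γ.tube '' {p | |p.2| ≤ δ / 2} := by
        rintro ⟨p, hp, rfl⟩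
        exact h ⟨p, lt_of_le_of_lt hp (by linarith [hδ.pos]), rfl⟩
      have hz : (fun _ => 0) =ᶠ[𝓝 x] Γ.push δ G := by
        filter_upwards [(isCompact_tube_image (Γ := Γ) (δ / 2)).isClosed.isOpen_compl.mem_nhds hx]
          with y hy
        exact (hδ.support_push hG hy).symm
      exact contDiffAt_const.congr_of_eventuallyEq hz.symm
  · exact HasCompactSupport.intro (isCompact_tube_image (Γ := Γ) (δ / 2))
      fun x hx => hδ.support_push hG hx

/-! ### Integration in tubular coordinates -/

variable (Γ)

/-- The parameter domain of one side of the tubular neighbourhood. -/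
def strip (δ : ℝ) : Set (ℝ × ℝ) := Ioc 0 Γ.L ×ˢ Ioo 0 δ

/-- The part of the tubular neighbourhood on the side `σ`. -/
def collar (δ σ : ℝ) : Set Plane := (fun p : ℝ × ℝ => Γ.tube (p.1, σ * p.2)) '' Γ.strip δ

lemma measurableSet_strip (δ : ℝ) : MeasurableSet (Γ.strip δ) :=
  measurableSet_Ioc.prod measurableSet_Ioo

variable {Γ}

lemma IsSide.abs_sigma {δ σ : ℝ} {Ω : Set Plane} (h : Γ.IsSide δ σ Ω) : |σ| = 1 := by
  have := h.sq
  rwa [← sq_abs, pow_eq_one_iff_of_nonneg (abs_nonneg _) two_ne_zero] at this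

lemma IsSide.abs_lt {δ σ : ℝ} {Ω : Set Plane} (h : Γ.IsSide δ σ Ω) {p : ℝ × ℝ}
    (hp : p ∈ Γ.strip δ) : |σ * p.2| < δ := by
  rw [abs_mul, h.abs_sigma, one_mul, abs_of_pos hp.2.1]
  exact hp.2.2

lemma IsSide.injOn {δ σ : ℝ} {Ω : Set Plane} (h : Γ.IsSide δ σ Ω) :
    InjOn (fun p : ℝ × ℝ => Γ.tube (p.1, σ * p.2)) (Γ.strip δ) := by
  intro p hp q hq he
  obtain ⟨h1, h2⟩ := h.radius.inj _ _ (h.abs_lt hp) (h.abs_lt hq) he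
  have hσ : σ ≠ 0 := by
    intro h0
    have := h.abs_sigma
    simp [h0] at this
  refine Prod.ext ?_ (mul_left_cancel₀ hσ h2)
  refine (AddCircle.coe_eq_coe_iff_of_mem_Ioc (a := 0) ?_ ?_).1 h1
  · rw [zero_add]; exact hp.1
  · rw [zero_add]; exact hq.1

/-- The map from coordinates to the plane. -/
def ofCoords (q : ℝ × ℝ) : Plane := !₂[q.1, q.2]

lemma measurePreserving_ofCoords : MeasurePreserving ofCoords volume volume :=
  ((EuclideanSpace.volume_preserving_symm_measurableEquiv_toLp (Fin 2)).symm).comp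
    ((volume_preserving_finTwoArrow ℝ).symm)

lemma measurableEmbedding_ofCoords : MeasurableEmbedding ofCoords :=
  ((MeasurableEquiv.finTwoArrow (α := ℝ)).symm.trans
    (MeasurableEquiv.toLp 2 (Fin 2 → ℝ))).measurableEmbedding

/-- This is the change of variables formula, written in plain coordinates of ℝ × ℝ so that a
determinant is available; `ofCoords` preserves volume. Since τ and N are orthonormal, the
determinant is the Jacobian up to sign, and the Jacobian is positive inside the tube. -/
theorem IsSide.integral_collar {δ σ : ℝ} {Ω : Set Plane} (h : Γ.IsSide δ σ Ω) (g : Plane → ℝ) :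
    ∫ x in Γ.collar δ σ, g x =
      ∫ p in Γ.strip δ, Γ.jac (p.1, σ * p.2) * g (Γ.tube (p.1, σ * p.2)) := by
  let q : ℝ × ℝ → ℝ × ℝ := fun p => (Γ.tube (p.1, σ * p.2) 0, Γ.tube (p.1, σ * p.2) 1)
  have hq : ∀ p, ofCoords (q p) = Γ.tube (p.1, σ * p.2) := fun p => by
    ext i
    fin_cases i <;> rfl
  have himg : Γ.collar δ σ = ofCoords '' (q '' Γ.strip δ) := by
    rw [image_image]
    exact (image_congr fun p _ => (hq p).symm)
  let q' : ℝ × ℝ → ℝ × ℝ →L[ℝ] ℝ × ℝ := fun p =>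
    (Matrix.toLin (.finTwoProd ℝ) (.finTwoProd ℝ)
      !![Γ.jac (p.1, σ * p.2) * Γ.tang p.1 0, σ * Γ.normal p.1 0;
         Γ.jac (p.1, σ * p.2) * Γ.tang p.1 1, σ * Γ.normal p.1 1]).toContinuousLinearMap
  have hderiv : ∀ p, HasFDerivAt q (q' p) p := by
    intro p
    have h1 : HasFDerivAt (fun p : ℝ × ℝ => (p.1, σ * p.2))
        ((ContinuousLinearMap.fst ℝ ℝ ℝ).prod (σ • ContinuousLinearMap.snd ℝ ℝ ℝ)) p :=
      hasFDerivAt_fst.prodMk (hasFDerivAt_snd.const_smul σ)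
    have h2 := (Γ.hasFDerivAt_tube (p.1, σ * p.2)).comp p h1
    have h3 := ((EuclideanSpace.proj 0 : Plane →L[ℝ] ℝ).hasFDerivAt.comp p h2).prodMk
      ((EuclideanSpace.proj 1 : Plane →L[ℝ] ℝ).hasFDerivAt.comp p h2)
    refine h3.congr_fderiv ?_
    simp only [q']
    rw [Matrix.toLin_finTwoProd_toContinuousLinearMap]
    ext <;> simp [tubeDeriv]
  have hdet : ∀ p, (q' p).det = -σ * Γ.jac (p.1, σ * p.2) := by
    intro p
    simp only [q', LinearMap.det_toContinuousLinearMap, LinearMap.det_toLin,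
      Matrix.det_fin_two_of, normal_zero, normal_one]
    linear_combination (-σ * Γ.jac (p.1, σ * p.2)) * Γ.tang_sq p.1
  have hinj : InjOn q (Γ.strip δ) := fun p hp p' hp' he =>
    h.injOn hp hp' (by simpa only [hq] using congrArg ofCoords he)
  rw [himg, measurePreserving_ofCoords.setIntegral_image_emb measurableEmbedding_ofCoords,
    integral_image_eq_integral_abs_det_fderiv_smul volume (Γ.measurableSet_strip δ)
      (fun p _ => (hderiv p).hasFDerivWithinAt) hinj]
  refine setIntegral_congr_fun (Γ.measurableSet_strip δ) fun p hp => ?_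
  have hj := h.radius.jac_lower (p.1, σ * p.2) (h.abs_lt hp)
  simp only [hq, hdet, smul_eq_mul, abs_mul, abs_neg, h.abs_sigma, one_mul]
  rw [abs_of_nonneg (by linarith)]

lemma IsSide.measurableSet_collar {δ σ : ℝ} {Ω : Set Plane} (h : Γ.IsSide δ σ Ω) :
    MeasurableSet (Γ.collar δ σ) := by
  refine (Γ.measurableSet_strip δ).image_of_continuousOn_injOn ?_ h.injOn
  exact (Γ.contDiff_tube.continuous.comp (by fun_prop)).continuousOn

lemma IsSide.collar_subset {δ σ : ℝ} {Ω : Set Plane} (h : Γ.IsSide δ σ Ω) :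
    Γ.collar δ σ ⊆ Ω := by
  rintro _ ⟨p, hp, rfl⟩
  refine (h.mem_iff _ _ (h.abs_lt hp)).2 ?_
  rw [← mul_assoc, ← _root_.sq, h.sq, one_mul]
  exact hp.2.1

lemma IsSide.mem_collar {δ σ : ℝ} {Ω : Set Plane} (h : Γ.IsSide δ σ Ω) {p : ℝ × ℝ}
    (hp : |p.2| < δ) (hΩ : Γ.tube p ∈ Ω) : Γ.tube p ∈ Γ.collar δ σ := by
  obtain ⟨s, r⟩ := p
  have h0 := (h.mem_iff s r hp).1 hΩ
  obtain ⟨t, ht, he⟩ := Function.Periodic.exists_mem_Ioc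
    (f := fun s => Γ.tube (s, r)) (fun s => Γ.tube_add_period s r) Γ.L_pos s 0
  rw [zero_add] at ht
  refine ⟨(t, σ * r), ⟨ht, h0, ?_⟩, ?_⟩
  · calc σ * r ≤ |σ * r| := le_abs_self _
      _ = |r| := by rw [abs_mul, h.abs_sigma, one_mul]
      _ < δ := hp
  · change Γ.tube (t, σ * (σ * r)) = _
    rw [← mul_assoc, ← _root_.sq, h.sq, one_mul]
    exact he.symm

lemma integrableOn_strip {δ : ℝ} {f : ℝ × ℝ → ℝ} (hf : ContinuousOn f (Icc 0 Γ.L ×ˢ Icc 0 δ)) :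
    IntegrableOn f (Γ.strip δ) :=
  (hf.integrableOn_compact (isCompact_Icc.prod isCompact_Icc)).mono_set
    (prod_mono Ioc_subset_Icc_self Ioo_subset_Icc_self)

lemma IsSide.integral_strip_le {δ σ : ℝ} {Ω : Set Plane} (h : Γ.IsSide δ σ Ω) {g : Plane → ℝ}
    (hg : Continuous g) (h0 : ∀ x, 0 ≤ g x) (hi : IntegrableOn g Ω) :
    ∫ p in Γ.strip δ, g (Γ.tube (p.1, σ * p.2)) ≤ 2 * ∫ x in Ω, g x := by
  have hc : Continuous fun p : ℝ × ℝ => Γ.tube (p.1, σ * p.2) :=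
    Γ.contDiff_tube.continuous.comp (by fun_prop)
  have hj : Continuous fun p : ℝ × ℝ => Γ.jac (p.1, σ * p.2) :=
    Γ.contDiff_jac.continuous.comp (by fun_prop)
  calc ∫ p in Γ.strip δ, g (Γ.tube (p.1, σ * p.2))
      ≤ ∫ p in Γ.strip δ, 2 * (Γ.jac (p.1, σ * p.2) * g (Γ.tube (p.1, σ * p.2))) := by
        refine setIntegral_mono_on (integrableOn_strip (hg.comp hc).continuousOn)
          (integrableOn_strip (((hj.mul (hg.comp hc))).const_smul (2 : ℝ)).continuousOn)
          (Γ.measurableSet_strip δ) fun p hp => ?_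
        have := h.radius.jac_lower (p.1, σ * p.2) (h.abs_lt hp)
        nlinarith [h0 (Γ.tube (p.1, σ * p.2))]
    _ = 2 * ∫ x in Γ.collar δ σ, g x := by rw [integral_const_mul, h.integral_collar]
    _ ≤ 2 * ∫ x in Ω, g x := by
        refine mul_le_mul_of_nonneg_left ?_ zero_le_two
        exact setIntegral_mono_set hi (Eventually.of_forall h0) h.collar_subset.eventuallyLE

end JordanCurve
end WaveStructure
end

noncomputable section
namespace WaveStructure

/-! ### Trace identities -/

lemma testFun.continuous {F : Type} [NormedAddCommGroup F] [NormedSpace ℝ F] (φ : testFun F) :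
    Continuous φ.1 := φ.2.1.continuous

lemma testFun.differentiable {F : Type} [NormedAddCommGroup F] [NormedSpace ℝ F] (φ : testFun F) :
    Differentiable ℝ φ.1 := φ.2.1.differentiable (by simp)

lemma testFun.continuous_pderiv {F : Type} [NormedAddCommGroup F] [NormedSpace ℝ F]
    (φ : testFun F) (j : Fin 2) : Continuous (pderiv j φ.1) := (contDiff_pderiv φ.2.1).continuous

lemma testFun.exists_bound {F : Type} [NormedAddCommGroup F] [NormedSpace ℝ F] (φ : testFun F) :
    ∃ C, 0 < C ∧ ∀ x, ‖φ.1 x‖ ≤ C := by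
  obtain ⟨C, hC⟩ := φ.2.2.exists_bound_of_continuous (testFun.continuous φ)
  exact ⟨max C 1, by positivity, fun x => (hC x).trans (le_max_left _ _)⟩

lemma exists_mulTest (Ω : Set Plane) (b : testFun ℝ) : ∃ T : L2 Ω ℝ →L[ℝ] L2 Ω ℝ,
    ∀ f : L2 Ω ℝ, T f =ᵐ[volume.restrict Ω] fun x => b.1 x • f x := by
  obtain ⟨C, hC, hb⟩ := (testFun.exists_bound b)
  obtain ⟨T, -, hT⟩ := exists_smulOp (F := ℝ) (μ := volume.restrict Ω) (m := b.1)
    (testFun.continuous b).aestronglyMeasurable hC.le (Eventually.of_forall hb)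
  exact ⟨T, hT⟩

/-- Multiplication by a test function. -/
def mulTest (Ω : Set Plane) (b : testFun ℝ) : L2 Ω ℝ →L[ℝ] L2 Ω ℝ := (exists_mulTest Ω b).choose

lemma mulTest_ae (Ω : Set Plane) (b : testFun ℝ) (f : L2 Ω ℝ) :
    mulTest Ω b f =ᵐ[volume.restrict Ω] fun x => b.1 x • f x := (exists_mulTest Ω b).choose_spec f

namespace JordanCurve

variable {Γ : JordanCurve}

/-- A cutoff function in the transversal variable. -/
def cutoff {δ : ℝ} (hδ : 0 < δ) : ContDiffBump (0 : ℝ) where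
  rIn := δ / 4
  rOut := δ / 2
  rIn_pos := by linarith
  rIn_lt_rOut := by linarith

lemma cutoff_zero_of {δ : ℝ} (hδ : 0 < δ) {r : ℝ} (hr : δ / 2 ≤ |r|) : cutoff hδ r = 0 :=
  (cutoff hδ).zero_of_le_dist (by rw [Real.dist_eq, sub_zero]; exact hr)

lemma cutoff_one_of {δ : ℝ} (hδ : 0 < δ) {r : ℝ} (hr : |r| ≤ δ / 4) : cutoff hδ r = 1 :=
  (cutoff hδ).one_of_mem_closedBall (by rw [Metric.mem_closedBall, Real.dist_eq, sub_zero]; exact hr)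

lemma deriv_cutoff_zero_of {δ : ℝ} (hδ : 0 < δ) {r : ℝ} (hr : δ / 2 ≤ |r|) :
    deriv (cutoff hδ) r = 0 := by
  refine IsLocalMin.deriv_eq_zero (Eventually.of_forall fun x => ?_)
  rw [cutoff_zero_of hδ hr]
  exact (cutoff hδ).nonneg

lemma contDiff_cutoff {δ : ℝ} (hδ : 0 < δ) : ContDiff ℝ ∞ (cutoff hδ) := (cutoff hδ).contDiff

lemma contDiff_deriv_cutoff {δ : ℝ} (hδ : 0 < δ) : ContDiff ℝ ∞ (deriv (cutoff hδ)) :=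
  (contDiff_infty_iff_deriv.1 (contDiff_cutoff hδ)).2

lemma IsTubeRadius.isTubeFun_div_jac {δ : ℝ} (hδ : Γ.IsTubeRadius δ) {G : ℝ × ℝ → ℝ}
    (hG : ContDiff ℝ ∞ G) (hp : ∀ r, Function.Periodic (fun s => G (s, r)) Γ.L)
    (h0 : ∀ p : ℝ × ℝ, δ / 2 ≤ |p.2| → G p = 0) : Γ.IsTubeFun δ (fun p => G p / Γ.jac p) where
  periodic r s := by
    have := hp r s
    simp only at this
    simp only [Γ.jac_add_period, this]
  smooth := hG.contDiffOn.div Γ.contDiff_jac.contDiffOn fun p hp => by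
    have := hδ.jac_lower p hp
    linarith
  zero p hp := by rw [h0 p hp, zero_div]

lemma IsTubeFun.push_tube {δ : ℝ} {G : ℝ × ℝ → ℝ} (hG : Γ.IsTubeFun δ G) (hδ : Γ.IsTubeRadius δ)
    {p : ℝ × ℝ} (hp : |p.2| < δ) : Γ.push δ G (Γ.tube p) = G p :=
  hδ.push_tube hG.periodic hp

/-- The integral over the curve as an integral over one side. -/
theorem IsSide.exists_trace_fields {δ σ : ℝ} {Ω : Set Plane} (h : Γ.IsSide δ σ Ω) :
    ∃ (b : testFun ℝ) (X : Fin 2 → testFun ℝ), ∀ a : Plane → ℝ, ContDiff ℝ ∞ a →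
      ∫ s in Ioc 0 Γ.L, a (Γ.γ s) =
        ∫ x in Ω, (b.1 x * a x + ∑ j, (X j).1 x * pderiv j a x) := by
  have hδ := h.radius
  have hδ0 := hδ.pos
  set χ := cutoff hδ0
  have hn : ∀ j, ContDiff ℝ ∞ fun p : ℝ × ℝ => Γ.normal p.1 j := fun j =>
    contDiff_coord (Γ.contDiff_normal.comp contDiff_fst) j
  -- Along a normal segment, -χ(σρ) a has value -a(γ(s)) at ρ = 0 and 0 at ρ = δ. The fields are
  -- chosen so that, after multiplication by the Jacobian, the integrand is the ρ-derivative of this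
  -- function; hence the division by the Jacobian.
  have hGb := hδ.isTubeFun_div_jac (G := fun p => -σ * deriv χ p.2)
    (contDiff_const.mul ((contDiff_deriv_cutoff hδ0).comp contDiff_snd)) (fun r s => rfl)
    (fun p hp => by simp only [χ, deriv_cutoff_zero_of hδ0 hp, mul_zero])
  have hGX := fun j : Fin 2 => hδ.isTubeFun_div_jac (G := fun p => -σ * (χ p.2 * Γ.normal p.1 j))
    (contDiff_const.mul (((contDiff_cutoff hδ0).comp contDiff_snd).mul (hn j)))
    (fun r s => by simp only [Γ.periodic_normal s])
    (fun p hp => by simp only [χ, cutoff_zero_of hδ0 hp, mul_zero, zero_mul])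
  refine ⟨⟨_, hδ.push_mem hGb⟩, fun j => ⟨_, hδ.push_mem (hGX j)⟩, fun a ha => ?_⟩
  have hda : Differentiable ℝ a := ha.differentiable (by simp)
  have hsub : ∀ x ∈ Ω \ Γ.collar δ σ, ∀ p : ℝ × ℝ, |p.2| < δ → Γ.tube p ≠ x := by
    rintro x ⟨hx, hxc⟩ p hp rfl
    exact hxc (h.mem_collar hp hx)
  rw [setIntegral_eq_of_subset_of_forall_sdiff_eq_zero h.isOpen.measurableSet h.collar_subset
    (fun x hx => by simp [push_of_notMem (hsub x hx)]), h.integral_collar]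
  let D : ℝ × ℝ → ℝ := fun p => fderiv ℝ a (Γ.tube (p.1, σ * p.2)) (Γ.normal p.1)
  let f : ℝ × ℝ → ℝ := fun p => -(σ * (deriv χ (σ * p.2) * a (Γ.tube (p.1, σ * p.2)) +
    χ (σ * p.2) * D p))
  have hct : Continuous fun p : ℝ × ℝ => Γ.tube (p.1, σ * p.2) :=
    Γ.contDiff_tube.continuous.comp (by fun_prop)
  have hD : Continuous D := ((ha.continuous_fderiv (by simp)).comp hct).clm_apply
    (Γ.contDiff_normal.continuous.comp continuous_fst)
  have hσ : Continuous fun p : ℝ × ℝ => σ * p.2 := by fun_prop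
  have hf : Continuous f := by
    refine (continuous_const.mul (Continuous.add ?_ ?_)).neg
    · exact ((contDiff_deriv_cutoff hδ0).continuous.comp hσ).mul (ha.continuous.comp hct)
    · exact ((contDiff_cutoff hδ0).continuous.comp hσ).mul hD
  have e1 : ∫ p in Γ.strip δ, Γ.jac (p.1, σ * p.2) *
      (Γ.push δ (fun p => (-σ * deriv χ p.2) / Γ.jac p) (Γ.tube (p.1, σ * p.2)) *
        a (Γ.tube (p.1, σ * p.2)) + ∑ j, Γ.push δ (fun p => (-σ * (χ p.2 * Γ.normal p.1 j)) /
          Γ.jac p) (Γ.tube (p.1, σ * p.2)) * pderiv j a (Γ.tube (p.1, σ * p.2))) =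
      ∫ p in Γ.strip δ, f p := by
    refine setIntegral_congr_fun (Γ.measurableSet_strip δ) fun p hp => ?_
    have hlt := h.abs_lt hp
    have hj : Γ.jac (p.1, σ * p.2) ≠ 0 := by linarith [hδ.jac_lower (p.1, σ * p.2) hlt]
    simp only [hGb.push_tube hδ (p := (p.1, σ * p.2)) hlt,
      (hGX _).push_tube hδ (p := (p.1, σ * p.2)) hlt, f, D,
      fderiv_eq_pderiv a, Fin.sum_univ_two, smul_eq_mul]
    field_simp
    ring
  refine Eq.trans ?_ e1.symm
  rw [strip, Measure.volume_eq_prod, setIntegral_prod]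
  swap
  · exact integrableOn_strip hf.continuousOn
  refine integral_congr_ae (Eventually.of_forall fun s => ?_)
  simp only
  have hderiv : ∀ ρ ∈ uIcc 0 δ, HasDerivAt (fun ρ => -(χ (σ * ρ) * a (Γ.tube (s, σ * ρ))))
      (f (s, ρ)) ρ := by
    intro ρ _
    have hm : HasDerivAt (fun ρ : ℝ => σ * ρ) σ ρ := by
      simpa using (hasDerivAt_id ρ).const_mul σ
    have h1 : HasDerivAt (fun ρ => χ (σ * ρ)) (deriv χ (σ * ρ) * σ) ρ :=
      ((contDiff_cutoff hδ0).differentiable (by simp) (σ * ρ)).hasDerivAt.comp ρ hm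
    have h2 : HasDerivAt (fun ρ => a (Γ.tube (s, σ * ρ))) (D (s, ρ) * σ) ρ :=
      (Γ.hasDerivAt_comp_tube_right hda s (σ * ρ)).comp ρ hm
    refine (h1.mul h2).neg.congr_deriv ?_
    simp only [f]
    ring
  rw [← integral_Ioc_eq_integral_Ioo, ← intervalIntegral.integral_of_le hδ0.le,
    intervalIntegral.integral_eq_sub_of_hasDerivAt hderiv
      ((hf.comp (by fun_prop : Continuous fun ρ : ℝ => (s, ρ))).intervalIntegrable _ _)]
  have hχ1 : χ (σ * δ) = 0 := cutoff_zero_of hδ0 (by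
    rw [abs_mul, h.abs_sigma, one_mul, abs_of_pos hδ0]; linarith)
  have hχ0 : χ (σ * 0) = 1 := cutoff_one_of hδ0 (by simp; linarith)
  rw [hχ1, hχ0]
  simp [tube_zero]

/-- Polarized trace identity. -/
theorem IsSide.exists_trace_identity {δ σ : ℝ} {Ω : Set Plane} (h : Γ.IsSide δ σ Ω) :
    ∃ (b : testFun ℝ) (X : Fin 2 → testFun ℝ), ∀ x ∈ traceSpace Γ Ω ℝ, ∀ y ∈ traceSpace Γ Ω ℝ,
      (inner ℝ x.2.2 y.2.2 : ℝ) = inner ℝ (mulTest Ω b x.1) y.1 +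
        ∑ j, (inner ℝ (mulTest Ω (X j) (x.2.1 j)) y.1 +
          inner ℝ (mulTest Ω (X j) x.1) (y.2.1 j)) := by
  obtain ⟨b, X, hbX⟩ := h.exists_trace_fields
  refine ⟨b, X, fun x hx => ?_⟩
  -- Both sides are continuous in x and in y separately, so density reduces the identity to two test
  -- functions, where it is the previous lemma for their product together with the Leibniz rule.
  refine traceSpace_induction (P := fun x => ∀ y ∈ traceSpace Γ Ω ℝ,
    (inner ℝ x.2.2 y.2.2 : ℝ) = inner ℝ (mulTest Ω b x.1) y.1 +
        ∑ j, (inner ℝ (mulTest Ω (X j) (x.2.1 j)) y.1 +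
          inner ℝ (mulTest Ω (X j) x.1) (y.2.1 j))) ?_ (fun φ y hy => ?_) hx
  · simp only [ofPred_forall]
    refine isClosed_iInter fun y => isClosed_iInter fun _ => isClosed_eq ?_ ?_
    · fun_prop
    · fun_prop
  refine traceSpace_induction (P := fun y =>
    (inner ℝ (testTriple Γ Ω φ).2.2 y.2.2 : ℝ) = inner ℝ (mulTest Ω b (testTriple Γ Ω φ).1) y.1 +
        ∑ j, (inner ℝ (mulTest Ω (X j) ((testTriple Γ Ω φ).2.1 j)) y.1 +
          inner ℝ (mulTest Ω (X j) (testTriple Γ Ω φ).1) (y.2.1 j))) ?_ (fun θ => ?_) hy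
  · exact isClosed_eq (by fun_prop) (by fun_prop)
  have hφ := MemLp.coeFn_toLp (memLp_of_test (testFun.continuous φ) φ.2.2 Ω)
  have hθ := MemLp.coeFn_toLp (memLp_of_test (testFun.continuous θ) θ.2.2 Ω)
  have hdφ := fun j => MemLp.coeFn_toLp (memLp_of_test (testFun.continuous_pderiv φ j)
    (hasCompactSupport_pderiv φ.2.2) Ω)
  have hdθ := fun j => MemLp.coeFn_toLp (memLp_of_test (testFun.continuous_pderiv θ j)
    (hasCompactSupport_pderiv θ.2.2) Ω)
  have e0 : (inner ℝ (testTriple Γ Ω φ).2.2 (testTriple Γ Ω θ).2.2 : ℝ) =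
      ∫ s in Ioc 0 Γ.L, φ.1 (Γ.γ s) * θ.1 (Γ.γ s) := by
    rw [L2_inner_eq]
    refine integral_congr_ae ?_
    filter_upwards [MemLp.coeFn_toLp (memLp_Ioc ((testFun.continuous φ).comp Γ.continuous_γ) 0 Γ.L),
      MemLp.coeFn_toLp (memLp_Ioc ((testFun.continuous θ).comp Γ.continuous_γ) 0 Γ.L)] with s h1 h2
    exact congrArg₂ (· * ·) h1 h2
  have e1 : (inner ℝ (mulTest Ω b (testTriple Γ Ω φ).1) (testTriple Γ Ω θ).1 : ℝ) =
      ∫ x in Ω, b.1 x * (φ.1 x * θ.1 x) := by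
    rw [integral_mul_mul_eq_inner (mulTest_ae Ω b)]
    refine integral_congr_ae ?_
    filter_upwards [hφ, hθ] with x h1 h2
    exact congrArg (b.1 x * ·) (congrArg₂ (· * ·) h1 h2)
  have e2 : ∀ j, (inner ℝ (mulTest Ω (X j) ((testTriple Γ Ω φ).2.1 j)) (testTriple Γ Ω θ).1 : ℝ) =
      ∫ x in Ω, (X j).1 x * (pderiv j φ.1 x * θ.1 x) := by
    intro j
    rw [integral_mul_mul_eq_inner (mulTest_ae Ω (X j))]
    refine integral_congr_ae ?_
    filter_upwards [hdφ j, hθ] with x h1 h2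
    exact congrArg ((X j).1 x * ·) (congrArg₂ (· * ·) h1 h2)
  have e3 : ∀ j, (inner ℝ (mulTest Ω (X j) (testTriple Γ Ω φ).1) ((testTriple Γ Ω θ).2.1 j) : ℝ) =
      ∫ x in Ω, (X j).1 x * (φ.1 x * pderiv j θ.1 x) := by
    intro j
    rw [integral_mul_mul_eq_inner (mulTest_ae Ω (X j))]
    refine integral_congr_ae ?_
    filter_upwards [hφ, hdθ j] with x h1 h2
    exact congrArg ((X j).1 x * ·) (congrArg₂ (· * ·) h1 h2)
  have hi : ∀ c : testFun ℝ, ∀ {g : Plane → ℝ}, Continuous g →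
      Integrable (fun x => c.1 x * g x) (volume.restrict Ω) := fun c g hg =>
    (((testFun.continuous c).mul hg).integrable_of_hasCompactSupport (c.2.2.mul_right)).restrict
  rw [e0, e1]
  simp only [e2, e3]
  rw [hbX (fun x => φ.1 x * θ.1 x) (φ.2.1.mul θ.2.1)]
  simp only [Fin.sum_univ_two]
  have i1 : Integrable (fun x => b.1 x * (φ.1 x * θ.1 x)) (volume.restrict Ω) :=
    hi b ((testFun.continuous φ).mul (testFun.continuous θ))
  have i2 : ∀ j, Integrable (fun x => (X j).1 x * (pderiv j φ.1 x * θ.1 x)) (volume.restrict Ω) :=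
    fun j => hi (X j) ((testFun.continuous_pderiv φ j).mul (testFun.continuous θ))
  have i3 : ∀ j, Integrable (fun x => (X j).1 x * (φ.1 x * pderiv j θ.1 x)) (volume.restrict Ω) :=
    fun j => hi (X j) ((testFun.continuous φ).mul (testFun.continuous_pderiv θ j))
  have i4 : ∀ j, Integrable (fun x => (X j).1 x * (pderiv j φ.1 x * θ.1 x) +
      (X j).1 x * (φ.1 x * pderiv j θ.1 x)) (volume.restrict Ω) := fun j => (i2 j).add (i3 j)
  rw [← integral_add (i2 0) (i3 0), ← integral_add (i2 1) (i3 1), ← integral_add (i4 0) (i4 1)]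
  refine Eq.trans ?_ (integral_add i1 ((i4 0).add (i4 1)))
  refine integral_congr_ae (Eventually.of_forall fun x => ?_)
  have hp : ∀ j, pderiv j (fun x => φ.1 x * θ.1 x) x =
      pderiv j φ.1 x * θ.1 x + φ.1 x * pderiv j θ.1 x := by
    intro j
    simp only [pderiv]
    rw [fderiv_fun_mul ((testFun.differentiable φ) x) ((testFun.differentiable θ) x)]
    simp
    ring
  simp only [hp]
  ring

end JordanCurve
end WaveStructure
end

noncomputable section
namespace WaveStructure

/-! ### The Poincaré inequality in the interior -/

/-- This is Cauchy–Schwarz, obtained by expanding ∫ (a‖f‖ - m)² ≥ 0 with m the integral of ‖f‖. -/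
lemma norm_sq_integral_le {E : Type*} [NormedAddCommGroup E] [NormedSpace ℝ E] {f : ℝ → E}
    {a : ℝ} (ha : 0 ≤ a) (hf : Continuous f) :
    ‖∫ r in (0 : ℝ)..a, f r‖ ^ 2 ≤ a * ∫ r in (0 : ℝ)..a, ‖f r‖ ^ 2 := by
  have h1 := intervalIntegral.norm_integral_le_integral_norm (f := f) (μ := volume) ha
  set m := ∫ r in (0 : ℝ)..a, ‖f r‖
  have hm : 0 ≤ m := (norm_nonneg _).trans h1
  have h2 : ‖∫ r in (0 : ℝ)..a, f r‖ ^ 2 ≤ m ^ 2 := pow_le_pow_left₀ (norm_nonneg _) h1 2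
  refine h2.trans ?_
  rcases ha.eq_or_lt with rfl | ha
  · simp [m]
  have h3 : 0 ≤ ∫ r in (0 : ℝ)..a, (a * ‖f r‖ - m) ^ 2 :=
    intervalIntegral.integral_nonneg ha.le fun r _ => sq_nonneg _
  have hfn := hf.norm
  have h4 : ∫ r in (0 : ℝ)..a, (a * ‖f r‖ - m) ^ 2 =
      a ^ 2 * (∫ r in (0 : ℝ)..a, ‖f r‖ ^ 2) - 2 * a * m * m + m ^ 2 * a := by
    have : ∀ r, (a * ‖f r‖ - m) ^ 2 = (a ^ 2 * ‖f r‖ ^ 2 - 2 * a * m * ‖f r‖) + m ^ 2 := by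
      intro r
      ring
    simp only [this]
    rw [intervalIntegral.integral_add, intervalIntegral.integral_sub,
      intervalIntegral.integral_const_mul, intervalIntegral.integral_const_mul,
      intervalIntegral.integral_const]
    · simp only [sub_zero, smul_eq_mul]
      ring
    all_goals exact Continuous.intervalIntegrable (by fun_prop) _ _
  have h5 : 0 ≤ a * (a * (∫ r in (0 : ℝ)..a, ‖f r‖ ^ 2) - m ^ 2) := by
    rw [h4] at h3
    linarith
  linarith [nonneg_of_mul_nonneg_right h5 ha]

lemma testFun.integrable_mul {φ θ : Plane → ℝ} (hφ : Continuous φ) (hθ : Continuous θ)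
    (hc : HasCompactSupport φ) (Ω : Set Plane) : IntegrableOn (fun x => φ x * θ x) Ω :=
  ((hφ.mul hθ).integrable_of_hasCompactSupport hc.mul_right).integrableOn

lemma testFun.integrable_sq {φ : Plane → ℝ} (hφ : Continuous φ)
    (hc : HasCompactSupport φ) (Ω : Set Plane) : IntegrableOn (fun x => φ x ^ 2) Ω := by
  simpa only [sq] using testFun.integrable_mul hφ hφ hc Ω

/-- The Poincaré inequality for test functions with support in a ball. -/
theorem testFun.poincare (u : testFun ℝ) {R : ℝ} (hu : ∀ x, R < ‖x‖ → u.1 x = 0) :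
    ∫ x, u.1 x ^ 2 ≤ 4 * R ^ 2 * ∫ x, pderiv 0 u.1 x ^ 2 := by
  have hc := testFun.continuous u
  have hd := testFun.continuous_pderiv u 0
  have hdc := hasCompactSupport_pderiv (j := 0) u.2.2
  have hcoord : ContDiff ℝ ∞ fun x : Plane => x 0 := contDiff_euclidean.1 contDiff_id 0
  have hcd : ∀ x : Plane, HasFDerivAt (fun x : Plane => x 0) (EuclideanSpace.proj 0 : Plane →L[ℝ] ℝ) x :=
    fun x => (EuclideanSpace.proj 0 : Plane →L[ℝ] ℝ).hasFDerivAt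
  have hp : ∀ x, fderiv ℝ (fun x : Plane => x 0 * u.1 x) x (EuclideanSpace.single 0 1) =
      u.1 x + x 0 * pderiv 0 u.1 x := by
    intro x
    rw [((hcd x).fun_mul (testFun.differentiable u x).hasFDerivAt).fderiv]
    simp [pderiv]
    ring
  have i1 : Integrable fun x => u.1 x ^ 2 := by
    simpa using testFun.integrable_sq hc u.2.2 univ
  have i2 : Integrable fun x => pderiv 0 u.1 x ^ 2 := by
    simpa using testFun.integrable_sq hd hdc univ
  have i3 : Integrable fun x => u.1 x * (x 0 * pderiv 0 u.1 x) := by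
    simpa using testFun.integrable_mul hc (hcoord.continuous.mul hd) u.2.2 univ
  -- Integration by parts of x₀u against ∂₀u gives ∫u² = -2∫ x₀ u ∂₀u. On the support |x₀| ≤ R, and
  -- Young's inequality absorbs half of ∫u².
  have key := integral_mul_fderiv_eq_neg_fderiv_mul_of_integrable (μ := (volume : Measure Plane))
    (f := fun x => x 0 * u.1 x) (g := u.1) (v := EuclideanSpace.single 0 1) ?_ ?_ ?_
    (fun x _ => (hcoord.mul u.2.1).differentiable (by simp) x)
    (fun x _ => testFun.differentiable u x)
  rotate_left
  · refine ((i1.add i3).congr (Eventually.of_forall fun x => ?_))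
    simp only [hp, Pi.add_apply]
    ring
  · refine i3.congr (Eventually.of_forall fun x => ?_)
    simp only [pderiv]
    ring
  · refine ((hcoord.continuous.mul hc).mul hc).integrable_of_hasCompactSupport u.2.2.mul_left
  have e : ∫ x, u.1 x ^ 2 = ∫ x, -2 * (u.1 x * (x 0 * pderiv 0 u.1 x)) := by
    simp only [hp] at key
    have h1 : ∫ x, x 0 * u.1 x * fderiv ℝ u.1 x (EuclideanSpace.single 0 1) =
        ∫ x, u.1 x * (x 0 * pderiv 0 u.1 x) :=
      integral_congr_ae (Eventually.of_forall fun x => by simp only [pderiv]; ring)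
    have h2 : ∫ x, (u.1 x + x 0 * pderiv 0 u.1 x) * u.1 x =
        (∫ x, u.1 x ^ 2) + ∫ x, u.1 x * (x 0 * pderiv 0 u.1 x) := by
      rw [← integral_add i1 i3]
      exact integral_congr_ae (Eventually.of_forall fun x => by simp only; ring)
    rw [h1, h2] at key
    rw [integral_const_mul]
    linarith
  have hle : ∫ x, u.1 x ^ 2 ≤ ∫ x, (1 / 2 * u.1 x ^ 2 + 2 * R ^ 2 * pderiv 0 u.1 x ^ 2) := by
    rw [e]
    refine integral_mono (i3.const_mul _) ((i1.const_mul _).add (i2.const_mul _)) fun x => ?_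
    simp only
    by_cases hx : R < ‖x‖
    · rw [hu x hx]
      simp only [zero_mul, mul_zero]
      positivity
    · have h1 : |x 0| ≤ R := by
        have := PiLp.norm_apply_le x 0
        rw [Real.norm_eq_abs] at this
        exact this.trans (not_lt.1 hx)
      have h2 : x 0 ^ 2 ≤ R ^ 2 := sq_le_sq' (abs_le.1 h1).1 (abs_le.1 h1).2
      nlinarith [sq_nonneg (u.1 x + 2 * (x 0 * pderiv 0 u.1 x)),
        mul_le_mul_of_nonneg_right h2 (sq_nonneg (pderiv 0 u.1 x))]
  rw [integral_add (i1.const_mul _) (i2.const_mul _), integral_const_mul, integral_const_mul] at hle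
  linarith

section TripleNorms

variable {Γ : JordanCurve} {Ω : Set Plane} (φ : testFun ℝ)

lemma norm_testTriple_fst : ‖(testTriple Γ Ω φ).1‖ ^ 2 = ∫ x in Ω, φ.1 x ^ 2 := by
  refine (L2_norm_sq_toLp (memLp_of_test (testFun.continuous φ) φ.2.2 Ω)).trans ?_
  simp

lemma norm_testTriple_grad (j : Fin 2) :
    ‖(testTriple Γ Ω φ).2.1 j‖ ^ 2 = ∫ x in Ω, pderiv j φ.1 x ^ 2 := by
  refine (L2_norm_sq_toLp (memLp_of_test (testFun.continuous_pderiv φ j)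
    (hasCompactSupport_pderiv φ.2.2) Ω)).trans ?_
  simp

lemma norm_testTriple_trace :
    ‖(testTriple Γ Ω φ).2.2‖ ^ 2 = ∫ s in Ioc 0 Γ.L, φ.1 (Γ.γ s) ^ 2 := by
  refine (L2_norm_sq_toLp (memLp_Ioc ((testFun.continuous φ).comp Γ.continuous_γ) 0 Γ.L)).trans ?_
  simp

end TripleNorms

namespace JordanCurve

variable {Γ : JordanCurve}

lemma continuous_gradSq (φ : testFun ℝ) : Continuous fun x => ∑ j, pderiv j φ.1 x ^ 2 :=
  continuous_finsetSum _ fun j _ => (testFun.continuous_pderiv φ j).pow 2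

lemma integrableOn_gradSq (φ : testFun ℝ) (Ω : Set Plane) :
    IntegrableOn (fun x => ∑ j, pderiv j φ.1 x ^ 2) Ω :=
  integrable_finsetSum _ fun j _ => testFun.integrable_sq (testFun.continuous_pderiv φ j)
    (hasCompactSupport_pderiv φ.2.2) Ω

lemma integral_strip_eq {δ : ℝ} (hδ : 0 ≤ δ) {f : ℝ × ℝ → ℝ} (hf : Continuous f) :
    ∫ p in Γ.strip δ, f p = ∫ s in Ioc 0 Γ.L, ∫ r in (0 : ℝ)..δ, f (s, r) := by
  rw [strip, Measure.volume_eq_prod, setIntegral_prod _ (integrableOn_strip hf.continuousOn)]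
  simp only [intervalIntegral.integral_of_le hδ, integral_Ioc_eq_integral_Ioo]

/-- A function on the collar is controlled by its boundary values and its gradient. -/
theorem IsSide.integral_strip_sq_le {δ σ : ℝ} {Ω : Set Plane} (h : Γ.IsSide δ σ Ω)
    (φ : testFun ℝ) : ∫ p in Γ.strip δ, φ.1 (Γ.tube (p.1, σ * p.2)) ^ 2 ≤
      2 * δ * (∫ s in Ioc 0 Γ.L, φ.1 (Γ.γ s) ^ 2) +
        4 * δ ^ 2 * ∫ x in Ω, ∑ j, pderiv j φ.1 x ^ 2 := by
  have hδ0 := h.radius.pos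
  have hct : Continuous fun p : ℝ × ℝ => Γ.tube (p.1, σ * p.2) :=
    Γ.contDiff_tube.continuous.comp (by fun_prop)
  let D : ℝ × ℝ → ℝ := fun p => fderiv ℝ φ.1 (Γ.tube (p.1, σ * p.2)) (Γ.normal p.1)
  have hD : Continuous D := ((φ.2.1.continuous_fderiv (by simp)).comp hct).clm_apply
    (Γ.contDiff_normal.continuous.comp continuous_fst)
  have hφt : Continuous fun p : ℝ × ℝ => φ.1 (Γ.tube (p.1, σ * p.2)) :=
    (testFun.continuous φ).comp hct
  -- The value at depth ρ is the boundary value plus the integral of the normal derivative;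
  -- Cauchy–Schwarz costs the length ρ ≤ δ.
  have hpt : ∀ s, ∀ ρ ∈ Ioo 0 δ, φ.1 (Γ.tube (s, σ * ρ)) ^ 2 ≤
      2 * φ.1 (Γ.γ s) ^ 2 + 2 * δ * ∫ r in (0 : ℝ)..δ, D (s, r) ^ 2 := by
    intro s ρ hρ
    have hDs : Continuous fun r => σ * D (s, r) := continuous_const.mul (hD.comp (by fun_prop))
    have e : ∫ r in (0 : ℝ)..ρ, σ * D (s, r) = φ.1 (Γ.tube (s, σ * ρ)) - φ.1 (Γ.γ s) := by
      rw [intervalIntegral.integral_eq_sub_of_hasDerivAt (f := fun r => φ.1 (Γ.tube (s, σ * r)))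
        (fun r _ => ?_) (hDs.intervalIntegrable _ _)]
      · simp [tube_zero]
      · have hm : HasDerivAt (fun ρ : ℝ => σ * ρ) σ r := by
          simpa using (hasDerivAt_id r).const_mul σ
        refine ((Γ.hasDerivAt_comp_tube_right (testFun.differentiable φ) s (σ * r)).comp r
          hm).congr_deriv ?_
        simp only [D]
        ring
    have h1 := norm_sq_integral_le hρ.1.le hDs
    rw [e] at h1
    have h2 : ∫ r in (0 : ℝ)..ρ, ‖σ * D (s, r)‖ ^ 2 ≤ ∫ r in (0 : ℝ)..δ, D (s, r) ^ 2 := by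
      have : ∀ r, ‖σ * D (s, r)‖ ^ 2 = D (s, r) ^ 2 := by
        intro r
        rw [norm_mul, Real.norm_eq_abs, h.abs_sigma, one_mul, Real.norm_eq_abs, sq_abs]
      simp only [this]
      refine intervalIntegral.integral_mono_interval le_rfl hρ.1.le hρ.2.le
        (Eventually.of_forall fun r => sq_nonneg _) ?_
      exact ((hD.comp (by fun_prop : Continuous fun r : ℝ => (s, r))).pow 2).intervalIntegrable _ _
    have h3 : 0 ≤ ∫ r in (0 : ℝ)..δ, D (s, r) ^ 2 :=
      intervalIntegral.integral_nonneg hδ0.le fun r _ => sq_nonneg _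
    rw [Real.norm_eq_abs, sq_abs] at h1
    have h4 : ρ * ∫ r in (0 : ℝ)..ρ, ‖σ * D (s, r)‖ ^ 2 ≤ δ * ∫ r in (0 : ℝ)..δ, D (s, r) ^ 2 :=
      (mul_le_mul_of_nonneg_left h2 hρ.1.le).trans (mul_le_mul_of_nonneg_right hρ.2.le h3)
    nlinarith [sq_nonneg (φ.1 (Γ.tube (s, σ * ρ)) - 2 * φ.1 (Γ.γ s))]
  have hI : Continuous fun s => ∫ r in (0 : ℝ)..δ, D (s, r) ^ 2 :=
    intervalIntegral.continuous_parametric_intervalIntegral_of_continuous' (by fun_prop) 0 δ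
  have hφγ : Continuous fun s => φ.1 (Γ.γ s) ^ 2 :=
    ((testFun.continuous φ).comp Γ.continuous_γ).pow 2
  have hIoc : ∀ {f : ℝ → ℝ}, Continuous f → IntegrableOn f (Ioc 0 Γ.L) := fun hf =>
    hf.integrableOn_Ioc
  have e1 : ∫ p in Γ.strip δ, D p ^ 2 = ∫ s in Ioc 0 Γ.L, ∫ r in (0 : ℝ)..δ, D (s, r) ^ 2 :=
    integral_strip_eq hδ0.le (f := fun p => D p ^ 2) (hD.pow 2)
  have e2 : ∫ p in Γ.strip δ, D p ^ 2 ≤ 2 * ∫ x in Ω, ∑ j, pderiv j φ.1 x ^ 2 := by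
    refine le_trans ?_ (h.integral_strip_le (continuous_gradSq φ)
      (fun x => Finset.sum_nonneg fun j _ => sq_nonneg _) (integrableOn_gradSq φ Ω))
    refine setIntegral_mono_on (integrableOn_strip (hD.pow 2).continuousOn)
      (integrableOn_strip ((continuous_gradSq φ).comp hct).continuousOn)
      (Γ.measurableSet_strip δ) fun p _ => ?_
    rw [Γ.sum_pderiv_sq φ.1 _ p.1]
    simp only [D]
    nlinarith [sq_nonneg (fderiv ℝ φ.1 (Γ.tube (p.1, σ * p.2)) (Γ.tang p.1))]
  calc ∫ p in Γ.strip δ, φ.1 (Γ.tube (p.1, σ * p.2)) ^ 2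
      = ∫ s in Ioc 0 Γ.L, ∫ ρ in Ioo 0 δ, φ.1 (Γ.tube (s, σ * ρ)) ^ 2 := by
        rw [integral_strip_eq hδ0.le (f := fun p => φ.1 (Γ.tube (p.1, σ * p.2)) ^ 2) (hφt.pow 2)]
        simp only [intervalIntegral.integral_of_le hδ0.le, integral_Ioc_eq_integral_Ioo]
    _ ≤ ∫ s in Ioc 0 Γ.L, δ * (2 * φ.1 (Γ.γ s) ^ 2 + 2 * δ * ∫ r in (0 : ℝ)..δ, D (s, r) ^ 2) := by
        refine integral_mono_of_nonneg (Eventually.of_forall fun s =>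
          integral_nonneg fun _ => sq_nonneg _) (hIoc (by fun_prop)) (Eventually.of_forall fun s => ?_)
        have : δ * (2 * φ.1 (Γ.γ s) ^ 2 + 2 * δ * ∫ r in (0 : ℝ)..δ, D (s, r) ^ 2) =
            ∫ _ρ in Ioo 0 δ, (2 * φ.1 (Γ.γ s) ^ 2 + 2 * δ * ∫ r in (0 : ℝ)..δ, D (s, r) ^ 2) := by
          simp [hδ0.le]
        simp only
        rw [this]
        refine setIntegral_mono_on ?_ (by simp) measurableSet_Ioo (hpt s)
        exact ((hφt.comp (by fun_prop : Continuous fun ρ : ℝ => (s, ρ))).pow 2).integrableOn_Icc.mono_set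
          Ioo_subset_Icc_self
    _ = 2 * δ * (∫ s in Ioc 0 Γ.L, φ.1 (Γ.γ s) ^ 2) + 2 * δ ^ 2 * ∫ p in Γ.strip δ, D p ^ 2 := by
        rw [e1, integral_const_mul, integral_add (hIoc (by fun_prop)) (hIoc (by fun_prop)),
          integral_const_mul, integral_const_mul]
        ring
    _ ≤ _ := by nlinarith [mul_le_mul_of_nonneg_left e2 (by positivity : 0 ≤ 2 * δ ^ 2)]

lemma IsTubeRadius.isTubeFun_cutoff {δ : ℝ} (hδ : Γ.IsTubeRadius δ) :
    Γ.IsTubeFun δ (fun p => cutoff hδ.pos p.2) where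
  periodic _ _ := rfl
  smooth := ((contDiff_cutoff hδ.pos).comp contDiff_snd).contDiffOn
  zero _ hp := cutoff_zero_of hδ.pos hp

/-- The tube map is a local homeomorphism at (s, 0), so a neighbourhood of γ(s) is the image of
parameters with |r| < δ/4, where the cutoff equals 1. -/
lemma IsTubeRadius.push_cutoff_eq_one {δ : ℝ} (hδ : Γ.IsTubeRadius δ) (s : ℝ) :
    ∀ᶠ y in 𝓝 (Γ.γ s), Γ.push δ (fun p => cutoff hδ.pos p.2) y = 1 := by
  have hδ0 := hδ.pos
  have hj : Γ.jac (s, 0) ≠ 0 := by simp [jac]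
  have hmap := ((Γ.contDiff_tube.contDiffAt (x := (s, (0 : ℝ)))).hasStrictFDerivAt'
    (Γ.hasFDerivAt_tube_equiv _ hj) (by simp)).map_nhds_eq_of_equiv
  rw [← tube_zero, ← hmap, eventually_map]
  have hopen : IsOpen {p : ℝ × ℝ | |p.2| < δ / 4} := isOpen_lt (by fun_prop) continuous_const
  filter_upwards [hopen.mem_nhds (show (s, (0 : ℝ)) ∈ {p : ℝ × ℝ | |p.2| < δ / 4} by
    simp only [mem_ofPred_eq, abs_zero]; linarith)] with p hp
  have hp' : |p.2| < δ / 4 := hp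
  rw [hδ.isTubeFun_cutoff.push_tube hδ (by linarith), cutoff_one_of hδ0 hp'.le]

open Classical in
/-- The product with a cutoff function that vanishes near the curve, extended by `0`. -/
def cutInt (Γ : JordanCurve) (ρ φ : Plane → ℝ) (x : Plane) : ℝ :=
  if x ∈ Γ.int then (1 - ρ x) * φ x else 0

/-- A point outside the interior is either on the curve, near which 1 - ρ vanishes, or in the open
exterior. This makes the extension by zero smooth across Γ, without any boundary condition on φ. -/
lemma cutInt_eventually_zero {ρ φ : Plane → ℝ} (hρ : ∀ s, ∀ᶠ y in 𝓝 (Γ.γ s), ρ y = 1) {x : Plane}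
    (hx : x ∉ Γ.int) : Γ.cutInt ρ φ =ᶠ[𝓝 x] fun _ => 0 := by
  by_cases h : x ∈ range Γ.γ
  · obtain ⟨s, rfl⟩ := h
    filter_upwards [hρ s] with y hy
    simp [cutInt, hy]
  · have hxe : x ∈ Γ.ext := ⟨h, fun hb => hx ⟨h, hb⟩⟩
    filter_upwards [Γ.isOpen_ext.mem_nhds hxe] with y hy
    rw [cutInt, if_neg]
    exact fun hy' => hy.2 hy'.2

lemma cutInt_eventually_eq {ρ φ : Plane → ℝ} {x : Plane} (hx : x ∈ Γ.int) :
    Γ.cutInt ρ φ =ᶠ[𝓝 x] fun y => (1 - ρ y) * φ y := by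
  filter_upwards [Γ.isOpen_int.mem_nhds hx] with y hy
  rw [cutInt, if_pos hy]

lemma cutInt_mem {ρ : Plane → ℝ} (hρs : ContDiff ℝ ∞ ρ)
    (hρ : ∀ s, ∀ᶠ y in 𝓝 (Γ.γ s), ρ y = 1) (φ : testFun ℝ) : Γ.cutInt ρ φ.1 ∈ testFun ℝ := by
  constructor
  · rw [contDiff_iff_contDiffAt]
    intro x
    by_cases hx : x ∈ Γ.int
    · exact ((contDiff_const.sub hρs).mul φ.2.1).contDiffAt.congr_of_eventuallyEq
        (cutInt_eventually_eq hx)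
    · exact contDiffAt_const.congr_of_eventuallyEq (cutInt_eventually_zero hρ hx)
  · refine φ.2.2.mono fun x hx h0 => hx ?_
    simp [cutInt, h0]

/-- The Poincaré inequality for functions on the interior, for test functions. -/
theorem IsTubeRadius.exists_poincare_test {δ : ℝ} (hδ : Γ.IsTubeRadius δ) :
    ∃ C, 0 < C ∧ ∀ φ : testFun ℝ, ∫ x in Γ.int, φ.1 x ^ 2 ≤
      C * ((∫ s in Ioc 0 Γ.L, φ.1 (Γ.γ s) ^ 2) + ∫ x in Γ.int, ∑ j, pderiv j φ.1 x ^ 2) := by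
  have hδ0 := hδ.pos
  have h := hδ.isSide_int
  let ρ : testFun ℝ := ⟨_, hδ.push_mem hδ.isTubeFun_cutoff⟩
  have hρ1 := hδ.push_cutoff_eq_one
  have hρ01 : ∀ x, 0 ≤ ρ.1 x ∧ ρ.1 x ≤ 1 := by
    intro x
    by_cases hx : ∃ p : ℝ × ℝ, |p.2| < δ ∧ Γ.tube p = x
    · obtain ⟨p, hp, rfl⟩ := hx
      simp only [ρ, hδ.isTubeFun_cutoff.push_tube hδ hp]
      exact ⟨(cutoff hδ0).nonneg, (cutoff hδ0).le_one⟩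
    · have : ρ.1 x = 0 := push_of_notMem (δ := δ) (G := fun p => cutoff hδ.pos p.2)
        fun p hp he => hx ⟨p, hp, he⟩
      rw [this]
      norm_num
  obtain ⟨M, hM, hMb⟩ := testFun.exists_bound (F := ℝ)
    ⟨pderiv 0 ρ.1, contDiff_pderiv ρ.2.1, hasCompactSupport_pderiv ρ.2.2⟩
  have hρc : ∀ x ∈ Γ.int, x ∉ Γ.collar δ (-1) → ρ.1 =ᶠ[𝓝 x] fun _ => 0 := by
    intro x hx hxc
    have hxK : x ∉ Γ.tube '' {p | |p.2| ≤ δ / 2} := by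
      rintro ⟨p, hp, rfl⟩
      exact hxc (h.mem_collar (lt_of_le_of_lt hp (by linarith)) hx)
    filter_upwards [(isCompact_tube_image (Γ := Γ) (δ / 2)).isClosed.isOpen_compl.mem_nhds hxK]
      with y hy
    exact hδ.support_push hδ.isTubeFun_cutoff hy
  obtain ⟨R₀, hR₀⟩ := Γ.isBounded_int.subset_closedBall 0
  set R := max R₀ 0
  have hRint : ∀ x ∈ Γ.int, ‖x‖ ≤ R := fun x hx =>
    (mem_closedBall_zero_iff.1 (hR₀ hx)).trans (le_max_left _ _)
  -- The function is split as (1-ρ)φ + ρφ. The first piece extends by zero to the plane and obeys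
  -- the Poincaré inequality there, with a gradient error M²φ² from the cutoff. The second piece,
  -- like this error, lives in the collar, where it is controlled by boundary values and gradient
  -- with the factor 4δ + 8δ².
  refine ⟨16 * R ^ 2 + (16 * R ^ 2 * M ^ 2 + 2) * (4 * δ + 8 * δ ^ 2), by positivity, fun φ => ?_⟩
  let u : testFun ℝ := ⟨_, cutInt_mem ρ.2.1 hρ1 φ⟩
  have hu0 : ∀ x ∉ Γ.int, u.1 x = 0 := fun x hx => (cutInt_eventually_zero hρ1 hx).eq_of_nhds
  have hdu0 : ∀ x ∉ Γ.int, pderiv 0 u.1 x = 0 := fun x hx => by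
    have : fderiv ℝ u.1 x = fderiv ℝ (fun _ => (0 : ℝ)) x := (cutInt_eventually_zero hρ1 hx).fderiv_eq
    simp [pderiv, this]
  have hu1 : ∀ x ∈ Γ.int, u.1 x = (1 - ρ.1 x) * φ.1 x := fun x hx =>
    (cutInt_eventually_eq hx).eq_of_nhds
  have hdu1 : ∀ x ∈ Γ.int, pderiv 0 u.1 x =
      (1 - ρ.1 x) * pderiv 0 φ.1 x - pderiv 0 ρ.1 x * φ.1 x := fun x hx => by
    have e1 : fderiv ℝ u.1 x = fderiv ℝ (fun y => (1 - ρ.1 y) * φ.1 y) x :=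
      (cutInt_eventually_eq hx).fderiv_eq
    have e2 := ((testFun.differentiable ρ x).hasFDerivAt.const_sub 1).fun_mul
      (testFun.differentiable φ x).hasFDerivAt
    rw [pderiv, e1, e2.fderiv]
    simp [pderiv]
    ring
  have hpo := testFun.poincare u fun x hx => hu0 x fun hxi => absurd (hRint x hxi) (not_le.2 hx)
  rw [← setIntegral_eq_integral_of_forall_compl_eq_zero (s := Γ.int)
      (fun x hx => by rw [hu0 x hx]; simp),
    ← setIntegral_eq_integral_of_forall_compl_eq_zero (s := Γ.int)
      (f := fun x => pderiv 0 u.1 x ^ 2) (fun x hx => by rw [hdu0 x hx]; simp)] at hpo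
  have iφ := testFun.integrable_sq (testFun.continuous φ) φ.2.2 Γ.int
  have idφ := testFun.integrable_sq (testFun.continuous_pderiv φ 0)
    (hasCompactSupport_pderiv φ.2.2) Γ.int
  have iu := testFun.integrable_sq (testFun.continuous u) u.2.2 Γ.int
  have idu := testFun.integrable_sq (testFun.continuous_pderiv u 0)
    (hasCompactSupport_pderiv u.2.2) Γ.int
  have hmc := h.measurableSet_collar
  have hmi := Γ.isOpen_int.measurableSet
  have icol : IntegrableOn ((Γ.collar δ (-1)).indicator fun x => φ.1 x ^ 2) Γ.int :=
    iφ.indicator hmc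
  have ecol : ∫ x in Γ.int, (Γ.collar δ (-1)).indicator (fun x => φ.1 x ^ 2) x =
      ∫ x in Γ.collar δ (-1), φ.1 x ^ 2 := by
    rw [setIntegral_indicator hmc, inter_eq_right.2 h.collar_subset]
  have b1 : ∫ x in Γ.int, φ.1 x ^ 2 ≤
      2 * (∫ x in Γ.int, u.1 x ^ 2) + 2 * ∫ x in Γ.collar δ (-1), φ.1 x ^ 2 := by
    rw [← ecol, ← integral_const_mul, ← integral_const_mul,
      ← integral_add (iu.const_mul 2) (icol.const_mul 2)]
    refine setIntegral_mono_on iφ ((iu.const_mul 2).add (icol.const_mul 2)) hmi fun x hx => ?_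
    rw [hu1 x hx]
    obtain ⟨r0, r1⟩ := hρ01 x
    by_cases hxc : x ∈ Γ.collar δ (-1)
    · rw [indicator_of_mem hxc]
      nlinarith [sq_nonneg ((1 - ρ.1 x) * φ.1 x), sq_nonneg (φ.1 x)]
    · rw [indicator_of_notMem hxc, (hρc x hx hxc).eq_of_nhds]
      nlinarith [sq_nonneg (φ.1 x)]
  have b2 : ∫ x in Γ.int, pderiv 0 u.1 x ^ 2 ≤
      2 * (∫ x in Γ.int, pderiv 0 φ.1 x ^ 2) + 2 * M ^ 2 * ∫ x in Γ.collar δ (-1), φ.1 x ^ 2 := by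
    rw [← ecol, ← integral_const_mul, ← integral_const_mul,
      ← integral_add (idφ.const_mul 2) (icol.const_mul (2 * M ^ 2))]
    refine setIntegral_mono_on idu ((idφ.const_mul 2).add (icol.const_mul (2 * M ^ 2))) hmi
      fun x hx => ?_
    rw [hdu1 x hx]
    obtain ⟨r0, r1⟩ := hρ01 x
    have hs : (1 - ρ.1 x) ^ 2 ≤ 1 := by nlinarith
    have hs' := mul_le_mul_of_nonneg_right hs (sq_nonneg (pderiv 0 φ.1 x))
    by_cases hxc : x ∈ Γ.collar δ (-1)
    · rw [indicator_of_mem hxc]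
      have hm := hMb x
      rw [Real.norm_eq_abs] at hm
      have hm2 : pderiv 0 ρ.1 x ^ 2 ≤ M ^ 2 := sq_le_sq' (abs_le.1 hm).1 (abs_le.1 hm).2
      have hm3 := mul_le_mul_of_nonneg_right hm2 (sq_nonneg (φ.1 x))
      nlinarith [sq_nonneg ((1 - ρ.1 x) * pderiv 0 φ.1 x + pderiv 0 ρ.1 x * φ.1 x)]
    · have hz : pderiv 0 ρ.1 x = 0 := by
        rw [pderiv, (hρc x hx hxc).fderiv_eq]
        simp
      rw [indicator_of_notMem hxc, hz]
      nlinarith [sq_nonneg (pderiv 0 φ.1 x)]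
  have b3 : ∫ x in Γ.collar δ (-1), φ.1 x ^ 2 ≤ 4 * δ * (∫ s in Ioc 0 Γ.L, φ.1 (Γ.γ s) ^ 2) +
        8 * δ ^ 2 * ∫ x in Γ.int, ∑ j, pderiv j φ.1 x ^ 2 := by
    have h1 := h.integral_strip_sq_le φ
    have hct : Continuous fun p : ℝ × ℝ => Γ.tube (p.1, -1 * p.2) :=
      Γ.contDiff_tube.continuous.comp (by fun_prop)
    have hj : Continuous fun p : ℝ × ℝ => Γ.jac (p.1, -1 * p.2) :=
      Γ.contDiff_jac.continuous.comp (by fun_prop)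
    have hφt := ((testFun.continuous φ).comp hct).pow 2
    have h2 : ∫ x in Γ.collar δ (-1), φ.1 x ^ 2 ≤
        ∫ p in Γ.strip δ, 2 * φ.1 (Γ.tube (p.1, -1 * p.2)) ^ 2 := by
      rw [h.integral_collar]
      refine setIntegral_mono_on (integrableOn_strip (hj.mul hφt).continuousOn)
        (integrableOn_strip (continuous_const.mul hφt).continuousOn)
        (Γ.measurableSet_strip δ) fun p hp => ?_
      exact mul_le_mul_of_nonneg_right (hδ.jac_upper (p.1, -1 * p.2) (h.abs_lt hp)) (sq_nonneg _)
    rw [integral_const_mul] at h2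
    linarith
  have b4 : ∫ x in Γ.int, pderiv 0 φ.1 x ^ 2 ≤ ∫ x in Γ.int, ∑ j, pderiv j φ.1 x ^ 2 := by
    refine setIntegral_mono_on idφ (integrableOn_gradSq φ _) hmi fun x _ => ?_
    rw [Fin.sum_univ_two]
    nlinarith [sq_nonneg (pderiv 1 φ.1 x)]
  set A := ∫ s in Ioc 0 Γ.L, φ.1 (Γ.γ s) ^ 2
  set G := ∫ x in Γ.int, ∑ j, pderiv j φ.1 x ^ 2
  set K := ∫ x in Γ.collar δ (-1), φ.1 x ^ 2
  have hA : 0 ≤ A := integral_nonneg fun _ => sq_nonneg _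
  have hG : 0 ≤ G := integral_nonneg fun _ => Finset.sum_nonneg fun _ _ => sq_nonneg _
  have hK : K ≤ (4 * δ + 8 * δ ^ 2) * (A + G) := by nlinarith [mul_nonneg hδ0.le hG, mul_nonneg (sq_nonneg δ) hA]
  have h5 : ∫ x in Γ.int, φ.1 x ^ 2 ≤ 16 * R ^ 2 * G + (16 * R ^ 2 * M ^ 2 + 2) * K := by
    have hR2 : 0 ≤ 4 * R ^ 2 := by positivity
    have h6 : ∫ x in Γ.int, pderiv 0 u.1 x ^ 2 ≤ 2 * G + 2 * M ^ 2 * K := by linarith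
    have := mul_le_mul_of_nonneg_left h6 hR2
    linarith
  refine h5.trans ?_
  have h7 := mul_le_mul_of_nonneg_left hK (by positivity : 0 ≤ 16 * R ^ 2 * M ^ 2 + 2)
  have h8 : 0 ≤ 16 * R ^ 2 * A := by positivity
  linarith

/-- The Poincaré inequality in the interior. -/
theorem exists_poincare (Γ : JordanCurve) : ∃ C, 0 < C ∧ ∀ x ∈ traceSpace Γ Γ.int ℝ,
    ‖x.1‖ ^ 2 ≤ C * (‖x.2.2‖ ^ 2 + ∑ j, ‖x.2.1 j‖ ^ 2) := by
  obtain ⟨δ, hδ⟩ := Γ.exists_tubeRadius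
  obtain ⟨C, hC, h⟩ := hδ.exists_poincare_test
  refine ⟨C, hC, fun x hx => traceSpace_induction
    (P := fun x : Triple Γ Γ.int ℝ => ‖x.1‖ ^ 2 ≤ C * (‖x.2.2‖ ^ 2 + ∑ j, ‖x.2.1 j‖ ^ 2))
    (isClosed_le (by fun_prop) (by fun_prop)) (fun φ => ?_) hx⟩
  rw [norm_testTriple_fst, norm_testTriple_trace]
  simp only [norm_testTriple_grad]
  rw [← integral_finsetSum]
  · exact h φ
  · exact fun j _ => testFun.integrable_sq (testFun.continuous_pderiv φ j)
      (hasCompactSupport_pderiv φ.2.2) _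

end JordanCurve
end WaveStructure
end

noncomputable section
namespace WaveStructure

/-! ### Fourier coefficients on the curve -/

variable {Γ : JordanCurve}

variable (Γ) in
/-- The `k`-th Fourier coefficient of a function on `(0, L]`. -/
def fcoef (f : ℝ → ℂ) (k : ℤ) : ℂ :=
  (1 / (Γ.L : ℂ)) * ∫ s in (0 : ℝ)..Γ.L, f s * Complex.exp (-(Complex.I * (freq Γ k : ℂ) * (s : ℂ)))

lemma fourierCoef_eq_fcoef (g : L2Γ Γ ℝ) (k : ℤ) :
    fourierCoef Γ g k = fcoef Γ (fun s => (g s : ℂ)) k := by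
  rw [fourierCoef, fcoef, intervalIntegral.integral_of_le Γ.L_pos.le]

lemma fcoef_eq_fourierCoeffOn (f : ℝ → ℂ) (k : ℤ) :
    fcoef Γ f k = fourierCoeffOn Γ.L_pos f k := by
  rw [fourierCoeffOn_eq_integral, fcoef, Complex.real_smul]
  congr 1
  · push_cast
    simp
  · refine intervalIntegral.integral_congr fun s _ => ?_
    simp only [fourier_coe_apply, smul_eq_mul]
    rw [mul_comm]
    congr 2
    have : (Γ.L : ℂ) ≠ 0 := by exact_mod_cast Γ.L_pos.ne'
    simp only [freq]
    push_cast
    rw [sub_zero]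
    field_simp

/-- Parseval's identity. -/
lemma hasSum_fcoef_sq {f : ℝ → ℂ} (hf : MemLp f 2 (volume.restrict (Ioc 0 Γ.L))) :
    HasSum (fun k => Γ.L * ‖fcoef Γ f k‖ ^ 2) (∫ s in Ioc 0 Γ.L, ‖f s‖ ^ 2) := by
  have h := (hasSum_sq_fourierCoeffOn Γ.L_pos hf).mul_left Γ.L
  simp only [fcoef_eq_fourierCoeffOn]
  have e : Γ.L * ((Γ.L - 0)⁻¹ • ∫ s in (0 : ℝ)..Γ.L, ‖f s‖ ^ 2) = ∫ s in Ioc 0 Γ.L, ‖f s‖ ^ 2 := by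
    rw [sub_zero, smul_eq_mul, mul_inv_cancel_left₀ Γ.L_pos.ne',
      intervalIntegral.integral_of_le Γ.L_pos.le]
  rwa [e] at h

lemma memLp_ofReal (g : L2Γ Γ ℝ) :
    MemLp (fun s => (g s : ℂ)) 2 (volume.restrict (Ioc 0 Γ.L)) :=
  (Lp.memLp g).ofReal

lemma hasSum_fourierCoef_sq (g : L2Γ Γ ℝ) :
    HasSum (fun k => Γ.L * ‖fourierCoef Γ g k‖ ^ 2) (‖g‖ ^ 2) := by
  have h := hasSum_fcoef_sq (memLp_ofReal g)
  simp only [fourierCoef_eq_fcoef]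
  rw [L2_norm_sq]
  simpa using h

/-- Bessel's inequality. -/
lemma sum_fcoef_sq_le {f : ℝ → ℂ} (hf : MemLp f 2 (volume.restrict (Ioc 0 Γ.L)))
    (S : Finset ℤ) : Γ.L * ∑ k ∈ S, ‖fcoef Γ f k‖ ^ 2 ≤ ∫ s in Ioc 0 Γ.L, ‖f s‖ ^ 2 := by
  rw [Finset.mul_sum]
  exact sum_le_hasSum S (fun k _ => mul_nonneg Γ.L_pos.le (sq_nonneg _)) (hasSum_fcoef_sq hf)

lemma continuous_expFactor (k : ℤ) :
    Continuous fun s : ℝ => Complex.exp (-(Complex.I * (freq Γ k : ℂ) * (s : ℂ))) := by fun_prop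

lemma norm_expFactor (k : ℤ) (s : ℝ) :
    ‖Complex.exp (-(Complex.I * (freq Γ k : ℂ) * (s : ℂ)))‖ = 1 := by
  rw [Complex.norm_exp]
  simp

lemma intervalIntegrable_mul_exp {f : ℝ → ℂ} (hf : MemLp f 2 (volume.restrict (Ioc 0 Γ.L)))
    (k : ℤ) : IntervalIntegrable
      (fun s => f s * Complex.exp (-(Complex.I * (freq Γ k : ℂ) * (s : ℂ)))) volume 0 Γ.L := by
  rw [intervalIntegrable_iff_integrableOn_Ioc_of_le Γ.L_pos.le]
  refine (hf.integrable (by norm_num)).mul_bdd (c := 1)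
    (continuous_expFactor k).aestronglyMeasurable ?_
  exact Eventually.of_forall fun s => (norm_expFactor k s).le

lemma fcoef_add {f g : ℝ → ℂ} (hf : MemLp f 2 (volume.restrict (Ioc 0 Γ.L)))
    (hg : MemLp g 2 (volume.restrict (Ioc 0 Γ.L))) (k : ℤ) :
    fcoef Γ (fun s => f s + g s) k = fcoef Γ f k + fcoef Γ g k := by
  simp only [fcoef, add_mul]
  rw [intervalIntegral.integral_add (intervalIntegrable_mul_exp hf k)
    (intervalIntegrable_mul_exp hg k), mul_add]

lemma fcoef_const_mul (c : ℂ) (f : ℝ → ℂ) (k : ℤ) :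
    fcoef Γ (fun s => c * f s) k = c * fcoef Γ f k := by
  simp only [fcoef, mul_assoc]
  rw [intervalIntegral.integral_const_mul]
  ring

lemma fcoef_congr_ae {f g : ℝ → ℂ} (h : f =ᵐ[volume.restrict (Ioc 0 Γ.L)] g) (k : ℤ) :
    fcoef Γ f k = fcoef Γ g k := by
  simp only [fcoef, intervalIntegral.integral_of_le Γ.L_pos.le]
  congr 1
  refine integral_congr_ae ?_
  filter_upwards [h] with s hs
  rw [hs]

lemma fourierCoef_add (g g' : L2Γ Γ ℝ) (k : ℤ) :
    fourierCoef Γ (g + g') k = fourierCoef Γ g k + fourierCoef Γ g' k := by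
  simp only [fourierCoef_eq_fcoef]
  rw [← fcoef_add (memLp_ofReal g) (memLp_ofReal g')]
  refine fcoef_congr_ae ?_ k
  filter_upwards [Lp.coeFn_add g g'] with s hs
  rw [hs, Pi.add_apply, Complex.ofReal_add]

lemma fourierCoef_smul (c : ℝ) (g : L2Γ Γ ℝ) (k : ℤ) :
    fourierCoef Γ (c • g) k = c * fourierCoef Γ g k := by
  simp only [fourierCoef_eq_fcoef]
  rw [← fcoef_const_mul]
  refine fcoef_congr_ae ?_ k
  filter_upwards [Lp.coeFn_smul c g] with s hs
  rw [hs, Pi.smul_apply, smul_eq_mul, Complex.ofReal_mul]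

lemma norm_fourierCoef_le (g : L2Γ Γ ℝ) (k : ℤ) :
    ‖fourierCoef Γ g k‖ ≤ (Real.sqrt Γ.L)⁻¹ * ‖g‖ := by
  have h := le_hasSum (hasSum_fourierCoef_sq g) k
    fun k _ => mul_nonneg Γ.L_pos.le (sq_nonneg _)
  have hs := Real.sqrt_pos.2 Γ.L_pos
  have e : Γ.L * ‖fourierCoef Γ g k‖ ^ 2 = (Real.sqrt Γ.L * ‖fourierCoef Γ g k‖) ^ 2 := by
    rw [mul_pow, Real.sq_sqrt Γ.L_pos.le]
  rw [e] at h
  have h' := abs_le_of_sq_le_sq h (norm_nonneg _)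
  rw [abs_of_nonneg (by positivity)] at h'
  rw [inv_mul_eq_div, le_div_iff₀ hs]
  linarith

/-- The Fourier coefficients as continuous linear maps. -/
def fourierCoefL (Γ : JordanCurve) (k : ℤ) : L2Γ Γ ℝ →L[ℝ] ℂ :=
  LinearMap.mkContinuous
    { toFun := fun g => fourierCoef Γ g k
      map_add' := fun g g' => fourierCoef_add g g' k
      map_smul' := fun c g => by
        rw [fourierCoef_smul, RingHom.id_apply, Complex.real_smul] }
    (Real.sqrt Γ.L)⁻¹ fun g => norm_fourierCoef_le g k

lemma fourierCoefL_apply (k : ℤ) (g : L2Γ Γ ℝ) : fourierCoefL Γ k g = fourierCoef Γ g k := rfl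

lemma eq_of_fourierCoef_eq {g g' : L2Γ Γ ℝ} (h : ∀ k, fourierCoef Γ g k = fourierCoef Γ g' k) :
    g = g' := by
  have h0 : ∀ k, fourierCoef Γ (g - g') k = 0 := fun k => by
    rw [← fourierCoefL_apply, map_sub, fourierCoefL_apply, fourierCoefL_apply, h, sub_self]
  have h1 := hasSum_fourierCoef_sq (g - g')
  simp only [h0, norm_zero, ne_eq, OfNat.ofNat_ne_zero, not_false_eq_true, zero_pow,
    mul_zero] at h1
  have h2 := h1.unique hasSum_zero
  rw [sq_eq_zero_iff, norm_eq_zero, sub_eq_zero] at h2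
  exact h2

/-! ### Sobolev norms on the curve -/

/-- The weight is moved into the sequence, so that the triangle inequality and homogeneity are
inherited from L² for the counting measure. -/
lemma hNormCoef_eq_eLpNorm (σ : ℝ) (c : ℤ → ℂ) : hNormCoef Γ σ c =
    eLpNorm (fun k => (Real.sqrt (Γ.L * (1 + freq Γ k ^ 2) ^ σ) : ℂ) * c k) 2 Measure.count := by
  rw [eLpNorm_eq_lintegral_rpow_enorm_toReal (by norm_num) (by norm_num), hNormCoef, lintegral_count]
  simp only [ENNReal.toReal_ofNat, one_div]
  congr 1
  refine tsum_congr fun k => ?_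
  have hw : 0 ≤ Γ.L * (1 + freq Γ k ^ 2) ^ σ :=
    mul_nonneg Γ.L_pos.le (Real.rpow_nonneg (by positivity) _)
  rw [← ofReal_norm, ENNReal.ofReal_rpow_of_nonneg (norm_nonneg _) (by norm_num)]
  congr 1
  rw [norm_mul, Complex.norm_real, Real.norm_eq_abs, abs_of_nonneg (Real.sqrt_nonneg _),
    Real.rpow_two, mul_pow, Real.sq_sqrt hw]

lemma hNormCoef_add_le (σ : ℝ) (c d : ℤ → ℂ) :
    hNormCoef Γ σ (fun k => c k + d k) ≤ hNormCoef Γ σ c + hNormCoef Γ σ d := by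
  simp only [hNormCoef_eq_eLpNorm, mul_add]
  exact eLpNorm_add_le .of_discrete .of_discrete (by norm_num)

lemma hNormCoef_smul (σ : ℝ) (a : ℝ) (c : ℤ → ℂ) :
    hNormCoef Γ σ (fun k => (a : ℂ) * c k) = ENNReal.ofReal |a| * hNormCoef Γ σ c := by
  simp only [hNormCoef_eq_eLpNorm]
  have : (fun k => (Real.sqrt (Γ.L * (1 + freq Γ k ^ 2) ^ σ) : ℂ) * ((a : ℂ) * c k)) =
      (a : ℂ) • fun k => (Real.sqrt (Γ.L * (1 + freq Γ k ^ 2) ^ σ) : ℂ) * c k := by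
    funext k
    simp only [Pi.smul_apply, smul_eq_mul]
    ring
  rw [this, eLpNorm_const_smul, ← ofReal_norm, Complex.norm_real, Real.norm_eq_abs]

lemma hNormCoef_sq (σ : ℝ) (c : ℤ → ℂ) : hNormCoef Γ σ c ^ 2 =
    ∑' k : ℤ, ENNReal.ofReal (Γ.L * (1 + freq Γ k ^ 2) ^ σ * ‖c k‖ ^ 2) := by
  rw [hNormCoef, ← ENNReal.rpow_natCast, ← ENNReal.rpow_mul]
  norm_num

lemma hNorm_add_le (σ : ℝ) (g g' : L2Γ Γ ℝ) :
    hNorm Γ σ (g + g') ≤ hNorm Γ σ g + hNorm Γ σ g' := by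
  simp only [hNorm]
  rw [show fourierCoef Γ (g + g') = fun k => fourierCoef Γ g k + fourierCoef Γ g' k from
    funext fun k => fourierCoef_add g g' k]
  exact hNormCoef_add_le σ _ _

lemma hNorm_smul (σ : ℝ) (a : ℝ) (g : L2Γ Γ ℝ) :
    hNorm Γ σ (a • g) = ENNReal.ofReal |a| * hNorm Γ σ g := by
  simp only [hNorm]
  rw [show fourierCoef Γ (a • g) = fun k => (a : ℂ) * fourierCoef Γ g k from
    funext fun k => fourierCoef_smul a g k]
  exact hNormCoef_smul σ a _

lemma hNormTan_add_le (σ : ℝ) (g g' : L2Γ Γ ℝ) :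
    hNormTan Γ σ (g + g') ≤ hNormTan Γ σ g + hNormTan Γ σ g' := by
  simp only [hNormTan, fourierCoef_add, mul_add]
  exact hNormCoef_add_le σ _ _

/-- The space `H^{1/2}(Γ)`. -/
def Hhalf (Γ : JordanCurve) : Submodule ℝ (L2Γ Γ ℝ) where
  carrier := {ψ | hNorm Γ (1 / 2) ψ < ⊤}
  add_mem' h h' := (hNorm_add_le _ _ _).trans_lt (ENNReal.add_lt_top.2 ⟨h, h'⟩)
  zero_mem' := by
    change hNorm Γ (1 / 2) 0 < ⊤
    rw [← zero_smul ℝ (0 : L2Γ Γ ℝ), hNorm_smul, abs_zero, ENNReal.ofReal_zero, zero_mul]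
    exact ENNReal.zero_lt_top
  smul_mem' c ψ h := by
    change hNorm Γ (1 / 2) (c • ψ) < ⊤
    rw [hNorm_smul]
    exact ENNReal.mul_lt_top ENNReal.ofReal_lt_top h

lemma mem_Hhalf {ψ : L2Γ Γ ℝ} : ψ ∈ Hhalf Γ ↔ hNorm Γ (1 / 2) ψ < ⊤ := Iff.rfl

lemma one_add_sq_rpow_half (x : ℝ) : (1 + x ^ 2) ^ (1 / 2 : ℝ) = Real.sqrt (1 + x ^ 2) :=
  (Real.sqrt_eq_rpow _).symm

lemma one_add_sq_rpow_neg_half (x : ℝ) :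
    (1 + x ^ 2) ^ (-1 / 2 : ℝ) = (Real.sqrt (1 + x ^ 2))⁻¹ := by
  rw [Real.sqrt_eq_rpow, ← Real.rpow_neg (by positivity)]
  norm_num

lemma abs_le_sqrt_one_add_sq (x : ℝ) : |x| ≤ Real.sqrt (1 + x ^ 2) := by
  rw [← Real.sqrt_sq_eq_abs]
  exact Real.sqrt_le_sqrt (by linarith)

lemma norm_I_freq_mul (k : ℤ) (c : ℂ) :
    ‖Complex.I * (freq Γ k : ℂ) * c‖ ^ 2 = freq Γ k ^ 2 * ‖c‖ ^ 2 := by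
  rw [norm_mul, norm_mul, Complex.norm_I, one_mul, Complex.norm_real, mul_pow, Real.norm_eq_abs,
    sq_abs]

/-- The square of `|𝔡_tan g|_{H^{-1/2}}`. -/
lemma hNormTan_sq (g : L2Γ Γ ℝ) : hNormTan Γ (-1 / 2) g ^ 2 =
    ∑' k : ℤ, ENNReal.ofReal (Γ.L * ((Real.sqrt (1 + freq Γ k ^ 2))⁻¹ *
      (freq Γ k ^ 2 * ‖fourierCoef Γ g k‖ ^ 2))) := by
  rw [hNormTan, hNormCoef_sq]
  refine tsum_congr fun k => ?_
  rw [norm_I_freq_mul, one_add_sq_rpow_neg_half, mul_assoc]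

lemma hNorm_half_sq (g : L2Γ Γ ℝ) : hNorm Γ (1 / 2) g ^ 2 =
    ∑' k : ℤ, ENNReal.ofReal (Γ.L * (Real.sqrt (1 + freq Γ k ^ 2) *
      ‖fourierCoef Γ g k‖ ^ 2)) := by
  rw [hNorm, hNormCoef_sq]
  refine tsum_congr fun k => ?_
  rw [one_add_sq_rpow_half, mul_assoc]

lemma inv_sqrt_mul_sq_le (x : ℝ) : (Real.sqrt (1 + x ^ 2))⁻¹ * x ^ 2 ≤ |x| := by
  have hs : 0 < Real.sqrt (1 + x ^ 2) := Real.sqrt_pos.2 (by positivity)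
  rw [inv_mul_le_iff₀ hs]
  refine le_of_eq_of_le (by rw [← sq, sq_abs] : x ^ 2 = |x| * |x|) ?_
  exact mul_le_mul_of_nonneg_right (abs_le_sqrt_one_add_sq x) (abs_nonneg x)

/-- The weights compare frequency by frequency: k²/√(1+k²) ≤ |k| ≤ √(1+k²). -/
lemma hNormTan_le_hNorm (g : L2Γ Γ ℝ) : hNormTan Γ (-1 / 2) g ≤ hNorm Γ (1 / 2) g := by
  rw [← ENNReal.pow_le_pow_left_iff two_ne_zero, hNormTan_sq, hNorm_half_sq]
  refine ENNReal.tsum_le_tsum fun k => ENNReal.ofReal_le_ofReal ?_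
  refine mul_le_mul_of_nonneg_left ?_ Γ.L_pos.le
  rw [← mul_assoc]
  exact mul_le_mul_of_nonneg_right
    ((inv_sqrt_mul_sq_le _).trans (abs_le_sqrt_one_add_sq _)) (sq_nonneg _)

lemma hNormTan_lt_top {g : L2Γ Γ ℝ} (hg : hNorm Γ (1 / 2) g < ⊤) :
    hNormTan Γ (-1 / 2) g < ⊤ := (hNormTan_le_hNorm g).trans_lt hg

/-- A bound of the homogeneous `H^{1/2}` seminorm controls `|𝔡_tan g|_{H^{-1/2}}`. -/
lemma hNormTan_sq_le_of_sum_le {g : L2Γ Γ ℝ} {A : ℝ}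
    (h : ∀ S : Finset ℤ, Γ.L * ∑ k ∈ S, |freq Γ k| * ‖fourierCoef Γ g k‖ ^ 2 ≤ A) :
    hNormTan Γ (-1 / 2) g ^ 2 ≤ ENNReal.ofReal A := by
  rw [hNormTan_sq, ENNReal.tsum_eq_iSup_sum]
  refine iSup_le fun S => ?_
  rw [← ENNReal.ofReal_sum_of_nonneg fun k _ => by have := Γ.L_pos; positivity]
  refine ENNReal.ofReal_le_ofReal (le_trans ?_ (h S))
  rw [Finset.mul_sum]
  refine Finset.sum_le_sum fun k _ => mul_le_mul_of_nonneg_left ?_ Γ.L_pos.le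
  rw [← mul_assoc]
  exact mul_le_mul_of_nonneg_right (inv_sqrt_mul_sq_le _) (sq_nonneg _)

/-- Since √(1+k²) ≤ 1 + |k|, Parseval's identity accounts for the 1 and the hypothesis for |k|.
Finite sums are used so that the bound survives limits in L². -/
lemma mem_Hhalf_of_sum_le {g : L2Γ Γ ℝ} {A : ℝ}
    (h : ∀ S : Finset ℤ, Γ.L * ∑ k ∈ S, |freq Γ k| * ‖fourierCoef Γ g k‖ ^ 2 ≤ A) :
    g ∈ Hhalf Γ := by
  rw [mem_Hhalf]
  suffices hNorm Γ (1 / 2) g ^ 2 < ⊤ by simpa [ENNReal.pow_lt_top_iff] using this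
  rw [hNorm_half_sq,
    ENNReal.tsum_eq_iSup_sum]
  refine lt_of_le_of_lt (iSup_le fun S => ?_) (ENNReal.ofReal_lt_top (r := ‖g‖ ^ 2 + A))
  rw [← ENNReal.ofReal_sum_of_nonneg fun k _ => by have := Γ.L_pos; positivity]
  refine ENNReal.ofReal_le_ofReal ?_
  have h1 := sum_le_hasSum S (fun k _ => mul_nonneg Γ.L_pos.le (sq_nonneg _))
    (hasSum_fourierCoef_sq g)
  refine le_trans ?_ (add_le_add h1 (h S))
  rw [Finset.mul_sum, ← Finset.sum_add_distrib]
  refine Finset.sum_le_sum fun k _ => ?_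
  rw [← mul_add, ← one_add_mul]
  refine mul_le_mul_of_nonneg_left (mul_le_mul_of_nonneg_right ?_ (sq_nonneg _)) Γ.L_pos.le
  refine Real.sqrt_le_iff.2 ⟨by positivity, ?_⟩
  nlinarith [abs_nonneg (freq Γ k), sq_abs (freq Γ k)]

/-- This is the spectral gap of the circle: all nonzero frequencies have modulus at least 2π/L. It
lets lower-order terms be absorbed once the zero mode is set aside. -/
lemma exists_one_le_freq (Γ : JordanCurve) : ∃ C, 0 < C ∧ ∀ k : ℤ, k ≠ 0 → 1 ≤ C * |freq Γ k| := by
  have hL := Γ.L_pos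
  refine ⟨Γ.L, hL, fun k hk => ?_⟩
  have h1 : (1 : ℝ) ≤ |(k : ℝ)| := by exact_mod_cast Int.one_le_abs hk
  rw [freq, abs_div, abs_mul, abs_of_pos hL, abs_of_pos (by positivity : 0 < 2 * Real.pi),
    mul_div_cancel₀ _ hL.ne']
  nlinarith [Real.pi_gt_three]

/-- At frequency zero both sides vanish, and elsewhere the spectral gap gives √(1+k²) ≤ (C+1)|k|.
Together with `inv_sqrt_mul_sq_le` this identifies |𝔡_tan g|_{H^{-1/2}} with the homogeneous H^{1/2}
seminorm. -/
lemma exists_abs_freq_le (Γ : JordanCurve) : ∃ C, 0 < C ∧ ∀ k : ℤ,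
    |freq Γ k| ≤ C * ((Real.sqrt (1 + freq Γ k ^ 2))⁻¹ * freq Γ k ^ 2) := by
  obtain ⟨C, hC, h⟩ := exists_one_le_freq Γ
  refine ⟨C + 1, by positivity, fun k => ?_⟩
  by_cases hk : k = 0
  · simp [hk, freq]
  have h1 := h k hk
  have hs : 0 < Real.sqrt (1 + freq Γ k ^ 2) := Real.sqrt_pos.2 (by positivity)
  rw [← mul_assoc, mul_comm (C + 1), mul_assoc, ← div_eq_inv_mul, le_div_iff₀ hs]
  have h2 : Real.sqrt (1 + freq Γ k ^ 2) ≤ (C + 1) * |freq Γ k| := by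
    refine Real.sqrt_le_iff.2 ⟨by positivity, ?_⟩
    nlinarith [abs_nonneg (freq Γ k), sq_abs (freq Γ k), mul_self_nonneg (C * |freq Γ k| - 1)]
  calc |freq Γ k| * Real.sqrt (1 + freq Γ k ^ 2) ≤ |freq Γ k| * ((C + 1) * |freq Γ k|) :=
        mul_le_mul_of_nonneg_left h2 (abs_nonneg _)
    _ = (C + 1) * freq Γ k ^ 2 := by rw [← sq_abs]; ring

end WaveStructure
end

noncomputable section
namespace WaveStructure

/-! ### Traces belong to `H^{1/2}` -/

lemma intervalIntegral_swap_of_continuous {E : Type*} [NormedAddCommGroup E] [NormedSpace ℝ E]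
    {f : ℝ × ℝ → E} (hf : Continuous f) (a b : ℝ) :
    ∫ s in (0 : ℝ)..a, ∫ r in (0 : ℝ)..b, f (s, r) =
      ∫ r in (0 : ℝ)..b, ∫ s in (0 : ℝ)..a, f (s, r) := by
  refine intervalIntegral_intervalIntegral_swap (F := fun s r => f (s, r)) ?_
  exact (hf.continuousOn.integrableOn_compact (isCompact_uIcc.prod isCompact_uIcc)).mono_set
    (prod_mono uIoc_subset_uIcc uIoc_subset_uIcc)

/-- A boundary value is controlled by weighted integrals of a function and its derivative. -/
lemma norm_sq_le_integral {c d : ℝ → ℂ} {δ : ℝ} (hδ : 0 < δ) (hd : Continuous d)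
    (hc : ∀ ρ, HasDerivAt c (d ρ) ρ) :
    ‖c 0‖ ^ 2 ≤ ∫ ρ in (0 : ℝ)..δ, (δ⁻¹ * ‖c ρ‖ ^ 2 + 2 * (‖c ρ‖ * ‖d ρ‖)) := by
  have hcc : Continuous c := continuous_iff_continuousAt.2 fun ρ => (hc ρ).continuousAt
  -- F is the derivative of (1 - ρ/δ)‖c(ρ)‖², which is ‖c(0)‖² at ρ = 0 and vanishes at ρ = δ.
  let F : ℝ → ℝ := fun ρ => -δ⁻¹ * ‖c ρ‖ ^ 2 + (1 - δ⁻¹ * ρ) * (2 * inner ℝ (c ρ) (d ρ))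
  have hF : Continuous F := by
    have : Continuous fun ρ => inner ℝ (c ρ) (d ρ) := hcc.inner hd
    fun_prop
  have hD : ∀ ρ ∈ uIcc 0 δ, HasDerivAt (fun ρ => (1 - δ⁻¹ * ρ) * ‖c ρ‖ ^ 2) (F ρ) ρ := fun ρ _ => by
    have h1 := ((hasDerivAt_id ρ).const_mul δ⁻¹).const_sub 1
    have h2 := h1.fun_mul (hc ρ).norm_sq
    simpa [F] using h2
  have hint := intervalIntegral.integral_eq_sub_of_hasDerivAt hD (hF.intervalIntegrable _ _)
  have h0 : ‖c 0‖ ^ 2 = ∫ ρ in (0 : ℝ)..δ, -F ρ := by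
    rw [intervalIntegral.integral_neg, hint]
    simp [hδ.ne']
  rw [h0]
  refine intervalIntegral.integral_mono_on hδ.le (hF.neg.intervalIntegrable _ _)
    (Continuous.intervalIntegrable (by fun_prop) _ _) fun ρ hρ => ?_
  have h1 := abs_real_inner_le_norm (c ρ) (d ρ)
  have h3 : 0 ≤ δ⁻¹ * ρ := mul_nonneg (inv_pos.2 hδ).le hρ.1
  have h4 : δ⁻¹ * ρ ≤ 1 := by rw [inv_mul_le_iff₀ hδ]; linarith [hρ.2]
  have h5 : -((1 - δ⁻¹ * ρ) * inner ℝ (c ρ) (d ρ)) ≤ ‖c ρ‖ * ‖d ρ‖ := by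
    calc -((1 - δ⁻¹ * ρ) * inner ℝ (c ρ) (d ρ)) = (1 - δ⁻¹ * ρ) * -inner ℝ (c ρ) (d ρ) := by ring
      _ ≤ (1 - δ⁻¹ * ρ) * (‖c ρ‖ * ‖d ρ‖) :=
        mul_le_mul_of_nonneg_left ((neg_le_abs _).trans h1) (by linarith)
      _ ≤ 1 * (‖c ρ‖ * ‖d ρ‖) := mul_le_mul_of_nonneg_right (by linarith) (by positivity)
      _ = _ := one_mul _
  simp only [F]
  linarith

/-! ### The homogeneous trace estimate on a flat strip. -/

section Flat

variable {Γ : JordanCurve} {G Gs Gr : ℝ × ℝ → ℝ}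

lemma memLp_slice (hG : Continuous G) (ρ : ℝ) :
    MemLp (fun s => ((G (s, ρ) : ℝ) : ℂ)) 2 (volume.restrict (Ioc 0 Γ.L)) :=
  memLp_Ioc (by fun_prop) 0 Γ.L

lemma continuous_fcoef_slice (hG : Continuous G) (k : ℤ) :
    Continuous fun ρ => fcoef Γ (fun s => ((G (s, ρ) : ℝ) : ℂ)) k := by
  refine continuous_const.mul
    (intervalIntegral.continuous_parametric_intervalIntegral_of_continuous' ?_ _ _)
  simp only [Function.uncurry_def]
  fun_prop

/-- Instead of differentiating under the integral, G is written as its value at 0 plus the integral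
of its derivative; Fubini then exhibits the coefficient as a primitive of a continuous function. -/
lemma hasDerivAt_fcoef_slice (hG : Continuous G) (hGr : Continuous Gr)
    (hr : ∀ s ρ, HasDerivAt (fun ρ => G (s, ρ)) (Gr (s, ρ)) ρ) (k : ℤ) (ρ : ℝ) :
    HasDerivAt (fun ρ => fcoef Γ (fun s => ((G (s, ρ) : ℝ) : ℂ)) k)
      (fcoef Γ (fun s => ((Gr (s, ρ) : ℝ) : ℂ)) k) ρ := by
  have key : ∀ ρ, fcoef Γ (fun s => ((G (s, ρ) : ℝ) : ℂ)) k =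
      fcoef Γ (fun s => ((G (s, 0) : ℝ) : ℂ)) k +
        ∫ τ in (0 : ℝ)..ρ, fcoef Γ (fun s => ((Gr (s, τ) : ℝ) : ℂ)) k := by
    intro ρ
    have hE := continuous_expFactor (Γ := Γ) k
    have e1 : ∀ s, ((G (s, ρ) : ℝ) : ℂ) = ((G (s, 0) : ℝ) : ℂ) + ((∫ τ in (0 : ℝ)..ρ, Gr (s, τ) : ℝ) : ℂ) := by
      intro s
      rw [intervalIntegral.integral_eq_sub_of_hasDerivAt (fun τ _ => hr s τ)
        (Continuous.intervalIntegrable (by fun_prop) _ _)]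
      push_cast
      ring
    have hI : Continuous fun s => ∫ τ in (0 : ℝ)..ρ, Gr (s, τ) :=
      intervalIntegral.continuous_parametric_intervalIntegral_of_continuous'
        (f := fun s τ => Gr (s, τ)) (by simpa [Function.uncurry_def] using hGr) _ _
    simp only [e1]
    rw [fcoef_add (memLp_slice hG 0) (memLp_Ioc (by fun_prop) 0 Γ.L)]
    congr 1
    simp only [fcoef]
    rw [intervalIntegral.integral_const_mul]
    congr 1
    rw [← intervalIntegral_swap_of_continuous (f := fun p : ℝ × ℝ => ((Gr (p.1, p.2) : ℝ) : ℂ) *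
      Complex.exp (-(Complex.I * (freq Γ k : ℂ) * (p.1 : ℂ)))) (by fun_prop)]
    refine intervalIntegral.integral_congr fun s _ => ?_
    simp only
    rw [intervalIntegral.integral_mul_const, intervalIntegral.integral_ofReal]
  have hd := intervalIntegral.integral_hasDerivAt_right
    ((continuous_fcoef_slice (Γ := Γ) hGr k).intervalIntegrable 0 ρ)
    ((continuous_fcoef_slice hGr k).stronglyMeasurableAtFilter _ _)
    (continuous_fcoef_slice hGr k).continuousAt
  refine (hd.const_add (fcoef Γ (fun s => ((G (s, 0) : ℝ) : ℂ)) k)).congr_of_eventuallyEq ?_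
  exact Eventually.of_forall key

lemma fcoef_deriv {f f' : ℝ → ℝ} (hf : ∀ s, HasDerivAt f (f' s) s) (hf' : Continuous f')
    (hper : f Γ.L = f 0) (k : ℤ) : fcoef Γ (fun s => ((f' s : ℝ) : ℂ)) k =
      Complex.I * (freq Γ k : ℂ) * fcoef Γ (fun s => ((f s : ℝ) : ℂ)) k := by
  let E : ℝ → ℂ := fun s => Complex.exp (-(Complex.I * (freq Γ k : ℂ) * (s : ℂ)))
  have hE : ∀ s, HasDerivAt E (-(Complex.I * (freq Γ k : ℂ)) * E s) s := fun s => by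
    have h1 : HasDerivAt (fun s : ℝ => -(Complex.I * (freq Γ k : ℂ) * (s : ℂ)))
        (-(Complex.I * (freq Γ k : ℂ))) s := by
      simpa using ((hasDerivAt_id s).ofReal_comp.const_mul (Complex.I * (freq Γ k : ℂ))).fun_neg
    refine h1.cexp.congr_deriv ?_
    simp only [E]
    ring
  have hfc : Continuous f := continuous_iff_continuousAt.2 fun ρ => (hf ρ).continuousAt
  have hEc : Continuous E := continuous_expFactor k
  have hEL : E Γ.L = E 0 := by
    have hL : (Γ.L : ℂ) ≠ 0 := by exact_mod_cast Γ.L_pos.ne'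
    simp only [E, freq]
    rw [show -(Complex.I * ((2 * Real.pi * k / Γ.L : ℝ) : ℂ) * (Γ.L : ℂ)) =
      ((-k : ℤ) : ℂ) * (2 * Real.pi * Complex.I) by push_cast; field_simp,
      Complex.exp_int_mul_two_pi_mul_I]
    simp
  have h := intervalIntegral.integral_eq_sub_of_hasDerivAt (a := 0) (b := Γ.L)
    (fun s _ => ((hf s).ofReal_comp).fun_mul (hE s))
    (Continuous.intervalIntegrable (by fun_prop) _ _)
  rw [intervalIntegral.integral_add (Continuous.intervalIntegrable (by fun_prop) _ _)
    (Continuous.intervalIntegrable (by fun_prop) _ _), hEL, hper, sub_self] at h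
  have h2 : ∫ s in (0 : ℝ)..Γ.L, ((f s : ℝ) : ℂ) * (-(Complex.I * (freq Γ k : ℂ)) * E s) =
      -(Complex.I * (freq Γ k : ℂ)) * ∫ s in (0 : ℝ)..Γ.L, ((f s : ℝ) : ℂ) * E s := by
    rw [← intervalIntegral.integral_const_mul]
    exact intervalIntegral.integral_congr fun s _ => by ring
  rw [h2] at h
  simp only [fcoef]
  change _ * ∫ s in (0 : ℝ)..Γ.L, ((f' s : ℝ) : ℂ) * E s = _ * (_ * ∫ s in (0 : ℝ)..Γ.L, ((f s : ℝ) : ℂ) * E s)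
  linear_combination (1 / (Γ.L : ℂ)) * h

/-- The `H^{1/2}` seminorm of the boundary values of a function on a strip. -/
theorem sum_freq_fcoef_le {δ C : ℝ} (hδ : 0 < δ) (hC : ∀ k : ℤ, k ≠ 0 → 1 ≤ C * |freq Γ k|)
    (hC0 : 0 < C) (hG : Continuous G) (hGs : Continuous Gs) (hGr : Continuous Gr)
    (hs : ∀ s ρ, HasDerivAt (fun s => G (s, ρ)) (Gs (s, ρ)) s)
    (hr : ∀ s ρ, HasDerivAt (fun ρ => G (s, ρ)) (Gr (s, ρ)) ρ)
    (hper : ∀ ρ, G (Γ.L, ρ) = G (0, ρ)) (S : Finset ℤ) :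
    Γ.L * ∑ k ∈ S, |freq Γ k| * ‖fcoef Γ (fun s => ((G (s, 0) : ℝ) : ℂ)) k‖ ^ 2 ≤
      ∫ p in Γ.strip δ, ((C / δ + 1) * Gs p ^ 2 + Gr p ^ 2) := by
  let c : ℤ → ℝ → ℂ := fun k ρ => fcoef Γ (fun s => ((G (s, ρ) : ℝ) : ℂ)) k
  let e : ℤ → ℝ → ℂ := fun k ρ => fcoef Γ (fun s => ((Gs (s, ρ) : ℝ) : ℂ)) k
  let d : ℤ → ℝ → ℂ := fun k ρ => fcoef Γ (fun s => ((Gr (s, ρ) : ℝ) : ℂ)) k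
  have hcc : ∀ k, Continuous (c k) := continuous_fcoef_slice hG
  have hec : ∀ k, Continuous (e k) := continuous_fcoef_slice hGs
  have hdc : ∀ k, Continuous (d k) := continuous_fcoef_slice hGr
  have hce : ∀ k ρ, ‖e k ρ‖ = |freq Γ k| * ‖c k ρ‖ := fun k ρ => by
    simp only [e, c]
    rw [fcoef_deriv (fun s => hs s ρ) (by fun_prop) (hper ρ)]
    simp
  -- The boundary bound is multiplied by |k|. The product 2|k|‖c‖‖d‖ is split by Young into |k|²‖c‖²
  -- + ‖d‖², and |k|‖c‖ is the coefficient of the tangential derivative; the lower-order term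
  -- |k|‖c‖²/δ is absorbed by the spectral gap. The zero mode contributes nothing, which is why the
  -- gradient alone suffices.
  have h1 : ∀ k, |freq Γ k| * ‖c k 0‖ ^ 2 ≤
      ∫ ρ in (0 : ℝ)..δ, ((C / δ + 1) * ‖e k ρ‖ ^ 2 + ‖d k ρ‖ ^ 2) := by
    intro k
    by_cases hk : k = 0
    · rw [show freq Γ k = 0 by simp [hk, freq], abs_zero, zero_mul]
      exact intervalIntegral.integral_nonneg hδ.le fun ρ _ => by positivity
    · refine (mul_le_mul_of_nonneg_left (norm_sq_le_integral hδ (hdc k)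
        (hasDerivAt_fcoef_slice hG hGr hr k)) (abs_nonneg _)).trans ?_
      rw [← intervalIntegral.integral_const_mul]
      refine intervalIntegral.integral_mono_on hδ.le
        (Continuous.intervalIntegrable (((((hcc k).norm.pow 2).const_mul _).add
          (((hcc k).norm.mul (hdc k).norm).const_mul 2)).const_mul _) _ _)
        (Continuous.intervalIntegrable (by have := hec k; have := hdc k; fun_prop) _ _)
        fun ρ _ => ?_
      rw [hce]
      have h2 := hC k hk
      have h3 : |freq Γ k| * (δ⁻¹ * ‖c k ρ‖ ^ 2) ≤ C / δ * (|freq Γ k| * ‖c k ρ‖) ^ 2 := by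
        have := mul_le_mul_of_nonneg_right h2
          (by positivity : 0 ≤ |freq Γ k| * (δ⁻¹ * ‖c k ρ‖ ^ 2))
        calc _ = 1 * (|freq Γ k| * (δ⁻¹ * ‖c k ρ‖ ^ 2)) := (one_mul _).symm
          _ ≤ _ := this
          _ = _ := by rw [div_eq_mul_inv]; ring
      change |freq Γ k| * (δ⁻¹ * ‖c k ρ‖ ^ 2 + 2 * (‖c k ρ‖ * ‖d k ρ‖)) ≤ _
      nlinarith [sq_nonneg (|freq Γ k| * ‖c k ρ‖ - ‖d k ρ‖)]
  have hL := Γ.L_pos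
  have hsum : ∀ {H : ℝ × ℝ → ℝ}, Continuous H → ∀ ρ,
      Γ.L * ∑ k ∈ S, ‖fcoef Γ (fun s => ((H (s, ρ) : ℝ) : ℂ)) k‖ ^ 2 ≤
        ∫ s in (0 : ℝ)..Γ.L, H (s, ρ) ^ 2 := fun hH ρ => by
    refine (sum_fcoef_sq_le (memLp_slice hH ρ) S).trans_eq ?_
    rw [intervalIntegral.integral_of_le hL.le]
    simp
  -- Bessel's inequality is applied on each slice ρ = const; since S is finite, no interchange of an
  -- infinite sum with the integral is needed.
  calc Γ.L * ∑ k ∈ S, |freq Γ k| * ‖c k 0‖ ^ 2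
      ≤ Γ.L * ∑ k ∈ S, ∫ ρ in (0 : ℝ)..δ, ((C / δ + 1) * ‖e k ρ‖ ^ 2 + ‖d k ρ‖ ^ 2) :=
        mul_le_mul_of_nonneg_left (Finset.sum_le_sum fun k _ => h1 k) hL.le
    _ = ∫ ρ in (0 : ℝ)..δ, ((C / δ + 1) * (Γ.L * ∑ k ∈ S, ‖e k ρ‖ ^ 2) +
          Γ.L * ∑ k ∈ S, ‖d k ρ‖ ^ 2) := by
        rw [← intervalIntegral.integral_finsetSum fun k _ =>
          Continuous.intervalIntegrable (by have := hec k; have := hdc k; fun_prop) _ _,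
          ← intervalIntegral.integral_const_mul]
        refine intervalIntegral.integral_congr fun ρ _ => ?_
        simp only [Finset.sum_add_distrib, ← Finset.mul_sum]
        ring
    _ ≤ ∫ ρ in (0 : ℝ)..δ, ∫ s in (0 : ℝ)..Γ.L, ((C / δ + 1) * Gs (s, ρ) ^ 2 + Gr (s, ρ) ^ 2) := by
        refine intervalIntegral.integral_mono_on hδ.le
          (Continuous.intervalIntegrable (by fun_prop) _ _)
          (Continuous.intervalIntegrable
            (intervalIntegral.continuous_parametric_intervalIntegral_of_continuous'
              (f := fun ρ s => (C / δ + 1) * Gs (s, ρ) ^ 2 + Gr (s, ρ) ^ 2)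
              (by simp only [Function.uncurry_def]; fun_prop) _ _) _ _) fun ρ _ => ?_
        rw [intervalIntegral.integral_add (Continuous.intervalIntegrable (by fun_prop) _ _)
          (Continuous.intervalIntegrable (by fun_prop) _ _), intervalIntegral.integral_const_mul]
        exact add_le_add (mul_le_mul_of_nonneg_left (hsum hGs ρ) (by positivity)) (hsum hGr ρ)
    _ = _ := by
        rw [JordanCurve.integral_strip_eq hδ.le (by fun_prop),
          ← intervalIntegral_swap_of_continuous
            (f := fun p => (C / δ + 1) * Gs p ^ 2 + Gr p ^ 2) (by fun_prop),
          intervalIntegral.integral_of_le hL.le]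

end Flat

namespace JordanCurve

variable {Γ : JordanCurve}

/-- The trace of an `H¹` function is in `H^{1/2}`, with a bound by the gradient. -/
theorem IsSide.exists_trace_half {δ σ : ℝ} {Ω : Set Plane} (h : Γ.IsSide δ σ Ω) :
    ∃ C, 0 < C ∧ ∀ x ∈ traceSpace Γ Ω ℝ, ∀ S : Finset ℤ,
      Γ.L * ∑ k ∈ S, |freq Γ k| * ‖fourierCoef Γ x.2.2 k‖ ^ 2 ≤ C * ∑ j, ‖x.2.1 j‖ ^ 2 := by
  have hδ0 := h.radius.pos
  obtain ⟨C₁, hC₁, hf⟩ := exists_one_le_freq Γ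
  -- The 2 comes from the lower bound 1/2 of the Jacobian in the change of variables, the 4 from the
  -- square of its upper bound in the s-derivative, and C₁/δ + 1 from the strip estimate.
  refine ⟨2 * (4 * (C₁ / δ + 1)), by positivity, fun x hx S => ?_⟩
  refine traceSpace_induction (P := fun x : Triple Γ Ω ℝ =>
    Γ.L * ∑ k ∈ S, |freq Γ k| * ‖fourierCoef Γ x.2.2 k‖ ^ 2 ≤
      2 * (4 * (C₁ / δ + 1)) * ∑ j, ‖x.2.1 j‖ ^ 2) ?_ (fun φ => ?_) hx
  · simp only [← fourierCoefL_apply]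
    exact isClosed_le (by fun_prop) (by fun_prop)
  have hct : Continuous fun p : ℝ × ℝ => Γ.tube (p.1, σ * p.2) :=
    Γ.contDiff_tube.continuous.comp (by fun_prop)
  have hφ' : Continuous (fderiv ℝ φ.1) := φ.2.1.continuous_fderiv (by simp)
  let G : ℝ × ℝ → ℝ := fun p => φ.1 (Γ.tube (p.1, σ * p.2))
  let Gt : ℝ × ℝ → ℝ := fun p => fderiv ℝ φ.1 (Γ.tube (p.1, σ * p.2)) (Γ.tang p.1)
  let Gn : ℝ × ℝ → ℝ := fun p => fderiv ℝ φ.1 (Γ.tube (p.1, σ * p.2)) (Γ.normal p.1)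
  have hG : Continuous G := (testFun.continuous φ).comp hct
  have hGt : Continuous Gt :=
    (hφ'.comp hct).clm_apply (Γ.contDiff_tang.continuous.comp continuous_fst)
  have hGn : Continuous Gn :=
    (hφ'.comp hct).clm_apply (Γ.contDiff_normal.continuous.comp continuous_fst)
  have hj : Continuous fun p : ℝ × ℝ => Γ.jac (p.1, σ * p.2) :=
    Γ.contDiff_jac.continuous.comp (by fun_prop)
  have key := sum_freq_fcoef_le (Γ := Γ) (G := G) (Gs := fun p => Γ.jac (p.1, σ * p.2) * Gt p)
    (Gr := fun p => σ * Gn p) hδ0 hf hC₁ hG (hj.mul hGt) (by fun_prop)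
    (fun s ρ => Γ.hasDerivAt_comp_tube_left (testFun.differentiable φ) s (σ * ρ))
    (fun s ρ => by
      have h1 := (Γ.hasDerivAt_comp_tube_right (testFun.differentiable φ) s (σ * ρ)).comp ρ
        ((hasDerivAt_id ρ).const_mul σ)
      refine h1.congr_deriv ?_
      simp only [Gn]
      ring)
    (fun ρ => by
      have := Γ.tube_add_period 0 (σ * ρ)
      simp only [zero_add] at this
      simp only [G, this]) S
  have e1 : ∀ k, fourierCoef Γ (testTriple Γ Ω φ).2.2 k =
      fcoef Γ (fun s => ((G (s, 0) : ℝ) : ℂ)) k := fun k => by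
    rw [fourierCoef_eq_fcoef]
    refine fcoef_congr_ae ?_ k
    filter_upwards [MemLp.coeFn_toLp
      (memLp_Ioc ((testFun.continuous φ).comp Γ.continuous_γ) 0 Γ.L)] with s hs
    have : (testTriple Γ Ω φ).2.2 s = φ.1 (Γ.γ s) := hs
    rw [this]
    simp [G, tube_zero]
  simp only [e1]
  refine key.trans ?_
  have e2 : ∑ j, ‖(testTriple Γ Ω φ).2.1 j‖ ^ 2 = ∫ x in Ω, ∑ j, pderiv j φ.1 x ^ 2 := by
    simp only [norm_testTriple_grad]
    exact (integral_finsetSum _ fun j _ => testFun.integrable_sq (testFun.continuous_pderiv φ j)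
      (hasCompactSupport_pderiv φ.2.2) Ω).symm
  rw [e2, mul_assoc, mul_left_comm]
  have e3 := h.integral_strip_le (continuous_gradSq φ)
      (fun x => Finset.sum_nonneg fun j _ => sq_nonneg _) (integrableOn_gradSq φ Ω)
  have e4 : 0 < 4 * (C₁ / δ + 1) := by positivity
  refine le_trans ?_ (mul_le_mul_of_nonneg_left e3 e4.le)
  rw [← integral_const_mul]
  refine setIntegral_mono_on (integrableOn_strip (Continuous.continuousOn (by fun_prop)))
      (integrableOn_strip (((continuous_gradSq φ).comp hct).const_mul _).continuousOn)
      (Γ.measurableSet_strip δ) fun p hp => ?_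
  rw [Γ.sum_pderiv_sq φ.1 _ p.1]
  change (C₁ / δ + 1) * (Γ.jac (p.1, σ * p.2) * Gt p) ^ 2 + (σ * Gn p) ^ 2 ≤
    4 * (C₁ / δ + 1) * (Gt p ^ 2 + Gn p ^ 2)
  have hp2 : |σ * p.2| < δ := h.abs_lt hp
  have j1 := h.radius.jac_lower (p := (p.1, σ * p.2)) hp2
  have j2 := h.radius.jac_upper (p := (p.1, σ * p.2)) hp2
  have j3 : Γ.jac (p.1, σ * p.2) ^ 2 ≤ 4 := by nlinarith
  have j4 : 1 ≤ C₁ / δ + 1 := by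
    have : 0 < C₁ / δ := by positivity
    linarith
  have j5 : (Γ.jac (p.1, σ * p.2) * Gt p) ^ 2 ≤ 4 * Gt p ^ 2 := by
    rw [mul_pow]
    exact mul_le_mul_of_nonneg_right j3 (sq_nonneg _)
  have j6 : (σ * Gn p) ^ 2 = Gn p ^ 2 := by rw [mul_pow, h.sq, one_mul]
  rw [j6]
  nlinarith [mul_le_mul_of_nonneg_left j5 (by linarith : 0 ≤ C₁ / δ + 1),
    mul_le_mul_of_nonneg_right j4 (sq_nonneg (Gn p)), sq_nonneg (Gn p)]

/-- The bound of the trace of `exists_trace_half` in terms of the norms of `H^{1/2}`. -/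
theorem IsSide.exists_trace_hNorm {δ σ : ℝ} {Ω : Set Plane} (h : Γ.IsSide δ σ Ω) :
    ∃ C, 0 < C ∧ ∀ x ∈ traceSpace Γ Ω ℝ, x.2.2 ∈ Hhalf Γ ∧
      (hNormTan Γ (-1 / 2) x.2.2).toReal ^ 2 ≤ C * ∑ j, ‖x.2.1 j‖ ^ 2 := by
  obtain ⟨C, hC, hb⟩ := h.exists_trace_half
  refine ⟨C, hC, fun x hx => ⟨mem_Hhalf_of_sum_le (hb x hx), ?_⟩⟩
  rw [← ENNReal.toReal_pow]
  exact ENNReal.toReal_le_of_le_ofReal (by positivity) (hNormTan_sq_le_of_sum_le (hb x hx))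

end JordanCurve

end WaveStructure
end

noncomputable section
namespace WaveStructure

/-! ### Extension of functions in `H^{1/2}` -/

variable {Γ : JordanCurve}

/-- The harmonic function on the half plane `r < 0` of frequency `k`. -/
def mode (Γ : JordanCurve) (k : ℤ) (p : ℝ × ℝ) : ℂ :=
  Complex.exp (Complex.I * (freq Γ k : ℂ) * (p.1 : ℂ) + ((|freq Γ k| * p.2 : ℝ) : ℂ))

lemma contDiff_mode (k : ℤ) : ContDiff ℝ ∞ (mode Γ k) := by
  have h1 : ContDiff ℝ ∞ fun p : ℝ × ℝ => (p.1 : ℂ) := Complex.ofRealCLM.contDiff.comp contDiff_fst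
  have h2 : ContDiff ℝ ∞ fun p : ℝ × ℝ => ((|freq Γ k| * p.2 : ℝ) : ℂ) :=
    Complex.ofRealCLM.contDiff.comp (contDiff_const.mul contDiff_snd)
  exact ((contDiff_const.mul h1).add h2).cexp

lemma continuous_mode (k : ℤ) : Continuous (mode Γ k) := (contDiff_mode k).continuous

lemma hasDerivAt_mode_left (k : ℤ) (s r : ℝ) :
    HasDerivAt (fun s => mode Γ k (s, r)) (Complex.I * (freq Γ k : ℂ) * mode Γ k (s, r)) s := by
  have h1 : HasDerivAt (fun s : ℝ => Complex.I * (freq Γ k : ℂ) * (s : ℂ) +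
      ((|freq Γ k| * r : ℝ) : ℂ)) (Complex.I * (freq Γ k : ℂ)) s := by
    simpa using ((hasDerivAt_id s).ofReal_comp.const_mul (Complex.I * (freq Γ k : ℂ))).add_const
      (((|freq Γ k| * r : ℝ) : ℂ))
  exact h1.cexp.congr_deriv (by rw [mode]; ring)

lemma hasDerivAt_mode_right (k : ℤ) (s r : ℝ) :
    HasDerivAt (fun r => mode Γ k (s, r)) ((|freq Γ k| : ℝ) * mode Γ k (s, r)) r := by
  have h1 : HasDerivAt (fun r : ℝ => Complex.I * (freq Γ k : ℂ) * (s : ℂ) +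
      ((|freq Γ k| * r : ℝ) : ℂ)) ((|freq Γ k| : ℝ) : ℂ) r := by
    simpa using (((hasDerivAt_id r).const_mul |freq Γ k|).ofReal_comp).const_add
      (Complex.I * (freq Γ k : ℂ) * (s : ℂ))
  exact h1.cexp.congr_deriv (by rw [mode]; ring)

lemma mode_add_period (k : ℤ) (s r : ℝ) : mode Γ k (s + Γ.L, r) = mode Γ k (s, r) := by
  have hL : (Γ.L : ℂ) ≠ 0 := by exact_mod_cast Γ.L_pos.ne'
  have e : Complex.I * (freq Γ k : ℂ) * (Γ.L : ℂ) = (k : ℂ) * (2 * Real.pi * Complex.I) := by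
    simp only [freq]
    push_cast
    field_simp
  simp only [mode]
  rw [show Complex.I * (freq Γ k : ℂ) * ((s + Γ.L : ℝ) : ℂ) + ((|freq Γ k| * r : ℝ) : ℂ) =
    (Complex.I * (freq Γ k : ℂ) * (s : ℂ) + ((|freq Γ k| * r : ℝ) : ℂ)) +
      Complex.I * (freq Γ k : ℂ) * (Γ.L : ℂ) by push_cast; ring, e, Complex.exp_add,
    Complex.exp_int_mul_two_pi_mul_I, mul_one]

lemma fcoef_mode (k m : ℤ) (r : ℝ) : fcoef Γ (fun s => mode Γ k (s, r)) m =
    if k = m then ((Real.exp (|freq Γ k| * r) : ℝ) : ℂ) else 0 := by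
  have hL : (Γ.L : ℂ) ≠ 0 := by exact_mod_cast Γ.L_pos.ne'
  have e1 : ∀ s : ℝ, mode Γ k (s, r) * Complex.exp (-(Complex.I * (freq Γ m : ℂ) * (s : ℂ))) =
      ((Real.exp (|freq Γ k| * r) : ℝ) : ℂ) *
        Complex.exp ((Complex.I * (freq Γ (k - m) : ℂ)) * (s : ℂ)) := fun s => by
    rw [mode, ← Complex.exp_add, Complex.ofReal_exp, ← Complex.exp_add]
    congr 1
    simp only [freq]
    push_cast
    ring
  simp only [fcoef, e1]
  rw [intervalIntegral.integral_const_mul]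
  by_cases h : k = m
  · rw [if_pos h, h, sub_self]
    simp only [freq, Int.cast_zero, mul_zero, zero_div, Complex.ofReal_zero, zero_mul, Complex.exp_zero,
      intervalIntegral.integral_const, sub_zero, Complex.real_smul, mul_one]
    field_simp
  · rw [if_neg h]
    have hk : ((k - m : ℤ) : ℂ) ≠ 0 := by exact_mod_cast sub_ne_zero.2 h
    have hpi : (Real.pi : ℂ) ≠ 0 := by exact_mod_cast Real.pi_ne_zero
    have hc : Complex.I * (freq Γ (k - m) : ℂ) ≠ 0 := by
      simp only [freq]
      push_cast at hk ⊢
      exact mul_ne_zero Complex.I_ne_zero (div_ne_zero (mul_ne_zero (mul_ne_zero two_ne_zero hpi) hk) hL)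
    rw [integral_exp_mul_complex hc]
    have e : Complex.I * (freq Γ (k - m) : ℂ) * (Γ.L : ℂ) =
        ((k - m : ℤ) : ℂ) * (2 * Real.pi * Complex.I) := by
      simp only [freq]
      push_cast
      field_simp
    rw [e, Complex.exp_int_mul_two_pi_mul_I]
    simp

lemma fcoef_sum {ι : Type*} (S : Finset ι) (a : ι → ℂ) {f : ι → ℝ → ℂ} (hf : ∀ i, Continuous (f i))
    (m : ℤ) : fcoef Γ (fun s => ∑ i ∈ S, a i * f i s) m = ∑ i ∈ S, a i * fcoef Γ (f i) m := by
  classical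
  induction S using Finset.induction_on with
  | empty => simp [fcoef]
  | insert i S hi ih =>
    simp only [Finset.sum_insert hi]
    rw [fcoef_add (memLp_Ioc (by fun_prop) 0 Γ.L)
      (memLp_Ioc (continuous_finsetSum _ fun i _ => by fun_prop) 0 Γ.L), ih, fcoef_const_mul]

/-- Parseval's identity for a sum of modes. -/
lemma integral_norm_sq_sum_mode (S : Finset ℤ) (a : ℤ → ℂ) (r : ℝ) :
    ∫ s in (0 : ℝ)..Γ.L, ‖∑ k ∈ S, a k * mode Γ k (s, r)‖ ^ 2 =
      Γ.L * ∑ k ∈ S, ‖a k‖ ^ 2 * Real.exp (|freq Γ k| * r) ^ 2 := by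
  have hc : ∀ k, Continuous fun s => mode Γ k (s, r) := fun k =>
    (continuous_mode k).comp (by fun_prop)
  have h := hasSum_fcoef_sq (Γ := Γ) (f := fun s => ∑ k ∈ S, a k * mode Γ k (s, r))
    (memLp_Ioc (continuous_finsetSum _ fun k _ => (hc k).const_mul _) 0 Γ.L)
  rw [intervalIntegral.integral_of_le Γ.L_pos.le]
  refine h.unique ?_
  rw [Finset.mul_sum]
  have e : ∀ m, fcoef Γ (fun s => ∑ k ∈ S, a k * mode Γ k (s, r)) m =
      if m ∈ S then a m * ((Real.exp (|freq Γ m| * r) : ℝ) : ℂ) else 0 := fun m => by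
    rw [fcoef_sum S a hc]
    simp only [fcoef_mode, mul_ite, mul_zero, Finset.sum_ite_eq']
  have h2 : HasSum (fun m => Γ.L * ‖fcoef Γ (fun s => ∑ k ∈ S, a k * mode Γ k (s, r)) m‖ ^ 2)
      (∑ m ∈ S, Γ.L * ‖fcoef Γ (fun s => ∑ k ∈ S, a k * mode Γ k (s, r)) m‖ ^ 2) :=
    hasSum_sum_of_ne_finset_zero fun m hm => by simp [e, hm]
  convert h2 using 1
  refine Finset.sum_congr rfl fun m hm => ?_
  rw [e, if_pos hm, norm_mul, Complex.norm_real, Real.norm_eq_abs, abs_of_pos (Real.exp_pos _),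
    mul_pow]

/-- The decay of a mode gains one power of the frequency. It turns the |k|² of the Dirichlet
integral into the |k| of the H^{1/2} seminorm. -/
lemma integral_exp_neg_sq_le {a δ : ℝ} (ha : 0 < a) :
    ∫ ρ in (0 : ℝ)..δ, Real.exp (a * (-1 * ρ)) ^ 2 ≤ (2 * a)⁻¹ := by
  have hd : ∀ ρ ∈ uIcc 0 δ, HasDerivAt (fun ρ => -(2 * a)⁻¹ * Real.exp (a * (-1 * ρ)) ^ 2)
      (Real.exp (a * (-1 * ρ)) ^ 2) ρ := fun ρ _ => by
    have h1 : HasDerivAt (fun ρ => a * (-1 * ρ)) (a * -1) ρ := by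
      simpa using ((hasDerivAt_id ρ).const_mul (-1)).const_mul a
    refine ((h1.exp.fun_pow 2).const_mul (-(2 * a)⁻¹)).congr_deriv ?_
    field_simp
    simp
  rw [intervalIntegral.integral_eq_sub_of_hasDerivAt hd
    (Continuous.intervalIntegrable (by fun_prop) _ _)]
  have h2 : 0 ≤ (2 * a)⁻¹ * Real.exp (a * (-1 * δ)) ^ 2 := by positivity
  simp only [mul_zero, Real.exp_zero, one_pow, mul_one]
  linarith

namespace JordanCurve

/-- The gradient of a function on the collar in tubular coordinates. -/
lemma IsTubeRadius.sum_pderiv_sq_push_le {δ : ℝ} (hδ : Γ.IsTubeRadius δ) {G Gs Gr : ℝ × ℝ → ℝ}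
    (hG : ∀ s r, HasDerivAt (fun s => G (s, r)) (Gs (s, r)) s)
    (hr : ∀ s r, HasDerivAt (fun r => G (s, r)) (Gr (s, r)) r) {φ : testFun ℝ}
    (hφ : ∀ p : ℝ × ℝ, |p.2| < δ → φ.1 (Γ.tube p) = G p) {p : ℝ × ℝ} (hp : |p.2| < δ) :
    ∑ j, pderiv j φ.1 (Γ.tube p) ^ 2 ≤ 4 * Gs p ^ 2 + Gr p ^ 2 := by
  obtain ⟨s, r⟩ := p
  have e1 : Γ.jac (s, r) * fderiv ℝ φ.1 (Γ.tube (s, r)) (Γ.tang s) = Gs (s, r) := by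
    refine HasDerivAt.unique (Γ.hasDerivAt_comp_tube_left (testFun.differentiable φ) s r) ?_
    exact (hG s r).congr_of_eventuallyEq (Eventually.of_forall fun s' => hφ (s', r) hp)
  have e2 : fderiv ℝ φ.1 (Γ.tube (s, r)) (Γ.normal s) = Gr (s, r) := by
    refine HasDerivAt.unique (Γ.hasDerivAt_comp_tube_right (testFun.differentiable φ) s r) ?_
    refine (hr s r).congr_of_eventuallyEq ?_
    have hopen : IsOpen {r : ℝ | |r| < δ} := isOpen_lt (by fun_prop) continuous_const
    filter_upwards [hopen.mem_nhds hp] with r' hr'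
    exact hφ (s, r') hr'
  rw [Γ.sum_pderiv_sq φ.1 _ s, e2, ← e1]
  have h1 := hδ.jac_lower (s, r) hp
  have h2 : 1 ≤ 4 * Γ.jac (s, r) ^ 2 := by nlinarith
  nlinarith [mul_le_mul_of_nonneg_right h2 (sq_nonneg (fderiv ℝ φ.1 (Γ.tube (s, r)) (Γ.tang s)))]

/-- The Dirichlet integral of a function supported in the collar. -/
lemma IsTubeRadius.integral_sum_pderiv_sq_le {δ : ℝ} (hδ : Γ.IsTubeRadius δ) {G Gs Gr : ℝ × ℝ → ℝ}
    (hG : ∀ s r, HasDerivAt (fun s => G (s, r)) (Gs (s, r)) s)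
    (hr : ∀ s r, HasDerivAt (fun r => G (s, r)) (Gr (s, r)) r)
    (hGs : Continuous Gs) (hGr : Continuous Gr) {φ : testFun ℝ}
    (hφ : ∀ p : ℝ × ℝ, |p.2| < δ → φ.1 (Γ.tube p) = G p)
    (hφ0 : ∀ x ∉ Γ.tube '' {p | |p.2| ≤ δ / 2}, φ.1 x = 0) :
    ∫ x in Γ.int, ∑ j, pderiv j φ.1 x ^ 2 ≤
      2 * ∫ p in Γ.strip δ, (4 * Gs (p.1, -1 * p.2) ^ 2 + Gr (p.1, -1 * p.2) ^ 2) := by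
  have h := hδ.isSide_int
  have hct : Continuous fun p : ℝ × ℝ => Γ.tube (p.1, -1 * p.2) :=
    Γ.contDiff_tube.continuous.comp (by fun_prop)
  have hj : Continuous fun p : ℝ × ℝ => Γ.jac (p.1, -1 * p.2) :=
    Γ.contDiff_jac.continuous.comp (by fun_prop)
  have hz : ∀ x ∈ Γ.int \ Γ.collar δ (-1), ∑ j, pderiv j φ.1 x ^ 2 = 0 := by
    rintro x ⟨hx, hxc⟩
    have hxK : x ∉ Γ.tube '' {p | |p.2| ≤ δ / 2} := by
      rintro ⟨p, hp, rfl⟩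
      exact hxc (h.mem_collar (lt_of_le_of_lt hp (by linarith [hδ.pos])) hx)
    have he : φ.1 =ᶠ[𝓝 x] fun _ => 0 := by
      filter_upwards [(isCompact_tube_image (Γ := Γ) (δ / 2)).isClosed.isOpen_compl.mem_nhds hxK]
        with y hy using hφ0 y hy
    simp [pderiv, he.fderiv_eq]
  rw [setIntegral_eq_of_subset_of_forall_sdiff_eq_zero Γ.isOpen_int.measurableSet
    h.collar_subset hz, h.integral_collar, ← integral_const_mul]
  refine setIntegral_mono_on
    (integrableOn_strip (hj.mul ((continuous_gradSq φ).comp hct)).continuousOn)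
    (integrableOn_strip (Continuous.continuousOn (by fun_prop)))
    (Γ.measurableSet_strip δ) fun p hp => ?_
  have hp2 : |-1 * p.2| < δ := h.abs_lt hp
  have h1 := hδ.sum_pderiv_sq_push_le hG hr hφ (p := (p.1, -1 * p.2)) hp2
  refine mul_le_mul (hδ.jac_upper _ hp2) h1 (Finset.sum_nonneg fun j _ => sq_nonneg _) (by norm_num)

end JordanCurve

/-! ### Decaying Fourier modes as test functions. -/

section Modes

open JordanCurve

variable {δ : ℝ} (hδ : Γ.IsTubeRadius δ)

/-- A mode, cut off away from the curve. -/
def cutMode (c : ℤ → ℂ) (k : ℤ) (p : ℝ × ℝ) : ℝ := cutoff hδ.pos p.2 * (c k * mode Γ k p).re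

lemma isTubeFun_cutMode (c : ℤ → ℂ) (k : ℤ) : Γ.IsTubeFun δ (cutMode hδ c k) where
  periodic r s := by simp only [cutMode, mode_add_period]
  smooth := (((contDiff_cutoff hδ.pos).comp contDiff_snd).mul
    (Complex.reCLM.contDiff.comp (contDiff_const.mul (contDiff_mode k)))).contDiffOn
  zero p hp := by simp only [cutMode, cutoff_zero_of hδ.pos hp, zero_mul]

/-- A mode as a test function. -/
def modeFun (c : ℤ → ℂ) (k : ℤ) : testFun ℝ := ⟨_, hδ.push_mem (isTubeFun_cutMode hδ c k)⟩

lemma sum_modeFun_tube (c : ℤ → ℂ) (S : Finset ℤ) {p : ℝ × ℝ} (hp : |p.2| < δ) :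
    (∑ k ∈ S, modeFun hδ c k).1 (Γ.tube p) =
      cutoff hδ.pos p.2 * (∑ k ∈ S, c k * mode Γ k p).re := by
  rw [Submodule.coe_sum, Finset.sum_apply, Complex.re_sum, Finset.mul_sum]
  exact Finset.sum_congr rfl fun k _ => (isTubeFun_cutMode hδ c k).push_tube hδ hp

lemma sum_modeFun_zero (c : ℤ → ℂ) (S : Finset ℤ) {x : Plane}
    (hx : x ∉ Γ.tube '' {p | |p.2| ≤ δ / 2}) : (∑ k ∈ S, modeFun hδ c k).1 x = 0 := by
  rw [Submodule.coe_sum, Finset.sum_apply]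
  exact Finset.sum_eq_zero fun k _ => hδ.support_push (isTubeFun_cutMode hδ c k) hx

/-- The Dirichlet integral of a sum of modes. -/
theorem exists_sum_mode_bound : ∃ K, 0 < K ∧ ∀ (c : ℤ → ℂ), c 0 = 0 → ∀ S : Finset ℤ,
    ∫ x in Γ.int, ∑ j, pderiv j (∑ k ∈ S, modeFun hδ c k).1 x ^ 2 ≤
      K * (Γ.L * ∑ k ∈ S, |freq Γ k| * ‖c k‖ ^ 2) := by
  have hδ0 := hδ.pos
  obtain ⟨C₁, hC₁, hf⟩ := exists_one_le_freq Γ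
  obtain ⟨M, hM⟩ := (isCompact_Icc (a := -δ) (b := δ)).exists_bound_of_continuousOn
    (contDiff_deriv_cutoff hδ0).continuous.continuousOn
  -- The gradient bound is 4|∂_s|² + |∂_r|², and splitting ∂_r into its mode and cutoff parts
  -- doubles the latter: 6 = 4 + 2. The cutoff part has size M²|c_k|² without a power of k, and the
  -- spectral gap converts it, since the zero mode has been removed.
  refine ⟨6 + 2 * M ^ 2 * C₁ ^ 2, by positivity, fun c hc0 S => ?_⟩
  let A : ℝ × ℝ → ℂ := fun p => ∑ k ∈ S, c k * mode Γ k p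
  let As : ℝ × ℝ → ℂ := fun p => ∑ k ∈ S, (c k * (Complex.I * (freq Γ k : ℂ))) * mode Γ k p
  let Ar : ℝ × ℝ → ℂ := fun p => ∑ k ∈ S, (c k * (|freq Γ k| : ℝ)) * mode Γ k p
  have hcont : ∀ a : ℤ → ℂ, Continuous fun p => ∑ k ∈ S, a k * mode Γ k p := fun a =>
    continuous_finsetSum _ fun k _ => (continuous_mode k).const_mul _
  have hA : Continuous A := hcont _
  have hAs : Continuous As := hcont _
  have hAr : Continuous Ar := hcont _
  let χ : ℝ → ℝ := cutoff hδ0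
  have hχ : Continuous χ := (contDiff_cutoff hδ0).continuous
  have hχ' : Continuous (deriv χ) := (contDiff_deriv_cutoff hδ0).continuous
  have dre : ∀ {f : ℝ → ℂ} {f' : ℂ} {x : ℝ}, HasDerivAt f f' x →
      HasDerivAt (fun x => (f x).re) f'.re x := fun h =>
    Complex.reCLM.hasFDerivAt.comp_hasDerivAt _ h
  let Gs : ℝ × ℝ → ℝ := fun p => χ p.2 * (As p).re
  let Gr : ℝ × ℝ → ℝ := fun p => deriv χ p.2 * (A p).re + χ p.2 * (Ar p).re
  have hs : ∀ s r, HasDerivAt (fun s => χ r * (A (s, r)).re) (Gs (s, r)) s := fun s r => by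
    refine (dre (HasDerivAt.fun_sum fun k _ => ?_)).const_mul _
    exact ((hasDerivAt_mode_left k s r).const_mul (c k)).congr_deriv (by ring)
  have hr : ∀ s r, HasDerivAt (fun r => χ r * (A (s, r)).re) (Gr (s, r)) r := fun s r => by
    have h1 : HasDerivAt χ (deriv χ r) r :=
      ((contDiff_cutoff hδ0).differentiable (by simp) r).hasDerivAt
    refine h1.fun_mul (dre (HasDerivAt.fun_sum fun k _ => ?_))
    exact ((hasDerivAt_mode_right k s r).const_mul (c k)).congr_deriv (by ring)
  have hGs : Continuous Gs := by fun_prop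
  have hGr : Continuous Gr := by fun_prop
  have key := hδ.integral_sum_pderiv_sq_le (G := fun p => χ p.2 * (A p).re) hs hr hGs hGr
    (φ := ∑ k ∈ S, modeFun hδ c k) (fun p hp => sum_modeFun_tube hδ c S hp)
    (fun x hx => sum_modeFun_zero hδ c S hx)
  refine key.trans ?_
  have hL := Γ.L_pos
  let B : ℝ × ℝ → ℝ := fun p => 4 * ‖As p‖ ^ 2 + 2 * M ^ 2 * ‖A p‖ ^ 2 + 2 * ‖Ar p‖ ^ 2
  have hB : Continuous B := by fun_prop
  have hle : ∫ p in Γ.strip δ, (4 * Gs (p.1, -1 * p.2) ^ 2 + Gr (p.1, -1 * p.2) ^ 2) ≤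
      ∫ p in Γ.strip δ, B (p.1, -1 * p.2) := by
    refine setIntegral_mono_on
      (JordanCurve.integrableOn_strip (Continuous.continuousOn (by fun_prop)))
      (JordanCurve.integrableOn_strip (Continuous.continuousOn (by fun_prop)))
      (Γ.measurableSet_strip δ) fun p hp => ?_
    have hp2 : |-1 * p.2| < δ := hδ.isSide_int.abs_lt hp
    have hm := hM (-1 * p.2) (abs_le.1 hp2.le)
    generalize hq : ((p.1, -1 * p.2) : ℝ × ℝ) = q
    have hq2 : -1 * p.2 = q.2 := by rw [← hq]
    rw [hq2, Real.norm_eq_abs] at hm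
    have hχ0 : 0 ≤ χ q.2 := (cutoff hδ0).nonneg
    have hχ1 : χ q.2 ≤ 1 := (cutoff hδ0).le_one
    have e1 : (χ q.2 * (As q).re) ^ 2 ≤ ‖As q‖ ^ 2 := by
      refine sq_le_sq' ?_ ?_ <;>
      nlinarith [abs_le.1 (Complex.abs_re_le_norm (As q)), norm_nonneg (As q)]
    have e2 : (χ q.2 * (Ar q).re) ^ 2 ≤ ‖Ar q‖ ^ 2 := by
      refine sq_le_sq' ?_ ?_ <;>
      nlinarith [abs_le.1 (Complex.abs_re_le_norm (Ar q)), norm_nonneg (Ar q)]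
    have e3 : (deriv χ q.2 * (A q).re) ^ 2 ≤ M ^ 2 * ‖A q‖ ^ 2 := by
      rw [← mul_pow, ← sq_abs, abs_mul]
      exact pow_le_pow_left₀ (by positivity)
        (mul_le_mul hm (Complex.abs_re_le_norm _) (abs_nonneg _) ((abs_nonneg _).trans hm)) 2
    simp only [Gs, Gr, B]
    nlinarith [sq_nonneg (deriv χ q.2 * (A q).re - χ q.2 * (Ar q).re)]
  have hI : ∫ p in Γ.strip δ, B (p.1, -1 * p.2) = ∫ ρ in (0 : ℝ)..δ, Γ.L * ∑ k ∈ S,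
      (6 * freq Γ k ^ 2 + 2 * M ^ 2) * ‖c k‖ ^ 2 * Real.exp (|freq Γ k| * (-1 * ρ)) ^ 2 := by
    rw [JordanCurve.integral_strip_eq hδ0.le (by fun_prop), ← intervalIntegral.integral_of_le hL.le,
      intervalIntegral_swap_of_continuous (f := fun p : ℝ × ℝ => B (p.1, -1 * p.2)) (by fun_prop)]
    refine intervalIntegral.integral_congr fun ρ _ => ?_
    simp only [B]
    rw [intervalIntegral.integral_add (Continuous.intervalIntegrable (by fun_prop) _ _)
        (Continuous.intervalIntegrable (by fun_prop) _ _),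
      intervalIntegral.integral_add (Continuous.intervalIntegrable (by fun_prop) _ _)
        (Continuous.intervalIntegrable (by fun_prop) _ _), intervalIntegral.integral_const_mul,
      intervalIntegral.integral_const_mul, intervalIntegral.integral_const_mul]
    simp only [A, As, Ar, integral_norm_sq_sum_mode]
    rw [mul_left_comm 4, mul_left_comm (2 * M ^ 2), mul_left_comm 2, ← mul_add, ← mul_add,
      Finset.mul_sum, Finset.mul_sum, Finset.mul_sum, ← Finset.sum_add_distrib,
      ← Finset.sum_add_distrib]
    congr 1
    refine Finset.sum_congr rfl fun k _ => ?_
    simp only [norm_mul, Complex.norm_I, Complex.norm_real, Real.norm_eq_abs, abs_abs, one_mul,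
      mul_pow, sq_abs]
    ring
  refine (mul_le_mul_of_nonneg_left (hle.trans_eq hI) (by norm_num)).trans ?_
  rw [intervalIntegral.integral_const_mul, intervalIntegral.integral_finsetSum fun k _ =>
    Continuous.intervalIntegrable (by fun_prop) _ _]
  rw [mul_left_comm, mul_left_comm (6 + 2 * M ^ 2 * C₁ ^ 2)]
  refine mul_le_mul_of_nonneg_left ?_ hL.le
  rw [Finset.mul_sum, Finset.mul_sum]
  refine Finset.sum_le_sum fun k _ => ?_
  rw [intervalIntegral.integral_const_mul]
  by_cases hk : k = 0
  · simp [hk, hc0]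
  have h1 := hf k hk
  have hpos : 0 < |freq Γ k| := by
    by_contra hle
    have : |freq Γ k| = 0 := le_antisymm (not_lt.1 hle) (abs_nonneg _)
    rw [this, mul_zero] at h1
    linarith
  have h2 := integral_exp_neg_sq_le (δ := δ) hpos
  have h3 : 6 * freq Γ k ^ 2 + 2 * M ^ 2 ≤ (6 + 2 * M ^ 2 * C₁ ^ 2) * |freq Γ k| ^ 2 := by
    have h4 : 1 ≤ C₁ ^ 2 * |freq Γ k| ^ 2 := by
      rw [← mul_pow]
      exact one_le_pow₀ h1
    have h5 := mul_le_mul_of_nonneg_left h4 (by positivity : 0 ≤ 2 * M ^ 2)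
    have h6 := sq_abs (freq Γ k)
    nlinarith
  calc 2 * ((6 * freq Γ k ^ 2 + 2 * M ^ 2) * ‖c k‖ ^ 2 *
        ∫ ρ in (0 : ℝ)..δ, Real.exp (|freq Γ k| * (-1 * ρ)) ^ 2)
      ≤ 2 * ((6 + 2 * M ^ 2 * C₁ ^ 2) * |freq Γ k| ^ 2 * ‖c k‖ ^ 2 * (2 * |freq Γ k|)⁻¹) := by
        refine mul_le_mul_of_nonneg_left (mul_le_mul (mul_le_mul_of_nonneg_right h3 (sq_nonneg _))
          h2 ?_ (by positivity)) (by norm_num)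
        exact intervalIntegral.integral_nonneg hδ0.le fun ρ _ => sq_nonneg _
    _ = _ := by field_simp

end Modes

end WaveStructure
end

/-! ### Summation of the modes to an extension of a given boundary function. -/

noncomputable section
namespace WaveStructure

open JordanCurve

variable {Γ : JordanCurve}

lemma testTriple_trace_ae (φ : testFun ℝ) (Ω : Set Plane) :
    (testTriple Γ Ω φ).2.2 =ᵐ[volume.restrict (Ioc 0 Γ.L)] fun s => φ.1 (Γ.γ s) :=
  MemLp.coeFn_toLp (memLp_Ioc ((testFun.continuous φ).comp Γ.continuous_γ) 0 Γ.L)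

lemma fourierCoef_testTriple (φ : testFun ℝ) (Ω : Set Plane) (m : ℤ) :
    fourierCoef Γ (testTriple Γ Ω φ).2.2 m = fcoef Γ (fun s => ((φ.1 (Γ.γ s) : ℝ) : ℂ)) m := by
  rw [fourierCoef_eq_fcoef]
  refine fcoef_congr_ae ?_ m
  filter_upwards [testTriple_trace_ae φ Ω] with s hs
  rw [hs]

lemma freq_neg (k : ℤ) : freq Γ (-k) = -freq Γ k := by
  simp only [freq]
  push_cast
  ring

lemma conj_mode (k : ℤ) (s : ℝ) : starRingEnd ℂ (mode Γ k (s, 0)) = mode Γ (-k) (s, 0) := by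
  simp only [mode, ← Complex.exp_conj, freq_neg]
  congr 1
  simp

lemma fourierCoef_neg (g : L2Γ Γ ℝ) (m : ℤ) :
    starRingEnd ℂ (fourierCoef Γ g (-m)) = fourierCoef Γ g m := by
  simp only [fourierCoef]
  rw [map_mul, ← integral_conj]
  congr 1
  · simp
  · refine integral_congr_ae (Eventually.of_forall fun s => ?_)
    simp only [map_mul, ← Complex.exp_conj, freq_neg]
    simp

/-- Taking the real part spreads a mode over the frequencies k and -k with weight one half each. For
the coefficients of a real function the halves coming from k and -k recombine to the full
coefficient. -/
lemma fourierCoef_modeFun {δ : ℝ} (hδ : Γ.IsTubeRadius δ) (c : ℤ → ℂ) (k m : ℤ) (Ω : Set Plane) :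
    fourierCoef Γ (testTriple Γ Ω (modeFun hδ c k)).2.2 m =
      (if k = m then c k / 2 else 0) + if -k = m then starRingEnd ℂ (c k) / 2 else 0 := by
  rw [fourierCoef_testTriple]
  have e : ∀ s, (((modeFun hδ c k).1 (Γ.γ s) : ℝ) : ℂ) =
      c k / 2 * mode Γ k (s, 0) + starRingEnd ℂ (c k) / 2 * mode Γ (-k) (s, 0) := fun s => by
    have h := sum_modeFun_tube hδ c {k} (p := (s, 0)) (by simpa using hδ.pos)
    rw [Finset.sum_singleton, Finset.sum_singleton, tube_zero, cutoff_one_of hδ.pos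
      (by simpa using (by linarith [hδ.pos] : 0 ≤ δ / 4)), one_mul] at h
    rw [h, Complex.re_eq_add_conj, map_mul, conj_mode]
    ring
  simp only [e]
  have hc : ∀ k, Continuous fun s => mode Γ k (s, 0) := fun k =>
    (continuous_mode k).comp (by fun_prop)
  rw [fcoef_add (memLp_Ioc ((hc _).const_mul _) 0 Γ.L) (memLp_Ioc ((hc _).const_mul _) 0 Γ.L),
    fcoef_const_mul, fcoef_const_mul, fcoef_mode, fcoef_mode]
  simp

lemma norm_trace_sum_modeFun_le {δ : ℝ} (hδ : Γ.IsTubeRadius δ) (c : ℤ → ℂ) (S : Finset ℤ)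
    (Ω : Set Plane) : ‖(testTriple Γ Ω (∑ k ∈ S, modeFun hδ c k)).2.2‖ ^ 2 ≤
      Γ.L * ∑ k ∈ S, ‖c k‖ ^ 2 := by
  have h := integral_norm_sq_sum_mode (Γ := Γ) S c 0
  simp only [mul_zero, Real.exp_zero, one_pow, mul_one] at h
  have hc : Continuous fun s => ∑ k ∈ S, c k * mode Γ k (s, 0) :=
    continuous_finsetSum _ fun k _ => ((continuous_mode k).comp (by fun_prop)).const_mul _
  rw [norm_testTriple_trace, ← h, ← intervalIntegral.integral_of_le Γ.L_pos.le]
  refine intervalIntegral.integral_mono_on Γ.L_pos.le (Continuous.intervalIntegrable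
    (((testFun.continuous _).comp Γ.continuous_γ).pow 2) _ _)
    (Continuous.intervalIntegrable (hc.norm.pow 2) _ _) fun s _ => ?_
  rw [← Γ.tube_zero, sum_modeFun_tube hδ c S (by simpa using hδ.pos), cutoff_one_of hδ.pos
    (by simpa using (by linarith [hδ.pos] : 0 ≤ δ / 4)), one_mul, ← sq_abs]
  exact pow_le_pow_left₀ (abs_nonneg _) (Complex.abs_re_le_norm _) 2

/-- Constants on the curve extend to functions with vanishing gradient on the interior. -/
lemma exists_const_triple (Γ : JordanCurve) : ∃ x ∈ traceSpace Γ Γ.int ℝ,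
    (∀ j, x.2.1 j = 0) ∧ ∀ m, fourierCoef Γ x.2.2 m = if m = 0 then 1 else 0 := by
  obtain ⟨R, hR⟩ := (Γ.isCompact_range.isBounded.union Γ.isBounded_int).subset_closedBall 0
  let θ : ContDiffBump (0 : Plane) :=
    { rIn := max R 1, rOut := max R 1 + 1, rIn_pos := by positivity, rIn_lt_rOut := by linarith }
  let φ : testFun ℝ := ⟨θ, θ.contDiff, θ.hasCompactSupport⟩
  have h1 : ∀ x ∈ range Γ.γ ∪ Γ.int, φ.1 x = 1 := fun x hx =>
    θ.one_of_mem_closedBall (Metric.closedBall_subset_closedBall (le_max_left _ _) (hR hx))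
  refine ⟨testTriple Γ Γ.int φ, testTriple_mem _ _ φ, fun j => ?_, fun m => ?_⟩
  · have h := norm_testTriple_grad (Γ := Γ) (Ω := Γ.int) (φ := φ) j
    rw [setIntegral_eq_zero_of_forall_eq_zero, sq_eq_zero_iff, norm_eq_zero] at h
    · exact h
    · intro x hx
      have he : φ.1 =ᶠ[𝓝 x] fun _ => 1 := by
        filter_upwards [Γ.isOpen_int.mem_nhds hx] with y hy using h1 y (Or.inr hy)
      simp [pderiv, he.fderiv_eq]
  · rw [fourierCoef_testTriple]
    have h := fcoef_mode (Γ := Γ) 0 m 0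
    simp only [mode, freq, Int.cast_zero, mul_zero, zero_div, Complex.ofReal_zero, zero_mul,
      add_zero, Complex.exp_zero, Real.exp_zero, Complex.ofReal_one] at h
    simp only [h1 _ (Or.inl ⟨_, rfl⟩), Complex.ofReal_one]
    rw [h]
    simp only [eq_comm]

/-- This is the converse of `hNormTan_sq_le_of_sum_le`; it gives the decay of coefficients that
makes the series of modes converge. -/
lemma sum_freq_sq_le_hNormTan {C : ℝ} (hC : 0 < C) (h : ∀ k : ℤ,
    |freq Γ k| ≤ C * ((Real.sqrt (1 + freq Γ k ^ 2))⁻¹ * freq Γ k ^ 2)) {g : L2Γ Γ ℝ}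
    (hg : g ∈ Hhalf Γ) (S : Finset ℤ) : Γ.L * ∑ k ∈ S, |freq Γ k| * ‖fourierCoef Γ g k‖ ^ 2 ≤
      C * (hNormTan Γ (-1 / 2) g).toReal ^ 2 := by
  have hL := Γ.L_pos
  have h1 : ENNReal.ofReal (∑ k ∈ S, Γ.L * ((Real.sqrt (1 + freq Γ k ^ 2))⁻¹ *
      (freq Γ k ^ 2 * ‖fourierCoef Γ g k‖ ^ 2))) ≤ hNormTan Γ (-1 / 2) g ^ 2 := by
    rw [hNormTan_sq, ENNReal.ofReal_sum_of_nonneg fun k _ => by positivity]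
    exact ENNReal.sum_le_tsum S
  have h2 : ∑ k ∈ S, Γ.L * ((Real.sqrt (1 + freq Γ k ^ 2))⁻¹ *
      (freq Γ k ^ 2 * ‖fourierCoef Γ g k‖ ^ 2)) ≤ (hNormTan Γ (-1 / 2) g).toReal ^ 2 := by
    rw [← ENNReal.toReal_pow]
    exact (ENNReal.ofReal_le_iff_le_toReal
      (ENNReal.pow_ne_top (hNormTan_lt_top (mem_Hhalf.1 hg)).ne)).1 h1
  refine le_trans ?_ (mul_le_mul_of_nonneg_left h2 hC.le)
  rw [Finset.mul_sum, Finset.mul_sum]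
  refine Finset.sum_le_sum fun k _ => ?_
  have h3 := mul_le_mul_of_nonneg_right (h k)
    (by positivity : 0 ≤ Γ.L * ‖fourierCoef Γ g k‖ ^ 2)
  calc _ = |freq Γ k| * (Γ.L * ‖fourierCoef Γ g k‖ ^ 2) := by ring
    _ ≤ _ := h3
    _ = _ := by ring

/-- Every function in `H^{1/2}(Γ)` is the trace of a function in `H¹(𝓘)`. -/
theorem exists_extension (Γ : JordanCurve) : ∃ C, 0 < C ∧ ∀ ψ ∈ Hhalf Γ,
    ∃ x ∈ traceSpace Γ Γ.int ℝ, x.2.2 = ψ ∧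
      ∑ j, ‖x.2.1 j‖ ^ 2 ≤ C * (hNormTan Γ (-1 / 2) ψ).toReal ^ 2 := by
  obtain ⟨δ, hδ⟩ := Γ.exists_tubeRadius
  obtain ⟨K, hK, hKb⟩ := exists_sum_mode_bound hδ
  obtain ⟨C₁, hC₁, hf⟩ := exists_one_le_freq Γ
  obtain ⟨C₂, hC₂, hf2⟩ := exists_abs_freq_le Γ
  obtain ⟨P, hP, hPb⟩ := exists_poincare Γ
  obtain ⟨y, hy, hy0, hyc⟩ := exists_const_triple Γ
  have hL := Γ.L_pos
  refine ⟨K * C₂, by positivity, fun ψ hψ => ?_⟩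
  set N := (hNormTan Γ (-1 / 2) ψ).toReal ^ 2
  -- The mean value is invisible to 𝔡_tan, so it must be extended with zero gradient. It is removed
  -- here and restored at the end by a constant.
  let c : ℤ → ℂ := fun k => if k = 0 then 0 else fourierCoef Γ ψ k
  have hc0 : c 0 = 0 := if_pos rfl
  let A : Finset ℤ → ℝ := fun S => Γ.L * ∑ k ∈ S, |freq Γ k| * ‖c k‖ ^ 2
  have hAN : ∀ S, A S ≤ C₂ * N := fun S => by
    refine le_trans (mul_le_mul_of_nonneg_left (Finset.sum_le_sum fun k _ => ?_) hL.le)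
      (sum_freq_sq_le_hNormTan hC₂ hf2 hψ S)
    by_cases hk : k = 0
    · simp [hk, freq]
    · simp [c, hk]
  let z : ℤ → Triple Γ Γ.int ℝ := fun k => testTriple Γ Γ.int (modeFun hδ c k)
  have hz : ∀ S : Finset ℤ, ∑ k ∈ S, z k = testTriple Γ Γ.int (∑ k ∈ S, modeFun hδ c k) := fun S =>
    (map_sum _ _ _).symm
  have hgrad : ∀ S : Finset ℤ, ∑ j, ‖(∑ k ∈ S, z k).2.1 j‖ ^ 2 ≤ K * A S := fun S => by
    rw [hz]
    refine le_trans (le_of_eq ?_) (hKb c hc0 S)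
    simp only [norm_testTriple_grad]
    exact (integral_finsetSum _ fun j _ => testFun.integrable_sq (testFun.continuous_pderiv _ j)
      (hasCompactSupport_pderiv (∑ k ∈ S, modeFun hδ c k).2.2) _).symm
  have htr : ∀ S : Finset ℤ, ‖(∑ k ∈ S, z k).2.2‖ ^ 2 ≤ C₁ * A S := fun S => by
    rw [hz]
    refine (norm_trace_sum_modeFun_le hδ c S _).trans ?_
    simp only [A]
    rw [mul_left_comm]
    refine mul_le_mul_of_nonneg_left ?_ hL.le
    rw [Finset.mul_sum]
    refine Finset.sum_le_sum fun k _ => ?_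
    by_cases hk : k = 0
    · simp [hk, hc0]
    · rw [← mul_assoc]
      exact le_mul_of_one_le_left (sq_nonneg _) (hf k hk)
  have hmem : ∀ S : Finset ℤ, ∑ k ∈ S, z k ∈ traceSpace Γ Γ.int ℝ := fun S =>
    Submodule.sum_mem _ fun k _ => testTriple_mem _ _ _
  set B := K + C₁ + P * (C₁ + K)
  have hB : 0 < B := by positivity
  have hA0 : ∀ S, 0 ≤ A S := fun S => mul_nonneg hL.le (Finset.sum_nonneg fun k _ => by positivity)
  -- Gradient and trace of a finite sum are bounded by A S, and the Poincaré inequality then bounds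
  -- the function itself. Hence the whole triple is controlled by a sum of nonnegative terms.
  have hnorm : ∀ S : Finset ℤ, ‖∑ k ∈ S, z k‖ ≤ Real.sqrt (B * A S) := fun S => by
    have h1 := hPb _ (hmem S)
    have h2 := hgrad S
    have h3 := htr S
    have hA := hA0 S
    have h4 : P * (‖(∑ k ∈ S, z k).2.2‖ ^ 2 + ∑ j, ‖(∑ k ∈ S, z k).2.1 j‖ ^ 2) ≤
        P * (C₁ * A S + K * A S) := mul_le_mul_of_nonneg_left (add_le_add h3 h2) hP.le
    have p1 : 0 ≤ K * A S := by positivity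
    have p2 : 0 ≤ C₁ * A S := by positivity
    have p3 : 0 ≤ P * (C₁ * A S + K * A S) := by positivity
    have hBA : B * A S = K * A S + C₁ * A S + P * (C₁ * A S + K * A S) := by
      simp only [B]
      ring
    rw [Prod.norm_def, Prod.norm_def]
    refine max_le (Real.le_sqrt_of_sq_le ?_) (max_le
      ((pi_norm_le_iff_of_nonneg (Real.sqrt_nonneg _)).2 fun j => Real.le_sqrt_of_sq_le ?_)
      (Real.le_sqrt_of_sq_le ?_))
    · linarith
    · have := Finset.single_le_sum (f := fun j => ‖(∑ k ∈ S, z k).2.1 j‖ ^ 2)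
        (fun j _ => sq_nonneg _) (Finset.mem_univ j)
      linarith
    · linarith
  have hsumA : Summable fun k => |freq Γ k| * ‖c k‖ ^ 2 := by
    refine summable_of_sum_le (c := C₂ * N / Γ.L) (fun k => by positivity) fun S => ?_
    rw [le_div_iff₀ hL, mul_comm]
    exact hAN S
  -- Cauchy criterion: the norm of a partial sum over a set far out is at most the square root of a
  -- tail of a convergent series.
  have hsum : Summable z := by
    rw [summable_iff_vanishing_norm] at hsumA ⊢
    intro ε hε
    obtain ⟨s, hs⟩ := hsumA (ε ^ 2 / (B * Γ.L)) (by positivity)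
    refine ⟨s, fun t ht => (hnorm t).trans_lt ?_⟩
    have h1 := (le_abs_self _).trans_lt (hs t ht)
    rw [Real.sqrt_lt' hε]
    rw [lt_div_iff₀ (by positivity)] at h1
    calc B * A t = (∑ k ∈ t, |freq Γ k| * ‖c k‖ ^ 2) * (B * Γ.L) := by
          simp only [A]
          ring
      _ < _ := h1
  obtain ⟨X, hX⟩ := hsum
  have hXt : Tendsto (fun S : Finset ℤ => ∑ k ∈ S, z k) atTop (𝓝 X) := by
    simpa [HasSum] using hX
  have hXm : X ∈ traceSpace Γ Γ.int ℝ :=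
    (isClosed_traceSpace _ _).mem_of_tendsto hXt (Eventually.of_forall hmem)
  have hXg : ∑ j, ‖X.2.1 j‖ ^ 2 ≤ K * C₂ * N := by
    have hcont : Continuous fun x : Triple Γ Γ.int ℝ => ∑ j, ‖x.2.1 j‖ ^ 2 := by fun_prop
    refine le_of_tendsto ((hcont.tendsto X).comp hXt) (Eventually.of_forall fun S => ?_)
    refine (hgrad S).trans ?_
    rw [mul_assoc]
    exact mul_le_mul_of_nonneg_left (hAN S) hK.le
  -- The coefficients of the trace are continuous in the triple, so they may be summed termwise;
  -- only k = m and k = -m contribute.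
  have hXc : ∀ m, fourierCoef Γ X.2.2 m = c m := fun m => by
    let T : Triple Γ Γ.int ℝ →L[ℝ] ℂ := (fourierCoefL Γ m).comp
      ((ContinuousLinearMap.snd ℝ _ _).comp (ContinuousLinearMap.snd ℝ _ _))
    have h1 : HasSum (fun k => (if k = m then c k / 2 else 0) +
        if -k = m then starRingEnd ℂ (c k) / 2 else 0) (fourierCoef Γ X.2.2 m) := by
      have := hX.mapL T
      simp only [← fourierCoef_modeFun hδ c _ m Γ.int]
      exact this
    have h2 : HasSum (fun k => if k = m then c k / 2 else 0) (c m / 2) := by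
      have := hasSum_single (f := fun k => if k = m then c k / 2 else 0) m fun k hk => if_neg hk
      simpa using this
    have h3 : HasSum (fun k => if -k = m then starRingEnd ℂ (c k) / 2 else 0)
        (starRingEnd ℂ (c (-m)) / 2) := by
      have := hasSum_single (f := fun k => if -k = m then starRingEnd ℂ (c k) / 2 else 0) (-m)
        fun k hk => if_neg fun h => hk (by rw [← h, neg_neg])
      simpa using this
    rw [h1.unique (h2.add h3)]
    have h4 : starRingEnd ℂ (c (-m)) = c m := by
      by_cases hm : m = 0
      · simp [hm, hc0]
      · simp only [c, neg_eq_zero, hm, if_false]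
        exact fourierCoef_neg ψ m
    rw [h4, add_halves]
  -- The mean value of a real function is real, so nothing is lost by taking the real part.
  refine ⟨X + (fourierCoef Γ ψ 0).re • y, add_mem hXm (Submodule.smul_mem _ _ hy), ?_, ?_⟩
  · refine eq_of_fourierCoef_eq fun m => ?_
    have e : (X + (fourierCoef Γ ψ 0).re • y).2.2 = X.2.2 + (fourierCoef Γ ψ 0).re • y.2.2 := rfl
    rw [e, fourierCoef_add, fourierCoef_smul, hXc, hyc]
    by_cases hm : m = 0
    · rw [if_pos hm, hm, hc0, zero_add, mul_one]
      have := fourierCoef_neg ψ 0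
      rw [neg_zero] at this
      exact Complex.conj_eq_iff_re.1 this
    · simp [hm, c]
  · have e : ∀ j, (X + (fourierCoef Γ ψ 0).re • y).2.1 j = X.2.1 j := fun j => by
      change X.2.1 j + (fourierCoef Γ ψ 0).re • y.2.1 j = _
      rw [hy0, smul_zero, add_zero]
    simpa only [e] using hXg

end WaveStructure
end

noncomputable section
namespace WaveStructure

/-! ### The Dirichlet-to-Neumann map -/

open JordanCurve

variable {Γ : JordanCurve}

lemma DepthAssumption.exists_bound {c₀ : ℝ} {hi : Plane → ℝ} (h : DepthAssumption Γ c₀ hi) :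
    ∃ M, 0 ≤ M ∧ ∀ x ∈ Γ.int, hi x ≤ M := by
  obtain ⟨M, hM⟩ := (Γ.isBounded_int.isCompact_closure).exists_bound_of_continuousOn
    h.smooth.continuousOn
  exact ⟨max M 0, le_max_right _ _, fun x hx =>
    (le_abs_self _).trans ((hM x (subset_closure hx)).trans (le_max_left _ _))⟩

lemma DepthAssumption.aestronglyMeasurable {c₀ : ℝ} {hi : Plane → ℝ}
    (h : DepthAssumption Γ c₀ hi) : AEStronglyMeasurable hi (volume.restrict Γ.int) :=
  (h.smooth.continuousOn.mono subset_closure).aestronglyMeasurable Γ.isOpen_int.measurableSet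

/-- The weighted gradient. -/
def weightedGrad (Γ : JordanCurve) (W : L2 Γ.int ℝ →L[ℝ] L2 Γ.int ℝ) :
    Triple Γ Γ.int ℝ →L[ℝ] PiLp 2 (fun _ : Fin 2 => L2 Γ.int ℝ) :=
  ((PiLp.continuousLinearEquiv 2 ℝ (fun _ : Fin 2 => L2 Γ.int ℝ)).symm :
    (Fin 2 → L2 Γ.int ℝ) →L[ℝ] PiLp 2 (fun _ : Fin 2 => L2 Γ.int ℝ)).comp
    (ContinuousLinearMap.pi fun j => W.comp ((ContinuousLinearMap.proj j).comp
      ((ContinuousLinearMap.fst ℝ _ _).comp (ContinuousLinearMap.snd ℝ _ _))))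

lemma weightedGrad_apply (W : L2 Γ.int ℝ →L[ℝ] L2 Γ.int ℝ) (x : Triple Γ Γ.int ℝ) (j : Fin 2) :
    weightedGrad Γ W x j = W (x.2.1 j) := rfl

/-- Splitting the weight as √h·√h turns the weighted Dirichlet form into an ordinary inner product,
so that orthogonal projection can replace a variational argument. -/
lemma inner_weightedGrad {hi : Plane → ℝ} (h0 : ∀ x ∈ Γ.int, 0 ≤ hi x)
    {W : L2 Γ.int ℝ →L[ℝ] L2 Γ.int ℝ}
    (hW : ∀ f : L2 Γ.int ℝ, W f =ᵐ[volume.restrict Γ.int] fun x => Real.sqrt (hi x) • f x)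
    (x y : Triple Γ Γ.int ℝ) : inner ℝ (weightedGrad Γ W x) (weightedGrad Γ W y) =
      ∫ z in Γ.int, hi z * ∑ j, x.2.1 j z * y.2.1 j z := by
  rw [PiLp.inner_apply]
  simp only [weightedGrad_apply, L2_inner_eq]
  have hint : ∀ f g : L2 Γ.int ℝ, Integrable (fun z => f z * g z) (volume.restrict Γ.int) :=
    fun f g => (Lp.memLp f).integrable_mul (Lp.memLp g)
  rw [← integral_finsetSum _ fun j _ => hint _ _]
  refine integral_congr_ae ?_
  have hall : ∀ᵐ z ∂(volume.restrict Γ.int), ∀ j, W (x.2.1 j) z = Real.sqrt (hi z) • x.2.1 j z ∧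
      W (y.2.1 j) z = Real.sqrt (hi z) • y.2.1 j z :=
    ae_all_iff.2 fun j => (hW _).and (hW _)
  filter_upwards [hall, ae_restrict_mem Γ.isOpen_int.measurableSet] with z hz hzi
  rw [Finset.mul_sum]
  refine Finset.sum_congr rfl fun j _ => ?_
  rw [(hz j).1, (hz j).2, smul_eq_mul, smul_eq_mul]
  calc _ = (Real.sqrt (hi z) * Real.sqrt (hi z)) * (x.2.1 j z * y.2.1 j z) := by ring
    _ = _ := by rw [Real.mul_self_sqrt (h0 z hzi)]

/-- The bilinear form of the Dirichlet-to-Neumann map is an inner product. -/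
theorem exists_dn_factorization {c₀ : ℝ} (hc₀ : 0 < c₀) {hi : Plane → ℝ}
    (hhi : DepthAssumption Γ c₀ hi) :
    ∃ Φ : Hhalf Γ →ₗ[ℝ] PiLp 2 (fun _ : Fin 2 => L2 Γ.int ℝ),
      (∀ ψ η : Hhalf Γ, dirichletToNeumann Γ hi ψ η = inner ℝ (Φ ψ) (Φ η)) ∧
      (∀ ψ : Hhalf Γ, ∀ x ∈ traceSpace Γ Γ.int ℝ, x.2.2 = ψ →
        ‖Φ ψ‖ ^ 2 ≤ ∫ z in Γ.int, hi z * ∑ j, x.2.1 j z * x.2.1 j z) ∧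
      (∀ ψ : Hhalf Γ, ∃ x ∈ traceSpace Γ Γ.int ℝ, x.2.2 = ψ ∧
        ‖Φ ψ‖ ^ 2 = ∫ z in Γ.int, hi z * ∑ j, x.2.1 j z * x.2.1 j z) := by
  have h0 : ∀ x ∈ Γ.int, 0 ≤ hi x := fun x hx => hc₀.le.trans (hhi.lower x hx)
  obtain ⟨M, hM, hMb⟩ := hhi.exists_bound
  obtain ⟨W, -, hW⟩ := exists_smulOp (F := ℝ) (m := fun x => Real.sqrt (hi x))
    (Real.continuous_sqrt.comp_aestronglyMeasurable hhi.aestronglyMeasurable)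
    (Real.sqrt_nonneg M) (by
      filter_upwards [ae_restrict_mem Γ.isOpen_int.measurableSet] with x hx
      rw [abs_of_nonneg (Real.sqrt_nonneg _)]
      exact Real.sqrt_le_sqrt (hMb x hx))
  set T := weightedGrad Γ W
  have hT : ∀ x y, inner ℝ (T x) (T y) = ∫ z in Γ.int, hi z * ∑ j, x.2.1 j z * y.2.1 j z :=
    inner_weightedGrad h0 hW
  let tr : Triple Γ Γ.int ℝ →L[ℝ] L2Γ Γ ℝ :=
    (ContinuousLinearMap.snd ℝ _ _).comp (ContinuousLinearMap.snd ℝ _ _)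
  let Z : Submodule ℝ (Triple Γ Γ.int ℝ) := traceSpace Γ Γ.int ℝ ⊓ LinearMap.ker tr.toLinearMap
  have hZ : ∀ x, x ∈ Z ↔ x ∈ traceSpace Γ Γ.int ℝ ∧ x.2.2 = 0 := fun x => Iff.rfl
  have hZc : IsClosed (Z : Set (Triple Γ Γ.int ℝ)) :=
    (isClosed_traceSpace Γ Γ.int).inter (isClosed_singleton.preimage tr.continuous)
  obtain ⟨P, hP, hPb⟩ := exists_poincare Γ
  have hlow : ∀ x : Triple Γ Γ.int ℝ, c₀ * ∑ j, ‖x.2.1 j‖ ^ 2 ≤ ‖T x‖ ^ 2 := fun x => by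
    rw [PiLp.norm_sq_eq_of_L2, Finset.mul_sum]
    refine Finset.sum_le_sum fun j _ => ?_
    simp only [T, weightedGrad_apply]
    rw [L2_norm_sq, L2_norm_sq, ← integral_const_mul]
    have hI : ∀ f : L2 Γ.int ℝ, Integrable (fun z => ‖f z‖ ^ 2) (volume.restrict Γ.int) :=
      fun f => (Lp.memLp f).integrable_norm_pow (by norm_num)
    refine integral_mono_ae ((hI _).const_mul c₀) (hI _) ?_
    filter_upwards [hW (x.2.1 j), ae_restrict_mem Γ.isOpen_int.measurableSet] with z hz hzi
    rw [hz, norm_smul, mul_pow, Real.norm_eq_abs (Real.sqrt _), sq_abs (Real.sqrt _),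
      Real.sq_sqrt (h0 z hzi)]
    exact mul_le_mul_of_nonneg_right (hhi.lower z hzi) (sq_nonneg _)
  let K := Z.map T.toLinearMap
  -- On functions with zero trace the Poincaré inequality and h ≥ c₀ bound the whole triple by its
  -- weighted gradient. So T is antilipschitz on the complete space Z and its range there is closed.
  have hKc : IsClosed (K : Set (PiLp 2 (fun _ : Fin 2 => L2 Γ.int ℝ))) := by
    have : CompleteSpace Z := hZc.completeSpace_coe
    let TZ := T.comp Z.subtypeL
    have hanti : AntilipschitzWith (Real.toNNReal (Real.sqrt ((1 + P) / c₀))) TZ := by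
      refine AddMonoidHomClass.antilipschitz_of_bound TZ fun x => ?_
      rw [Real.coe_toNNReal _ (Real.sqrt_nonneg _)]
      have h1 := hPb _ ((hZ _).1 x.2).1
      have h2 := hlow x
      have h3 := ((hZ _).1 x.2).2
      have hb : ∀ r : ℝ, 0 ≤ r → r ^ 2 ≤ (1 + P) * ∑ j, ‖x.1.2.1 j‖ ^ 2 →
          r ≤ Real.sqrt ((1 + P) / c₀) * ‖TZ x‖ := fun r hr h => by
        refine abs_le_of_sq_le_sq' ?_ (by positivity) |>.2
        rw [mul_pow, Real.sq_sqrt (by positivity), div_mul_eq_mul_div, le_div_iff₀ hc₀]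
        calc r ^ 2 * c₀ ≤ ((1 + P) * ∑ j, ‖x.1.2.1 j‖ ^ 2) * c₀ :=
              mul_le_mul_of_nonneg_right h hc₀.le
          _ = (1 + P) * (c₀ * ∑ j, ‖x.1.2.1 j‖ ^ 2) := by ring
          _ ≤ _ := mul_le_mul_of_nonneg_left h2 (by positivity)
      have hs : 0 ≤ ∑ j, ‖x.1.2.1 j‖ ^ 2 := Finset.sum_nonneg fun j _ => sq_nonneg _
      have hPs := mul_nonneg hP.le hs
      have hsj : ∀ j, ‖x.1.2.1 j‖ ^ 2 ≤ ∑ j, ‖x.1.2.1 j‖ ^ 2 := fun j =>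
        Finset.single_le_sum (f := fun j => ‖x.1.2.1 j‖ ^ 2) (fun j _ => sq_nonneg _)
          (Finset.mem_univ j)
      rw [h3, norm_zero] at h1
      change ‖x.1‖ ≤ _
      rw [Prod.norm_def, Prod.norm_def]
      refine max_le (hb _ (norm_nonneg _) (by linarith)) (max_le
        ((pi_norm_le_iff_of_nonneg (by positivity)).2 fun j => hb _ (norm_nonneg _) ?_) ?_)
      · linarith [hsj j]
      · rw [h3, norm_zero]
        positivity
    have e : (K : Set (PiLp 2 (fun _ : Fin 2 => L2 Γ.int ℝ))) = range TZ := by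
      ext y
      constructor
      · rintro ⟨x, hx, rfl⟩
        exact ⟨⟨x, hx⟩, rfl⟩
      · rintro ⟨x, rfl⟩
        exact ⟨x, x.2, rfl⟩
    rw [e]
    exact hanti.isClosed_range TZ.uniformContinuous
  have : CompleteSpace K := hKc.completeSpace_coe
  -- Q is the projection onto the orthogonal complement of K. Two extensions with the same trace
  -- differ by an element of Z, so Q ∘ T depends on the trace only; this makes Φ linear although
  -- extensions are chosen arbitrarily.
  let Q := ContinuousLinearMap.id ℝ (PiLp 2 (fun _ : Fin 2 => L2 Γ.int ℝ)) - K.starProjection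
  have hQK : ∀ v ∈ K, Q v = 0 := fun v hv => by
    simp [Q, Submodule.starProjection_eq_self_iff.2 hv]
  have hQ : ∀ x ∈ traceSpace Γ Γ.int ℝ, ∀ y ∈ traceSpace Γ Γ.int ℝ, x.2.2 = y.2.2 →
      Q (T x) = Q (T y) := fun x hx y hy h => by
    rw [← sub_eq_zero, ← map_sub, ← map_sub]
    refine hQK _ ⟨x - y, (hZ _).2 ⟨sub_mem hx hy, ?_⟩, rfl⟩
    change x.2.2 - y.2.2 = 0
    rw [h, sub_self]
  have hQo : ∀ v, ∀ w ∈ K, inner ℝ (Q v) w = 0 := fun v w hw => K.starProjection_inner_eq_zero v w hw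
  have hQself : ∀ v, (∀ w ∈ K, inner ℝ v w = 0) → Q v = v := fun v hv => by
    have : K.starProjection v = 0 :=
      K.eq_starProjection_of_mem_of_inner_eq_zero (zero_mem K) fun w hw => by
        rw [sub_zero]
        exact hv w hw
    simp [Q, this]
  have hQinner : ∀ v w, inner ℝ (Q v) w = inner ℝ (Q v) (Q w) := fun v w => by
    simp only [Q, _root_.sub_apply, ContinuousLinearMap.id_apply]
    rw [inner_sub_right _ w, K.starProjection_inner_eq_zero v _ (K.starProjection_apply_mem w),
      sub_zero]
  obtain ⟨C, hC, hext⟩ := exists_extension Γ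
  choose E hE hEt hEb using hext
  let Φ : Hhalf Γ →ₗ[ℝ] PiLp 2 (fun _ : Fin 2 => L2 Γ.int ℝ) :=
    { toFun := fun ψ => Q (T (E ψ ψ.2))
      map_add' := fun ψ η => by
        rw [← map_add, ← map_add]
        refine hQ _ (hE _ _) _ (add_mem (hE _ _) (hE _ _)) ?_
        change _ = (E ψ ψ.2).2.2 + (E η η.2).2.2
        rw [hEt, hEt, hEt]
        rfl
      map_smul' := fun a ψ => by
        rw [RingHom.id_apply, ← map_smul, ← map_smul]
        refine hQ _ (hE _ _) _ (Submodule.smul_mem _ _ (hE _ _)) ?_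
        change _ = a • (E ψ ψ.2).2.2
        rw [hEt, hEt]
        rfl }
  have hΦ : ∀ (ψ : Hhalf Γ), ∀ x ∈ traceSpace Γ Γ.int ℝ, x.2.2 = ψ → Φ ψ = Q (T x) :=
    fun ψ x hx h => hQ _ (hE _ _) _ hx (by rw [hEt, h])
  -- The projection onto K is itself T of a zero-trace function. Subtracting that function gives an
  -- extension with weighted gradient orthogonal to K, which is the weak form of the elliptic
  -- equation.
  have hharm : ∀ ψ : Hhalf Γ, ∃ x ∈ traceSpace Γ Γ.int ℝ, x.2.2 = ψ ∧ Q (T x) = T x := fun ψ => by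
    obtain ⟨z, hz, hzT⟩ := K.starProjection_apply_mem (T (E ψ ψ.2))
    refine ⟨E ψ ψ.2 - z, sub_mem (hE _ _) ((hZ _).1 hz).1, ?_, ?_⟩
    · change (E ψ ψ.2).2.2 - z.2.2 = ψ
      rw [((hZ _).1 hz).2, sub_zero, hEt]
    · have e : T (E ψ ψ.2 - z) = Q (T (E ψ ψ.2)) := by
        rw [map_sub]
        change _ = T (E ψ ψ.2) - K.starProjection (T (E ψ ψ.2))
        rw [← hzT]
        rfl
      rw [e]
      exact hQself _ (hQo _)
  refine ⟨Φ, fun ψ η => ?_, fun ψ x hx h => ?_, fun ψ => ?_⟩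
  · have hex : ∃ dp : Fin 2 → L2 Γ.int ℝ, ∃ p, IsHarmonicExtension Γ hi ψ p dp := by
      obtain ⟨x, hx, hxt, hxQ⟩ := hharm ψ
      refine ⟨x.2.1, x.1, ⟨isExtension_iff.2 (by rw [← hxt]; exact hx), fun q dq hq => ?_⟩⟩
      rw [isExtension_iff] at hq
      have := hQo (T x) (T (q, dq, 0)) ⟨_, (hZ _).2 ⟨hq, rfl⟩, rfl⟩
      rwa [hxQ, hT] at this
    have hex2 : ∃ dq : Fin 2 → L2 Γ.int ℝ, ∃ q, IsExtension Γ (η : L2Γ Γ ℝ) q dq :=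
      ⟨(E η η.2).2.1, (E η η.2).1, isExtension_iff.2 (by
        have := hE η η.2
        nth_rw 3 [← hEt η η.2]
        exact this)⟩
    obtain ⟨p, hp1, hp2⟩ := hex.choose_spec
    obtain ⟨q, hq⟩ := hex2.choose_spec
    rw [isExtension_iff] at hp1 hq
    -- Existence selects the first branch in both definitions. Which harmonic extension and which
    -- test extension were chosen is irrelevant, since Q sees only their traces.
    rw [dirichletToNeumann, harmonicGrad, extensionGrad, dif_pos hex, dif_pos hex2]
    have e1 := hT (p, hex.choose, (ψ : L2Γ Γ ℝ)) (q, hex2.choose, (η : L2Γ Γ ℝ))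
    have e2 : Q (T (p, hex.choose, (ψ : L2Γ Γ ℝ))) = T (p, hex.choose, (ψ : L2Γ Γ ℝ)) := by
      refine hQself _ ?_
      rintro _ ⟨z, hz, rfl⟩
      have hz' := (hZ _).1 hz
      have := hp2 z.1 z.2.1 (isExtension_iff.2 (by rw [← hz'.2]; exact hz'.1))
      exact (hT (p, hex.choose, (ψ : L2Γ Γ ℝ)) z).trans this
    rw [← e1, ← e2, hQinner, hΦ ψ _ hp1 rfl, hΦ η _ hq rfl]
  · rw [hΦ ψ x hx h, ← hT, real_inner_self_eq_norm_sq]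
    -- Dirichlet's principle: a projection does not increase the norm.
    refine pow_le_pow_left₀ (norm_nonneg _) ?_ 2
    have h1 : ‖Q (T x)‖ ^ 2 ≤ ‖Q (T x)‖ * ‖T x‖ := by
      rw [← real_inner_self_eq_norm_sq, ← hQinner]
      exact real_inner_le_norm _ _
    by_contra hlt
    push Not at hlt
    nlinarith [norm_nonneg (T x), norm_nonneg (Q (T x))]
  · obtain ⟨x, hx, hxt, hxQ⟩ := hharm ψ
    refine ⟨x, hx, hxt, ?_⟩
    rw [hΦ ψ x hx hxt, hxQ, ← hT, real_inner_self_eq_norm_sq]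

lemma le_weighted_dirichlet {hi : Plane → ℝ} {c M : ℝ} (hc : ∀ x ∈ Γ.int, c ≤ hi x)
    (hM : ∀ x ∈ Γ.int, hi x ≤ M) (hm : AEStronglyMeasurable hi (volume.restrict Γ.int))
    (x : Triple Γ Γ.int ℝ) :
    c * ∑ j, ‖x.2.1 j‖ ^ 2 ≤ ∫ z in Γ.int, hi z * ∑ j, x.2.1 j z * x.2.1 j z ∧
      ∫ z in Γ.int, hi z * ∑ j, x.2.1 j z * x.2.1 j z ≤ M * ∑ j, ‖x.2.1 j‖ ^ 2 := by
  have hI : ∀ j, Integrable (fun z => x.2.1 j z * x.2.1 j z) (volume.restrict Γ.int) :=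
    fun j => (Lp.memLp _).integrable_mul (Lp.memLp _)
  have hS : Integrable (fun z => ∑ j, x.2.1 j z * x.2.1 j z) (volume.restrict Γ.int) :=
    integrable_finsetSum _ fun j _ => hI j
  have e : ∑ j, ‖x.2.1 j‖ ^ 2 = ∫ z in Γ.int, ∑ j, x.2.1 j z * x.2.1 j z := by
    rw [integral_finsetSum _ fun j _ => hI j]
    refine Finset.sum_congr rfl fun j _ => ?_
    rw [L2_norm_sq]
    refine integral_congr_ae (Eventually.of_forall fun z => ?_)
    simp only [Real.norm_eq_abs, sq_abs]
    ring
  have hpos : ∀ z, 0 ≤ ∑ j, x.2.1 j z * x.2.1 j z := fun z =>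
    Finset.sum_nonneg fun j _ => mul_self_nonneg _
  have hW : Integrable (fun z => hi z * ∑ j, x.2.1 j z * x.2.1 j z) (volume.restrict Γ.int) := by
    refine hS.bdd_mul (c := max |c| |M|) hm ?_
    filter_upwards [ae_restrict_mem Γ.isOpen_int.measurableSet] with z hz
    exact abs_le_max_abs_abs (hc z hz) (hM z hz)
  rw [e, ← integral_const_mul, ← integral_const_mul]
  refine ⟨setIntegral_mono_on (hS.const_mul c) hW Γ.isOpen_int.measurableSet fun z hz =>
    mul_le_mul_of_nonneg_right (hc z hz) (hpos z), setIntegral_mono_on hW (hS.const_mul M)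
    Γ.isOpen_int.measurableSet fun z hz => mul_le_mul_of_nonneg_right (hM z hz) (hpos z)⟩

/-- The Dirichlet-to-Neumann form is equivalent to `|𝔡_tan ψ|²_{H^{-1/2}}`. -/
theorem exists_dnConstants (Γ : JordanCurve) {c₀ : ℝ} (hc₀ : 0 < c₀) (M : ℝ) :
    ∃ cl cu : ℝ, 0 < cl ∧ cl < cu ∧ ∀ hi : Plane → ℝ, DepthAssumption Γ c₀ hi →
      (∀ x ∈ Γ.int, hi x ≤ M) → IsDNConstants Γ hi cl cu := by
  obtain ⟨δ, hδ⟩ := Γ.exists_tubeRadius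
  obtain ⟨C, hC, hext⟩ := exists_extension Γ
  obtain ⟨C', hC', htr⟩ := hδ.isSide_int.exists_trace_hNorm
  have hcl : 0 < c₀ / C' := by positivity
  -- The lower constant comes from the trace estimate for the harmonic extension, and `max M 0 * C`
  -- from comparing its energy with that of the explicit extension. The last two summands only
  -- ensure that the constants are strictly ordered.
  refine ⟨c₀ / C', max M 0 * C + c₀ / C' + 1, hcl, by
    have : 0 ≤ max M 0 * C := by positivity
    linarith, fun hi hhi hM ψ hψ => ?_⟩
  obtain ⟨Φ, hΦ, hup, hlo⟩ := exists_dn_factorization hc₀ hhi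
  have hM' : ∀ x ∈ Γ.int, hi x ≤ max M 0 := fun x hx => (hM x hx).trans (le_max_left _ _)
  have hb := le_weighted_dirichlet hhi.lower hM' hhi.aestronglyMeasurable
  have e := hΦ ⟨ψ, hψ⟩ ⟨ψ, hψ⟩
  rw [real_inner_self_eq_norm_sq] at e
  change dirichletToNeumann Γ hi ψ ψ = _ at e
  rw [e]
  set N := (hNormTan Γ (-1 / 2) ψ).toReal ^ 2
  have hN : 0 ≤ N := sq_nonneg _
  constructor
  · obtain ⟨x, hx, hxt, hxe⟩ := hlo ⟨ψ, hψ⟩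
    rw [hxe]
    refine le_trans ?_ (hb x).1
    have h1 := (htr x hx).2
    rw [hxt] at h1
    rw [div_mul_eq_mul_div, div_le_iff₀ hC', mul_assoc]
    refine mul_le_mul_of_nonneg_left ?_ hc₀.le
    rw [mul_comm]
    exact h1
  · obtain ⟨x, hx, hxt, hxb⟩ := hext ψ hψ
    refine (hup ⟨ψ, hψ⟩ x hx hxt).trans ((hb x).2.trans ?_)
    have h2 := mul_le_mul_of_nonneg_left hxb (le_max_right M 0)
    refine h2.trans ?_
    change max M 0 * (C * N) ≤ _
    have := mul_nonneg hcl.le hN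
    linarith

end WaveStructure
end

noncomputable section
namespace WaveStructure

/-! ### The symmetrizer -/

section Symmetrizer

variable {gr H₀ c₀ M₀ : ℝ}

lemma state_norm_sq (y : State) : ‖y‖ ^ 2 = y 0 ^ 2 + y 1 ^ 2 + y 2 ^ 2 := by
  rw [EuclideanSpace.norm_sq_eq, Fin.sum_univ_three]
  simp

/-- The action of `Σ(u)` on `ℝ³`. -/
def sigmaOp (gr H₀ : ℝ) (U : State) : State →L[ℝ] State :=
  Matrix.toEuclideanCLM (n := Fin 3) (𝕜 := ℝ) (sigmaMat gr H₀ U)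

/-- The action of `S(u)` on `ℝ³`. -/
def symOp (gr H₀ : ℝ) (U : State) : State →L[ℝ] State :=
  Matrix.toEuclideanCLM (n := Fin 3) (𝕜 := ℝ) (symMat gr H₀ U)

lemma ofLp_sigmaOp (U y : State) : (sigmaOp gr H₀ U y).ofLp = sigmaMat gr H₀ U *ᵥ y.ofLp := rfl

lemma ofLp_symOp (U y : State) : (symOp gr H₀ U y).ofLp = symMat gr H₀ U *ᵥ y.ofLp := rfl

lemma sigmaOp_zero (U y : State) :
    sigmaOp gr H₀ U y 0 = gr * y 0 + U 1 * y 1 + U 2 * y 2 := by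
  rw [ofLp_sigmaOp]
  simp [sigmaMat, Matrix.mulVec, dotProduct, Fin.sum_univ_three]

lemma sigmaOp_one (U y : State) : sigmaOp gr H₀ U y 1 = U 1 * y 0 + (H₀ + U 0) * y 1 := by
  rw [ofLp_sigmaOp]
  simp [sigmaMat, Matrix.mulVec, dotProduct, Fin.sum_univ_three]

lemma sigmaOp_two (U y : State) : sigmaOp gr H₀ U y 2 = U 2 * y 0 + (H₀ + U 0) * y 2 := by
  rw [ofLp_sigmaOp]
  simp [sigmaMat, Matrix.mulVec, dotProduct, Fin.sum_univ_three]

lemma det_sigmaMat (U : State) : (sigmaMat gr H₀ U).det =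
    (H₀ + U 0) * (gr * (H₀ + U 0) - (U 1 ^ 2 + U 2 ^ 2)) := by
  simp [sigmaMat, Matrix.det_fin_three]
  ring

lemma IsSubcritical.depth_pos (hgr : 0 < gr) (hc₀ : 0 < c₀) {U : State}
    (h : IsSubcritical gr H₀ c₀ U) : 0 < H₀ + U 0 := by
  have h1 : c₀ ≤ gr * (H₀ + U 0) - (U 1 ^ 2 + U 2 ^ 2) := h
  by_contra hle
  nlinarith [sq_nonneg (U 1), sq_nonneg (U 2), mul_nonneg hgr.le (sub_nonneg.2 (not_lt.1 hle))]

lemma IsSubcritical.isUnit_det (hgr : 0 < gr) (hc₀ : 0 < c₀) {U : State}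
    (h : IsSubcritical gr H₀ c₀ U) : IsUnit (sigmaMat gr H₀ U).det := by
  rw [det_sigmaMat, isUnit_iff_ne_zero]
  exact (mul_pos (h.depth_pos hgr hc₀) (hc₀.trans_le h)).ne'

lemma IsSubcritical.symOp_sigmaOp (hgr : 0 < gr) (hc₀ : 0 < c₀) {U : State}
    (h : IsSubcritical gr H₀ c₀ U) (y : State) : symOp gr H₀ U (sigmaOp gr H₀ U y) = y := by
  refine WithLp.ofLp_injective 2 ?_
  rw [ofLp_symOp, ofLp_sigmaOp, Matrix.mulVec_mulVec, symMat,
    Matrix.nonsing_inv_mul _ (h.isUnit_det hgr hc₀), Matrix.one_mulVec]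

lemma IsSubcritical.sigmaOp_symOp (hgr : 0 < gr) (hc₀ : 0 < c₀) {U : State}
    (h : IsSubcritical gr H₀ c₀ U) (y : State) : sigmaOp gr H₀ U (symOp gr H₀ U y) = y := by
  refine WithLp.ofLp_injective 2 ?_
  rw [ofLp_sigmaOp, ofLp_symOp, Matrix.mulVec_mulVec, symMat,
    Matrix.mul_nonsing_inv _ (h.isUnit_det hgr hc₀), Matrix.one_mulVec]

lemma dotProduct_eq_inner (x y : State) : x.ofLp ⬝ᵥ y.ofLp = inner ℝ x y := by
  rw [PiLp.inner_apply]
  simp [dotProduct, Fin.sum_univ_three, mul_comm]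

lemma inner_sigmaOp (U y : State) : inner ℝ (sigmaOp gr H₀ U y) y =
    gr * y 0 ^ 2 + 2 * y 0 * (U 1 * y 1 + U 2 * y 2) + (H₀ + U 0) * (y 1 ^ 2 + y 2 ^ 2) := by
  rw [← dotProduct_eq_inner, dotProduct, Fin.sum_univ_three, sigmaOp_zero, sigmaOp_one, sigmaOp_two]
  ring

lemma abs_apply_le_norm (U : State) (i : Fin 3) : |U i| ≤ ‖U‖ := by
  simpa using PiLp.norm_apply_le U i

/-- The coercivity constant of the symmetrizer. -/
def alphaConst (gr H₀ M₀ : ℝ) : ℝ := (gr + H₀ + M₀)⁻¹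

/-- The upper bound of the symmetrizer. -/
def betaConst (gr H₀ c₀ M₀ : ℝ) : ℝ := 2 * (gr + H₀ + M₀) / c₀

lemma alphaConst_pos (hgr : 0 < gr) (hH₀ : 0 < H₀) (hM₀ : 0 ≤ M₀) : 0 < alphaConst gr H₀ M₀ := by
  unfold alphaConst
  positivity

lemma betaConst_pos (hgr : 0 < gr) (hH₀ : 0 < H₀) (hc₀ : 0 < c₀) (hM₀ : 0 ≤ M₀) :
    0 < betaConst gr H₀ c₀ M₀ := by
  unfold betaConst
  positivity

/-- Bounds of the quadratic form of `Σ(u)` in the subcritical case. -/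
lemma IsSubcritical.inner_sigmaOp_bounds (hgr : 0 < gr) (hc₀ : 0 < c₀) {U : State}
    (hU : ‖U‖ ≤ M₀) (h : IsSubcritical gr H₀ c₀ U) (y : State) :
    c₀ * ‖y‖ ^ 2 ≤ 2 * (gr + H₀ + M₀) * inner ℝ (sigmaOp gr H₀ U y) y ∧
      ‖sigmaOp gr H₀ U y‖ ^ 2 ≤ (gr + H₀ + M₀) * inner ℝ (sigmaOp gr H₀ U y) y := by
  have hh := h.depth_pos hgr hc₀
  have hD : c₀ ≤ gr * (H₀ + U 0) - (U 1 ^ 2 + U 2 ^ 2) := h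
  have hU0 := (le_abs_self _).trans ((abs_apply_le_norm U 0).trans hU)
  rw [state_norm_sq, state_norm_sq, sigmaOp_zero, sigmaOp_one, sigmaOp_two, inner_sigmaOp]
  set a := y 0
  set b := y 1
  set c := y 2
  set p := U 1
  set q := U 2
  set k := H₀ + U 0
  set Q := gr * a ^ 2 + 2 * a * (p * b + q * c) + k * (b ^ 2 + c ^ 2) with hQ
  -- Completing squares in two ways. Subcriticality makes both remainders at least c₀ times part of
  -- |y|², so the sum of the identities bounds |y|² by (g + h)Q; the squares in the same sum are
  -- exactly the entries of Σy, which gives the second estimate.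
  have e1 : gr * Q = (gr * a + p * b + q * c) ^ 2 +
      (gr * k - (p ^ 2 + q ^ 2)) * (b ^ 2 + c ^ 2) + (p * c - q * b) ^ 2 := by rw [hQ]; ring
  have e2 : k * Q = (p * a + k * b) ^ 2 + (q * a + k * c) ^ 2 +
      (gr * k - (p ^ 2 + q ^ 2)) * a ^ 2 := by rw [hQ]; ring
  have i1 := mul_le_mul_of_nonneg_right hD (by positivity : 0 ≤ b ^ 2 + c ^ 2)
  have i2 := mul_le_mul_of_nonneg_right hD (sq_nonneg a)
  have hbc : 0 ≤ c₀ * (b ^ 2 + c ^ 2) := by positivity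
  have ha : 0 ≤ c₀ * a ^ 2 := by positivity
  have hQ0 : 0 ≤ Q := by
    by_contra hlt
    have : gr * Q < 0 := mul_neg_of_pos_of_neg hgr (not_le.1 hlt)
    nlinarith [sq_nonneg (gr * a + p * b + q * c), sq_nonneg (p * c - q * b)]
  have hkm : (gr + k) * Q ≤ (gr + H₀ + M₀) * Q := mul_le_mul_of_nonneg_right (by linarith) hQ0
  have hm : 0 ≤ (gr + H₀ + M₀) * Q := mul_nonneg (by linarith) hQ0
  constructor
  · nlinarith [sq_nonneg (gr * a + p * b + q * c), sq_nonneg (p * c - q * b),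
      sq_nonneg (p * a + k * b), sq_nonneg (q * a + k * c)]
  · nlinarith [sq_nonneg (p * c - q * b)]

/-- With y = S(u)w, coercivity of Σ(u) reads c₀|y|² ≤ 2(g+H₀+M₀) w·y; apply Cauchy–Schwarz and
divide by |y|. -/
lemma IsSubcritical.norm_symOp_le (hgr : 0 < gr) (hH₀ : 0 < H₀) (hc₀ : 0 < c₀) {U : State}
    (hU : ‖U‖ ≤ M₀) (h : IsSubcritical gr H₀ c₀ U) : ‖symOp gr H₀ U‖ ≤ betaConst gr H₀ c₀ M₀ := by
  have hM₀ := (norm_nonneg U).trans hU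
  refine ContinuousLinearMap.opNorm_le_bound _ (betaConst_pos hgr hH₀ hc₀ hM₀).le fun w => ?_
  have h1 := (h.inner_sigmaOp_bounds hgr hc₀ hU (symOp gr H₀ U w)).1
  rw [h.sigmaOp_symOp hgr hc₀] at h1
  have h2 := real_inner_le_norm w (symOp gr H₀ U w)
  rw [betaConst, div_mul_eq_mul_div, le_div_iff₀ hc₀]
  by_cases h0 : ‖symOp gr H₀ U w‖ = 0
  · rw [h0, zero_mul]
    positivity
  · have h3 : 0 < ‖symOp gr H₀ U w‖ := lt_of_le_of_ne (norm_nonneg _) (Ne.symm h0)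
    have h4 := mul_le_mul_of_nonneg_left h2 (by positivity : 0 ≤ 2 * (gr + H₀ + M₀))
    refine le_of_mul_le_mul_right ?_ h3
    linarith

lemma sigmaMat_isSymm (U : State) : (sigmaMat gr H₀ U).IsSymm := by
  ext i j
  fin_cases i <;> fin_cases j <;> rfl

lemma gMat_isSymm (j : Fin 2) : (gMat j).IsSymm := by
  ext i k
  fin_cases j <;> fin_cases i <;> fin_cases k <;> simp [gMat]

/-- `S(u)` is a symmetrizer. -/
theorem IsSubcritical.isSymmetrizer (hgr : 0 < gr) (hH₀ : 0 < H₀) (hc₀ : 0 < c₀) {U : State}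
    (hU : ‖U‖ ≤ M₀) (h : IsSubcritical gr H₀ c₀ U) :
    IsSymmetrizer (symMat gr H₀ U) (fun j => sigmaMat gr H₀ U * gMat j)
      (alphaConst gr H₀ M₀) (betaConst gr H₀ c₀ M₀) where
  symm := by
    rw [Matrix.IsSymm, symMat, Matrix.transpose_nonsing_inv, (sigmaMat_isSymm U).eq]
  symm_mul j := by
    -- S(u)Σ(u)G_j is just G_j.
    rw [symMat, Matrix.nonsing_inv_mul_cancel_left _ _ (h.isUnit_det hgr hc₀)]
    exact gMat_isSymm j
  lower w := by
    have hM₀ := (norm_nonneg U).trans hU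
    -- Coercivity of the inverse is the upper bound |Σy|² ≤ (g+H₀+M₀) Σy·y at y = S(u)w.
    have h1 := (h.inner_sigmaOp_bounds hgr hc₀ hU (symOp gr H₀ U w)).2
    rw [h.sigmaOp_symOp hgr hc₀] at h1
    rw [← ofLp_symOp, dotProduct_eq_inner, alphaConst, inv_mul_le_iff₀ (by positivity)]
    exact h1
  upper w := by
    rw [← ofLp_symOp, dotProduct_eq_inner]
    calc inner ℝ w (symOp gr H₀ U w) ≤ ‖w‖ * ‖symOp gr H₀ U w‖ := real_inner_le_norm _ _
      _ ≤ ‖w‖ * (betaConst gr H₀ c₀ M₀ * ‖w‖) := mul_le_mul_of_nonneg_left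
        ((symOp gr H₀ U).le_of_opNorm_le (h.norm_symOp_le hgr hH₀ hc₀ hU) w) (norm_nonneg _)
      _ = _ := by ring

/-- Σ is affine in the state, so gravity and reference depth cancel in the difference and a
quadratic inequality in the differences of the components remains. -/
lemma norm_sigmaOp_sub_le (U U' y : State) :
    ‖sigmaOp gr H₀ U y - sigmaOp gr H₀ U' y‖ ≤ 2 * ‖U - U'‖ * ‖y‖ := by
  refine abs_le_of_sq_le_sq' ?_ (by positivity) |>.2
  rw [mul_pow, mul_pow, state_norm_sq, state_norm_sq, state_norm_sq]
  simp only [PiLp.sub_apply, sigmaOp_zero, sigmaOp_one, sigmaOp_two]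
  generalize y 0 = a, y 1 = b, y 2 = c
  have e0 : U 0 = U' 0 + (U 0 - U' 0) := by ring
  have e1 : U 1 = U' 1 + (U 1 - U' 1) := by ring
  have e2 : U 2 = U' 2 + (U 2 - U' 2) := by ring
  generalize U 0 - U' 0 = z at *
  generalize U 1 - U' 1 = p at *
  generalize U 2 - U' 2 = q at *
  rw [e0, e1, e2]
  have : (gr * a + (U' 1 + p) * b + (U' 2 + q) * c - (gr * a + U' 1 * b + U' 2 * c)) ^ 2 +
      ((U' 1 + p) * a + (H₀ + (U' 0 + z)) * b - (U' 1 * a + (H₀ + U' 0) * b)) ^ 2 +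
      ((U' 2 + q) * a + (H₀ + (U' 0 + z)) * c - (U' 2 * a + (H₀ + U' 0) * c)) ^ 2 =
      (p * b + q * c) ^ 2 + (p * a + z * b) ^ 2 + (q * a + z * c) ^ 2 := by ring
  rw [this]
  nlinarith [sq_nonneg (p * c - q * b), sq_nonneg (p * a - z * b), sq_nonneg (q * a - z * c),
    sq_nonneg (z * a), sq_nonneg (z * b), sq_nonneg (z * c), sq_nonneg (p * a), sq_nonneg (p * b),
    sq_nonneg (p * c), sq_nonneg (q * a), sq_nonneg (q * b), sq_nonneg (q * c)]

/-- The symmetrizer is a Lipschitz function of the state. -/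
lemma norm_symOp_sub_le (hgr : 0 < gr) (hH₀ : 0 < H₀) (hc₀ : 0 < c₀) {U U' : State}
    (hU : ‖U‖ ≤ M₀) (hU' : ‖U'‖ ≤ M₀) (h : IsSubcritical gr H₀ c₀ U)
    (h' : IsSubcritical gr H₀ c₀ U') : ‖symOp gr H₀ U - symOp gr H₀ U'‖ ≤
      2 * betaConst gr H₀ c₀ M₀ ^ 2 * ‖U - U'‖ := by
  have hβ := (betaConst_pos hgr hH₀ hc₀ ((norm_nonneg U).trans hU)).le
  refine ContinuousLinearMap.opNorm_le_bound _ (by positivity) fun w => ?_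
  set y := symOp gr H₀ U' w
  -- Resolvent identity: S - S' = S(Σ' - Σ)S'.
  have e : (symOp gr H₀ U - symOp gr H₀ U') w =
      symOp gr H₀ U (sigmaOp gr H₀ U' y - sigmaOp gr H₀ U y) := by
    rw [_root_.sub_apply, map_sub, h.symOp_sigmaOp hgr hc₀, h'.sigmaOp_symOp hgr hc₀]
  rw [e]
  have h1 := (symOp gr H₀ U).le_of_opNorm_le (h.norm_symOp_le hgr hH₀ hc₀ hU)
    (sigmaOp gr H₀ U' y - sigmaOp gr H₀ U y)
  have h2 := norm_sigmaOp_sub_le (gr := gr) (H₀ := H₀) U' U y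
  have h3 := (symOp gr H₀ U').le_of_opNorm_le (h'.norm_symOp_le hgr hH₀ hc₀ hU') w
  rw [norm_sub_rev U' U] at h2
  calc _ ≤ _ := h1
    _ ≤ betaConst gr H₀ c₀ M₀ * (2 * ‖U - U'‖ * (betaConst gr H₀ c₀ M₀ * ‖w‖)) :=
      mul_le_mul_of_nonneg_left (h2.trans (mul_le_mul_of_nonneg_left h3 (by positivity))) hβ
    _ = _ := by ring

lemma continuous_sigmaMat : Continuous fun U : State => sigmaMat gr H₀ U := by
  refine continuous_matrix fun i j => ?_
  fin_cases i <;> fin_cases j <;> simp [sigmaMat] <;> fun_prop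

/-- By Cramer's rule the inverse is the adjugate over the determinant. The reciprocal of a
continuous function is measurable even where the determinant vanishes. -/
lemma stronglyMeasurable_symOp : StronglyMeasurable fun U : State => symOp gr H₀ U := by
  let L : Matrix (Fin 3) (Fin 3) ℝ →ₗ[ℝ] (State →L[ℝ] State) :=
    (Matrix.toEuclideanCLM (n := Fin 3) (𝕜 := ℝ)).toAlgEquiv.toLinearMap
  have hL : Continuous L := L.continuous_of_finiteDimensional
  have e : (fun U : State => symOp gr H₀ U) = fun U => (sigmaMat gr H₀ U).det⁻¹ •
      L (sigmaMat gr H₀ U).adjugate := by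
    funext U
    rw [← map_smul, ← Ring.inverse_eq_inv', ← Matrix.inv_def]
    rfl
  rw [e]
  have hd : Continuous fun U : State => (sigmaMat gr H₀ U).det := continuous_sigmaMat.matrix_det
  exact (hd.measurable.inv.stronglyMeasurable).smul
    (hL.comp continuous_sigmaMat.matrix_adjugate).stronglyMeasurable

end Symmetrizer

end WaveStructure
end

noncomputable section
namespace WaveStructure

/-! ### The symmetrizer as a family of operators -/

lemma ae_ae_of_ae_prod_swap {α β : Type*} [MeasurableSpace α] [MeasurableSpace β] {μ : Measure α}
    {ν : Measure β} [SFinite μ] [SFinite ν] {p : α × β → Prop} (h : ∀ᵐ z ∂(μ.prod ν), p z) :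
    ∀ᵐ y ∂ν, ∀ᵐ x ∂μ, p (x, y) :=
  Measure.ae_ae_of_ae_prod
    ((Measure.measurePreserving_swap (μ := ν) (ν := μ)).quasiMeasurePreserving.ae h)

/-- By continuity the bad times in the open interval form an open set; being null it is empty. The
endpoints follow by taking closures. -/
lemma mem_of_ae_mem_Ioo {X : Type*} [TopologicalSpace X] {T : ℝ} (hT : 0 < T) {v : ℝ → X}
    (hv : ContinuousOn v (Icc 0 T)) {C : Set X} (hC : IsClosed C)
    (h : ∀ᵐ t ∂(volume.restrict (Ioo 0 T)), v t ∈ C) : ∀ t ∈ Icc 0 T, v t ∈ C := by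
  have hopen : IsOpen (Ioo 0 T ∩ v ⁻¹' Cᶜ) :=
    (hv.mono Ioo_subset_Icc_self).isOpen_inter_preimage isOpen_Ioo hC.isOpen_compl
  have hmeas : volume (Ioo 0 T ∩ v ⁻¹' Cᶜ) = 0 := by
    rw [ae_restrict_iff' measurableSet_Ioo, ae_iff] at h
    refine measure_mono_null (fun t ht => ?_) h
    exact fun hc => ht.2 (hc ht.1)
  rw [hopen.measure_eq_zero_iff volume] at hmeas
  have hmaps : MapsTo v (Ioo 0 T) C := fun t ht => by
    by_contra hc
    have : t ∈ Ioo 0 T ∩ v ⁻¹' Cᶜ := ⟨ht, hc⟩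
    rw [hmeas] at this
    exact this
  intro t ht
  have h1 := ((hv t ht).mono Ioo_subset_Icc_self).mem_closure
    (by rwa [closure_Ioo hT.ne]) hmaps
  rwa [hC.closure_eq] at h1

section Background

variable {Γ : JordanCurve} {gr H₀ c₀ M₀ M₁ T : ℝ} {u ut : ℝ → Plane → State}

/-- The background state is Lipschitz continuous in time. -/
lemma BackgroundState.ae_lipschitz (h : BackgroundState Γ gr H₀ c₀ M₀ M₁ T u ut) :
    ∀ᵐ x ∂(volume.restrict Γ.ext), ∀ t ∈ Icc 0 T, ∀ t' ∈ Icc 0 T,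
      ‖u t x - u t' x‖ ≤ M₁ * |t - t'| := by
  have hm : ∀ᵐ x ∂(volume.restrict Γ.ext),
      AEStronglyMeasurable (fun t => ut t x) (volume.restrict (Ioo 0 T)) :=
    (h.meas_dt.comp_quasiMeasurePreserving
      (Measure.measurePreserving_swap (μ := volume.restrict Γ.ext)
        (ν := volume.restrict (Ioo 0 T))).quasiMeasurePreserving).prodMk_left
  filter_upwards [h.hasDeriv, ae_ae_of_ae_prod_swap h.bound_dt, hm] with x hx hb hmx
  have hb' : ∀ᵐ t ∂(volume.restrict (Ioc 0 T)), ‖ut t x‖ ≤ M₁ := by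
    rwa [Measure.restrict_congr_set Ioo_ae_eq_Ioc] at hb
  rw [Measure.restrict_congr_set Ioo_ae_eq_Ioc] at hmx
  have hint : ∀ t ∈ Icc 0 T, IntervalIntegrable (fun t => ut t x) volume 0 t := fun t ht => by
    rw [intervalIntegrable_iff_integrableOn_Ioc_of_le ht.1]
    have : IntegrableOn (fun t => ut t x) (Ioc 0 T) :=
      Integrable.of_bound (by simpa using hmx) M₁ hb'
    exact this.mono_set (Ioc_subset_Ioc_right ht.2)
  intro t ht t' ht'
  rw [hx t ht, hx t' ht', add_sub_add_left_eq_sub,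
    intervalIntegral.integral_interval_sub_left (hint t ht) (hint t' ht')]
  refine intervalIntegral.norm_integral_le_of_norm_le_const_ae ?_
  rw [ae_restrict_iff' measurableSet_Ioc] at hb'
  filter_upwards [hb'] with s hs hst
  refine hs ⟨?_, ?_⟩
  · exact lt_of_le_of_lt (le_min ht'.1 ht.1) hst.1
  · exact hst.2.trans (max_le ht'.2 ht.2)

lemma BackgroundState.ae_continuousOn (h : BackgroundState Γ gr H₀ c₀ M₀ M₁ T u ut)
    (hM₁ : 0 ≤ M₁) :
    ∀ᵐ x ∂(volume.restrict Γ.ext), ContinuousOn (fun t => u t x) (Icc 0 T) := by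
  filter_upwards [h.ae_lipschitz] with x hx
  refine LipschitzOnWith.continuousOn (K := M₁.toNNReal) (LipschitzOnWith.of_dist_le_mul ?_)
  intro t ht t' ht'
  rw [dist_eq_norm, Real.dist_eq, Real.coe_toNNReal _ hM₁]
  exact hx t ht t' ht'

/-- The bounds hold almost everywhere in space-time, while the symmetrizer is needed at every time.
Fubini puts the exceptional set in space alone, and continuity in time removes the exceptional
times. -/
lemma BackgroundState.ae_bounds (h : BackgroundState Γ gr H₀ c₀ M₀ M₁ T u ut) (hT : 0 < T)
    (hM₁ : 0 ≤ M₁) : ∀ᵐ x ∂(volume.restrict Γ.ext), ∀ t ∈ Icc 0 T,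
      ‖u t x‖ ≤ M₀ ∧ IsSubcritical gr H₀ c₀ (u t x) := by
  filter_upwards [h.ae_continuousOn hM₁, ae_ae_of_ae_prod_swap h.bound,
    ae_ae_of_ae_prod_swap h.subcritical] with x hx h1 h2
  have hC : IsClosed {U : State | ‖U‖ ≤ M₀ ∧ IsSubcritical gr H₀ c₀ U} := by
    refine IsClosed.inter (isClosed_le continuous_norm continuous_const) ?_
    have hc : Continuous fun U : State => gr * (H₀ + U 0) - (U 1 ^ 2 + U 2 ^ 2) := by fun_prop
    exact isClosed_le continuous_const hc
  exact mem_of_ae_mem_Ioo hT hx hC (h1.and h2)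

/-- Almost every time slice is measurable, hence a dense set of them; by continuity in time an
arbitrary slice is an almost everywhere limit of such slices. -/
lemma BackgroundState.aestronglyMeasurable (h : BackgroundState Γ gr H₀ c₀ M₀ M₁ T u ut)
    (hT : 0 < T) (hM₁ : 0 ≤ M₁) {t : ℝ} (ht : t ∈ Icc 0 T) :
    AEStronglyMeasurable (u t) (volume.restrict Γ.ext) := by
  have hm : ∀ᵐ t ∂(volume.restrict (Ioo 0 T)),
      AEStronglyMeasurable (u t) (volume.restrict Γ.ext) := h.meas.prodMk_left
  have hcl : t ∈ closure {s | s ∈ Ioo 0 T ∧ AEStronglyMeasurable (u s) (volume.restrict Γ.ext)} :=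
    mem_of_ae_mem_Ioo hT (v := fun t => t) continuousOn_id isClosed_closure (by
      filter_upwards [hm, ae_restrict_mem measurableSet_Ioo] with s hs hs'
      exact subset_closure ⟨hs', hs⟩) t ht
  obtain ⟨s, hs, hlim⟩ := mem_closure_iff_seq_limit.1 hcl
  refine aestronglyMeasurable_of_tendsto_ae atTop (fun n => (hs n).2) ?_
  filter_upwards [h.ae_continuousOn hM₁] with x hx
  exact (hx t ht).tendsto.comp (tendsto_nhdsWithin_iff.2
    ⟨hlim, Eventually.of_forall fun n => Ioo_subset_Icc_self (hs n).1⟩)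

/-- The symmetrizer as a Lipschitz family of operators on `L²(𝓔)`. -/
theorem BackgroundState.exists_symmetrizer (h : BackgroundState Γ gr H₀ c₀ M₀ M₁ T u ut)
    (hgr : 0 < gr) (hH₀ : 0 < H₀) (hc₀ : 0 < c₀) (hM₀ : 0 ≤ M₀) (hT : 0 < T) :
    ∃ 𝒮 : ℝ → L2 Γ.ext State →L[ℝ] L2 Γ.ext State,
      (∀ t ∈ Icc 0 T, ‖𝒮 t‖ ≤ betaConst gr H₀ c₀ M₀) ∧
      (∀ t ∈ Icc 0 T, ∀ t' ∈ Icc 0 T,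
        ‖𝒮 t - 𝒮 t'‖ ≤ 2 * betaConst gr H₀ c₀ M₀ ^ 2 * M₁ * |t - t'|) ∧
      ∀ t ∈ Icc 0 T, ∀ f : L2 Γ.ext State,
        𝒮 t f =ᵐ[volume.restrict Γ.ext] fun x => symOp gr H₀ (u t x) (f x) := by
  have hM₁ : 0 ≤ M₁ := hM₀.trans h.bound_le
  have hb := h.ae_bounds hT hM₁
  have hβ := betaConst_pos hgr hH₀ hc₀ hM₀
  -- Outside [0,T] the family is set to 0; no property is claimed there.
  have hex : ∀ t, ∃ S : L2 Γ.ext State →L[ℝ] L2 Γ.ext State, t ∈ Icc 0 T →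
      ‖S‖ ≤ betaConst gr H₀ c₀ M₀ ∧
      ∀ f : L2 Γ.ext State, S f =ᵐ[volume.restrict Γ.ext] fun x => symOp gr H₀ (u t x) (f x) := by
    intro t
    by_cases ht : t ∈ Icc 0 T
    · obtain ⟨S, hS⟩ := exists_mulOp (F := State) (G := State)
        (A := fun x => symOp gr H₀ (u t x)) (μ := volume.restrict Γ.ext)
        (stronglyMeasurable_symOp.aestronglyMeasurable.comp_aemeasurable
          (h.aestronglyMeasurable hT hM₁ ht).aemeasurable) hβ.le
        (hb.mono fun x hx => (hx t ht).2.norm_symOp_le hgr hH₀ hc₀ (hx t ht).1)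
      exact ⟨S, fun _ => hS⟩
    · exact ⟨0, fun h => absurd h ht⟩
  choose 𝒮 h𝒮 using hex
  refine ⟨𝒮, fun t ht => (h𝒮 t ht).1, fun t ht t' ht' => ?_, fun t ht => (h𝒮 t ht).2⟩
  refine ContinuousLinearMap.opNorm_le_bound _ (by positivity) fun f => ?_
  refine Lp.norm_le_mul_norm_of_ae_le_mul ?_
  rw [_root_.sub_apply]
  filter_upwards [(h𝒮 t ht).2 f, (h𝒮 t' ht').2 f, hb, h.ae_lipschitz,
    Lp.coeFn_sub (𝒮 t f) (𝒮 t' f)] with x h1 h2 hx hl h3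
  rw [h3, Pi.sub_apply, h1, h2, ← _root_.sub_apply]
  refine ContinuousLinearMap.le_of_opNorm_le _ ?_ _
  refine (norm_symOp_sub_le hgr hH₀ hc₀ (hx t ht).1 (hx t' ht').1 (hx t ht).2 (hx t' ht').2).trans ?_
  rw [mul_assoc _ M₁]
  exact mul_le_mul_of_nonneg_left (hl t ht t' ht') (by positivity)

end Background

end WaveStructure
end

noncomputable section
namespace WaveStructure

/-! ### Weighted norms in time -/

section TimeNorms

variable {lam t : ℝ}

lemma l2Norm_sq (lam t : ℝ) (f : ℝ → ℝ≥0∞) : l2Norm lam t f ^ 2 =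
    ∫⁻ τ in Icc 0 t, ENNReal.ofReal (Real.exp (-2 * lam * τ)) * f τ ^ 2 := by
  rw [l2Norm, ← ENNReal.rpow_natCast, ← ENNReal.rpow_mul]
  norm_num

lemma l2Norm_mono {t' : ℝ} (h : t ≤ t') (f : ℝ → ℝ≥0∞) : l2Norm lam t f ≤ l2Norm lam t' f :=
  ENNReal.rpow_le_rpow (lintegral_mono_set (Icc_subset_Icc_right h)) (by norm_num)

lemma l2Norm_congr {f g : ℝ → ℝ≥0∞} (h : ∀ τ ∈ Icc 0 t, f τ = g τ) :
    l2Norm lam t f = l2Norm lam t g := by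
  simp only [l2Norm]
  rw [setLIntegral_congr_fun measurableSet_Icc fun τ hτ => by rw [h τ hτ]]

lemma exp_sq (lam τ : ℝ) : Real.exp (-lam * τ) ^ 2 = Real.exp (-2 * lam * τ) := by
  rw [sq, ← Real.exp_add]
  congr 1
  ring

lemma iNorm_congr {φ χ : ℝ → ℝ} (h : ∀ τ ∈ Icc 0 t, φ τ = χ τ) :
    iNorm lam t φ = iNorm lam t χ := by
  have h1 : l2Norm lam t (fun τ => ENNReal.ofReal |φ τ|) =
      l2Norm lam t (fun τ => ENNReal.ofReal |χ τ|) := l2Norm_congr fun τ hτ => by rw [h τ hτ]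
  rw [iNorm, iNorm, h1]
  congr 1
  exact iSup_congr fun τ => iSup_congr fun hτ => by rw [h τ hτ]

lemma iNorm_const_mul_le (c : ℝ) (φ : ℝ → ℝ) :
    iNorm lam t (fun τ => c * φ τ) ≤ ENNReal.ofReal |c| * iNorm lam t φ := by
  have h1 : l2Norm lam t (fun τ => ENNReal.ofReal |c * φ τ|) =
      ENNReal.ofReal |c| * l2Norm lam t (fun τ => ENNReal.ofReal |φ τ|) := by
    have e : l2Norm lam t (fun τ => ENNReal.ofReal |c * φ τ|) ^ 2 =
        (ENNReal.ofReal |c| * l2Norm lam t (fun τ => ENNReal.ofReal |φ τ|)) ^ 2 := by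
      rw [mul_pow, l2Norm_sq, l2Norm_sq, ← lintegral_const_mul' _ _ (by finiteness)]
      refine lintegral_congr fun τ => ?_
      rw [abs_mul, ENNReal.ofReal_mul (abs_nonneg _)]
      ring
    exact (ENNReal.pow_right_strictMono two_ne_zero).injective e
  rw [iNorm, iNorm, h1, mul_add]
  refine add_le_add (iSup₂_le fun τ hτ => ?_) (le_of_eq (by ring))
  calc ENNReal.ofReal (Real.exp (-lam * τ) * |c * φ τ|)
      = ENNReal.ofReal |c| * ENNReal.ofReal (Real.exp (-lam * τ) * |φ τ|) := by
        rw [← ENNReal.ofReal_mul (abs_nonneg _), abs_mul]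
        congr 1
        ring
    _ ≤ _ := mul_le_mul_right (le_iSup₂ (f := fun τ (_ : τ ∈ Icc 0 t) =>
        ENNReal.ofReal (Real.exp (-lam * τ) * |φ τ|)) τ hτ) _

lemma le_iNorm (φ : ℝ → ℝ) {τ : ℝ} (hτ : τ ∈ Icc 0 t) :
    ENNReal.ofReal (Real.exp (-lam * τ) * |φ τ|) ≤ iNorm lam t φ :=
  (le_iSup₂ (f := fun τ (_ : τ ∈ Icc 0 t) =>
    ENNReal.ofReal (Real.exp (-lam * τ) * |φ τ|)) τ hτ).trans le_self_add

lemma ofReal_mul_l2Norm_sq_le (hlam : 0 ≤ lam) (φ : ℝ → ℝ) :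
    ENNReal.ofReal lam * l2Norm lam t (fun τ => ENNReal.ofReal |φ τ|) ^ 2 ≤ iNorm lam t φ ^ 2 := by
  have h : ENNReal.ofReal (Real.sqrt lam) * l2Norm lam t (fun τ => ENNReal.ofReal |φ τ|) ≤
      iNorm lam t φ := le_add_self
  calc _ = (ENNReal.ofReal (Real.sqrt lam) * l2Norm lam t (fun τ => ENNReal.ofReal |φ τ|)) ^ 2 := by
        rw [mul_pow, ← ENNReal.ofReal_pow (Real.sqrt_nonneg _), Real.sq_sqrt hlam]
    _ ≤ _ := pow_le_pow_left' h 2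

/-- The duality inequality. -/
lemma lintegral_le_sStar_mul_iNorm {f φ : ℝ → ℝ} (hφ : Measurable φ) (hfin : iNorm lam t φ ≠ ⊤) :
    ∫⁻ τ in Icc 0 t, ENNReal.ofReal (Real.exp (-2 * lam * τ) * |f τ * φ τ|) ≤
      sStar lam t f * iNorm lam t φ := by
  -- If I(φ) = 0 then φ vanishes on [0,t]; otherwise φ/I(φ) is admissible in the supremum.
  by_cases h0 : iNorm lam t φ = 0
  · have hz : ∀ τ ∈ Icc 0 t, φ τ = 0 := fun τ hτ => by
      have h1 := le_iNorm (lam := lam) φ hτ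
      rw [h0, nonpos_iff_eq_zero, ENNReal.ofReal_eq_zero] at h1
      have h2 : |φ τ| ≤ 0 := by
        by_contra hlt
        exact absurd h1 (not_le.2 (mul_pos (Real.exp_pos _) (not_le.1 hlt)))
      exact abs_eq_zero.1 (le_antisymm h2 (abs_nonneg _))
    rw [setLIntegral_congr_fun measurableSet_Icc (g := fun _ => 0) fun τ hτ => by simp [hz τ hτ]]
    simp
  set I := (iNorm lam t φ).toReal
  have hI : 0 < I := ENNReal.toReal_pos h0 hfin
  have hIe : iNorm lam t φ = ENNReal.ofReal I := (ENNReal.ofReal_toReal hfin).symm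
  have h1 : iNorm lam t (fun τ => I⁻¹ * φ τ) ≤ 1 := by
    refine (iNorm_const_mul_le _ _).trans ?_
    rw [hIe, ← ENNReal.ofReal_mul (abs_nonneg _), abs_of_pos (inv_pos.2 hI),
      inv_mul_cancel₀ hI.ne', ENNReal.ofReal_one]
  have h2 : ∫⁻ τ in Icc 0 t, ENNReal.ofReal (Real.exp (-2 * lam * τ) * |f τ * (I⁻¹ * φ τ)|) ≤
      sStar lam t f :=
    le_iSup_of_le (fun τ => I⁻¹ * φ τ) (le_iSup_of_le (hφ.const_mul _)
      (le_iSup_of_le h1 le_rfl))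
  have h3 : ∫⁻ τ in Icc 0 t, ENNReal.ofReal (Real.exp (-2 * lam * τ) * |f τ * φ τ|) =
      (∫⁻ τ in Icc 0 t, ENNReal.ofReal (Real.exp (-2 * lam * τ) * |f τ * (I⁻¹ * φ τ)|)) *
        ENNReal.ofReal I := by
    rw [← lintegral_mul_const' _ _ (by finiteness)]
    refine lintegral_congr fun τ => ?_
    rw [← ENNReal.ofReal_mul (by positivity)]
    congr 1
    rw [mul_left_comm (f τ), abs_mul I⁻¹, abs_of_pos (inv_pos.2 hI)]
    field_simp
  rw [h3, hIe]
  exact mul_le_mul_left h2 _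

lemma sStar_mono {f g : ℝ → ℝ} (h : ∀ᵐ τ ∂(volume.restrict (Icc 0 t)), |f τ| ≤ |g τ|) :
    sStar lam t f ≤ sStar lam t g := by
  refine iSup_mono fun φ => iSup_mono fun _ => iSup_mono fun _ => lintegral_mono_ae ?_
  filter_upwards [h] with τ hτ
  refine ENNReal.ofReal_le_ofReal (mul_le_mul_of_nonneg_left ?_ (Real.exp_pos _).le)
  rw [abs_mul, abs_mul]
  exact mul_le_mul_of_nonneg_right hτ (abs_nonneg _)

/-- A test function on [0,t] is extended by zero to the longer interval; this does not increase I
and leaves the integral unchanged on [0,t]. -/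
lemma sStar_mono_time {t' : ℝ} (h : t ≤ t') (f : ℝ → ℝ) : sStar lam t f ≤ sStar lam t' f := by
  refine iSup_le fun φ => iSup_le fun hφ => iSup_le fun hφ1 => ?_
  let χ : ℝ → ℝ := (Icc 0 t).indicator φ
  have hχ : Measurable χ := hφ.indicator measurableSet_Icc
  have e1 : ∀ τ ∈ Icc 0 t, χ τ = φ τ := fun τ hτ => indicator_of_mem hτ φ
  have e0 : ∀ τ, τ ∉ Icc 0 t → χ τ = 0 := fun τ hτ => indicator_of_notMem hτ φ
  have hl2 : l2Norm lam t' (fun τ => ENNReal.ofReal |χ τ|) ≤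
      l2Norm lam t (fun τ => ENNReal.ofReal |φ τ|) := by
    refine ENNReal.rpow_le_rpow ?_ (by norm_num)
    rw [← lintegral_indicator measurableSet_Icc, ← lintegral_indicator measurableSet_Icc]
    refine lintegral_mono fun τ => ?_
    by_cases hτ : τ ∈ Icc 0 t
    · simp only [indicator_of_mem hτ, indicator_of_mem (Icc_subset_Icc_right h hτ), e1 τ hτ, le_refl]
    · rw [indicator_of_notMem hτ]
      refine le_of_eq ?_
      rw [indicator_apply_eq_zero]
      intro _
      simp [e0 τ hτ]
  have hI : iNorm lam t' χ ≤ 1 := by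
    refine le_trans (add_le_add (iSup₂_le fun τ _ => ?_) (mul_le_mul_right hl2 _)) hφ1
    by_cases hτ : τ ∈ Icc 0 t
    · rw [e1 τ hτ]
      exact le_iSup₂ (f := fun τ (_ : τ ∈ Icc 0 t) =>
        ENNReal.ofReal (Real.exp (-lam * τ) * |φ τ|)) τ hτ
    · simp [e0 τ hτ]
  refine le_trans ?_ (le_iSup_of_le χ (le_iSup_of_le hχ (le_iSup_of_le hI le_rfl)))
  rw [setLIntegral_congr_fun measurableSet_Icc
    (g := fun τ => ENNReal.ofReal (Real.exp (-2 * lam * τ) * |f τ * χ τ|)) fun τ hτ => by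
      simp only [e1 τ hτ]]
  exact lintegral_mono_set (Icc_subset_Icc_right h)

/-- The supremum part of I ≤ 1 bounds e^{-λτ}|φ(τ)| by 1 pointwise, so the integrand is at most C.
-/
lemma sStar_lt_top (hlam : 0 ≤ lam) {f : ℝ → ℝ} {C : ℝ}
    (hf : ∀ᵐ τ ∂(volume.restrict (Icc 0 t)), |f τ| ≤ C) : sStar lam t f < ⊤ := by
  have hle : sStar lam t f ≤ ∫⁻ _τ in Icc 0 t, ENNReal.ofReal C := by
    refine iSup_le fun φ => iSup_le fun _ => iSup_le fun hφ => lintegral_mono_ae ?_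
    filter_upwards [hf, ae_restrict_mem measurableSet_Icc] with τ h1 h2
    have h3 := (le_iNorm (lam := lam) φ h2).trans hφ
    rw [ENNReal.ofReal_le_one] at h3
    have h4 : Real.exp (-lam * τ) ≤ 1 := by
      rw [Real.exp_le_one_iff]
      nlinarith [mul_nonneg hlam h2.1]
    refine ENNReal.ofReal_le_ofReal ?_
    rw [← exp_sq, abs_mul]
    have hpos := Real.exp_pos (-lam * τ)
    calc Real.exp (-lam * τ) ^ 2 * (|f τ| * |φ τ|)
        = Real.exp (-lam * τ) * |f τ| * (Real.exp (-lam * τ) * |φ τ|) := by ring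
      _ ≤ Real.exp (-lam * τ) * |f τ| * 1 := mul_le_mul_of_nonneg_left h3 (by positivity)
      _ ≤ 1 * C * 1 := by
        refine mul_le_mul_of_nonneg_right (mul_le_mul h4 h1 (abs_nonneg _) zero_le_one) zero_le_one
      _ = C := by ring
  refine hle.trans_lt ?_
  rw [setLIntegral_const]
  exact ENNReal.mul_lt_top ENNReal.ofReal_lt_top (by simp)

lemma continuousOn_weight {φ : ℝ → ℝ} {s : Set ℝ} (hφ : ContinuousOn φ s) :
    ContinuousOn (fun τ => Real.exp (-2 * lam * τ) * φ τ) s :=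
  (Continuous.continuousOn (by fun_prop)).mul hφ

lemma intervalIntegrable_weight (ht : 0 ≤ t) {φ : ℝ → ℝ} (hφ : ContinuousOn φ (Icc 0 t)) :
    IntervalIntegrable (fun τ => Real.exp (-2 * lam * τ) * φ τ) volume 0 t :=
  (continuousOn_weight hφ).intervalIntegrable_of_Icc ht

lemma l2Norm_sq_eq (ht : 0 ≤ t) {φ : ℝ → ℝ} (hφ : ContinuousOn φ (Icc 0 t)) :
    l2Norm lam t (fun τ => ENNReal.ofReal |φ τ|) ^ 2 =
      ENNReal.ofReal (∫ τ in (0 : ℝ)..t, Real.exp (-2 * lam * τ) * φ τ ^ 2) := by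
  rw [l2Norm_sq, intervalIntegral.integral_of_le ht, ← integral_Icc_eq_integral_Ioc,
    ofReal_integral_eq_lintegral_ofReal]
  · refine lintegral_congr fun τ => ?_
    rw [← ENNReal.ofReal_pow (abs_nonneg _), sq_abs, ENNReal.ofReal_mul (Real.exp_pos _).le]
  · exact (continuousOn_weight (hφ.pow 2)).integrableOn_Icc
  · exact Eventually.of_forall fun τ => by positivity

lemma iNorm_sq_le (hlam : 0 ≤ lam) (ht : 0 ≤ t) {φ : ℝ → ℝ}
    (hφ : ContinuousOn φ (Icc 0 t)) {A B : ℝ} (hA : ∀ τ ∈ Icc 0 t, Real.exp (-2 * lam * τ) * φ τ ^ 2 ≤ A)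
    (hB : lam * ∫ τ in (0 : ℝ)..t, Real.exp (-2 * lam * τ) * φ τ ^ 2 ≤ B) :
    iNorm lam t φ < ⊤ ∧ (iNorm lam t φ).toReal ^ 2 ≤ 2 * A + 2 * B := by
  have hA0 : 0 ≤ A := le_trans (by positivity) (hA 0 (left_mem_Icc.2 ht))
  have hint : 0 ≤ ∫ τ in (0 : ℝ)..t, Real.exp (-2 * lam * τ) * φ τ ^ 2 :=
    intervalIntegral.integral_nonneg ht fun τ _ => by positivity
  have hB0 : 0 ≤ B := le_trans (mul_nonneg hlam hint) hB
  have h1 : ⨆ τ ∈ Icc 0 t, ENNReal.ofReal (Real.exp (-lam * τ) * |φ τ|) ≤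
      ENNReal.ofReal (Real.sqrt A) := by
    refine iSup₂_le fun τ hτ => ENNReal.ofReal_le_ofReal (Real.le_sqrt_of_sq_le ?_)
    rw [mul_pow, exp_sq, sq_abs]
    exact hA τ hτ
  have h2 : ENNReal.ofReal (Real.sqrt lam) * l2Norm lam t (fun τ => ENNReal.ofReal |φ τ|) ≤
      ENNReal.ofReal (Real.sqrt B) := by
    rw [← ENNReal.pow_le_pow_left_iff two_ne_zero, mul_pow, l2Norm_sq_eq ht hφ,
      ← ENNReal.ofReal_pow (Real.sqrt_nonneg _), ← ENNReal.ofReal_pow (Real.sqrt_nonneg _),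
      Real.sq_sqrt hlam, Real.sq_sqrt hB0, ← ENNReal.ofReal_mul hlam]
    exact ENNReal.ofReal_le_ofReal hB
  have h3 : iNorm lam t φ ≤ ENNReal.ofReal (Real.sqrt A + Real.sqrt B) := by
    rw [ENNReal.ofReal_add (Real.sqrt_nonneg _) (Real.sqrt_nonneg _)]
    exact add_le_add h1 h2
  refine ⟨h3.trans_lt ENNReal.ofReal_lt_top, ?_⟩
  have h4 : (iNorm lam t φ).toReal ≤ Real.sqrt A + Real.sqrt B :=
    ENNReal.toReal_le_of_le_ofReal (by positivity) h3
  have h5 := pow_le_pow_left₀ ENNReal.toReal_nonneg h4 2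
  nlinarith [Real.sq_sqrt hA0, Real.sq_sqrt hB0, sq_nonneg (Real.sqrt A - Real.sqrt B)]

lemma iNorm_lt_top (hlam : 0 ≤ lam) (ht : 0 ≤ t) {φ : ℝ → ℝ}
    (hφ : ContinuousOn φ (Icc 0 t)) : iNorm lam t φ < ⊤ := by
  obtain ⟨A, hA⟩ := isCompact_Icc.exists_bound_of_continuousOn
    (continuousOn_weight (lam := lam) (hφ.pow 2))
  exact (iNorm_sq_le hlam ht hφ (A := A) (fun τ hτ => (le_abs_self _).trans (hA τ hτ)) le_rfl).1

lemma exp_mul_abs_le_iNorm (hlam : 0 ≤ lam) (ht : 0 ≤ t) {φ : ℝ → ℝ}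
    (hφ : ContinuousOn φ (Icc 0 t)) {τ : ℝ} (hτ : τ ∈ Icc 0 t) :
    Real.exp (-lam * τ) * |φ τ| ≤ (iNorm lam t φ).toReal :=
  (ENNReal.ofReal_le_iff_le_toReal (iNorm_lt_top hlam ht hφ).ne).1 (le_iNorm φ hτ)

lemma lam_mul_integral_le_iNorm (hlam : 0 ≤ lam) (ht : 0 ≤ t) {φ : ℝ → ℝ}
    (hφ : ContinuousOn φ (Icc 0 t)) :
    lam * ∫ τ in (0 : ℝ)..t, Real.exp (-2 * lam * τ) * φ τ ^ 2 ≤ (iNorm lam t φ).toReal ^ 2 := by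
  have h := ofReal_mul_l2Norm_sq_le (t := t) hlam φ
  rw [l2Norm_sq_eq ht hφ, ← ENNReal.ofReal_mul hlam] at h
  rw [← ENNReal.toReal_pow]
  exact (ENNReal.ofReal_le_iff_le_toReal (ENNReal.pow_lt_top (iNorm_lt_top hlam ht hφ)).ne).1 h

/-- The duality inequality for continuous functions. -/
lemma integral_le_sStar_mul_iNorm (hlam : 0 ≤ lam) (ht : 0 ≤ t) {φ : ℝ → ℝ}
    (hφ : ContinuousOn φ (Icc 0 t)) {f : ℝ → ℝ} (hf : ContinuousOn f (Icc 0 t)) :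
    ∫ τ in (0 : ℝ)..t, Real.exp (-2 * lam * τ) * (|f τ| * |φ τ|) ≤
      (sStar lam t f).toReal * (iNorm lam t φ).toReal := by
  obtain ⟨C, hC⟩ := isCompact_Icc.exists_bound_of_continuousOn hf
  have hS : sStar lam t f < ⊤ := sStar_lt_top hlam (C := C) (by
    filter_upwards [ae_restrict_mem measurableSet_Icc] with τ hτ using hC τ hτ)
  have hI := iNorm_lt_top hlam ht hφ
  -- The test functions of S* are measurable on the whole line, so φ is replaced by its continuous
  -- extension with constant values outside [0,t].
  let χ : ℝ → ℝ := IccExtend ht ((Icc 0 t).domRestrict φ)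
  have hχ : Continuous χ := hφ.domRestrict.Icc_extend'
  have e : ∀ τ ∈ Icc 0 t, χ τ = φ τ := fun τ hτ => IccExtend_of_mem ht _ hτ
  have h1 := lintegral_le_sStar_mul_iNorm (lam := lam) (t := t) (f := f) hχ.measurable
    (by rw [iNorm_congr e]; exact hI.ne)
  rw [iNorm_congr e, setLIntegral_congr_fun measurableSet_Icc
    (g := fun τ => ENNReal.ofReal (Real.exp (-2 * lam * τ) * (|f τ| * |φ τ|))) fun τ hτ => by
      simp only [e τ hτ, abs_mul], ← ofReal_integral_eq_lintegral_ofReal] at h1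
  · rw [intervalIntegral.integral_of_le ht, ← integral_Icc_eq_integral_Ioc, ← ENNReal.toReal_mul]
    exact (ENNReal.ofReal_le_iff_le_toReal (ENNReal.mul_lt_top hS hI).ne).1 h1
  · exact (continuousOn_weight (hf.abs.mul hφ.abs)).integrableOn_Icc
  · exact Eventually.of_forall fun τ => by positivity

end TimeNorms

end WaveStructure
end

noncomputable section
namespace WaveStructure

/-! ### Energy estimates in time -/

/-- A function whose slopes to the right are bounded by a continuous function. -/
lemma sub_le_integral_of_slope_le {t : ℝ} (ht : 0 ≤ t) {f φ : ℝ → ℝ}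
    (hf : ContinuousOn f (Icc 0 t)) (hφ : ContinuousOn φ (Icc 0 t))
    (h : ∀ x ∈ Ico 0 t, ∃ q : ℝ → ℝ, Tendsto q (𝓝[>] x) (𝓝 (φ x)) ∧
      ∀ᶠ z in 𝓝[>] x, slope f x z ≤ q z) : f t - f 0 ≤ ∫ τ in (0 : ℝ)..t, φ τ := by
  let χ : ℝ → ℝ := IccExtend ht ((Icc 0 t).domRestrict φ)
  have hχ : Continuous χ := hφ.domRestrict.Icc_extend'
  have e : ∀ τ ∈ Icc 0 t, χ τ = φ τ := fun τ hτ => IccExtend_of_mem ht _ hτ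
  have hB : ∀ x, HasDerivAt (fun τ => f 0 + ∫ s in (0 : ℝ)..τ, χ s) (χ x) x := fun x =>
    (intervalIntegral.integral_hasDerivAt_right (hχ.intervalIntegrable _ _)
      (hχ.stronglyMeasurableAtFilter _ _) hχ.continuousAt).const_add (f 0)
  -- Comparison with the primitive of φ needs only a bound of the right slopes of f, not
  -- differentiability.
  have key := image_le_of_liminf_slope_right_le_deriv_boundary hf (by simp : f 0 ≤ f 0 +
      ∫ s in (0 : ℝ)..0, χ s) (fun x _ => (hB x).continuousAt.continuousWithinAt)
    (fun x _ => (hB x).hasDerivWithinAt) (fun x hx r hr => by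
      obtain ⟨q, hq, hle⟩ := h x hx
      rw [e x (Ico_subset_Icc_self hx)] at hr
      refine Eventually.frequently ?_
      filter_upwards [hle, hq.eventually_lt_const hr] with z h1 h2
      exact h1.trans_lt h2) (right_mem_Icc.2 ht)
  have e2 : ∫ s in (0 : ℝ)..t, χ s = ∫ s in (0 : ℝ)..t, φ s := by
    refine intervalIntegral.integral_congr fun s hs => e s ?_
    rwa [uIcc_of_le ht] at hs
  linarith

/-! ### Weighted estimates for Hilbert space valued functions of time. -/

section Hilbert

variable {E₁ E₂ : Type*} [NormedAddCommGroup E₁] [InnerProductSpace ℝ E₁] [NormedAddCommGroup E₂]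
  [InnerProductSpace ℝ E₂]

lemma tendsto_slope_right {E : Type*} [NormedAddCommGroup E] [NormedSpace ℝ E] {g : ℝ → E} {g' : E}
    {t x : ℝ} (hx : x ∈ Ico 0 t) (hg : HasDerivWithinAt g g' (Icc 0 t) x) :
    Tendsto (slope g x) (𝓝[>] x) (𝓝 g') := by
  have h1 : HasDerivWithinAt g g' (Ioo x t) x :=
    hg.mono fun z hz => ⟨hx.1.trans hz.1.le, hz.2.le⟩
  rw [hasDerivWithinAt_iff_tendsto_slope' (by simp), nhdsWithin_Ioo_eq_nhdsGT hx.2] at h1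
  exact h1

lemma tendsto_right {X : Type*} [TopologicalSpace X] {g : ℝ → X} {t x : ℝ} (hx : x ∈ Ico 0 t)
    (hg : ContinuousOn g (Icc 0 t)) : Tendsto g (𝓝[>] x) (𝓝 (g x)) := by
  have h1 := (hg x (Ico_subset_Icc_self hx)).mono
    (fun z hz => ⟨hx.1.trans hz.1.le, hz.2.le⟩ : Ioo x t ⊆ Icc 0 t)
  rw [ContinuousWithinAt, nhdsWithin_Ioo_eq_nhdsGT hx.2] at h1
  exact h1

lemma HasDerivWithinAt.continuousOn_of_forall {E : Type*} [NormedAddCommGroup E] [NormedSpace ℝ E]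
    {g g' : ℝ → E} {s : Set ℝ} (h : ∀ τ ∈ s, HasDerivWithinAt g (g' τ) s τ) : ContinuousOn g s :=
  fun τ hτ => (h τ hτ).continuousWithinAt

/-- The evolution of a pairing with a Lipschitz family of operators. -/
theorem weighted_pairing_le {lam t K : ℝ} (ht : 0 ≤ t) (Y : E₁ →L[ℝ] E₂)
    {𝒮 : ℝ → E₂ →L[ℝ] E₂} {g g' : ℝ → E₁} {w w' : ℝ → E₂}
    (hg : ∀ τ ∈ Icc 0 t, HasDerivWithinAt g (g' τ) (Icc 0 t) τ)
    (hw : ∀ τ ∈ Icc 0 t, HasDerivWithinAt w (w' τ) (Icc 0 t) τ)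
    (hg' : ContinuousOn g' (Icc 0 t)) (hw' : ContinuousOn w' (Icc 0 t))
    (hSc : ContinuousOn 𝒮 (Icc 0 t))
    (hS : ∀ τ ∈ Icc 0 t, ∀ τ' ∈ Icc 0 t, ‖𝒮 τ - 𝒮 τ'‖ ≤ K * |τ - τ'|) :
    Real.exp (-2 * lam * t) * inner ℝ (Y (g t)) (𝒮 t (w t)) - inner ℝ (Y (g 0)) (𝒮 0 (w 0)) ≤
      ∫ τ in (0 : ℝ)..t, Real.exp (-2 * lam * τ) * (inner ℝ (Y (g' τ)) (𝒮 τ (w τ)) +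
        inner ℝ (Y (g τ)) (𝒮 τ (w' τ)) - 2 * lam * inner ℝ (Y (g τ)) (𝒮 τ (w τ)) +
        K * (‖Y (g τ)‖ * ‖w τ‖)) := by
  have hgc := HasDerivWithinAt.continuousOn_of_forall hg
  have hwc := HasDerivWithinAt.continuousOn_of_forall hw
  have hYg : ContinuousOn (fun τ => Y (g τ)) (Icc 0 t) := Y.continuous.comp_continuousOn hgc
  have hYg' : ContinuousOn (fun τ => Y (g' τ)) (Icc 0 t) := Y.continuous.comp_continuousOn hg'
  have hSw : ContinuousOn (fun τ => 𝒮 τ (w τ)) (Icc 0 t) := hSc.clm_apply hwc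
  have hSw' : ContinuousOn (fun τ => 𝒮 τ (w' τ)) (Icc 0 t) := hSc.clm_apply hw'
  let E : ℝ → ℝ := fun τ => Real.exp (-2 * lam * τ)
  have hE : Continuous E := by fun_prop
  have hEd : ∀ x, HasDerivAt E (-2 * lam * E x) x := fun x => by
    have h1 : HasDerivAt (fun τ => -2 * lam * τ) (-2 * lam) x := by
      simpa using (hasDerivAt_id x).const_mul (-2 * lam)
    exact h1.exp.congr_deriv (mul_comm _ _)
  let A : ℝ → ℝ := fun τ => inner ℝ (Y (g τ)) (𝒮 τ (w τ))
  have hA : ContinuousOn A (Icc 0 t) := hYg.inner hSw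
  -- As 𝒮 is merely Lipschitz, the pairing need not be differentiable. Its right slopes are still
  -- bounded, with K‖Yg‖‖w‖ in place of the term that would contain the derivative of 𝒮.
  have key := sub_le_integral_of_slope_le ht (f := fun τ => E τ * A τ)
    (φ := fun τ => E τ * (inner ℝ (Y (g' τ)) (𝒮 τ (w τ)) +
        inner ℝ (Y (g τ)) (𝒮 τ (w' τ)) - 2 * lam * A τ + K * (‖Y (g τ)‖ * ‖w τ‖)))
    (hE.continuousOn.mul hA) (hE.continuousOn.mul ((((hYg'.inner hSw).add (hYg.inner hSw')).sub
      (continuousOn_const.mul hA)).add (continuousOn_const.mul (hYg.norm.mul hwc.norm))))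
    (fun x hx => by
      have hxI := Ico_subset_Icc_self hx
      refine ⟨fun z => E z * (inner ℝ (Y (slope g x z)) (𝒮 z (w z)) +
        K * (‖Y (g x)‖ * ‖w z‖) + inner ℝ (Y (g x)) (𝒮 x (slope w x z))) + A x * slope E x z, ?_, ?_⟩
      · have h1 := tendsto_slope_right hx (hg x hxI)
        have h2 := tendsto_slope_right hx (hw x hxI)
        have h3 := tendsto_slope_right hx (hEd x).hasDerivWithinAt
        have h4 := tendsto_right hx hSw
        have h5 := tendsto_right hx hwc
        have h6 := tendsto_right hx hE.continuousOn
        have h7 := (h6.mul (((((Y.continuous.tendsto _).comp h1).inner h4).add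
          ((h5.norm.const_mul ‖Y (g x)‖).const_mul K)).add
          ((tendsto_const_nhds (x := Y (g x))).inner
            (((𝒮 x).continuous.tendsto _).comp h2)))).add (h3.const_mul (A x))
        refine h7.congr' ?_ |>.trans (le_of_eq ?_)
        · exact Eventually.of_forall fun z => rfl
        · congr 1
          ring
      · have hmem : Ioo x t ∈ 𝓝[>] x := Ioo_mem_nhdsGT hx.2
        filter_upwards [hmem] with z hz
        have hzI : z ∈ Icc 0 t := ⟨hx.1.trans hz.1.le, hz.2.le⟩
        have hzx : 0 < z - x := sub_pos.2 hz.1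
        have e1 : slope (fun τ => E τ * A τ) x z =
            E z * ((z - x)⁻¹ * (A z - A x)) + A x * slope E x z := by
          simp only [slope_def_field]
          field_simp
          ring
        -- Discrete product rule, varying g, then 𝒮, then w.
        have e2 : (z - x)⁻¹ * (A z - A x) = inner ℝ (Y (slope g x z)) (𝒮 z (w z)) +
            (z - x)⁻¹ * inner ℝ (Y (g x)) ((𝒮 z - 𝒮 x) (w z)) +
            inner ℝ (Y (g x)) (𝒮 x (slope w x z)) := by
          simp only [A, slope_def_module, map_smul, map_sub, inner_smul_left, inner_smul_right,
            inner_sub_left, inner_sub_right, _root_.sub_apply, conj_trivial]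
          ring
        have e3 : (z - x)⁻¹ * inner ℝ (Y (g x)) ((𝒮 z - 𝒮 x) (w z)) ≤
            K * (‖Y (g x)‖ * ‖w z‖) := by
          rw [inv_mul_le_iff₀ hzx]
          have h1 := hS z hzI x hxI
          rw [abs_of_pos hzx] at h1
          calc _ ≤ ‖Y (g x)‖ * ‖(𝒮 z - 𝒮 x) (w z)‖ := real_inner_le_norm _ _
            _ ≤ ‖Y (g x)‖ * (K * (z - x) * ‖w z‖) :=
              mul_le_mul_of_nonneg_left ((𝒮 z - 𝒮 x).le_of_opNorm_le h1 _) (norm_nonneg _)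
            _ = _ := by ring
        rw [e1, e2]
        have hEz : 0 ≤ E z := (Real.exp_pos _).le
        refine add_le_add (mul_le_mul_of_nonneg_left ?_ hEz) le_rfl
        linarith)
  simpa [E, A] using key

/-- Differentiating the weight in e^{-2λs}‖g‖² produces the term with the factor λ. This is the
source of every gain in λ. -/
lemma integral_weight_inner {lam t : ℝ} (ht : 0 ≤ t) {g g' : ℝ → E₁}
    (hg : ∀ τ ∈ Icc 0 t, HasDerivWithinAt g (g' τ) (Icc 0 t) τ)
    (hg' : ContinuousOn g' (Icc 0 t)) :
    2 * ∫ s in (0 : ℝ)..t, Real.exp (-2 * lam * s) * inner ℝ (g s) (g' s) =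
      Real.exp (-2 * lam * t) * ‖g t‖ ^ 2 - ‖g 0‖ ^ 2 +
        2 * (lam * ∫ s in (0 : ℝ)..t, Real.exp (-2 * lam * s) * ‖g s‖ ^ 2) := by
  have hgc := HasDerivWithinAt.continuousOn_of_forall hg
  have hEc : Continuous fun τ => Real.exp (-2 * lam * τ) := by fun_prop
  have hEd : ∀ x, HasDerivAt (fun τ => Real.exp (-2 * lam * τ))
      (-2 * lam * Real.exp (-2 * lam * x)) x := fun x => by
    have h1 : HasDerivAt (fun τ => -2 * lam * τ) (-2 * lam) x := by
      simpa using (hasDerivAt_id x).const_mul (-2 * lam)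
    exact h1.exp.congr_deriv (mul_comm _ _)
  have i1 := intervalIntegrable_weight (lam := lam) ht (φ := fun s => ‖g s‖ ^ 2) (hgc.norm.pow 2)
  have i2 := intervalIntegrable_weight (lam := lam) ht (hgc.inner hg')
  have hftc := intervalIntegral.integral_eq_sub_of_hasDerivAt_of_le ht
    (f := fun s => Real.exp (-2 * lam * s) * ‖g s‖ ^ 2)
    (f' := fun s => 2 * (Real.exp (-2 * lam * s) * inner ℝ (g s) (g' s)) -
      2 * lam * (Real.exp (-2 * lam * s) * ‖g s‖ ^ 2))
    (hEc.continuousOn.mul (hgc.norm.pow 2)) (fun s hs => by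
      have h1 : HasDerivAt g (g' s) s := (hg s (Ioo_subset_Icc_self hs)).hasDerivAt
        (Icc_mem_nhds hs.1 hs.2)
      refine ((hEd s).fun_mul h1.norm_sq).congr_deriv ?_
      ring) ((i2.const_mul 2).sub (i1.const_mul (2 * lam)))
  rw [intervalIntegral.integral_sub (i2.const_mul 2) (i1.const_mul (2 * lam)),
    intervalIntegral.integral_const_mul, intervalIntegral.integral_const_mul] at hftc
  simp only [mul_zero, Real.exp_zero, one_mul] at hftc
  linarith

/-- The basic energy estimate for a differentiable function. -/
theorem iNorm_sq_le_of_hasDeriv {lam t : ℝ} (hlam : 0 ≤ lam) (ht : 0 ≤ t) {g g' : ℝ → E₁}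
    (hg : ∀ τ ∈ Icc 0 t, HasDerivWithinAt g (g' τ) (Icc 0 t) τ)
    (hg' : ContinuousOn g' (Icc 0 t)) :
    (iNorm lam t fun τ => ‖g τ‖).toReal ^ 2 ≤
      6 * ‖g 0‖ ^ 2 + 36 * (sStar lam t fun τ => ‖g' τ‖).toReal ^ 2 := by
  have hgc := HasDerivWithinAt.continuousOn_of_forall hg
  set I := (iNorm lam t fun τ => ‖g τ‖).toReal
  set S := (sStar lam t fun τ => ‖g' τ‖).toReal
  have hdual : ∫ τ in (0 : ℝ)..t, Real.exp (-2 * lam * τ) * (‖g' τ‖ * ‖g τ‖) ≤ S * I := by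
    have := integral_le_sStar_mul_iNorm hlam ht hgc.norm (f := fun τ => ‖g' τ‖) hg'.norm
    simpa only [abs_norm] using this
  have hsub : ∀ {τ}, τ ≤ t → Icc 0 τ ⊆ Icc 0 t := fun h => Icc_subset_Icc_right h
  -- The bound is uniform in the upper limit τ, so it yields both the supremum part and the L² part
  -- of I.
  have main : ∀ τ ∈ Icc 0 t, Real.exp (-2 * lam * τ) * ‖g τ‖ ^ 2 +
      2 * (lam * ∫ s in (0 : ℝ)..τ, Real.exp (-2 * lam * s) * ‖g s‖ ^ 2) ≤
        ‖g 0‖ ^ 2 + 2 * (S * I) := by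
    intro τ hτ
    have hgτ := hgc.mono (hsub hτ.2)
    have hg'τ := hg'.mono (hsub hτ.2)
    have i2 := intervalIntegrable_weight (lam := lam) hτ.1 (hgτ.inner hg'τ)
    have hftc := integral_weight_inner (lam := lam) hτ.1
      (fun s hs => (hg s (hsub hτ.2 hs)).mono (hsub hτ.2)) hg'τ
    have hle : ∫ s in (0 : ℝ)..τ, Real.exp (-2 * lam * s) * inner ℝ (g s) (g' s) ≤
        ∫ s in (0 : ℝ)..t, Real.exp (-2 * lam * s) * (‖g' s‖ * ‖g s‖) := by
      have i3 := intervalIntegrable_weight (lam := lam) ht (φ := fun s => ‖g' s‖ * ‖g s‖)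
        (hg'.norm.mul hgc.norm)
      refine (intervalIntegral.integral_mono_on hτ.1 i2
        (intervalIntegrable_weight (lam := lam) hτ.1 (φ := fun s => ‖g' s‖ * ‖g s‖)
          (hg'τ.norm.mul hgτ.norm)) fun s _ =>
        mul_le_mul_of_nonneg_left ?_ (Real.exp_pos _).le).trans
        (intervalIntegral.integral_mono_interval le_rfl hτ.1 hτ.2
          (Eventually.of_forall fun s => ?_) i3)
      · rw [mul_comm]
        exact real_inner_le_norm _ _
      · simp only [Pi.zero_apply]
        positivity
    linarith
  have hI0 : 0 ≤ I := ENNReal.toReal_nonneg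
  have hS0 : 0 ≤ S := ENNReal.toReal_nonneg
  have hint : ∀ τ ∈ Icc 0 t, 0 ≤ lam * ∫ s in (0 : ℝ)..τ, Real.exp (-2 * lam * s) * ‖g s‖ ^ 2 :=
    fun τ hτ => mul_nonneg hlam (intervalIntegral.integral_nonneg hτ.1 fun s _ => by positivity)
  have hfin := (iNorm_sq_le hlam ht hgc.norm (A := ‖g 0‖ ^ 2 + 2 * (S * I))
    (B := (‖g 0‖ ^ 2 + 2 * (S * I)) / 2) (fun τ hτ => by linarith [main τ hτ, hint τ hτ]) (by
      have h1 := main t (right_mem_Icc.2 ht)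
      have h2 : 0 ≤ Real.exp (-2 * lam * t) * ‖g t‖ ^ 2 := by positivity
      linarith)).2
  change I ^ 2 ≤ _ at hfin
  -- So far I² ≤ 3‖g(0)‖² + 6SI; half of I² absorbs the product, whence the constants 6 and 36.
  nlinarith [sq_nonneg (I - 6 * S)]

/-- Young's inequality with a quarter of η, because four terms of the boundary source have to share
the available ηI². -/
lemma two_mul_mul_le {η x y : ℝ} (hη : 0 < η) : 2 * (x * y) ≤ η / 4 * y ^ 2 + 4 * x ^ 2 / η := by
  have h := sq_nonneg (η / 4 * y - x)
  have e : η / 4 * y ^ 2 + 4 * x ^ 2 / η - 2 * (x * y) = 4 / η * (η / 4 * y - x) ^ 2 := by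
    field_simp
    ring
  have : 0 ≤ 4 / η * (η / 4 * y - x) ^ 2 := by positivity
  linarith

lemma sStar_toReal_mono {lam t : ℝ} (hlam : 0 ≤ lam) {f g : ℝ → ℝ} (hg : ContinuousOn g (Icc 0 t))
    (h : ∀ τ ∈ Icc 0 t, |f τ| ≤ |g τ|) : (sStar lam t f).toReal ≤ (sStar lam t g).toReal := by
  obtain ⟨C, hC⟩ := isCompact_Icc.exists_bound_of_continuousOn hg
  have hS : sStar lam t g < ⊤ := sStar_lt_top hlam (C := C) (by
    filter_upwards [ae_restrict_mem measurableSet_Icc] with τ hτ using hC τ hτ)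
  refine ENNReal.toReal_mono hS.ne (sStar_mono ?_)
  filter_upwards [ae_restrict_mem measurableSet_Icc] with τ hτ using h τ hτ

set_option maxHeartbeats 1000000 in
/-- The bound of the boundary source by the data and a small multiple of the solution. -/
theorem exists_boundary_source_bound {c₁ cY β η : ℝ} (hc₁ : 0 ≤ c₁) (hcY : 0 ≤ cY) (hβ : 0 ≤ β)
    (hη : 0 < η) : ∃ C, 0 < C ∧ ∀ {lam t K : ℝ}, 0 < lam → 0 ≤ K → K ≤ lam → 0 ≤ t →
      ∀ {Y : E₁ →L[ℝ] E₂} {𝒮 : ℝ → E₂ →L[ℝ] E₂} {g g' : ℝ → E₁} {w w' F : ℝ → E₂} {N q : ℝ → ℝ},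
      ‖Y‖ ≤ cY → (∀ τ ∈ Icc 0 t, ‖𝒮 τ‖ ≤ β) →
      (∀ τ ∈ Icc 0 t, ∀ τ' ∈ Icc 0 t, ‖𝒮 τ - 𝒮 τ'‖ ≤ K * |τ - τ'|) →
      (∀ τ ∈ Icc 0 t, HasDerivWithinAt g (g' τ) (Icc 0 t) τ) →
      (∀ τ ∈ Icc 0 t, HasDerivWithinAt w (w' τ) (Icc 0 t) τ) →
      ContinuousOn g' (Icc 0 t) → ContinuousOn w' (Icc 0 t) → ContinuousOn F (Icc 0 t) →
      ContinuousOn N (Icc 0 t) → ContinuousOn q (Icc 0 t) →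
      (∀ τ ∈ Icc 0 t, ‖g' τ‖ ≤ N τ) →
      (∀ τ ∈ Icc 0 t, q τ ≤ c₁ * (N τ * ‖w τ‖) + inner ℝ (Y (g τ)) (F τ) -
        inner ℝ (Y (g τ)) (𝒮 τ (w' τ))) →
      2 * ∫ τ in (0 : ℝ)..t, Real.exp (-2 * lam * τ) * q τ ≤
        η * (iNorm lam t fun τ => ‖w τ‖).toReal ^ 2 + C * (‖g 0‖ ^ 2 +
          (sStar lam t fun τ => ‖F τ‖).toReal ^ 2 + (sStar lam t N).toReal ^ 2) := by
  set c₂ := cY * β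
  set c₃ := 2 * c₂ + cY
  set s := 4 * (c₃ + 1) / η
  set P := 4 * c₂ ^ 2 / η + cY + c₃ * s
  have hc₂ : 0 ≤ c₂ := by positivity
  have hc₃ : 0 ≤ c₃ := by positivity
  have hs : 0 < s := by positivity
  have hP : 0 ≤ P := by positivity
  -- P multiplies I(g)², which is at most 6‖g(0)‖² + 36S*(N)²; 42 covers both contributions.
  refine ⟨42 * P + 4 * c₂ ^ 2 / η + 4 * (c₁ + c₂) ^ 2 / η + cY + 1, by positivity, ?_⟩
  intro lam t K hlam hK0 hK ht Y 𝒮 g g' w w' F N q hY hSb hS hg hw hg' hw' hF hN hq hgN hqle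
  have hgc := HasDerivWithinAt.continuousOn_of_forall hg
  have hwc := HasDerivWithinAt.continuousOn_of_forall hw
  have hSc : ContinuousOn 𝒮 (Icc 0 t) := by
    refine LipschitzOnWith.continuousOn (K := K.toNNReal) (LipschitzOnWith.of_dist_le_mul ?_)
    intro τ hτ τ' hτ'
    rw [dist_eq_norm, Real.dist_eq, Real.coe_toNNReal _ hK0]
    exact hS τ hτ τ' hτ'
  set a := (iNorm lam t fun τ => ‖w τ‖).toReal
  set G := (iNorm lam t fun τ => ‖g τ‖).toReal
  set Sf := (sStar lam t fun τ => ‖F τ‖).toReal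
  set SN := (sStar lam t N).toReal
  have ha : 0 ≤ a := ENNReal.toReal_nonneg
  have hG0 : 0 ≤ G := ENNReal.toReal_nonneg
  have hSf : 0 ≤ Sf := ENNReal.toReal_nonneg
  have hSN : 0 ≤ SN := ENNReal.toReal_nonneg
  have hN0 : ∀ τ ∈ Icc 0 t, 0 ≤ N τ := fun τ hτ => (norm_nonneg _).trans (hgN τ hτ)
  have hG : G ^ 2 ≤ 6 * ‖g 0‖ ^ 2 + 36 * SN ^ 2 := by
    refine (iNorm_sq_le_of_hasDeriv hlam.le ht hg hg').trans ?_
    have h1 : (sStar lam t fun τ => ‖g' τ‖).toReal ≤ SN := sStar_toReal_mono hlam.le hN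
      fun τ hτ => by rw [abs_norm, abs_of_nonneg (hN0 τ hτ)]; exact hgN τ hτ
    have h2 := pow_le_pow_left₀ ENNReal.toReal_nonneg h1 2
    linarith
  have hYb : ∀ x, ‖Y x‖ ≤ cY * ‖x‖ := fun x => Y.le_of_opNorm_le hY x
  have hA : ∀ τ ∈ Icc 0 t, ∀ x y, |inner ℝ (Y x) (𝒮 τ y)| ≤ c₂ * (‖x‖ * ‖y‖) := fun τ hτ x y => by
    refine (abs_real_inner_le_norm _ _).trans ?_
    calc ‖Y x‖ * ‖𝒮 τ y‖ ≤ cY * ‖x‖ * (β * ‖y‖) := mul_le_mul (hYb x)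
          ((𝒮 τ).le_of_opNorm_le (hSb τ hτ) y) (norm_nonneg _) (by positivity)
      _ = _ := by
        simp only [c₂]
        ring
  -- The sum q + D no longer contains w', since the two terms ⟨Yg, 𝒮w'⟩ cancel. The weighted
  -- integral of D is bounded below by endpoint values of the pairing, which replaces integration by
  -- parts in time.
  let D : ℝ → ℝ := fun τ => inner ℝ (Y (g' τ)) (𝒮 τ (w τ)) + inner ℝ (Y (g τ)) (𝒮 τ (w' τ)) -
    2 * lam * inner ℝ (Y (g τ)) (𝒮 τ (w τ)) + K * (‖Y (g τ)‖ * ‖w τ‖)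
  have hpair := weighted_pairing_le (lam := lam) ht Y hg hw hg' hw' hSc hS
  change _ ≤ ∫ τ in (0 : ℝ)..t, Real.exp (-2 * lam * τ) * D τ at hpair
  have hD : ContinuousOn D (Icc 0 t) := by
    have h1 : ContinuousOn (fun τ => Y (g τ)) (Icc 0 t) := Y.continuous.comp_continuousOn hgc
    have h2 : ContinuousOn (fun τ => Y (g' τ)) (Icc 0 t) := Y.continuous.comp_continuousOn hg'
    have h3 := hSc.clm_apply hwc
    have h4 := hSc.clm_apply hw'
    exact (((h2.inner h3).add (h1.inner h4)).sub (continuousOn_const.mul (h1.inner h3))).add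
      (continuousOn_const.mul (h1.norm.mul hwc.norm))
  have i1 := intervalIntegrable_weight (lam := lam) ht (φ := fun τ => |N τ| * |‖w τ‖|)
    (hN.abs.mul hwc.norm.abs)
  have i2 := intervalIntegrable_weight (lam := lam) ht (φ := fun τ => |‖F τ‖| * |‖g τ‖|)
    (hF.norm.abs.mul hgc.norm.abs)
  have i3 := intervalIntegrable_weight (lam := lam) ht (φ := fun τ => ‖g τ‖ ^ 2) (hgc.norm.pow 2)
  have i4 := intervalIntegrable_weight (lam := lam) ht (φ := fun τ => ‖w τ‖ ^ 2) (hwc.norm.pow 2)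
  have iq := intervalIntegrable_weight (lam := lam) ht hq
  have iD := intervalIntegrable_weight (lam := lam) ht hD
  have hmain : (∫ τ in (0 : ℝ)..t, Real.exp (-2 * lam * τ) * q τ) +
      (∫ τ in (0 : ℝ)..t, Real.exp (-2 * lam * τ) * D τ) ≤
      (c₁ + c₂) * (∫ τ in (0 : ℝ)..t, Real.exp (-2 * lam * τ) * (|N τ| * |‖w τ‖|)) +
      cY * (∫ τ in (0 : ℝ)..t, Real.exp (-2 * lam * τ) * (|‖F τ‖| * |‖g τ‖|)) +
      c₃ * s / 2 * lam * (∫ τ in (0 : ℝ)..t, Real.exp (-2 * lam * τ) * ‖g τ‖ ^ 2) +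
      c₃ / (2 * s) * lam * (∫ τ in (0 : ℝ)..t, Real.exp (-2 * lam * τ) * ‖w τ‖ ^ 2) := by
    rw [← intervalIntegral.integral_add iq iD, ← intervalIntegral.integral_const_mul,
      ← intervalIntegral.integral_const_mul, ← intervalIntegral.integral_const_mul,
      ← intervalIntegral.integral_const_mul,
      ← intervalIntegral.integral_add (i1.const_mul _) (i2.const_mul _),
      ← intervalIntegral.integral_add ((i1.const_mul _).add (i2.const_mul _)) (i3.const_mul _),
      ← intervalIntegral.integral_add (((i1.const_mul _).add (i2.const_mul _)).add
        (i3.const_mul _)) (i4.const_mul _)]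
    refine intervalIntegral.integral_mono_on ht (iq.add iD)
      ((((i1.const_mul _).add (i2.const_mul _)).add (i3.const_mul _)).add (i4.const_mul _))
      fun τ hτ => ?_
    have hpt : q τ + D τ ≤ (c₁ + c₂) * (|N τ| * |‖w τ‖|) + cY * (|‖F τ‖| * |‖g τ‖|) +
        c₃ * s / 2 * lam * ‖g τ‖ ^ 2 + c₃ / (2 * s) * lam * ‖w τ‖ ^ 2 := by
      rw [abs_norm, abs_norm, abs_norm, abs_of_nonneg (hN0 τ hτ)]
      have h1 := hqle τ hτ
      have h2 : inner ℝ (Y (g τ)) (F τ) ≤ cY * (‖F τ‖ * ‖g τ‖) :=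
        (real_inner_le_norm _ _).trans (by
          have := mul_le_mul_of_nonneg_right (hYb (g τ)) (norm_nonneg (F τ))
          linarith)
      have h3 : inner ℝ (Y (g' τ)) (𝒮 τ (w τ)) ≤ c₂ * (N τ * ‖w τ‖) :=
        ((le_abs_self _).trans (hA τ hτ _ _)).trans (mul_le_mul_of_nonneg_left
          (mul_le_mul_of_nonneg_right (hgN τ hτ) (norm_nonneg _)) hc₂)
      have h4 : -(2 * lam * inner ℝ (Y (g τ)) (𝒮 τ (w τ))) ≤ 2 * lam * (c₂ * (‖g τ‖ * ‖w τ‖)) := by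
        rw [← mul_neg]
        exact mul_le_mul_of_nonneg_left ((neg_le_abs _).trans (hA τ hτ _ _)) (by positivity)
      have h5 : K * (‖Y (g τ)‖ * ‖w τ‖) ≤ lam * (cY * (‖g τ‖ * ‖w τ‖)) := by
        rw [← mul_assoc cY]
        exact mul_le_mul hK (mul_le_mul_of_nonneg_right (hYb _) (norm_nonneg _))
          (by positivity) hlam.le
      -- The factor λ is kept on both squares, to match the λ-weighted L² part of I for g and for w.
      have h6 : c₃ * lam * (‖g τ‖ * ‖w τ‖) ≤
          c₃ * s / 2 * lam * ‖g τ‖ ^ 2 + c₃ / (2 * s) * lam * ‖w τ‖ ^ 2 := by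
        have e : c₃ * s / 2 * lam * ‖g τ‖ ^ 2 + c₃ / (2 * s) * lam * ‖w τ‖ ^ 2 -
            c₃ * lam * (‖g τ‖ * ‖w τ‖) = c₃ * lam / (2 * s) * (s * ‖g τ‖ - ‖w τ‖) ^ 2 := by
          field_simp
          ring
        have : 0 ≤ c₃ * lam / (2 * s) * (s * ‖g τ‖ - ‖w τ‖) ^ 2 := by positivity
        linarith
      have h7 : 2 * lam * (c₂ * (‖g τ‖ * ‖w τ‖)) + lam * (cY * (‖g τ‖ * ‖w τ‖)) =
          c₃ * lam * (‖g τ‖ * ‖w τ‖) := by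
        simp only [c₃]
        ring
      simp only [D]
      linarith
    have := mul_le_mul_of_nonneg_left hpt (Real.exp_pos (-2 * lam * τ)).le
    linarith
  have d1 : ∫ τ in (0 : ℝ)..t, Real.exp (-2 * lam * τ) * (|N τ| * |‖w τ‖|) ≤ SN * a :=
    integral_le_sStar_mul_iNorm hlam.le ht hwc.norm hN
  have d2 : ∫ τ in (0 : ℝ)..t, Real.exp (-2 * lam * τ) * (|‖F τ‖| * |‖g τ‖|) ≤ Sf * G :=
    integral_le_sStar_mul_iNorm hlam.le ht hgc.norm hF.norm
  have d3 : lam * ∫ τ in (0 : ℝ)..t, Real.exp (-2 * lam * τ) * ‖g τ‖ ^ 2 ≤ G ^ 2 :=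
    lam_mul_integral_le_iNorm hlam.le ht hgc.norm
  have d4 : lam * ∫ τ in (0 : ℝ)..t, Real.exp (-2 * lam * τ) * ‖w τ‖ ^ 2 ≤ a ^ 2 :=
    lam_mul_integral_le_iNorm hlam.le ht hwc.norm
  have d5 : -(Real.exp (-2 * lam * t) * inner ℝ (Y (g t)) (𝒮 t (w t))) ≤ c₂ * (G * a) := by
    have htI : t ∈ Icc 0 t := right_mem_Icc.2 ht
    have h1 := exp_mul_abs_le_iNorm hlam.le ht hgc.norm htI
    have h2 := exp_mul_abs_le_iNorm hlam.le ht hwc.norm htI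
    rw [abs_norm] at h1 h2
    have h3 := hA t htI (g t) (w t)
    rw [← mul_neg, ← exp_sq]
    calc Real.exp (-lam * t) ^ 2 * -inner ℝ (Y (g t)) (𝒮 t (w t))
        ≤ Real.exp (-lam * t) ^ 2 * (c₂ * (‖g t‖ * ‖w t‖)) :=
          mul_le_mul_of_nonneg_left ((neg_le_abs _).trans h3) (sq_nonneg _)
      _ = c₂ * ((Real.exp (-lam * t) * ‖g t‖) * (Real.exp (-lam * t) * ‖w t‖)) := by ring
      _ ≤ c₂ * (G * a) := mul_le_mul_of_nonneg_left
          (mul_le_mul h1 h2 (by positivity) hG0) hc₂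
  have d6 : inner ℝ (Y (g 0)) (𝒮 0 (w 0)) ≤ c₂ * (‖g 0‖ * a) := by
    have h0I : (0 : ℝ) ∈ Icc 0 t := left_mem_Icc.2 ht
    have h2 := exp_mul_abs_le_iNorm hlam.le ht hwc.norm h0I
    rw [abs_norm, mul_zero, Real.exp_zero, one_mul] at h2
    exact ((le_abs_self _).trans (hA 0 h0I _ _)).trans
      (mul_le_mul_of_nonneg_left (mul_le_mul_of_nonneg_left h2 (norm_nonneg _)) hc₂)
  have f1 := mul_le_mul_of_nonneg_left d1 (add_nonneg hc₁ hc₂)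
  have f2 := mul_le_mul_of_nonneg_left d2 hcY
  have f3 := mul_le_mul_of_nonneg_left d3 (by positivity : 0 ≤ c₃ * s / 2)
  have f4 := mul_le_mul_of_nonneg_left d4 (by positivity : 0 ≤ c₃ / (2 * s))
  have y1 := two_mul_mul_le (x := (c₁ + c₂) * SN) (y := a) hη
  have y2 := two_mul_mul_le (x := c₂ * G) (y := a) hη
  have y3 := two_mul_mul_le (x := c₂ * ‖g 0‖) (y := a) hη
  have y4 : c₃ / s * a ^ 2 ≤ η / 4 * a ^ 2 := by
    refine mul_le_mul_of_nonneg_right ?_ (sq_nonneg a)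
    simp only [s]
    rw [div_div_eq_mul_div, div_le_iff₀ (by positivity)]
    nlinarith
  have y5 : 2 * (cY * (Sf * G)) ≤ cY * Sf ^ 2 + cY * G ^ 2 := by
    nlinarith [mul_nonneg hcY (sq_nonneg (Sf - G))]
  have z1 : 4 * (c₂ * G) ^ 2 / η + cY * G ^ 2 + c₃ * s * G ^ 2 = P * G ^ 2 := by
    simp only [P]
    ring
  have z2 := mul_le_mul_of_nonneg_left hG hP
  have z3 : 4 * ((c₁ + c₂) * SN) ^ 2 / η = 4 * (c₁ + c₂) ^ 2 / η * SN ^ 2 := by ring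
  have z4 : 4 * (c₂ * ‖g 0‖) ^ 2 / η = 4 * c₂ ^ 2 / η * ‖g 0‖ ^ 2 := by ring
  have z5 : 2 * (c₃ / (2 * s) * a ^ 2) = c₃ / s * a ^ 2 := by
    field_simp
  have k1 : 0 ≤ 4 * c₂ ^ 2 / η := by positivity
  have k2 : 0 ≤ 4 * (c₁ + c₂) ^ 2 / η := by positivity
  have total : 2 * ∫ τ in (0 : ℝ)..t, Real.exp (-2 * lam * τ) * q τ ≤
      η * a ^ 2 + ((6 * P + 4 * c₂ ^ 2 / η) * ‖g 0‖ ^ 2 + cY * Sf ^ 2 +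
        (36 * P + 4 * (c₁ + c₂) ^ 2 / η) * SN ^ 2) := by
    linarith
  refine total.trans ?_
  have s1 := sq_nonneg ‖g 0‖
  have s2 := sq_nonneg Sf
  have s3 := sq_nonneg SN
  have t1 := mul_nonneg hP s2
  have t2 := mul_nonneg k1 s2
  have t3 := mul_nonneg k2 s2
  have t4 := mul_nonneg k2 s1
  have t5 := mul_nonneg hcY s1
  have t6 := mul_nonneg hP s1
  have t7 := mul_nonneg k1 s3
  have t8 := mul_nonneg hcY s3
  have t9 := mul_nonneg hP s3
  clear_value P c₂ a Sf SN
  nlinarith only [t1, t2, t3, t4, t5, t6, t7, t8, t9, s1, s2, s3]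

end Hilbert

end WaveStructure
end

noncomputable section
namespace WaveStructure

/-! ### Components of vector valued functions -/

section Map

variable {F G : Type} [NormedAddCommGroup F] [NormedSpace ℝ F] [NormedAddCommGroup G]
  [NormedSpace ℝ G]

/-- A linear map acting on the values of `(f, ∇f, f|_Γ)`. -/
def mapTriple (Γ : JordanCurve) (Ω : Set Plane) (A : F →L[ℝ] G) (x : Triple Γ Ω F) :
    Triple Γ Ω G :=
  (A.compLpL 2 _ x.1, fun j => A.compLpL 2 _ (x.2.1 j), A.compLpL 2 _ x.2.2)

lemma continuous_mapTriple (Γ : JordanCurve) (Ω : Set Plane) (A : F →L[ℝ] G) :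
    Continuous (mapTriple Γ Ω A) := by
  unfold mapTriple
  fun_prop

lemma compLpL_toLp {α : Type*} [MeasurableSpace α] {μ : Measure α} (A : F →L[ℝ] G) {f : α → F}
    {g : α → G} (hf : MemLp f 2 μ) (hg : MemLp g 2 μ) (h : ∀ x, A (f x) = g x) :
    A.compLpL 2 μ (hf.toLp f) = hg.toLp g := by
  refine Lp.ext ?_
  filter_upwards [A.coeFn_compLpL (hf.toLp f), hf.coeFn_toLp, hg.coeFn_toLp] with x h1 h2 h3
  rw [h1, h2, h3, h]

lemma pderiv_clm_comp (A : F →L[ℝ] G) {φ : Plane → F} (hφ : ContDiff ℝ ∞ φ) (j : Fin 2)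
    (x : Plane) : A (pderiv j φ x) = pderiv j (fun x => A (φ x)) x := by
  have h : HasFDerivAt (fun x => A (φ x)) (A.comp (fderiv ℝ φ x)) x :=
    A.hasFDerivAt.comp x (hφ.differentiable (by simp) x).hasFDerivAt
  simp only [pderiv, h.fderiv, ContinuousLinearMap.comp_apply]

lemma mapTriple_mem {Γ : JordanCurve} {Ω : Set Plane} (A : F →L[ℝ] G) {x : Triple Γ Ω F}
    (hx : x ∈ traceSpace Γ Ω F) : mapTriple Γ Ω A x ∈ traceSpace Γ Ω G := by
  refine traceSpace_induction (P := fun x => mapTriple Γ Ω A x ∈ traceSpace Γ Ω G)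
    ((isClosed_traceSpace Γ Ω).preimage (continuous_mapTriple Γ Ω A)) (fun φ => ?_) hx
  let χ : testFun G := ⟨fun x => A (φ.1 x), A.contDiff.comp φ.2.1,
    φ.2.2.comp_left (map_zero A)⟩
  have e : mapTriple Γ Ω A (testTriple Γ Ω φ) = testTriple Γ Ω χ := by
    refine Prod.ext ?_ (Prod.ext (funext fun j => ?_) ?_)
    · exact compLpL_toLp A (memLp_of_test φ.2.1.continuous φ.2.2 Ω)
        (memLp_of_test χ.2.1.continuous χ.2.2 Ω) fun _ => rfl
    · exact compLpL_toLp A (memLp_of_test (contDiff_pderiv (j := j) φ.2.1).continuous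
        (hasCompactSupport_pderiv φ.2.2) Ω) (memLp_of_test (contDiff_pderiv (j := j) χ.2.1).continuous
        (hasCompactSupport_pderiv χ.2.2) Ω) (pderiv_clm_comp A φ.2.1 j)
    · exact compLpL_toLp A (memLp_Ioc (φ.2.1.continuous.comp Γ.continuous_γ) 0 Γ.L)
        (memLp_Ioc (χ.2.1.continuous.comp Γ.continuous_γ) 0 Γ.L) fun _ => rfl
  rw [e]
  exact testTriple_mem Γ Ω χ

end Map

lemma inner_compLpL {α : Type*} [MeasurableSpace α] {μ : Measure α} {E F G : Type*}
    [NormedAddCommGroup E] [InnerProductSpace ℝ E] [NormedAddCommGroup F] [InnerProductSpace ℝ F]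
    [NormedAddCommGroup G] [InnerProductSpace ℝ G] {A : E →L[ℝ] G} {B : F →L[ℝ] G} {C : F →L[ℝ] E}
    (h : ∀ x y, (inner ℝ (A x) (B y) : ℝ) = inner ℝ x (C y)) (f : Lp E 2 μ) (g : Lp F 2 μ) :
    (inner ℝ (A.compLpL 2 μ f) (B.compLpL 2 μ g) : ℝ) = inner ℝ f (C.compLpL 2 μ g) := by
  rw [L2.inner_def, L2.inner_def]
  refine integral_congr_ae ?_
  filter_upwards [A.coeFn_compLpL f, B.coeFn_compLpL g, C.coeFn_compLpL g] with x h1 h2 h3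
  rw [h1, h2, h3, h]

/-- The component `U ↦ U^I`. -/
def firstComp : State →L[ℝ] ℝ := EuclideanSpace.proj (0 : Fin 3)

/-- The inclusion of the `j`-th component of `U^II`. -/
def secondIncl (j : Fin 2) : ℝ →L[ℝ] State :=
  ContinuousLinearMap.toSpanSingleton ℝ (EuclideanSpace.single j.succ (1 : ℝ))

/-- The operator of the matrix `G_j`. -/
def gOp (j : Fin 2) : State →L[ℝ] State := Matrix.toEuclideanCLM (n := Fin 3) (𝕜 := ℝ) (gMat j)

lemma ofLp_gOp (j : Fin 2) (y : State) : (gOp j y).ofLp = gMat j *ᵥ y.ofLp := rfl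

lemma norm_firstComp_le : ‖firstComp‖ ≤ 1 :=
  ContinuousLinearMap.opNorm_le_bound _ zero_le_one fun U => by
    rw [one_mul]
    exact abs_apply_le_norm U 0

/-- Row j of the velocity block of G_i is nonzero only for i = j and then selects U^I. Hence the
velocity components of ∑ G_i ∂_i w form the gradient of w^I, which is what the boundary pairing
needs. -/
lemma inner_secondIncl_gOp (i j : Fin 2) (r : ℝ) (y : State) :
    (inner ℝ (secondIncl j r) (gOp i y) : ℝ) =
      inner ℝ r ((if i = j then firstComp else 0) y) := by
  have e : (inner ℝ (secondIncl j r) (gOp i y) : ℝ) = (gMat i *ᵥ y.ofLp) j.succ * r := by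
    simp [secondIncl, ContinuousLinearMap.toSpanSingleton_apply, inner_smul_left,
      EuclideanSpace.inner_single_left, ← ofLp_gOp, mul_comm]
  rw [e]
  fin_cases i <;> fin_cases j <;>
    simp [gMat, firstComp, Matrix.mulVec, dotProduct, Fin.sum_univ_three]

/-- The spatial part `∑ G_j ∂_j w` of the system. -/
def spaceOp {Ω : Set Plane} (dw : Fin 2 → L2 Ω State) : L2 Ω State :=
  ∑ j, (gOp j).compLpL 2 _ (dw j)

/-- The pairing of boundary traces, written in the exterior region. -/
theorem JordanCurve.exists_boundary_pairing (Γ : JordanCurve) :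
    ∃ (c₁ : ℝ) (Y : L2 Γ.ext ℝ →L[ℝ] L2 Γ.ext State)
      (q : (L2 Γ.ext ℝ × (Fin 2 → L2 Γ.ext ℝ)) × (L2 Γ.ext State × (Fin 2 → L2 Γ.ext State)) → ℝ),
      0 ≤ c₁ ∧ Continuous q ∧
      (∀ x ∈ traceSpace Γ Γ.ext ℝ, ∀ y ∈ traceSpace Γ Γ.ext State,
        (inner ℝ x.2.2 (firstComp.compLpL 2 _ y.2.2) : ℝ) = q ((x.1, x.2.1), (y.1, y.2.1))) ∧
      ∀ a b, q (a, b) ≤ c₁ * (‖a‖ * ‖b.1‖) + inner ℝ (Y a.1) (spaceOp b.2) := by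
  obtain ⟨δ, hδ⟩ := Γ.exists_tubeRadius
  obtain ⟨b, X, hid⟩ := hδ.isSide_ext.exists_trace_identity
  let T := mulTest Γ.ext b
  let V := fun j => mulTest Γ.ext (X j)
  let P : L2 Γ.ext State →L[ℝ] L2 Γ.ext ℝ := firstComp.compLpL 2 _
  -- Y a = (0, X₁a, X₂a), so that pairing Y a with the spatial operator returns ∑ X_j a ∂_j w^I.
  let Y : L2 Γ.ext ℝ →L[ℝ] L2 Γ.ext State := ∑ j, ((secondIncl j).compLpL 2 _).comp (V j)
  have hP : ∀ f, ‖P f‖ ≤ ‖f‖ := fun f => by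
    simpa using P.le_of_opNorm_le ((ContinuousLinearMap.norm_compLpL_le _).trans norm_firstComp_le) f
  refine ⟨‖T‖ + ∑ j, ‖V j‖, Y, fun z => inner ℝ (T z.1.1) (P z.2.1) +
    ∑ j, (inner ℝ (V j (z.1.2 j)) (P z.2.1) + inner ℝ (V j z.1.1) (P (z.2.2 j))), ?_, ?_,
    fun x hx y hy => hid x hx _ (mapTriple_mem firstComp hy), fun a w => ?_⟩
  · positivity
  · fun_prop
  · have hY : (inner ℝ (Y a.1) (spaceOp w.2) : ℝ) = ∑ j, inner ℝ (V j a.1) (P (w.2 j)) := by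
      have h0 : ∀ f : L2 Γ.ext State,
          (0 : State →L[ℝ] ℝ).compLpL 2 (volume.restrict Γ.ext) f = 0 := fun f => by
        refine norm_le_zero_iff.1 ?_
        simpa using ((0 : State →L[ℝ] ℝ).compLpL 2 (volume.restrict Γ.ext)).le_of_opNorm_le
          (ContinuousLinearMap.norm_compLpL_le _) f
      have h1 : ∀ i j, (inner ℝ ((secondIncl j).compLpL 2 (volume.restrict Γ.ext) (V j a.1))
          ((gOp i).compLpL 2 _ (w.2 i)) : ℝ) = if i = j then inner ℝ (V j a.1) (P (w.2 i)) else 0 := by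
        intro i j
        rw [inner_compLpL (inner_secondIncl_gOp i j)]
        split_ifs with h
        · rfl
        · rw [h0, inner_zero_right]
      simp only [Y, spaceOp, _root_.sum_apply, ContinuousLinearMap.comp_apply,
        sum_inner, inner_sum, h1, Finset.mem_univ, if_true, Finset.sum_ite_eq]
    have hb : ∀ (S : L2 Γ.ext ℝ →L[ℝ] L2 Γ.ext ℝ) (f : L2 Γ.ext ℝ), ‖f‖ ≤ ‖a‖ →
        (inner ℝ (S f) (P w.1) : ℝ) ≤ ‖S‖ * (‖a‖ * ‖w.1‖) := fun S f hf => by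
      refine (real_inner_le_norm _ _).trans ?_
      rw [← mul_assoc]
      exact mul_le_mul ((S.le_opNorm f).trans (mul_le_mul_of_nonneg_left hf (norm_nonneg _)))
        (hP _) (norm_nonneg _) (by positivity)
    have h2 := hb T a.1 (norm_fst_le a)
    have h3 : ∀ j, _ := fun j => hb (V j) (a.2 j) ((norm_le_pi_norm a.2 j).trans (norm_snd_le a))
    have h4 := Finset.sum_le_sum fun j (_ : j ∈ Finset.univ) => h3 j
    -- The terms in which w is not differentiated are bounded by norms; the remaining one is exactly
    -- the pairing with Y.
    rw [hY, add_mul, Finset.sum_mul]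
    simp only [Finset.sum_add_distrib]
    linarith

end WaveStructure
end

noncomputable section
namespace WaveStructure

/-! ### The equation in symmetric form -/

lemma coeFn_spaceOp {Ω : Set Plane} (dw : Fin 2 → L2 Ω State) :
    spaceOp dw =ᵐ[volume.restrict Ω] fun x => ∑ j, gOp j (dw j x) := by
  simp only [spaceOp, Fin.sum_univ_two]
  filter_upwards [(gOp 0).coeFn_compLpL (dw 0), (gOp 1).coeFn_compLpL (dw 1),
    Lp.coeFn_add ((gOp 0).compLpL 2 (volume.restrict Ω) (dw 0)) ((gOp 1).compLpL 2 _ (dw 1))]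
    with x h0 h1 h
  rw [h, Pi.add_apply, h0, h1]

/-- Solutions of the equation satisfy `S(u) ∂_t w + ∑ G_j ∂_j w = f`. -/
theorem symmetric_equation {Γ : JordanCurve} {gr H₀ c₀ M₀ M₁ T : ℝ} {u ut : ℝ → Plane → State}
    (h : BackgroundState Γ gr H₀ c₀ M₀ M₁ T u ut) (hgr : 0 < gr) (hc₀ : 0 < c₀)
    (hM₁ : 0 ≤ M₁) (hT : 0 < T) {𝒮 : ℝ → L2 Γ.ext State →L[ℝ] L2 Γ.ext State}
    (h𝒮 : ∀ t ∈ Icc 0 T, ∀ f : L2 Γ.ext State,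
        𝒮 t f =ᵐ[volume.restrict Γ.ext] fun x => symOp gr H₀ (u t x) (f x))
    {f : ℝ → L2 Γ.ext State} {w : W1 Γ.ext State T}
    (heq : ∀ᵐ t ∂(volume.restrict (Ioo 0 T)), ∀ᵐ x ∂(volume.restrict Γ.ext),
      (w.dt t x).ofLp + ∑ j, (sigmaMat gr H₀ (u t x) * gMat j) *ᵥ (w.dx j t x).ofLp =
        sigmaMat gr H₀ (u t x) *ᵥ (f t x).ofLp) :
    ∀ᵐ t ∂(volume.restrict (Icc 0 T)), f t = 𝒮 t (w.dt t) + spaceOp fun j => w.dx j t := by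
  rw [← Measure.restrict_congr_set Ioo_ae_eq_Icc]
  filter_upwards [heq, ae_restrict_mem measurableSet_Ioo] with t ht htI
  have htI' := Ioo_subset_Icc_self htI
  refine Lp.ext ?_
  filter_upwards [ht, h𝒮 t htI' (w.dt t), coeFn_spaceOp (fun j => w.dx j t), h.ae_bounds hT hM₁,
    Lp.coeFn_add (𝒮 t (w.dt t)) (spaceOp fun j => w.dx j t)] with x hx h1 h2 h3 h4
  rw [h4, Pi.add_apply, h1, h2]
  have hsub := (h3 t htI').2
  have e : w.dt t x + sigmaOp gr H₀ (u t x) (∑ j, gOp j (w.dx j t x)) =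
      sigmaOp gr H₀ (u t x) (f t x) := by
    refine WithLp.ofLp_injective 2 ?_
    rw [WithLp.ofLp_add, ofLp_sigmaOp, ofLp_sigmaOp, ← hx, WithLp.ofLp_sum, Matrix.mulVec_sum]
    simp only [ofLp_gOp, Matrix.mulVec_mulVec]
  -- Multiplying by S(u) cancels Σ(u) in front of the spatial part and of the source.
  have e2 := congrArg (symOp gr H₀ (u t x)) e
  rw [map_add, hsub.symOp_sigmaOp hgr hc₀, hsub.symOp_sigmaOp hgr hc₀] at e2
  exact e2.symm

/-! ### The energy of the boundary function -/

section Energy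

variable {H : Type*} [NormedAddCommGroup H] [InnerProductSpace ℝ H]

/-- The energy estimate for the boundary function. -/
theorem boundary_energy_le {lam t : ℝ} (hlam : 0 < lam) (ht : 0 ≤ t) {Ψ Ψ' R : ℝ → H}
    (hΨ : ∀ τ ∈ Icc 0 t, HasDerivWithinAt Ψ (Ψ' τ) (Icc 0 t) τ)
    (hΨ' : ContinuousOn Ψ' (Icc 0 t)) (hR : ContinuousOn R (Icc 0 t)) :
    2 * ∫ s in (0 : ℝ)..t, Real.exp (-2 * lam * s) * inner ℝ (Ψ s) (R s - Ψ' s) ≤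
      -(Real.exp (-2 * lam * t) * ‖Ψ t‖ ^ 2 +
        lam * ∫ s in (0 : ℝ)..t, Real.exp (-2 * lam * s) * ‖Ψ s‖ ^ 2) + ‖Ψ 0‖ ^ 2 +
        lam⁻¹ * ∫ s in (0 : ℝ)..t, Real.exp (-2 * lam * s) * ‖R s‖ ^ 2 := by
  have hc := HasDerivWithinAt.continuousOn_of_forall hΨ
  have i1 := intervalIntegrable_weight (lam := lam) ht (hc.inner hR)
  have i2 := intervalIntegrable_weight (lam := lam) ht (hc.inner hΨ')
  have i3 := intervalIntegrable_weight (lam := lam) ht (φ := fun s => ‖Ψ s‖ ^ 2) (hc.norm.pow 2)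
  have i4 := intervalIntegrable_weight (lam := lam) ht (φ := fun s => ‖R s‖ ^ 2) (hR.norm.pow 2)
  have e : ∫ s in (0 : ℝ)..t, Real.exp (-2 * lam * s) * inner ℝ (Ψ s) (R s - Ψ' s) =
      (∫ s in (0 : ℝ)..t, Real.exp (-2 * lam * s) * inner ℝ (Ψ s) (R s)) -
        ∫ s in (0 : ℝ)..t, Real.exp (-2 * lam * s) * inner ℝ (Ψ s) (Ψ' s) := by
    rw [← intervalIntegral.integral_sub i1 i2]
    refine intervalIntegral.integral_congr fun s _ => ?_
    simp only [inner_sub_right, mul_sub]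
  -- Young's inequality with parameter λ spends one of the two copies of λ∫‖Ψ‖² supplied by the
  -- weight; the other survives in the energy.
  have hle : 2 * ∫ s in (0 : ℝ)..t, Real.exp (-2 * lam * s) * inner ℝ (Ψ s) (R s) ≤
      lam * (∫ s in (0 : ℝ)..t, Real.exp (-2 * lam * s) * ‖Ψ s‖ ^ 2) +
        lam⁻¹ * ∫ s in (0 : ℝ)..t, Real.exp (-2 * lam * s) * ‖R s‖ ^ 2 := by
    rw [← intervalIntegral.integral_const_mul, ← intervalIntegral.integral_const_mul,
      ← intervalIntegral.integral_const_mul,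
      ← intervalIntegral.integral_add (i3.const_mul _) (i4.const_mul _)]
    refine intervalIntegral.integral_mono_on ht (i1.const_mul 2)
      ((i3.const_mul _).add (i4.const_mul _)) fun s _ => ?_
    have h1 : 2 * inner ℝ (Ψ s) (R s) ≤ lam * ‖Ψ s‖ ^ 2 + lam⁻¹ * ‖R s‖ ^ 2 := by
      have h2 := real_inner_le_norm (Ψ s) (R s)
      have h3 : lam * ‖Ψ s‖ ^ 2 + lam⁻¹ * ‖R s‖ ^ 2 - 2 * (‖Ψ s‖ * ‖R s‖) =
          lam⁻¹ * (lam * ‖Ψ s‖ - ‖R s‖) ^ 2 := by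
        field_simp
        ring
      have h4 : 0 ≤ lam⁻¹ * (lam * ‖Ψ s‖ - ‖R s‖) ^ 2 := by positivity
      linarith
    have := mul_le_mul_of_nonneg_left h1 (Real.exp_pos (-2 * lam * s)).le
    linarith
  have h2 := integral_weight_inner (lam := lam) ht hΨ hΨ'
  rw [e]
  linarith

end Energy

/-! ### Functions of time with values in `H^{1/2}(Γ)` -/

section Half

variable {Γ : JordanCurve} {H : Type*} [NormedAddCommGroup H] [InnerProductSpace ℝ H]

lemma hNormTan_toReal_sub_le {a b : L2Γ Γ ℝ} (ha : a ∈ Hhalf Γ) (hb : b ∈ Hhalf Γ) :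
    |(hNormTan Γ (-1 / 2) a).toReal - (hNormTan Γ (-1 / 2) b).toReal| ≤
      (hNormTan Γ (-1 / 2) (a - b)).toReal := by
  have key : ∀ {a b : L2Γ Γ ℝ}, a ∈ Hhalf Γ → b ∈ Hhalf Γ → (hNormTan Γ (-1 / 2) a).toReal ≤
      (hNormTan Γ (-1 / 2) (a - b)).toReal + (hNormTan Γ (-1 / 2) b).toReal := by
    intro a b ha hb
    have hab := hNormTan_lt_top ((Hhalf Γ).sub_mem ha hb)
    have hb' := hNormTan_lt_top hb
    rw [← ENNReal.toReal_add hab.ne hb'.ne]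
    refine ENNReal.toReal_mono (ENNReal.add_lt_top.2 ⟨hab, hb'⟩).ne ?_
    simpa using hNormTan_add_le (-1 / 2) (a - b) b
  have hsym : hNormTan Γ (-1 / 2) (b - a) = hNormTan Γ (-1 / 2) (a - b) := by
    have h : ∀ c : L2Γ Γ ℝ, hNormTan Γ (-1 / 2) (-c) = hNormTan Γ (-1 / 2) c := fun c => by
      have : ∀ k, fourierCoef Γ (-c) k = -fourierCoef Γ c k := fun k => by
        simpa using fourierCoef_smul (-1) c k
      simp only [hNormTan, hNormCoef, this, norm_mul, norm_neg]
    rw [← h, neg_sub]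
  have h1 := key ha hb
  have h2 := key hb ha
  rw [hsym] at h2
  rw [abs_le]
  constructor <;> linarith

/-- `Φ` represents the Dirichlet-to-Neumann form. -/
structure IsFactor (Γ : JordanCurve) (Φ : L2Γ Γ ℝ →ₗ[ℝ] H) (cl cu : ℝ) : Prop where
  pos : 0 < cl
  le : cl ≤ cu
  lower : ∀ ρ ∈ Hhalf Γ, cl * (hNormTan Γ (-1 / 2) ρ).toReal ^ 2 ≤ ‖Φ ρ‖ ^ 2
  upper : ∀ ρ ∈ Hhalf Γ, ‖Φ ρ‖ ^ 2 ≤ cu * (hNormTan Γ (-1 / 2) ρ).toReal ^ 2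

variable {Φ : L2Γ Γ ℝ →ₗ[ℝ] H} {cl cu : ℝ}

lemma IsFactor.norm_le (h : IsFactor Γ Φ cl cu) {ρ : L2Γ Γ ℝ} (hρ : ρ ∈ Hhalf Γ) :
    ‖Φ ρ‖ ≤ Real.sqrt cu * (hNormTan Γ (-1 / 2) ρ).toReal := by
  have hcu : 0 ≤ cu := h.pos.le.trans h.le
  refine abs_le_of_sq_le_sq' ?_ (by positivity) |>.2
  rw [mul_pow, Real.sq_sqrt hcu]
  exact h.upper ρ hρ

lemma IsFactor.norm_le_hNorm (h : IsFactor Γ Φ cl cu) {ρ : L2Γ Γ ℝ} (hρ : ρ ∈ Hhalf Γ) :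
    ‖Φ ρ‖ ≤ Real.sqrt cu * (hNorm Γ (1 / 2) ρ).toReal :=
  (h.norm_le hρ).trans (mul_le_mul_of_nonneg_left
    (ENNReal.toReal_mono (mem_Hhalf.1 hρ).ne (hNormTan_le_hNorm ρ)) (Real.sqrt_nonneg _))

lemma IsFactor.le_norm (h : IsFactor Γ Φ cl cu) {ρ : L2Γ Γ ℝ} (hρ : ρ ∈ Hhalf Γ) :
    (hNormTan Γ (-1 / 2) ρ).toReal ≤ (Real.sqrt cl)⁻¹ * ‖Φ ρ‖ := by
  have hs := Real.sqrt_pos.2 h.pos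
  rw [inv_mul_eq_div, le_div_iff₀ hs]
  refine abs_le_of_sq_le_sq' ?_ (norm_nonneg _) |>.2
  rw [mul_pow, Real.sq_sqrt h.pos.le, mul_comm]
  exact h.lower ρ hρ

/-- The lower bound of the form makes the seminorm of a difference at most a multiple of the norm of
its image, so continuity of the image carries over. -/
lemma IsFactor.continuousOn_hNormTan (h : IsFactor Γ Φ cl cu) {s : Set ℝ} {ρ : ℝ → L2Γ Γ ℝ}
    (hρ : ∀ t ∈ s, ρ t ∈ Hhalf Γ) (hc : ContinuousOn (fun t => Φ (ρ t)) s) :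
    ContinuousOn (fun t => (hNormTan Γ (-1 / 2) (ρ t)).toReal) s := by
  intro t ht
  rw [ContinuousWithinAt, tendsto_iff_dist_tendsto_zero]
  have h1 := (tendsto_iff_norm_sub_tendsto_zero.1 (hc t ht)).const_mul (Real.sqrt cl)⁻¹
  rw [mul_zero] at h1
  refine squeeze_zero' (Eventually.of_forall fun _ => dist_nonneg) ?_ h1
  filter_upwards [self_mem_nhdsWithin] with τ hτ
  rw [← map_sub]
  exact (hNormTan_toReal_sub_le (hρ τ hτ) (hρ t ht)).trans
    (h.le_norm ((Hhalf Γ).sub_mem (hρ τ hτ) (hρ t ht)))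

/-- On H^{1/2} the upper bound makes Φ continuous, so it commutes with differentiation in that norm.
-/
lemma IsFactor.hasDerivWithinAt (h : IsFactor Γ Φ cl cu) {T : ℝ} {ψ ψt : ℝ → L2Γ Γ ℝ}
    (hψ : IsC1H Γ (1 / 2) T ψ ψt) {t : ℝ} (ht : t ∈ Icc 0 T) :
    HasDerivWithinAt (fun τ => Φ (ψ τ)) (Φ (ψt t)) (Icc 0 T) t := by
  rw [hasDerivWithinAt_iff_tendsto_slope, tendsto_iff_norm_sub_tendsto_zero]
  have h1 := ((ENNReal.tendsto_toReal ENNReal.zero_ne_top).comp (hψ.hasDeriv t ht)).const_mul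
    (Real.sqrt cu)
  rw [ENNReal.toReal_zero, mul_zero] at h1
  refine squeeze_zero' (Eventually.of_forall fun _ => norm_nonneg _) ?_ h1
  filter_upwards [self_mem_nhdsWithin] with τ hτ
  have hne : τ - t ≠ 0 := sub_ne_zero.2 hτ.2
  have hpos : 0 < |τ - t| := abs_pos.2 hne
  have hmem : ψ τ - ψ t - (τ - t) • ψt t ∈ Hhalf Γ := (Hhalf Γ).sub_mem
    ((Hhalf Γ).sub_mem (hψ.mem τ hτ.1) (hψ.mem t ht)) ((Hhalf Γ).smul_mem _ (hψ.mem_dt t ht))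
  have e : slope (fun τ => Φ (ψ τ)) t τ - Φ (ψt t) =
      (τ - t)⁻¹ • Φ (ψ τ - ψ t - (τ - t) • ψt t) := by
    rw [slope_def_module, map_sub, map_sub, map_smul, smul_sub _ (Φ (ψ τ) - Φ (ψ t)), smul_smul,
      inv_mul_cancel₀ hne, one_smul]
  rw [e, norm_smul, norm_inv, Real.norm_eq_abs, Function.comp_apply, ENNReal.toReal_div,
    ENNReal.toReal_ofReal hpos.le, inv_mul_eq_div, ← mul_div_assoc]
  exact div_le_div_of_nonneg_right (h.norm_le_hNorm hmem) hpos.le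

lemma IsFactor.continuousOn_dt (h : IsFactor Γ Φ cl cu) {T : ℝ} {ψ ψt : ℝ → L2Γ Γ ℝ}
    (hψ : IsC1H Γ (1 / 2) T ψ ψt) : ContinuousOn (fun τ => Φ (ψt τ)) (Icc 0 T) := by
  intro t ht
  rw [ContinuousWithinAt, tendsto_iff_norm_sub_tendsto_zero]
  have h1 := ((ENNReal.tendsto_toReal ENNReal.zero_ne_top).comp (hψ.continuous_dt t ht)).const_mul
    (Real.sqrt cu)
  rw [ENNReal.toReal_zero, mul_zero] at h1
  refine squeeze_zero' (Eventually.of_forall fun _ => norm_nonneg _) ?_ h1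
  filter_upwards [self_mem_nhdsWithin] with τ hτ
  rw [← map_sub]
  exact h.norm_le_hNorm ((Hhalf Γ).sub_mem (hψ.mem_dt τ hτ) (hψ.mem_dt t ht))

/-- The map of `exists_dn_factorization` is extended algebraically from H^{1/2} to all of L²(Γ),
which avoids subtypes. The extension is not claimed to be continuous for the L² norm, and its values
off H^{1/2} play no role. -/
theorem exists_isFactor {c₀ : ℝ} (hc₀ : 0 < c₀) {hi : Plane → ℝ} (hhi : DepthAssumption Γ c₀ hi)
    (hcl : 0 < cl) (hcu : cl ≤ cu) (hDN : IsDNConstants Γ hi cl cu) :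
    ∃ Φ : L2Γ Γ ℝ →ₗ[ℝ] PiLp 2 (fun _ : Fin 2 => L2 Γ.int ℝ), IsFactor Γ Φ cl cu ∧
      ∀ ψ ∈ Hhalf Γ, ∀ η ∈ Hhalf Γ, dirichletToNeumann Γ hi ψ η = inner ℝ (Φ ψ) (Φ η) := by
  obtain ⟨Φ₀, h₀, -⟩ := exists_dn_factorization hc₀ hhi
  obtain ⟨Φ, hΦ⟩ := Φ₀.exists_extend
  have e : ∀ ψ (hψ : ψ ∈ Hhalf Γ), Φ ψ = Φ₀ ⟨ψ, hψ⟩ := fun ψ hψ => by rw [← hΦ]; rfl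
  have hin : ∀ ψ ∈ Hhalf Γ, ∀ η ∈ Hhalf Γ,
      dirichletToNeumann Γ hi ψ η = inner ℝ (Φ ψ) (Φ η) := fun ψ hψ η hη => by
    rw [e ψ hψ, e η hη]
    exact h₀ ⟨ψ, hψ⟩ ⟨η, hη⟩
  refine ⟨Φ, ⟨hcl, hcu, fun ρ hρ => ?_, fun ρ hρ => ?_⟩, hin⟩
  · rw [← real_inner_self_eq_norm_sq, ← hin ρ hρ ρ hρ]
    exact (hDN ρ hρ).1
  · rw [← real_inner_self_eq_norm_sq, ← hin ρ hρ ρ hρ]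
    exact (hDN ρ hρ).2

/-- The trace of the first component. -/
theorem exists_firstComp_trace (Γ : JordanCurve) : ∃ C, 0 < C ∧ ∀ y ∈ traceSpace Γ Γ.ext State,
    firstComp.compLpL 2 _ y.2.2 ∈ Hhalf Γ ∧
      (hNormTan Γ (-1 / 2) (firstComp.compLpL 2 _ y.2.2)).toReal ^ 2 ≤ C * ∑ j, ‖y.2.1 j‖ ^ 2 := by
  obtain ⟨δ, hδ⟩ := Γ.exists_tubeRadius
  obtain ⟨C, hC, h⟩ := hδ.isSide_ext.exists_trace_hNorm
  refine ⟨C, hC, fun y hy => ?_⟩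
  obtain ⟨h1, h2⟩ := h _ (mapTriple_mem firstComp hy)
  refine ⟨h1, h2.trans (mul_le_mul_of_nonneg_left (Finset.sum_le_sum fun j _ => ?_) hC.le)⟩
  refine pow_le_pow_left₀ (norm_nonneg _) ?_ 2
  change ‖firstComp.compLpL 2 (volume.restrict Γ.ext) (y.2.1 j)‖ ≤ _
  simpa using (firstComp.compLpL 2 (volume.restrict Γ.ext)).le_of_opNorm_le
    ((ContinuousLinearMap.norm_compLpL_le _).trans norm_firstComp_le) (y.2.1 j)

/-- The trace estimate bounds Φ of a trace difference by the difference of gradients, so continuity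
of the gradient in L² suffices. -/
lemma IsFactor.continuousOn_trace (h : IsFactor Γ Φ cl cu) {s : Set ℝ}
    {y : ℝ → Triple Γ Γ.ext State} (hy : ∀ t ∈ s, y t ∈ traceSpace Γ Γ.ext State)
    (hc : ∀ j, ContinuousOn (fun t => (y t).2.1 j) s) :
    ContinuousOn (fun t => Φ (firstComp.compLpL 2 _ (y t).2.2)) s := by
  obtain ⟨C, hC, htr⟩ := exists_firstComp_trace Γ
  have hcu : 0 ≤ cu := h.pos.le.trans h.le
  intro t ht
  rw [ContinuousWithinAt, tendsto_iff_norm_sub_tendsto_zero]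
  have h1 : Tendsto (fun τ => Real.sqrt (cu * (C * ∑ j, ‖(y τ).2.1 j - (y t).2.1 j‖ ^ 2)))
      (𝓝[s] t) (𝓝 0) := by
    have h2 : Tendsto (fun τ => cu * (C * ∑ j, ‖(y τ).2.1 j - (y t).2.1 j‖ ^ 2)) (𝓝[s] t)
        (𝓝 (cu * (C * ∑ _j : Fin 2, 0 ^ 2))) := by
      refine (tendsto_finsetSum _ fun j _ => ?_).const_mul C |>.const_mul cu
      exact (tendsto_iff_norm_sub_tendsto_zero.1 (hc j t ht)).pow 2
    simpa using h2.sqrt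
  refine squeeze_zero' (Eventually.of_forall fun _ => norm_nonneg _) ?_ h1
  filter_upwards [self_mem_nhdsWithin] with τ hτ
  obtain ⟨h2, h3⟩ := htr _ (Submodule.sub_mem _ (hy τ hτ) (hy t ht))
  rw [← map_sub, ← map_sub]
  refine Real.le_sqrt_of_sq_le ?_
  exact (h.upper _ h2).trans (mul_le_mul_of_nonneg_left h3 hcu)

end Half

end WaveStructure
end

noncomputable section
namespace WaveStructure

/-! ### Weak dissipativity -/

lemma l2Norm_congr_ae {lam t : ℝ} {f g : ℝ → ℝ≥0∞}
    (h : ∀ᵐ τ ∂(volume.restrict (Icc 0 t)), f τ = g τ) : l2Norm lam t f = l2Norm lam t g := by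
  simp only [l2Norm]
  congr 1
  refine lintegral_congr_ae ?_
  filter_upwards [h] with τ hτ
  rw [hτ]

lemma sStar_congr {lam t : ℝ} {f g : ℝ → ℝ} (h : ∀ᵐ τ ∂(volume.restrict (Icc 0 t)), f τ = g τ) :
    sStar lam t f = sStar lam t g :=
  le_antisymm (sStar_mono (h.mono fun τ hτ => by rw [hτ])) (sStar_mono (h.mono fun τ hτ => by rw [hτ]))

lemma hNormTan_eq_ofReal {Γ : JordanCurve} {ρ : L2Γ Γ ℝ} (hρ : ρ ∈ Hhalf Γ) :
    hNormTan Γ (-1 / 2) ρ = ENNReal.ofReal |(hNormTan Γ (-1 / 2) ρ).toReal| := by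
  rw [abs_of_nonneg ENNReal.toReal_nonneg, ENNReal.ofReal_toReal (hNormTan_lt_top hρ).ne]

lemma l2Norm_hNormTan_sq {Γ : JordanCurve} {lam t : ℝ} (ht : 0 ≤ t) {ρ : ℝ → L2Γ Γ ℝ}
    (hρ : ∀ τ ∈ Icc 0 t, ρ τ ∈ Hhalf Γ)
    (hc : ContinuousOn (fun τ => (hNormTan Γ (-1 / 2) (ρ τ)).toReal) (Icc 0 t)) :
    l2Norm lam t (fun τ => hNormTan Γ (-1 / 2) (ρ τ)) ^ 2 = ENNReal.ofReal
      (∫ τ in (0 : ℝ)..t, Real.exp (-2 * lam * τ) * (hNormTan Γ (-1 / 2) (ρ τ)).toReal ^ 2) := by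
  rw [← l2Norm_sq_eq ht hc, l2Norm_congr fun τ hτ => hNormTan_eq_ofReal (hρ τ hτ)]

lemma boundaryEnergy_eq {Γ : JordanCurve} {cl lam t : ℝ} (hcl : 0 ≤ cl) (hlam : 0 ≤ lam)
    (ht : 0 ≤ t) {ψ : ℝ → L2Γ Γ ℝ} (hψ : ∀ τ ∈ Icc 0 t, ψ τ ∈ Hhalf Γ)
    (hc : ContinuousOn (fun τ => (hNormTan Γ (-1 / 2) (ψ τ)).toReal) (Icc 0 t)) :
    boundaryEnergy Γ cl ψ lam t = ENNReal.ofReal (cl * (Real.exp (-2 * lam * t) *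
      (hNormTan Γ (-1 / 2) (ψ t)).toReal ^ 2 + lam * ∫ τ in (0 : ℝ)..t,
        Real.exp (-2 * lam * τ) * (hNormTan Γ (-1 / 2) (ψ τ)).toReal ^ 2)) := by
  have hI : 0 ≤ ∫ τ in (0 : ℝ)..t,
      Real.exp (-2 * lam * τ) * (hNormTan Γ (-1 / 2) (ψ τ)).toReal ^ 2 :=
    intervalIntegral.integral_nonneg ht fun τ _ => by positivity
  rw [boundaryEnergy, l2Norm_hNormTan_sq ht hψ hc, ENNReal.ofReal_mul hcl,
    ENNReal.ofReal_add (by positivity) (by positivity), ENNReal.ofReal_mul (Real.exp_pos _).le,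
    ENNReal.ofReal_mul hlam, ENNReal.ofReal_pow ENNReal.toReal_nonneg,
    ENNReal.ofReal_toReal (hNormTan_lt_top (hψ t (right_mem_Icc.2 ht))).ne]

/-- The sources f and g₂ are not assumed to be regular in time. Replacing them by continuous
representatives that agree almost everywhere makes every norm finite and allows the passage to real
numbers. -/
lemma dataTerm_eq {Γ : JordanCurve} {C lam t T : ℝ} (hC : 0 ≤ C) (hlam : 0 ≤ lam)
    (ht : 0 ≤ t) {ψ g₂ ρ : ℝ → L2Γ Γ ℝ} {f F : ℝ → L2 Γ.ext State} {g₁ext : W1 Γ.ext ℝ T}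
    (hψ : ψ 0 ∈ Hhalf Γ) (hρ : ∀ τ ∈ Icc 0 t, ρ τ ∈ Hhalf Γ)
    (hc : ContinuousOn (fun τ => (hNormTan Γ (-1 / 2) (ρ τ)).toReal) (Icc 0 t))
    (hg₂ : ∀ᵐ τ ∂(volume.restrict (Icc 0 t)), g₂ τ = ρ τ)
    (hfF : ∀ᵐ τ ∂(volume.restrict (Icc 0 t)), f τ = F τ) (hF : ContinuousOn F (Icc 0 t))
    (hN : ContinuousOn g₁ext.norm1 (Icc 0 t)) :
    dataTerm Γ C ψ f g₁ext g₂ lam t = ENNReal.ofReal (C * ((hNormTan Γ (-1 / 2) (ψ 0)).toReal ^ 2 +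
      ‖g₁ext.val 0‖ ^ 2 + (sStar lam t fun τ => ‖F τ‖).toReal ^ 2 +
      (sStar lam t g₁ext.norm1).toReal ^ 2 + lam⁻¹ * ∫ τ in (0 : ℝ)..t,
        Real.exp (-2 * lam * τ) * (hNormTan Γ (-1 / 2) (ρ τ)).toReal ^ 2)) := by
  have hI : 0 ≤ ∫ τ in (0 : ℝ)..t,
      Real.exp (-2 * lam * τ) * (hNormTan Γ (-1 / 2) (ρ τ)).toReal ^ 2 :=
    intervalIntegral.integral_nonneg ht fun τ _ => by positivity
  have hS : ∀ {φ : ℝ → ℝ}, ContinuousOn φ (Icc 0 t) → sStar lam t φ ≠ ⊤ := fun {φ} hφ => by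
    obtain ⟨A, hA⟩ := isCompact_Icc.exists_bound_of_continuousOn hφ
    refine (sStar_lt_top hlam (C := A) ?_).ne
    filter_upwards [ae_restrict_mem measurableSet_Icc] with τ hτ using hA τ hτ
  rw [dataTerm, l2Norm_congr_ae (g := fun τ => hNormTan Γ (-1 / 2) (ρ τ))
      (hg₂.mono fun τ hτ => by rw [hτ]), l2Norm_hNormTan_sq ht hρ hc,
    sStar_congr (g := fun τ => ‖F τ‖) (hfF.mono fun τ hτ => by rw [hτ]), ENNReal.ofReal_mul hC,
    ENNReal.ofReal_add (by positivity) (by positivity),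
    ENNReal.ofReal_add (by positivity) (by positivity),
    ENNReal.ofReal_add (by positivity) (by positivity),
    ENNReal.ofReal_add (by positivity) (by positivity),
    ENNReal.ofReal_mul (by positivity), ENNReal.ofReal_pow ENNReal.toReal_nonneg,
    ENNReal.ofReal_pow (ENNReal.toReal_nonneg (a := sStar lam t fun τ => ‖F τ‖)),
    ENNReal.ofReal_pow (ENNReal.toReal_nonneg (a := sStar lam t g₁ext.norm1)),
    ENNReal.ofReal_toReal (hNormTan_lt_top hψ).ne, ENNReal.ofReal_toReal (hS hF.norm),
    ENNReal.ofReal_toReal (hS hN)]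

lemma dataTerm_mono {Γ : JordanCurve} {C lam t t' T : ℝ} (h : t ≤ t')
    (ψ g₂ : ℝ → L2Γ Γ ℝ) (f : ℝ → L2 Γ.ext State) (g₁ext : W1 Γ.ext ℝ T) :
    dataTerm Γ C ψ f g₁ext g₂ lam t ≤ dataTerm Γ C ψ f g₁ext g₂ lam t' := by
  have h1 := sStar_mono_time (lam := lam) h fun τ => ‖f τ‖
  have h2 := sStar_mono_time (lam := lam) h g₁ext.norm1
  have h3 := l2Norm_mono (lam := lam) h fun τ => hNormTan Γ (-1 / 2) (g₂ τ)
  unfold dataTerm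
  gcongr

lemma W1.continuousOn_val {Ω : Set Plane} {F : Type} [NormedAddCommGroup F] [NormedSpace ℝ F]
    {T : ℝ} (f : W1 Ω F T) : ContinuousOn f.val (Icc 0 T) :=
  HasDerivWithinAt.continuousOn_of_forall f.hasDeriv

lemma W1.continuousOn_grad {Ω : Set Plane} {F : Type} [NormedAddCommGroup F] [NormedSpace ℝ F]
    {T : ℝ} (f : W1 Ω F T) : ContinuousOn (fun t => (f.val t, fun j => f.dx j t)) (Icc 0 T) :=
  f.continuousOn_val.prodMk (continuousOn_pi.2 f.continuousOn_dx)

lemma W1.continuousOn_norm1 {Ω : Set Plane} {F : Type} [NormedAddCommGroup F] [NormedSpace ℝ F]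
    {T : ℝ} (f : W1 Ω F T) : ContinuousOn f.norm1 (Icc 0 T) :=
  (((f.continuousOn_val.norm.pow 2).add (continuousOn_finsetSum _ fun j _ =>
    (f.continuousOn_dx j).norm.pow 2)).sqrt).add f.continuousOn_dt.norm

lemma W1.norm_dt_le {Ω : Set Plane} {F : Type} [NormedAddCommGroup F] [NormedSpace ℝ F]
    {T : ℝ} (f : W1 Ω F T) (t : ℝ) : ‖f.dt t‖ ≤ f.norm1 t :=
  le_add_of_nonneg_left (Real.sqrt_nonneg _)

lemma W1.norm_grad_le {Ω : Set Plane} {F : Type} [NormedAddCommGroup F] [NormedSpace ℝ F]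
    {T : ℝ} (f : W1 Ω F T) (t : ℝ) : ‖(f.val t, fun j => f.dx j t)‖ ≤ f.norm1 t := by
  refine le_trans ?_ (le_add_of_nonneg_right (norm_nonneg _))
  have hs : 0 ≤ ∑ j, ‖f.dx j t‖ ^ 2 := Finset.sum_nonneg fun _ _ => sq_nonneg _
  refine max_le (Real.le_sqrt_of_sq_le (by simpa using hs))
    ((pi_norm_le_iff_of_nonneg (Real.sqrt_nonneg _)).2 fun j => Real.le_sqrt_of_sq_le ?_)
  have := Finset.single_le_sum (f := fun j => ‖f.dx j t‖ ^ 2) (fun _ _ => sq_nonneg _)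
    (Finset.mem_univ j)
  have h0 := sq_nonneg ‖f.val t‖
  simp only at this ⊢
  linarith

/-- The boundary term as the sum of the boundary source and the Dirichlet-to-Neumann form. -/
lemma boundaryTerm_eq {Γ : JordanCurve} {gr H₀ T : ℝ} {hi : Plane → ℝ} {u : ℝ → Plane → State}
    {f : ℝ → L2 Γ.ext State} {g₁ g₂ : ℝ → L2Γ Γ ℝ} {w : W1 Γ.ext State T} {wΓ : ℝ → L2Γ Γ State}
    {ψ ψt : ℝ → L2Γ Γ ℝ} (h : IsRegularSolution Γ gr H₀ T hi u f g₁ g₂ w wΓ ψ ψt) {t : ℝ}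
    (ht : t ∈ Ioo 0 T) (hη : firstComp.compLpL 2 _ (wΓ t) ∈ Hhalf Γ) :
    boundaryTerm Γ (wΓ t) = 2 * inner ℝ (g₁ t) (firstComp.compLpL 2 _ (wΓ t)) +
      2 * dirichletToNeumann Γ hi (ψ t) (firstComp.compLpL 2 _ (wΓ t)) := by
  have h1 := h.boundary₁ t ht _ hη
  rw [← L2_inner_eq] at h1
  have h2 : ∫ s in Ioc 0 Γ.L, wΓ t s 0 * normalPart Γ s (wΓ t s) =
      ∫ s in Ioc 0 Γ.L, normalPart Γ s (wΓ t s) * firstComp.compLpL 2 _ (wΓ t) s := by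
    refine integral_congr_ae ?_
    filter_upwards [firstComp.coeFn_compLpL (wΓ t)] with s hs
    rw [hs, mul_comm]
    rfl
  rw [boundaryTerm, h2]
  linarith

lemma boundary_data_eq {Γ : JordanCurve} {gr H₀ T : ℝ} {hi : Plane → ℝ} {u : ℝ → Plane → State}
    {f : ℝ → L2 Γ.ext State} {g₁ g₂ : ℝ → L2Γ Γ ℝ} {w : W1 Γ.ext State T} {wΓ : ℝ → L2Γ Γ State}
    {ψ ψt : ℝ → L2Γ Γ ℝ} (h : IsRegularSolution Γ gr H₀ T hi u f g₁ g₂ w wΓ ψ ψt) {t : ℝ}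
    (ht : t ∈ Ioo 0 T) : g₂ t = ψt t + firstComp.compLpL 2 _ (wΓ t) := by
  refine Lp.ext ?_
  filter_upwards [h.boundary₂ t ht, firstComp.coeFn_compLpL (wΓ t),
    Lp.coeFn_add (ψt t) (firstComp.compLpL 2 _ (wΓ t))] with s h1 h2 h3
  rw [h3, Pi.add_apply, h2, ← h1]
  rfl

set_option maxHeartbeats 1000000 in
/-- The boundary term of the linearized system is weakly dissipative. -/
theorem exists_isWeaklyDissipative (Γ : JordanCurve) {gr H₀ c₀ M₀ α : ℝ} (hgr : 0 < gr)
    (hH₀ : 0 < H₀) (hc₀ : 0 < c₀) (hM₀ : 0 ≤ M₀) (hα : 0 < α) : ∃ C, 0 < C ∧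
      ∀ {M₁ cl cu T lam₀ : ℝ} {hi : Plane → ℝ} {u ut : ℝ → Plane → State}
        {f : ℝ → L2 Γ.ext State} {g₁ g₂ : ℝ → L2Γ Γ ℝ} {g₁ext : W1 Γ.ext ℝ T}
        {w : W1 Γ.ext State T} {wΓ : ℝ → L2Γ Γ State} {ψ ψt : ℝ → L2Γ Γ ℝ},
        0 < cl → cl < cu → 0 < T → 0 < lam₀ → 2 * betaConst gr H₀ c₀ M₀ ^ 2 * M₁ ≤ lam₀ →
        DepthAssumption Γ c₀ hi → IsDNConstants Γ hi cl cu →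
        BackgroundState Γ gr H₀ c₀ M₀ M₁ T u ut →
        (∀ t ∈ Ioo 0 T, HasTrace Γ Γ.ext (g₁ext.val t) (fun j => g₁ext.dx j t) (g₁ t)) →
        IsRegularSolution Γ gr H₀ T hi u f g₁ g₂ w wΓ ψ ψt →
        IsWeaklyDissipative Γ w (fun t => boundaryTerm Γ (wΓ t)) α lam₀
          (boundaryEnergy Γ cl ψ) (dataTerm Γ (C + cu) ψ f g₁ext g₂) := by
  obtain ⟨c₁, Y, q, hc₁, hqc, hq, hqle⟩ := Γ.exists_boundary_pairing
  have hβ := betaConst_pos hgr hH₀ hc₀ hM₀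
  -- The available multiple of I(w)² is α/8, which is the last term of the estimate.
  obtain ⟨C, hC, hsource⟩ := exists_boundary_source_bound (E₁ := L2 Γ.ext ℝ)
    (E₂ := L2 Γ.ext State) hc₁ (norm_nonneg Y) hβ.le (by positivity : 0 < α / 8)
  refine ⟨C, hC, ?_⟩
  intro M₁ cl cu T lam₀ hi u ut f g₁ g₂ g₁ext w wΓ ψ ψt hcl hclu hT hlam₀ hK hhi hDN hu htr hsol
  have hcu : 0 < cu := hcl.trans hclu
  have hM₁ : 0 ≤ M₁ := hM₀.trans hu.bound_le
  obtain ⟨Φ, hΦ, hΦin⟩ := exists_isFactor hc₀ hhi hcl hclu.le hDN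
  obtain ⟨𝒮, h𝒮b, h𝒮l, h𝒮⟩ := hu.exists_symmetrizer hgr hH₀ hc₀ hM₀ hT
  obtain ⟨_, _, hη⟩ := exists_firstComp_trace Γ
  let y : ℝ → Triple Γ Γ.ext State := fun t => (w.val t, fun j => w.dx j t, wΓ t)
  have hy : ∀ t ∈ Icc 0 T, y t ∈ traceSpace Γ Γ.ext State := fun t ht =>
    hasTrace_iff.1 (hsol.trace t ht)
  let η : ℝ → L2Γ Γ ℝ := fun t => firstComp.compLpL 2 _ (wΓ t)
  have hηm : ∀ t ∈ Icc 0 T, η t ∈ Hhalf Γ := fun t ht => (hη (y t) (hy t ht)).1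
  -- The second boundary condition identifies ρ with g₂ on the open interval. Unlike g₂, it is known
  -- to lie in H^{1/2} at all times of [0,T], with Φρ continuous.
  let ρ : ℝ → L2Γ Γ ℝ := fun t => ψt t + η t
  have hρm : ∀ t ∈ Icc 0 T, ρ t ∈ Hhalf Γ := fun t ht =>
    (Hhalf Γ).add_mem (hsol.regular.mem_dt t ht) (hηm t ht)
  have hΨd : ∀ t ∈ Icc 0 T, HasDerivWithinAt (fun τ => Φ (ψ τ)) (Φ (ψt t)) (Icc 0 T) t :=
    fun t ht => hΦ.hasDerivWithinAt hsol.regular ht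
  have hΨc := HasDerivWithinAt.continuousOn_of_forall hΨd
  have hΨtc := hΦ.continuousOn_dt hsol.regular
  have hηc : ContinuousOn (fun t => Φ (η t)) (Icc 0 T) :=
    hΦ.continuousOn_trace (y := y) hy w.continuousOn_dx
  have hρc : ContinuousOn (fun t => Φ (ρ t)) (Icc 0 T) :=
    (hΨtc.add hηc).congr fun t _ => map_add Φ _ _
  have hNψ := hΦ.continuousOn_hNormTan hsol.regular.mem hΨc
  have hNρ := hΦ.continuousOn_hNormTan hρm hρc
  let Q : ℝ → ℝ := fun t => q ((g₁ext.val t, fun j => g₁ext.dx j t), (w.val t, fun j => w.dx j t))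
  have hQ : ContinuousOn Q (Icc 0 T) :=
    hqc.comp_continuousOn (g₁ext.continuousOn_grad.prodMk w.continuousOn_grad)
  -- By the symmetrized equation F is the continuous representative of the source f.
  let F : ℝ → L2 Γ.ext State := fun t => 𝒮 t (w.dt t) + spaceOp fun j => w.dx j t
  have h𝒮c : ContinuousOn 𝒮 (Icc 0 T) := by
    refine LipschitzOnWith.continuousOn (K := (2 * betaConst gr H₀ c₀ M₀ ^ 2 * M₁).toNNReal)
      (LipschitzOnWith.of_dist_le_mul fun τ hτ τ' hτ' => ?_)
    rw [dist_eq_norm, Real.dist_eq, Real.coe_toNNReal _ (by positivity)]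
    exact h𝒮l τ hτ τ' hτ'
  have hF : ContinuousOn F (Icc 0 T) := (h𝒮c.clm_apply w.continuousOn_dt).add
    (continuousOn_finsetSum _ fun j _ =>
      ((gOp j).compLpL 2 _).continuous.comp_continuousOn (w.continuousOn_dx j))
  have hfF : ∀ᵐ t ∂(volume.restrict (Icc 0 T)), f t = F t :=
    symmetric_equation hu hgr hc₀ hM₁ hT h𝒮 hsol.equation
  -- The first boundary condition tested with η = w^I splits off ⟨g₁, η⟩ = Q and leaves ⟨Λψ, η⟩ =
  -- ⟨Φψ, Φη⟩, where η = ρ - ∂_tψ. The right-hand side is continuous on [0,T], so the boundary term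
  -- is integrable.
  have hB : ∀ t ∈ Ioo 0 T, boundaryTerm Γ (wΓ t) =
      2 * Q t + 2 * inner ℝ (Φ (ψ t)) (Φ (ρ t) - Φ (ψt t)) := by
    intro t ht
    have ht' := Ioo_subset_Icc_self ht
    rw [boundaryTerm_eq hsol ht (hηm t ht'), hΦin _ (hsol.regular.mem t ht') _ (hηm t ht'),
      ← map_sub, add_sub_cancel_left]
    congr 2
    exact hq _ (hasTrace_iff.1 (htr t ht)) _ (hy t ht')
  have hRc : ContinuousOn (fun t => 2 * Q t + 2 * inner ℝ (Φ (ψ t)) (Φ (ρ t) - Φ (ψt t)))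
      (Icc 0 T) := (continuousOn_const.mul hQ).add
    (continuousOn_const.mul (hΨc.inner (hρc.sub hΨtc)))
  have hg₂ : ∀ᵐ t ∂(volume.restrict (Icc 0 T)), g₂ t = ρ t := by
    rw [← Measure.restrict_congr_set Ioo_ae_eq_Icc]
    filter_upwards [ae_restrict_mem measurableSet_Ioo] with t ht using boundary_data_eq hsol ht
  have hsub : ∀ {t}, t ∈ Icc 0 T → Icc 0 t ⊆ Icc 0 T := fun ht => Icc_subset_Icc_right ht.2
  have hE : ∀ lam ≥ lam₀, ∀ t ∈ Icc 0 T, _ := fun lam hlam t ht =>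
    boundaryEnergy_eq hcl.le (hlam₀.le.trans hlam) ht.1
      (fun τ hτ => hsol.regular.mem τ (hsub ht hτ)) (hNψ.mono (hsub ht))
  have hD : ∀ lam ≥ lam₀, ∀ t ∈ Icc 0 T, _ := fun lam hlam t ht =>
    dataTerm_eq (add_pos hC hcu).le (hlam₀.le.trans hlam) ht.1
      (hsol.regular.mem 0 (left_mem_Icc.2 hT.le)) (fun τ hτ => hρm τ (hsub ht hτ))
      (hNρ.mono (hsub ht)) (ae_restrict_of_ae_restrict_of_subset (hsub ht) hg₂)
      (ae_restrict_of_ae_restrict_of_subset (hsub ht) hfF) (hF.mono (hsub ht))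
      (g₁ext.continuousOn_norm1.mono (hsub ht))
  refine ⟨?_, fun lam hlam t ht => ?_, fun lam hlam t ht => ?_, fun lam hlam t ht => ?_,
    fun lam _ t _ t' _ htt' => dataTerm_mono htt' _ _ _ _, fun lam hlam t ht => ?_⟩
  · rw [integrableOn_Icc_iff_integrableOn_Ioo]
    exact (hRc.integrableOn_Icc.mono_set Ioo_subset_Icc_self).congr_fun
      (fun t ht => (hB t ht).symm) measurableSet_Ioo
  · rw [hE lam hlam t ht]
    exact ENNReal.ofReal_lt_top
  · rw [hD lam hlam t ht]
    exact ENNReal.ofReal_lt_top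
  · exact iNorm_lt_top (hlam₀.le.trans hlam) ht.1 (w.continuousOn_val.norm.mono (hsub ht))
  · have hlam0 : 0 < lam := hlam₀.trans_le hlam
    have hs := hsub ht
    have i1 := intervalIntegrable_weight (lam := lam) ht.1 (hQ.mono hs)
    have i2 := intervalIntegrable_weight (lam := lam) ht.1
      (φ := fun τ => inner ℝ (Φ (ψ τ)) (Φ (ρ τ) - Φ (ψt τ))) ((hΨc.inner (hρc.sub hΨtc)).mono hs)
    have e : ∫ τ in (0 : ℝ)..t, Real.exp (-2 * lam * τ) * boundaryTerm Γ (wΓ τ) =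
        2 * (∫ τ in (0 : ℝ)..t, Real.exp (-2 * lam * τ) * Q τ) +
        2 * ∫ τ in (0 : ℝ)..t, Real.exp (-2 * lam * τ) *
          inner ℝ (Φ (ψ τ)) (Φ (ρ τ) - Φ (ψt τ)) := by
      rw [← intervalIntegral.integral_const_mul, ← intervalIntegral.integral_const_mul,
        ← intervalIntegral.integral_add (i1.const_mul 2) (i2.const_mul 2),
        intervalIntegral.integral_of_le ht.1, intervalIntegral.integral_of_le ht.1,
        integral_Ioc_eq_integral_Ioo, integral_Ioc_eq_integral_Ioo]
      refine setIntegral_congr_fun measurableSet_Ioo fun τ hτ => ?_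
      rw [hB τ ⟨hτ.1, hτ.2.trans_le ht.2⟩]
      ring
    have b1 := hsource hlam0 (by positivity) (hK.trans hlam) ht.1 le_rfl
      (fun τ hτ => h𝒮b τ (hs hτ)) (fun τ hτ τ' hτ' => h𝒮l τ (hs hτ) τ' (hs hτ'))
      (fun τ hτ => (g₁ext.hasDeriv τ (hs hτ)).mono hs) (fun τ hτ => (w.hasDeriv τ (hs hτ)).mono hs)
      (g₁ext.continuousOn_dt.mono hs) (w.continuousOn_dt.mono hs) (hF.mono hs)
      (g₁ext.continuousOn_norm1.mono hs) (hQ.mono hs) (fun τ _ => g₁ext.norm_dt_le τ)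
      (fun τ _ => by
        have h1 := hqle (g₁ext.val τ, fun j => g₁ext.dx j τ) (w.val τ, fun j => w.dx j τ)
        have h2 := mul_le_mul_of_nonneg_left (mul_le_mul_of_nonneg_right (g₁ext.norm_grad_le τ)
          (norm_nonneg (w.val τ))) hc₁
        simp only [F, inner_add_right]
        simp only at h1
        linarith)
    have b2 := boundary_energy_le hlam0 ht.1 (fun τ hτ => (hΨd τ (hs hτ)).mono hs)
      (hΨtc.mono hs) (hρc.mono hs)
    -- The lower constant passes from the energy of Φψ to that of 𝔡_tan ψ; the upper constant is
    -- needed only for the data ψ(0) and g₂.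
    have k1 : cl * (Real.exp (-2 * lam * t) * (hNormTan Γ (-1 / 2) (ψ t)).toReal ^ 2 +
        lam * ∫ τ in (0 : ℝ)..t, Real.exp (-2 * lam * τ) *
          (hNormTan Γ (-1 / 2) (ψ τ)).toReal ^ 2) ≤
        Real.exp (-2 * lam * t) * ‖Φ (ψ t)‖ ^ 2 +
          lam * ∫ τ in (0 : ℝ)..t, Real.exp (-2 * lam * τ) * ‖Φ (ψ τ)‖ ^ 2 := by
      have m1 := mul_le_mul_of_nonneg_left (hΦ.lower _ (hsol.regular.mem t ht))
        (Real.exp_pos (-2 * lam * t)).le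
      have m2 : cl * ∫ τ in (0 : ℝ)..t, Real.exp (-2 * lam * τ) *
          (hNormTan Γ (-1 / 2) (ψ τ)).toReal ^ 2 ≤
          ∫ τ in (0 : ℝ)..t, Real.exp (-2 * lam * τ) * ‖Φ (ψ τ)‖ ^ 2 := by
        rw [← intervalIntegral.integral_const_mul]
        refine intervalIntegral.integral_mono_on ht.1
          ((intervalIntegrable_weight ht.1 ((hNψ.mono hs).pow 2)).const_mul cl)
          (intervalIntegrable_weight ht.1 ((hΨc.norm.mono hs).pow 2)) fun τ hτ => ?_
        have := mul_le_mul_of_nonneg_left (hΦ.lower _ (hsol.regular.mem τ (hs hτ)))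
          (Real.exp_pos (-2 * lam * τ)).le
        linarith
      have m3 := mul_le_mul_of_nonneg_left m2 hlam0.le
      linarith
    have k2 : ∫ τ in (0 : ℝ)..t, Real.exp (-2 * lam * τ) * ‖Φ (ρ τ)‖ ^ 2 ≤
        cu * ∫ τ in (0 : ℝ)..t, Real.exp (-2 * lam * τ) *
          (hNormTan Γ (-1 / 2) (ρ τ)).toReal ^ 2 := by
      rw [← intervalIntegral.integral_const_mul]
      refine intervalIntegral.integral_mono_on ht.1
        (intervalIntegrable_weight ht.1 ((hρc.norm.mono hs).pow 2))
        ((intervalIntegrable_weight ht.1 ((hNρ.mono hs).pow 2)).const_mul cu) fun τ hτ => ?_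
      have := mul_le_mul_of_nonneg_left (hΦ.upper _ (hρm τ (hs hτ)))
        (Real.exp_pos (-2 * lam * τ)).le
      linarith
    have k3 := mul_le_mul_of_nonneg_left k2 (inv_nonneg.2 hlam0.le)
    have k4 := hΦ.upper _ (hsol.regular.mem 0 (left_mem_Icc.2 hT.le))
    have hI1 : 0 ≤ ∫ τ in (0 : ℝ)..t,
        Real.exp (-2 * lam * τ) * (hNormTan Γ (-1 / 2) (ψ τ)).toReal ^ 2 :=
      intervalIntegral.integral_nonneg ht.1 fun τ _ => by positivity
    have hI2 : 0 ≤ lam⁻¹ * ∫ τ in (0 : ℝ)..t,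
        Real.exp (-2 * lam * τ) * (hNormTan Γ (-1 / 2) (ρ τ)).toReal ^ 2 :=
      mul_nonneg (inv_nonneg.2 hlam0.le)
        (intervalIntegral.integral_nonneg ht.1 fun τ _ => by positivity)
    rw [hE lam hlam t ht, hD lam hlam t ht, ENNReal.toReal_ofReal (by positivity),
      ENNReal.toReal_ofReal (by positivity), e]
    -- The data term carries C + cu on every summand, whereas each summand needs only one of the
    -- two; the excess is nonnegative.
    have n1 := mul_nonneg hC.le hI2
    have n2 := mul_nonneg hC.le (sq_nonneg (hNormTan Γ (-1 / 2) (ψ 0)).toReal)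
    have n3 := mul_nonneg hcu.le (sq_nonneg ‖g₁ext.val 0‖)
    have n4 := mul_nonneg hcu.le (sq_nonneg (sStar lam t fun τ => ‖F τ‖).toReal)
    have n5 := mul_nonneg hcu.le (sq_nonneg (sStar lam t g₁ext.norm1).toReal)
    linarith

end WaveStructure
end

/-! ### Choice of the constants and conclusion. -/

theorem mainTheorem6 (gr H₀ : ℝ) (hgr : 0 < gr) (hH₀ : 0 < H₀) (Γ : WaveStructure.JordanCurve) :
    (∀ c₀ M : ℝ, 0 < c₀ → ∃ cl cu : ℝ, 0 < cl ∧ cl < cu ∧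
      ∀ hi : WaveStructure.Plane → ℝ, WaveStructure.DepthAssumption Γ c₀ hi →
        (∀ x ∈ Γ.int, hi x ≤ M) → WaveStructure.IsDNConstants Γ hi cl cu) ∧
    ∃ (α₀ β₀ lam₀ : ℝ → ℝ → ℝ) (C₀ : ℝ → ℝ → ℝ → ℝ → ℝ),
      ∀ c₀ M₀ M₁ cl cu : ℝ, 0 < c₀ → 0 ≤ M₀ → M₀ ≤ M₁ → 0 < cl → cl < cu →
        0 < α₀ c₀ M₀ ∧ 0 < β₀ c₀ M₀ ∧ 0 < lam₀ c₀ M₁ ∧ 0 < C₀ c₀ cl cu M₀ ∧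
        (∀ U : WaveStructure.State, ‖U‖ ≤ M₀ → WaveStructure.IsSubcritical gr H₀ c₀ U →
          WaveStructure.IsSymmetrizer (WaveStructure.symMat gr H₀ U)
            (fun j => WaveStructure.sigmaMat gr H₀ U * WaveStructure.gMat j)
            (α₀ c₀ M₀) (β₀ c₀ M₀)) ∧
        ∀ (hi : WaveStructure.Plane → ℝ) (T : ℝ)
          (u ut : ℝ → WaveStructure.Plane → WaveStructure.State)
          (f : ℝ → WaveStructure.L2 Γ.ext WaveStructure.State)
          (g₁ g₂ : ℝ → WaveStructure.L2Γ Γ ℝ)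
          (g₁ext : WaveStructure.W1 Γ.ext ℝ T)
          (w : WaveStructure.W1 Γ.ext WaveStructure.State T)
          (wΓ : ℝ → WaveStructure.L2Γ Γ WaveStructure.State)
          (ψ ψt : ℝ → WaveStructure.L2Γ Γ ℝ),
          0 < T →
          WaveStructure.DepthAssumption Γ c₀ hi →
          WaveStructure.IsDNConstants Γ hi cl cu →
          WaveStructure.BackgroundState Γ gr H₀ c₀ M₀ M₁ T u ut →
          (∀ t ∈ Set.Ioo 0 T, WaveStructure.HasTrace Γ Γ.ext (g₁ext.val t)
            (fun j => g₁ext.dx j t) (g₁ t)) →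
          WaveStructure.IsRegularSolution Γ gr H₀ T hi u f g₁ g₂ w wΓ ψ ψt →
          WaveStructure.IsWeaklyDissipative Γ w
            (fun t => WaveStructure.boundaryTerm Γ (wΓ t))
            (α₀ c₀ M₀) (lam₀ c₀ M₁)
            (WaveStructure.boundaryEnergy Γ cl ψ)
            (WaveStructure.dataTerm Γ (C₀ c₀ cl cu M₀) ψ f g₁ext g₂) := by
  refine ⟨fun c₀ M hc₀ => WaveStructure.exists_dnConstants Γ hc₀ M, ?_⟩
  -- The constant is chosen as a function of c₀ and M₀ before any solution is given; 0 is a default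
  -- value for inadmissible parameters.
  have hex : ∀ c₀ M₀ : ℝ, ∃ C : ℝ, 0 < c₀ → 0 ≤ M₀ → 0 < C ∧ _ := fun c₀ M₀ => by
    by_cases h : 0 < c₀ ∧ 0 ≤ M₀
    · obtain ⟨C, hC⟩ := WaveStructure.exists_isWeaklyDissipative Γ hgr hH₀ h.1 h.2
        (WaveStructure.alphaConst_pos hgr hH₀ h.2)
      exact ⟨C, fun _ _ => hC⟩
    · exact ⟨0, fun h1 h2 => absurd ⟨h1, h2⟩ h⟩
  choose C hC using hex
  refine ⟨fun _ M₀ => WaveStructure.alphaConst gr H₀ M₀,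
    fun c₀ M₀ => WaveStructure.betaConst gr H₀ c₀ M₀,
    -- λ₀ may depend on M₁ but not on M₀, so the bound β is taken at M₁, which dominates its value
    -- at M₀. The summand 1 keeps λ₀ positive when M₁ = 0.
    fun c₀ M₁ => 2 * WaveStructure.betaConst gr H₀ c₀ M₁ ^ 2 * M₁ + 1,
    fun c₀ _ cu M₀ => C c₀ M₀ + cu, ?_⟩
  intro c₀ M₀ M₁ cl cu hc₀ hM₀ hM hcl hclu
  have hM₁ := hM₀.trans hM
  obtain ⟨hCpos, hCdiss⟩ := hC c₀ M₀ hc₀ hM₀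
  have hβ := WaveStructure.betaConst_pos hgr hH₀ hc₀ hM₀
  have hβle : WaveStructure.betaConst gr H₀ c₀ M₀ ≤ WaveStructure.betaConst gr H₀ c₀ M₁ := by
    unfold WaveStructure.betaConst
    gcongr
  have hlam₀ : 0 < 2 * WaveStructure.betaConst gr H₀ c₀ M₁ ^ 2 * M₁ + 1 := by positivity
  refine ⟨WaveStructure.alphaConst_pos hgr hH₀ hM₀, hβ, hlam₀, by
    have := hcl.trans hclu
    positivity, fun U hU h => h.isSymmetrizer hgr hH₀ hc₀ hU, ?_⟩
  intro hi T u ut f g₁ g₂ g₁ext w wΓ ψ ψt hT hhi hDN hu htr hsol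
  refine hCdiss hcl hclu hT hlam₀ ?_ hhi hDN hu htr hsol
  have h : 2 * WaveStructure.betaConst gr H₀ c₀ M₀ ^ 2 * M₁ ≤
      2 * WaveStructure.betaConst gr H₀ c₀ M₁ ^ 2 * M₁ := by
    gcongr
  linarith
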